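/- Let $\Omega$ be one of $[0,1]$, $[0,\infty)$ (with Lebesgue measure) or $\mathbb N=\{1,2,\dots\}$ (with counting measure), let $\mu$ be its measure, and let $L_0$ be the space of real measurable functions on $\Omega$ modulo equality a.e. An r.i. space $X$ on $\Omega$ is a Banach space $X\subset L_0$ (we put $\|f\|_X=\infty$ for $f\in L_0\setminus X$) containing $\chi_B$ whenever $\mu(B)<\infty$, such that $\|f\|_X\le\|g\|_X$ whenever $|f|\le|g|$ a.e., the unit ball $\{f:\|f\|_X\le1\}$ is closed in $L_0$ for convergence in measure on sets of finite measure (Fatou property), and $\|f\|_X=\|g\|_X$ whenever $|f|$ and $|g|$ have the same distribution. (For $\Omega=\mathbb N$ these are the symmetric sequence spaces.) $X$ is $p$-convex, respectively $p$-concave ($1\le p<\infty$), if there is a constant $M$ such that for all $f_1,\dots,f_n\in X$ $$\Big\|\Big(\sum_k|f_k|^p\Big)^{1/p}\Big\|_X\le M\Big(\sum_k\|f_k\|_X^p\Big)^{1/p},\quad\text{respectively}\quad \Big(\sum_k\|f_k\|_X^p\Big)^{1/p}\le M\Big\|\Big(\sum_k|f_k|^p\Big)^{1/p}\Big\|_X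 .$$ For r.i. spaces $X,Y$ on $\Omega$ and $f\in X+Y$ let $K(t,f)=\inf\{\|x\|_X+t\|y\|_Y:\ x+y=f\}$, $t>0$. The pair $(X,Y)$ is a Calderón couple if, whenever $f,g\in X+Y$ satisfy $K(t,f)\le K(t,g)$ for all $t>0$, there is a linear operator $T:X+Y\to X+Y$ with $Tg=f$ such that $\|T\|_X=\sup\{\|Th\|_X:\|h\|_X\le1\}<\infty$ and $\|T\|_Y<\infty$ (defined likewise). It is a uniform Calderón couple if, for some constant $C$ independent of $f,g$, the operator $T$ can always be chosen with $\max(\|T\|_X,\|T\|_Y)\le C$. Let $\mathbf J=\{n\in\mathbb Z:n<0\}$, $\mathbb Z$, $\{n\in\mathbb Z:n\ge0\}$ for $\Omega=[0,1]$, $[0,\infty)$, $\mathbb N$ respectively, let $e_n=\chi_{[2^n,2^{n+1})}$ for $n\in\mathbf J$, and for $x:\mathbf J\to\mathbb R$ put $\|x\|_{E_X}=\|\sum_{n\in\mathbf J}x(n)e_n\|_X$. For an interval $I\subset\mathbb Z$, a pair $(x_n,y_n)_{n\in I}$ of families of nonzero finitely supported sequences on $\mathbf J$ is interlaced if $\operatorname{supp}x_n<\operatorname{supp}y_n$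 for $n\in I$ and $\operatorname{supp}y_n<\operatorname{supp}x_{n+1}$ whenever $n,n+1\in I$ (where $A<B$ means $a<b$ for all $a\in A$, $b\in B$). $X$ is stretchable if there is a constant $C$ such that for every $I$, every interlaced pair with $\|y_n\|_{E_X}\le\|x_n\|_{E_X}=1$ $(n\in I)$ and all finitely nonzero scalars $(\alpha_n)_{n\in I}$, $$\Big\|\sum_{n\in I}\alpha_ny_n\Big\|_{E_X}\le C\Big\|\sum_{n\in I}\alpha_nx_n\Big\|_{E_X};$$ $X$ is compressible if there is a constant $C$ such that for every $I$, every interlaced pair with $\|x_n\|_{E_X}\le\|y_n\|_{E_X}=1$ $(n\in I)$ and all finitely nonzero $(\alpha_n)_{n\in I}$, $\|\sum_{n\in I}\alpha_nx_n\|_{E_X}\le C\|\sum_{n\in I}\alpha_ny_n\|_{E_X}$. Theorem. Let $X,Y$ be r.i. spaces on $\Omega$ such that, for some $1\le p<\infty$, $X$ is $p$-concave and $Y$ is $p$-convex, and suppose that $Y$ is $r$-concave for some $1\le r<\infty$. Then the following are equivalent: (i) $(X,Y)$ is a Calderón couple; (ii) $(X,Y)$ is a uniform Calderón couple; (iii)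 $X$ is stretchable and $Y$ is compressible. -/

import Mathlib

open MeasureTheory Filter Topology
open scoped ENNReal NNReal

namespace CalderonRI

/-- The space `L₀(μ)` of real measurable functions, modulo equality almost everywhere. -/
abbrev L0 {Ω : Type*} [MeasurableSpace Ω] (μ : Measure Ω) : Type _ := Ω →ₘ[μ] ℝ

/-- The class in `L₀(μ)` of the characteristic function of a measurable set. -/
noncomputable def charFn {Ω : Type*} [MeasurableSpace Ω] (μ : Measure Ω) (B : Set Ω)
    (hB : MeasurableSet B) : L0 μ :=
  AEEqFun.mk (B.indicator fun _ => (1 : ℝ))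
    (measurable_const.indicator hB).aestronglyMeasurable

/-- A Köthe function space, given by its norm, extended by the value `∞` outside the space.
The space itself is `{f | nrm f < ∞}`. The Fatou property is part of the definition; as `L₀(μ)`
is metrizable for `σ`-finite `μ`, closedness of the unit ball for convergence in measure on sets of
finite measure is expressed with sequences. -/
structure KotheSpace {Ω : Type*} [MeasurableSpace Ω] (μ : Measure Ω) where
  /-- the extended norm -/
  nrm : L0 μ → ℝ≥0∞
  eq_zero_iff : ∀ f, nrm f = 0 ↔ f = 0
  smul : ∀ (c : ℝ) (f : L0 μ), nrm (c • f) = ‖c‖ₑ * nrm f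
  add_le : ∀ f g, nrm (f + g) ≤ nrm f + nrm g
  charFn_lt_top : ∀ (B : Set Ω) (hB : MeasurableSet B), μ B < ∞ → nrm (charFn μ B hB) < ∞
  mono : ∀ f g : L0 μ, (∀ᵐ ω ∂μ, |f ω| ≤ |g ω|) → nrm f ≤ nrm g
  fatou : ∀ (f : ℕ → L0 μ) (g : L0 μ), (∀ n, nrm (f n) ≤ 1) →
    (∀ B : Set Ω, MeasurableSet B → μ B < ∞ →
      TendstoInMeasure (μ.restrict B) (fun n => (f n : Ω → ℝ)) atTop (g : Ω → ℝ)) →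
    nrm g ≤ 1
  complete : ∀ f : ℕ → L0 μ, (∀ n, nrm (f n) < ∞) →
    (∀ ε : ℝ≥0∞, 0 < ε → ∃ n₀, ∀ m ≥ n₀, ∀ n ≥ n₀, nrm (f m - f n) < ε) →
    ∃ g, nrm g < ∞ ∧ Tendsto (fun n => nrm (f n - g)) atTop (𝓝 0)

namespace KotheSpace

variable {Ω : Type*} [MeasurableSpace Ω] {μ : Measure Ω}

/-- The underlying vector space `X = {f | ‖f‖_X < ∞}`. -/
def space (X : KotheSpace μ) : Submodule ℝ (L0 μ) where
  carrier := {f | X.nrm f < ∞}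
  add_mem' {f g} hf hg := (X.add_le f g).trans_lt (ENNReal.add_lt_top.2 ⟨hf, hg⟩)
  zero_mem' := by
    have h : X.nrm 0 = 0 := (X.eq_zero_iff 0).2 rfl
    simp [h]
  smul_mem' c f hf := by
    have h : X.nrm (c • f) < ∞ := by
      rw [X.smul]
      exact ENNReal.mul_lt_top (by simp) hf
    exact h

/-- The function `(∑ₖ |fₖ|^p)^(1/p)`. -/
noncomputable def pSum (p : ℝ) {n : ℕ} (f : Fin n → L0 μ) : L0 μ :=
  AEEqFun.mk (fun ω => (∑ k, |f k ω| ^ p) ^ (1 / p)) (by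
    refine Measurable.aestronglyMeasurable ?_
    refine Measurable.pow_const (Finset.measurable_sum _ fun k _ => ?_) _
    exact ((f k).measurable.abs).pow_const _)

/-- `p`-convexity, for real `p`. -/
def IsPConvex (X : KotheSpace μ) (p : ℝ) : Prop :=
  ∃ M : ℝ≥0, ∀ (n : ℕ) (f : Fin n → L0 μ), (∀ k, f k ∈ X.space) →
    X.nrm (pSum p f) ≤ M * (∑ k, X.nrm (f k) ^ p) ^ (1 / p)

/-- `p`-concavity, for real `p`. -/
def IsPConcave (X : KotheSpace μ) (p : ℝ) : Prop :=
  ∃ M : ℝ≥0, ∀ (n : ℕ) (f : Fin n → L0 μ), (∀ k, f k ∈ X.space) →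
    (∑ k, X.nrm (f k) ^ p) ^ (1 / p) ≤ M * X.nrm (pSum p f)

/-- Rearrangement invariance: functions whose absolute values have the same distribution
(equivalently, functions with the same decreasing rearrangement) have the same norm. -/
def IsRearrangementInvariant (X : KotheSpace μ) : Prop :=
  ∀ f g : L0 μ, (∀ s : ℝ, 0 ≤ s → μ {ω | s < |f ω|} = μ {ω | s < |g ω|}) → X.nrm f = X.nrm g

/-- The algebraic sum `X + Y` inside `L₀(μ)`. -/
abbrev sumSpace (X Y : KotheSpace μ) : Submodule ℝ (L0 μ) := X.space ⊔ Y.space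

/-- The Peetre functional `K(t, f) = inf {‖x‖_X + t ‖y‖_Y : x + y = f}`. It is used for `t > 0`
only, where decompositions with `x ∉ X` or `y ∉ Y` contribute the value `∞`. -/
noncomputable def K (X Y : KotheSpace μ) (t : ℝ≥0) (f : L0 μ) : ℝ≥0∞ :=
  ⨅ (x : L0 μ) (y : L0 μ) (_ : x + y = f), X.nrm x + t * Y.nrm y

/-- For a linear operator `T` on a subspace `V` of `L₀(μ)`, the quantity
`‖T‖_X = sup {‖T f‖_X : ‖f‖_X ≤ 1}`. -/
noncomputable def opNrm (X : KotheSpace μ) {V : Submodule ℝ (L0 μ)} (T : V →ₗ[ℝ] V) : ℝ≥0∞ :=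
  ⨆ (f : V) (_ : X.nrm f ≤ 1), X.nrm (T f)

/-- `(X, Y)` is a Calderón couple. (Finiteness of `‖T‖_X` and `‖T‖_Y` implies that `T` is bounded
on `X + Y`.) -/
def IsCalderonCouple (X Y : KotheSpace μ) : Prop :=
  ∀ f g : sumSpace X Y, (∀ t : ℝ≥0, 0 < t → K X Y t f ≤ K X Y t g) →
    ∃ T : sumSpace X Y →ₗ[ℝ] sumSpace X Y, X.opNrm T < ∞ ∧ Y.opNrm T < ∞ ∧ T g = f

/-- `(X, Y)` is a uniform Calderón couple. -/
def IsUniformCalderonCouple (X Y : KotheSpace μ) : Prop :=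
  ∃ C : ℝ≥0, ∀ f g : sumSpace X Y, (∀ t : ℝ≥0, 0 < t → K X Y t f ≤ K X Y t g) →
    ∃ T : sumSpace X Y →ₗ[ℝ] sumSpace X Y, max (X.opNrm T) (Y.opNrm T) ≤ C ∧ T g = f

end KotheSpace

/-! Shift properties of sequence norms -/

/-- `supp x < supp y`. -/
def SuppLT {J : Set ℤ} (x y : J → ℝ) : Prop :=
  ∀ a ∈ Function.support x, ∀ b ∈ Function.support y, a < b

/-- `(xₙ, yₙ)`, `n ∈ I`, is an interlaced pair of finitely supported nonzero sequences.
(The values of `x` and `y` outside `I` play no role.) -/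
structure Interlaced {J : Set ℤ} (I : Set ℤ) (x y : ℤ → J → ℝ) : Prop where
  finite_left : ∀ n ∈ I, (Function.support (x n)).Finite
  finite_right : ∀ n ∈ I, (Function.support (y n)).Finite
  ne_zero_left : ∀ n ∈ I, x n ≠ 0
  ne_zero_right : ∀ n ∈ I, y n ≠ 0
  lt : ∀ n ∈ I, SuppLT (x n) (y n)
  lt_succ : ∀ n ∈ I, n + 1 ∈ I → SuppLT (y n) (x (n + 1))

/-- The right-shift property; `I` runs over all intervals of `ℤ`, and the finitely nonzero scalar
sequences on `I` are given by their values on finite sets `s ⊆ I`. -/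
def HasRSP {J : Set ℤ} (E : (J → ℝ) → ℝ≥0∞) : Prop :=
  ∃ C : ℝ≥0, ∀ I : Set ℤ, I.OrdConnected → ∀ x y : ℤ → J → ℝ, Interlaced I x y →
    (∀ n ∈ I, E (y n) ≤ E (x n) ∧ E (x n) = 1) →
    ∀ (s : Finset ℤ) (α : ℤ → ℝ), (s : Set ℤ) ⊆ I →
      E (∑ n ∈ s, α n • y n) ≤ C * E (∑ n ∈ s, α n • x n)

/-- The left-shift property. -/
def HasLSP {J : Set ℤ} (E : (J → ℝ) → ℝ≥0∞) : Prop :=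
  ∃ C : ℝ≥0, ∀ I : Set ℤ, I.OrdConnected → ∀ x y : ℤ → J → ℝ, Interlaced I x y →
    (∀ n ∈ I, E (x n) ≤ E (y n) ∧ E (y n) = 1) →
    ∀ (s : Finset ℤ) (α : ℤ → ℝ), (s : Set ℤ) ⊆ I →
      E (∑ n ∈ s, α n • x n) ≤ C * E (∑ n ∈ s, α n • y n)

/-- The three underlying sets `Ω ⊆ ℝ`: `[0, 1]`, `[0, ∞)`, and `ℕ = {1, 2, 3, …}`. -/
inductive Domain
  | unitInterval
  | halfLine
  | naturals

namespace Domain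

/-- Lebesgue measure on `[0, 1]` and on `[0, ∞)`, counting measure on `{1, 2, 3, …}`, each regarded
as a measure on `ℝ` concentrated on `Ω`; so `L₀` of it is the space of measurable functions on `Ω`
modulo equality almost everywhere. -/
noncomputable def measure : Domain → Measure ℝ
  | unitInterval => volume.restrict (Set.Icc 0 1)
  | halfLine => volume.restrict (Set.Ici 0)
  | naturals => Measure.sum fun n : ℕ => Measure.dirac ((n : ℝ) + 1)

/-- The index set of the dyadic intervals `[2ⁿ, 2ⁿ⁺¹)` that make up `Ω`. -/
def index : Domain → Set ℤ
  | unitInterval => Set.Iio 0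
  | halfLine => Set.univ
  | naturals => Set.Ici 0

end Domain

/-- The step function `∑ₖ x(k) eₖ` with `eₖ = χ_[2ᵏ, 2ᵏ⁺¹)`; at each point at most one term is
nonzero. -/
noncomputable def dyadicStep {J : Set ℤ} (x : J → ℝ) (t : ℝ) : ℝ :=
  ∑' k : J, (Set.Ico ((2 : ℝ) ^ (k : ℤ)) (2 ^ ((k : ℤ) + 1))).indicator (fun _ => x k) t

theorem measurable_dyadicStep {J : Set ℤ} (x : J → ℝ) : Measurable (dyadicStep x) := by
  have hs : ∀ t : ℝ, Summable fun k : J =>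
      (Set.Ico ((2 : ℝ) ^ (k : ℤ)) (2 ^ ((k : ℤ) + 1))).indicator (fun _ => x k) t := by
    intro t
    refine summable_of_hasFiniteSupport ?_
    apply Set.Subsingleton.finite
    intro a ha b hb
    have ha' := Set.mem_of_indicator_ne_zero (Function.mem_support.1 ha)
    have hb' := Set.mem_of_indicator_ne_zero (Function.mem_support.1 hb)
    have h1 := (zpow_lt_zpow_iff_right₀ (one_lt_two : (1 : ℝ) < 2)).1 (ha'.1.trans_lt hb'.2)
    have h2 := (zpow_lt_zpow_iff_right₀ (one_lt_two : (1 : ℝ) < 2)).1 (hb'.1.trans_lt ha'.2)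
    apply Subtype.ext
    omega
  refine measurable_of_tendsto_metrizable' (atTop : Filter (Finset J))
    (f := fun (s : Finset J) t => ∑ k ∈ s,
      (Set.Ico ((2 : ℝ) ^ (k : ℤ)) (2 ^ ((k : ℤ) + 1))).indicator (fun _ => x k) t) ?_ ?_
  · intro s
    exact Finset.measurable_sum _ fun k _ => measurable_const.indicator measurableSet_Ico
  · exact tendsto_pi_nhds.2 fun t => (hs t).hasSum

/-- A rearrangement-invariant space on `Ω` (a symmetric sequence space when `Ω = ℕ`). -/
structure RISpace (D : Domain) extends KotheSpace D.measure where
  rearrangement_invariant : toKotheSpace.IsRearrangementInvariant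

namespace RISpace

variable {D : Domain}

/-- The norm of the sequence space `E_X`: `‖x‖_{E_X} = ‖∑ₖ x(k) eₖ‖_X`. -/
noncomputable def seqNrm (X : RISpace D) (x : D.index → ℝ) : ℝ≥0∞ :=
  X.nrm (AEEqFun.mk (dyadicStep x) (measurable_dyadicStep x).aestronglyMeasurable)

/-- `X` is stretchable if `E_X` has the right-shift property. -/
def IsStretchable (X : RISpace D) : Prop := HasRSP X.seqNrm

/-- `X` is compressible if `E_X` has the left-shift property. -/
def IsCompressible (X : RISpace D) : Prop := HasLSP X.seqNrm

end RISpace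

end CalderonRI

namespace CalderonRI

/-! ### Lattice norms on two-sided sequences -/

/-- A lattice norm on sequences, with the Fatou property; coordinates outside `J` are ignored. -/
structure IsSeqNorm (J : Set ℤ) (E : (ℤ → ℝ) → ℝ≥0∞) : Prop where
  smul : ∀ (c : ℝ) (x : ℤ → ℝ), E (c • x) = ‖c‖ₑ * E x
  add_le : ∀ x y, E (x + y) ≤ E x + E y
  mono : ∀ x y : ℤ → ℝ, (∀ n ∈ J, |x n| ≤ |y n|) → E x ≤ E y
  fatou : ∀ (x : ℤ → ℝ) (c : ℝ≥0∞), (∀ s : Finset ℤ, E ((s : Set ℤ).indicator x) ≤ c) → E x ≤ c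
  single_ne_zero : ∀ n ∈ J, E (Pi.single n 1) ≠ 0
  single_ne_top : ∀ n, E (Pi.single n 1) ≠ ∞

/-- Finite families `(hⱼ, gⱼ)` of finitely supported sequences that occupy consecutive parts of
`ℤ`, with `hⱼ` to the left of `gⱼ`. -/
structure ShiftFamily (s : Finset ℤ) (h g : ℤ → ℤ → ℝ) : Prop where
  finite_left : ∀ j ∈ s, (Function.support (h j)).Finite
  finite_right : ∀ j ∈ s, (Function.support (g j)).Finite
  lt : ∀ j ∈ s, ∀ a b, h j a ≠ 0 → g j b ≠ 0 → a < b
  lt_of_lt : ∀ i ∈ s, ∀ j ∈ s, i < j →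
    ∀ a b, (h i a ≠ 0 ∨ g i a ≠ 0) → (h j b ≠ 0 ∨ g j b ≠ 0) → a < b

/-- Shifting to the right with control of `E` is bounded for `N`. -/
def RightShift (E N : (ℤ → ℝ) → ℝ≥0∞) (C : ℝ≥0) : Prop :=
  ∀ (s : Finset ℤ) (h g : ℤ → ℤ → ℝ), ShiftFamily s h g → (∀ j ∈ s, E (g j) ≤ E (h j)) →
    N (∑ j ∈ s, g j) ≤ C * N (∑ j ∈ s, h j)

/-- Shifting to the left with control of `F` is bounded for `N`. -/
def LeftShift (F N : (ℤ → ℝ) → ℝ≥0∞) (C : ℝ≥0) : Prop :=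
  ∀ (s : Finset ℤ) (h g : ℤ → ℤ → ℝ), ShiftFamily s g h → (∀ j ∈ s, F (g j) ≤ F (h j)) →
    N (∑ j ∈ s, g j) ≤ C * N (∑ j ∈ s, h j)

namespace IsSeqNorm

variable {J : Set ℤ} {E : (ℤ → ℝ) → ℝ≥0∞} (hE : IsSeqNorm J E)

include hE

theorem zero : E 0 = 0 := by
  have := hE.smul 0 0
  simpa using this

theorem mono' {x y : ℤ → ℝ} (h : ∀ n, |x n| ≤ |y n|) : E x ≤ E y := hE.mono x y fun n _ => h n

theorem congr {x y : ℤ → ℝ} (h : ∀ n ∈ J, |x n| = |y n|) : E x = E y :=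
  le_antisymm (hE.mono _ _ fun n hn => (h n hn).le) (hE.mono _ _ fun n hn => (h n hn).ge)

theorem neg (x : ℤ → ℝ) : E (-x) = E x := hE.congr fun n _ => by simp

theorem sum_le {ι : Type*} (s : Finset ι) (f : ι → ℤ → ℝ) : E (∑ i ∈ s, f i) ≤ ∑ i ∈ s, E (f i) := by
  classical
  induction s using Finset.induction_on with
  | empty => simp [hE.zero]
  | insert a s ha ih =>
    rw [Finset.sum_insert ha, Finset.sum_insert ha]
    exact (hE.add_le _ _).trans (by gcongr)

theorem indicator_mono {S T : Set ℤ} (h : S ⊆ T) (x : ℤ → ℝ) :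
    E (S.indicator x) ≤ E (T.indicator x) := by
  refine hE.mono' fun n => ?_
  by_cases hn : n ∈ S
  · simp [hn, h hn]
  · simp [hn]

theorem indicator_le (S : Set ℤ) (x : ℤ → ℝ) : E (S.indicator x) ≤ E x := by
  simpa using hE.indicator_mono (Set.subset_univ S) x

theorem le_indicator_add {S T U : Set ℤ} (h : S ⊆ T ∪ U) (x : ℤ → ℝ) :
    E (S.indicator x) ≤ E (T.indicator x) + E (U.indicator x) := by
  have h1 : E (S.indicator x) ≤ E (T.indicator x + (U \ T).indicator x) := by
    refine hE.mono' fun n => ?_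
    by_cases hn : n ∈ S
    · rcases h hn with h' | h'
      · simp [hn, h']
      · by_cases h'' : n ∈ T <;> simp [hn, h', h'']
    · simp [hn]
  exact h1.trans ((hE.add_le _ _).trans (by gcongr; exact hE.indicator_mono Set.sdiff_subset x))

theorem single (n : ℤ) (c : ℝ) : E (Pi.single n c) = ‖c‖ₑ * E (Pi.single n 1) := by
  rw [← hE.smul]; congr 1; ext m; by_cases h : m = n
  · subst h; simp
  · simp [h]

theorem ne_top_of_finite {x : ℤ → ℝ} (h : (Function.support x).Finite) : E x ≠ ∞ := by
  have hx : x = ∑ n ∈ h.toFinset, Pi.single n (x n) := by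
    ext m
    rw [Finset.sum_apply]
    by_cases hm : x m = 0
    · rw [hm, Finset.sum_eq_zero]
      intro n hn
      rcases eq_or_ne n m with rfl | h'
      · simp at hn; exact absurd hm hn
      · simp [h'.symm]
    · rw [Finset.sum_eq_single m]
      · simp
      · intro n _ h'; simp [h'.symm]
      · intro h'; simp at h'; exact absurd h' hm
  rw [hx]
  refine ((hE.sum_le _ _).trans_lt ?_).ne
  refine ENNReal.sum_lt_top.2 fun n _ => ?_
  rw [hE.single]
  exact ENNReal.mul_lt_top (by simp) (hE.single_ne_top n).lt_top

theorem indicator_ne_top {S : Set ℤ} (h : S.Finite) (x : ℤ → ℝ) : E (S.indicator x) ≠ ∞ :=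
  hE.ne_top_of_finite (h.subset (by simp))

theorem abs_mul_single_le (x : ℤ → ℝ) (n : ℤ) : ‖x n‖ₑ * E (Pi.single n 1) ≤ E x := by
  rw [← hE.single]
  refine hE.mono' fun m => ?_
  by_cases h : m = n
  · subst h; simp
  · simp [h]

/-- If a functional inequality holds up to a factor for all pieces of finite support, it holds. -/
theorem sum_indicator_le {ι : Type*} (s : Finset ι) (S : ι → Set ℤ)
    (hS : ∀ i ∈ s, ∀ j ∈ s, i ≠ j → Disjoint (S i) (S j)) (x : ℤ → ℝ) :
    E (∑ i ∈ s, (S i).indicator x) ≤ E x := by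
  refine hE.mono' fun n => ?_
  rw [Finset.sum_apply]
  by_cases h : ∃ i ∈ s, n ∈ S i
  · obtain ⟨i, hi, hn⟩ := h
    rw [Finset.sum_eq_single_of_mem i hi]
    · simp [hn]
    · intro j hj hji
      exact Set.indicator_of_notMem (fun h' => (hS j hj i hi hji).le_bot ⟨h', hn⟩) _
  · push Not at h
    rw [Finset.sum_eq_zero fun i hi => Set.indicator_of_notMem (h i hi) _]
    simp

/-- A linear functional that attains the norm of the restriction of `b` to a finite set. -/
theorem exists_norming {S : Set ℤ} (hS : S.Finite) (b : ℤ → ℝ) :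
    ∃ φ : (ℤ → ℝ) →ₗ[ℝ] ℝ, φ b = (E (S.indicator b)).toReal ∧
      ∀ x, |φ x| ≤ (E (S.indicator x)).toReal := by
  set N : (ℤ → ℝ) → ℝ := fun x => (E (S.indicator x)).toReal with hN
  have hsm : ∀ (c : ℝ) x, N (c • x) = |c| * N x := by
    intro c x
    have : S.indicator (c • x) = c • S.indicator x := by
      ext n; by_cases hn : n ∈ S <;> simp [hn]
    simp only [hN, this, hE.smul, ENNReal.toReal_mul]
    simp
  have hadd : ∀ x y, N (x + y) ≤ N x + N y := by
    intro x y
    simp only [hN]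
    rw [← ENNReal.toReal_add (hE.indicator_ne_top hS _) (hE.indicator_ne_top hS _)]
    refine ENNReal.toReal_mono (ENNReal.add_ne_top.2
      ⟨hE.indicator_ne_top hS _, hE.indicator_ne_top hS _⟩) ?_
    rw [Set.indicator_add']
    exact hE.add_le _ _
  by_cases hb : b = 0
  · exact ⟨0, by simp [hb, hE.zero], fun x => by simp⟩
  obtain ⟨φ, h1, h2⟩ := exists_extension_of_le_sublinear
    (LinearPMap.mkSpanSingleton b (N b) hb : (ℤ → ℝ) →ₗ.[ℝ] ℝ) N
    (fun c hc x => by rw [hsm, abs_of_pos hc]) hadd (by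
      rintro ⟨x, hx⟩
      obtain ⟨c, rfl⟩ := Submodule.mem_span_singleton.1 hx
      have h3 := LinearPMap.mkSpanSingleton'_apply (σ := RingHom.id ℝ) b (N b) (fun c hc =>
        (smul_eq_zero.1 hc).elim (fun hc => by simp [hc]) fun hx' => absurd hx' hb) c hx
      refine (le_of_eq h3).trans ?_
      change c * N b ≤ N (c • b)
      rw [hsm]
      exact mul_le_mul_of_nonneg_right (le_abs_self c) ENNReal.toReal_nonneg)
  refine ⟨φ, ?_, fun x => abs_le.2 ⟨?_, h2 x⟩⟩
  · exact (h1 ⟨b, Submodule.mem_span_singleton_self b⟩).trans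
      (LinearPMap.mkSpanSingleton_apply ℝ ℝ hb (N b))
  · have := h2 (-x)
    have h3 := hsm (-1) x
    simp at h3
    rw [h3, map_neg] at this
    linarith

end IsSeqNorm


namespace IsSeqNorm

variable {J : Set ℤ} {E : (ℤ → ℝ) → ℝ≥0∞}

/-- A multiplication operator. -/
noncomputable def mulOp (d : ℤ → ℝ) : (ℤ → ℝ) →ₗ[ℝ] (ℤ → ℝ) where
  toFun h k := d k * h k
  map_add' x y := by ext k; simp [mul_add]
  map_smul' c x := by ext k; simp; ring

theorem mulOp_le (hE : IsSeqNorm J E) {d : ℤ → ℝ} {K : ℝ≥0} (hd : ∀ k, |d k| ≤ K) (h : ℤ → ℝ) :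
    E (mulOp d h) ≤ K * E h := by
  have : E (mulOp d h) ≤ E ((K : ℝ) • h) := by
    refine hE.mono' fun n => ?_
    simp only [mulOp, LinearMap.coe_mk, AddHom.coe_mk, Pi.smul_apply, smul_eq_mul, abs_mul]
    exact mul_le_mul_of_nonneg_right ((hd n).trans (le_abs_self _)) (abs_nonneg _)
  refine this.trans (le_of_eq ?_)
  rw [hE.smul]
  simp

theorem exists_jump_operator (hE : IsSeqNorm J E) {a b : ℤ → ℝ} {P : Set ℤ} {K : ℝ≥0} (hPJ : P ⊆ J)
    (hfin : ∀ k, E ((Set.Iio k).indicator b) ≠ ∞)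
    (hP : ∀ k ∈ P, E ((Set.Iio (k + 1)).indicator a) ≤ K * E ((Set.Iio (k + 1)).indicator b))
    (hj : ∀ k ∈ P, 2 * E ((Set.Iio k).indicator b) < E ((Set.Iio (k + 1)).indicator b)) :
    ∃ T : (ℤ → ℝ) →ₗ[ℝ] (ℤ → ℝ), (∀ k ∈ P, T b k = a k) ∧ (∀ k ∉ P, ∀ h, T h k = 0) ∧
      ∀ N, IsSeqNorm J N → ∀ h, N (T h) ≤ (2 * K : ℝ≥0) * N h := by
  classical
  have key : ∀ k ∈ P, b k ≠ 0 ∧ |a k| ≤ 2 * K * |b k| := by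
    intro k hk
    set e := E (Pi.single k 1) with he
    have he0 : e ≠ 0 := hE.single_ne_zero k (hPJ hk)
    have het : e ≠ ∞ := hE.single_ne_top k
    have h1 : ‖a k‖ₑ * e ≤ K * E ((Set.Iio (k + 1)).indicator b) := by
      have := hE.abs_mul_single_le ((Set.Iio (k + 1)).indicator a) k
      simp only [Set.mem_Iio, lt_add_iff_pos_right, zero_lt_one, Set.indicator_of_mem] at this
      exact this.trans (hP k hk)
    have h2 : E ((Set.Iio (k + 1)).indicator b) ≤ E ((Set.Iio k).indicator b) + ‖b k‖ₑ * e := by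
      have h3 : Set.Iio (k + 1) ⊆ Set.Iio k ∪ {k} := by
        intro i hi
        simp only [Set.mem_Iio, Set.mem_union, Set.mem_singleton_iff] at hi ⊢
        omega
      refine (hE.le_indicator_add h3 b).trans ?_
      gcongr
      rw [he, ← hE.single]
      refine hE.mono' fun n => ?_
      by_cases h : n = k
      · subst h; simp
      · simp [h]
    have h4 := hj k hk
    set β := E ((Set.Iio k).indicator b)
    set β' := E ((Set.Iio (k + 1)).indicator b)
    have hβ : β' ≤ 2 * (‖b k‖ₑ * e) := by
      have hβt : β ≠ ∞ := hfin k
      have : β + β' ≤ β + 2 * (‖b k‖ₑ * e) := by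
        calc β + β' ≤ β + (β + ‖b k‖ₑ * e) := by gcongr
          _ = 2 * β + ‖b k‖ₑ * e := by ring
          _ ≤ β' + ‖b k‖ₑ * e := by gcongr
          _ ≤ (β + ‖b k‖ₑ * e) + ‖b k‖ₑ * e := by gcongr
          _ = _ := by ring
      exact (ENNReal.add_le_add_iff_left hβt).1 this
    constructor
    · intro hb
      rw [hb] at hβ
      simp at hβ
      rw [hβ] at h4
      simp at h4
    · have h5 : ‖a k‖ₑ * e ≤ (2 * K * ‖b k‖ₑ) * e := by
        calc _ ≤ K * β' := h1
          _ ≤ K * (2 * (‖b k‖ₑ * e)) := by gcongr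
          _ = _ := by ring
      have h6 := (ENNReal.mul_le_mul_iff_left he0 het).1 h5
      have h7 := ENNReal.toReal_mono (by finiteness) h6
      simpa using h7
  refine ⟨mulOp fun k => if k ∈ P then a k / b k else 0, ?_, ?_, ?_⟩
  · intro k hk
    simp [mulOp, hk, (key k hk).1]
  · intro k hk h
    simp [mulOp, hk]
  · intro N hN h
    refine hN.mulOp_le (fun k => ?_) h
    split_ifs with hk
    · rw [abs_div, div_le_iff₀ (abs_pos.2 (key k hk).1)]
      simpa using (key k hk).2
    · simp

theorem exists_shift_operator (hE : IsSeqNorm J E) {a b : ℤ → ℝ} {P : Set ℤ} {K : ℝ≥0}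
    (hfin : ∀ k, E ((Set.Iio k).indicator b) ≠ ∞)
    (hac : ∀ ε : ℝ≥0∞, 0 < ε → ∃ n, E ((Set.Iio n).indicator b) < ε)
    (hP : ∀ k ∈ P, E ((Set.Iio (k + 1)).indicator a) ≤ K * E ((Set.Iio (k + 1)).indicator b))
    (hj : ∀ k ∈ P, E ((Set.Iio (k + 1)).indicator b) ≤ 2 * E ((Set.Iio k).indicator b))
    (hpos : ∀ k ∈ P, E ((Set.Iio k).indicator b) ≠ 0) :
    ∃ T : (ℤ → ℝ) →ₗ[ℝ] (ℤ → ℝ), (∀ k ∈ P, T b k = a k) ∧ (∀ k ∉ P, ∀ h, T h k = 0) ∧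
      ∀ N C, IsSeqNorm J N → RightShift E N C → ∀ h, N (T h) ≤ (33 * C * K : ℝ≥0) * N h := by
  classical
  set β : ℤ → ℝ := fun k => (E ((Set.Iio k).indicator b)).toReal with hβdef
  have hβE : ∀ k, E ((Set.Iio k).indicator b) = ENNReal.ofReal (β k) := fun k =>
    (ENNReal.ofReal_toReal (hfin k)).symm
  have hβm : Monotone β := fun i j hij => ENNReal.toReal_mono (hfin j)
    (hE.indicator_mono (Set.Iio_subset_Iio hij) b)
  have hβ0 : ∀ ε : ℝ, 0 < ε → ∃ n, β n < ε := by
    intro ε hε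
    obtain ⟨n, hn⟩ := hac (ENNReal.ofReal ε) (by simpa using hε)
    rw [hβE] at hn
    exact ⟨n, (ENNReal.ofReal_lt_ofReal_iff hε).1 hn⟩
  have hβpos : ∀ k ∈ P, 0 < β k := fun k hk => ENNReal.toReal_pos (hpos k hk) (hfin k)
  have hβj : ∀ k ∈ P, β (k + 1) ≤ 2 * β k := by
    intro k hk
    have := ENNReal.toReal_mono (by finiteness [hfin k]) (hj k hk)
    simpa [hβdef] using this
  set lev : ℤ → ℤ := fun k => Int.log 4 (β k) with hlev
  have lev1 : ∀ k ∈ P, (4 : ℝ) ^ lev k ≤ β k := fun k hk => by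
    exact_mod_cast Int.zpow_log_le_self (b := 4) (by norm_num) (hβpos k hk)
  have lev2 : ∀ k, β k < (4 : ℝ) ^ (lev k + 1) := fun k => by
    exact_mod_cast Int.lt_zpow_succ_log_self (b := 4) (by norm_num) (β k)
  set S : ℤ → Set ℤ := fun j => {i | β i < (4 : ℝ) ^ j ∧ (4 : ℝ) ^ (j - 1) ≤ β (i + 1)} with hS
  have lt_of : ∀ {i k : ℤ}, β i < β k → i < k := fun h => hβm.reflect_lt h
  have hSfin : ∀ k ∈ P, (S (lev k)).Finite := by
    intro k hk
    obtain ⟨n, hn⟩ := hβ0 ((4 : ℝ) ^ (lev k - 1)) (by positivity)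
    refine (Set.finite_Icc n k).subset fun i hi => ⟨?_, (lt_of (hi.1.trans_le (lev1 k hk))).le⟩
    have := lt_of (hn.trans_le hi.2)
    omega
  set σ : ℤ → ℝ := fun j => (E ((S j).indicator b)).toReal with hσdef
  have hσ : ∀ k ∈ P, 3 * (4 : ℝ) ^ (lev k - 1) ≤ σ (lev k) := by
    intro k hk
    set j := lev k
    obtain ⟨n0, hn0⟩ := hβ0 ((4 : ℝ) ^ (j - 1)) (by positivity)
    have h4 : (4 : ℝ) ^ j = 4 * 4 ^ (j - 1) := by
      rw [← zpow_one_add₀ (by norm_num)]; congr 1; ring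
    have h4p : (0 : ℝ) < 4 ^ (j - 1) := by positivity
    obtain ⟨n, hn1, hn2⟩ := Int.exists_least_of_bdd (P := fun i => (4 : ℝ) ^ j ≤ β i)
      ⟨n0, fun z hz => (lt_of (hn0.trans_le (by linarith))).le⟩ ⟨k, lev1 k hk⟩
    obtain ⟨m, hm1, hm2⟩ := Int.exists_least_of_bdd (P := fun i => (4 : ℝ) ^ (j - 1) ≤ β (i + 1))
      ⟨n0 - 1, fun z hz => by have := lt_of (hn0.trans_le hz); omega⟩
      ⟨k, by have := hβm (show k ≤ k + 1 by omega); have := lev1 k hk; linarith⟩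
    have hm3 : β m < (4 : ℝ) ^ (j - 1) := by
      by_contra h
      have := hm2 (m - 1) (by simpa using h)
      omega
    have hsub : Set.Iio n ⊆ Set.Iio m ∪ S j := by
      intro i hi
      by_cases him : i < m
      · exact Or.inl him
      · right
        refine ⟨?_, hm1.trans (hβm (by omega))⟩
        by_contra h
        have := hn2 i (not_lt.1 h)
        simp at hi
        omega
    have h5 := hE.le_indicator_add hsub b
    have h6 := ENNReal.toReal_mono (ENNReal.add_ne_top.2
      ⟨hfin m, hE.indicator_ne_top (hSfin k hk) b⟩) h5
    rw [ENNReal.toReal_add (hfin m) (hE.indicator_ne_top (hSfin k hk) b)] at h6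
    change β n ≤ β m + σ j at h6
    linarith
  have hσpos : ∀ k ∈ P, 0 < σ (lev k) := fun k hk =>
    lt_of_lt_of_le (by positivity) (hσ k hk)
  have hφ : ∀ j, ∃ φ : (ℤ → ℝ) →ₗ[ℝ] ℝ, (S j).Finite → φ b = σ j ∧
      ∀ x, |φ x| ≤ (E ((S j).indicator x)).toReal := by
    intro j
    by_cases h : (S j).Finite
    · obtain ⟨φ, h1, h2⟩ := hE.exists_norming h b
      exact ⟨φ, fun _ => ⟨h1, h2⟩⟩
    · exact ⟨0, fun h' => absurd h' h⟩
  choose φ hφ using hφ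
  set T : (ℤ → ℝ) →ₗ[ℝ] (ℤ → ℝ) :=
    LinearMap.pi fun k => if k ∈ P then (a k / σ (lev k)) • φ (lev k) else 0 with hT
  have hTin : ∀ k ∈ P, ∀ h, T h k = a k / σ (lev k) * φ (lev k) h := by
    intro k hk h; simp [hT, hk]
  have hTout : ∀ k ∉ P, ∀ h, T h k = 0 := by
    intro k hk h; simp [hT, hk]
  refine ⟨T, ?_, hTout, ?_⟩
  · intro k hk
    rw [hTin k hk, ((hφ _) (hSfin k hk)).1, div_mul_cancel₀ _ (hσpos k hk).ne']
  intro N C hN hRS h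
  refine hN.fatou _ _ fun s => ?_
  set Q := s.filter (· ∈ P) with hQ
  set L := Q.image lev with hL
  set g : ℤ → ℤ → ℝ := fun j => {k | k ∈ Q ∧ lev k = j}.indicator (T h) with hg
  have hmemP : ∀ {k}, k ∈ Q → k ∈ P := fun hk => (Finset.mem_filter.1 hk).2
  have hLk : ∀ j ∈ L, ∃ k ∈ P, lev k = j := by
    intro j hj
    obtain ⟨k, hk, rfl⟩ := Finset.mem_image.1 hj
    exact ⟨k, hmemP hk, rfl⟩
  have hsum : (s : Set ℤ).indicator (T h) = ∑ j ∈ L, g j := by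
    ext k
    rw [Finset.sum_apply]
    by_cases hk : k ∈ Q
    · rw [Finset.sum_eq_single_of_mem (lev k) (Finset.mem_image_of_mem _ hk)]
      · have : k ∈ s := (Finset.mem_filter.1 hk).1
        simp [hg, hk, this]
      · intro j _ hj
        simp [hg, hj.symm]
    · rw [Finset.sum_eq_zero (fun j _ => by simp [hg, hk])]
      by_cases hks : k ∈ s
      · have : k ∉ P := fun h' => hk (Finset.mem_filter.2 ⟨hks, h'⟩)
        simp [hks, hTout k this]
      · simp [hks]
  have hgE : ∀ j ∈ L, E (g j) ≤ E ((11 * K : ℝ) • (S j).indicator h) := by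
    intro j hjL
    set Qj := Q.filter fun k => lev k = j with hQj
    have hne : Qj.Nonempty := by
      obtain ⟨k, hk, hkj⟩ := Finset.mem_image.1 hjL
      exact ⟨k, Finset.mem_filter.2 ⟨hk, hkj⟩⟩
    set k := Qj.max' hne with hk
    have hkQ : k ∈ Qj := Finset.max'_mem _ _
    have hkP : k ∈ P := hmemP (Finset.mem_filter.1 hkQ).1
    have hkj : lev k = j := (Finset.mem_filter.1 hkQ).2
    have hgeq : g j = (φ j h / σ j) • {k | k ∈ Q ∧ lev k = j}.indicator a := by
      ext i
      by_cases hi : i ∈ Q ∧ lev i = j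
      · have hi' : i ∈ {k | k ∈ Q ∧ lev k = j} := hi
        simp only [hg, Pi.smul_apply, Set.indicator_of_mem hi', smul_eq_mul]
        rw [hTin i (hmemP hi.1), hi.2]
        ring
      · have hi' : i ∉ {k | k ∈ Q ∧ lev k = j} := hi
        simp only [hg, Pi.smul_apply, Set.indicator_of_notMem hi', smul_zero]
    have hSj : (S j).Finite := hkj ▸ hSfin k hkP
    have hσj : 3 * (4 : ℝ) ^ (j - 1) ≤ σ j := hkj ▸ hσ k hkP
    have h1 : E ({k | k ∈ Q ∧ lev k = j}.indicator a) ≤ K * ENNReal.ofReal (32 * 4 ^ (j - 1)) := by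
      refine (hE.indicator_mono (T := Set.Iio (k + 1)) ?_ a).trans ((hP k hkP).trans ?_)
      · intro i hi
        have := Finset.le_max' Qj i (Finset.mem_filter.2 hi)
        simp only [Set.mem_Iio]
        omega
      · rw [hβE]
        gcongr
        have h3 := lev2 k
        have h2 := hβj k hkP
        rw [hkj] at h3
        have h4 : (4 : ℝ) ^ (j + 1) = 16 * 4 ^ (j - 1) := by
          rw [show j + 1 = 2 + (j - 1) by ring, zpow_add₀ (by norm_num)]; norm_num
        linarith
    set n := (E ((S j).indicator h)).toReal with hn
    have hnE : E ((S j).indicator h) = ENNReal.ofReal n :=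
      (ENNReal.ofReal_toReal (hE.indicator_ne_top hSj h)).symm
    have hn0 : 0 ≤ n := ENNReal.toReal_nonneg
    have h4p : (0 : ℝ) < 4 ^ (j - 1) := by positivity
    have h5 : ‖φ j h / σ j‖ₑ ≤ ENNReal.ofReal (n / (3 * 4 ^ (j - 1))) := by
      rw [Real.enorm_eq_ofReal_abs]
      refine ENNReal.ofReal_le_ofReal ?_
      rw [abs_div]
      have := (hφ j hSj).2 h
      have h6 : 0 < σ j := by linarith
      rw [abs_of_pos h6]
      gcongr
    rw [hgeq, hE.smul, hE.smul, hnE]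
    calc _ ≤ ENNReal.ofReal (n / (3 * 4 ^ (j - 1))) * (K * ENNReal.ofReal (32 * 4 ^ (j - 1))) := by
          gcongr
      _ = ENNReal.ofReal (32 / 3 * K * n) := by
          rw [← ENNReal.ofReal_coe_nnreal, ← ENNReal.ofReal_mul (by positivity),
            ← ENNReal.ofReal_mul (by positivity)]
          congr 1
          field_simp
      _ ≤ ENNReal.ofReal (11 * K * n) := by
          refine ENNReal.ofReal_le_ofReal ?_
          have : 0 ≤ (K : ℝ) * n := by positivity
          nlinarith
      _ = _ := by
          rw [ENNReal.ofReal_mul (by positivity), Real.enorm_eq_ofReal_abs,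
            abs_of_nonneg (by positivity)]
  have hclass : ∀ r : ℤ, N (∑ j ∈ L.filter (fun j => j % 3 = r), g j) ≤ C * (11 * K * N h) := by
    intro r
    have hfam : ShiftFamily (L.filter fun j => j % 3 = r)
        (fun j => (11 * K : ℝ) • (S j).indicator h) g := by
      have hS' : ∀ j i, ((11 * K : ℝ) • (S j).indicator h) i ≠ 0 → i ∈ S j := by
        intro j i hi
        by_contra h'
        simp [h'] at hi
      have hg' : ∀ j i, g j i ≠ 0 → i ∈ Q ∧ lev i = j := by
        intro j i hi
        by_contra h'
        exact hi (Set.indicator_of_notMem (s := {k | k ∈ Q ∧ lev k = j}) h' _)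
      constructor
      · intro j hj
        obtain ⟨k, hk, rfl⟩ := hLk j (Finset.mem_filter.1 hj).1
        exact (hSfin k hk).subset fun i hi => hS' _ i hi
      · intro j hj
        exact (Finset.finite_toSet Q).subset fun i hi => (hg' j i hi).1
      · intro j _ i k hi hk
        obtain ⟨h1, rfl⟩ := hg' _ _ hk
        exact lt_of ((hS' _ _ hi).1.trans_le (lev1 k (hmemP h1)))
      · intro i hi j hj hij p q hp hq
        have hij3 : i + 3 ≤ j := by
          have h1 := (Finset.mem_filter.1 hi).2
          have h2 := (Finset.mem_filter.1 hj).2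
          omega
        obtain ⟨k, hk, hki⟩ := hLk i (Finset.mem_filter.1 hi).1
        have hp1 : β (p + 1) < (4 : ℝ) ^ (i + 2) := by
          rcases hp with hp | hp
          · have h1 := lt_of ((hS' _ _ hp).1.trans_le (hki ▸ lev1 k hk))
            have h2 := hβm (show p + 1 ≤ k by omega)
            have h3 := lev2 k
            rw [hki] at h3
            have h4 : (4 : ℝ) ^ (i + 1) ≤ 4 ^ (i + 2) :=
              zpow_le_zpow_right₀ (by norm_num) (by omega)
            linarith
          · obtain ⟨h1, h2⟩ := hg' _ _ hp
            have h3 := hβj p (hmemP h1)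
            have h4 := lev2 p
            rw [h2] at h4
            have h5 : (4 : ℝ) ^ (i + 2) = 4 * 4 ^ (i + 1) := by
              rw [← zpow_one_add₀ (by norm_num)]; congr 1; ring
            have h6 : (0 : ℝ) < 4 ^ (i + 1) := by positivity
            linarith
        have hq1 : (4 : ℝ) ^ (j - 1) ≤ β (q + 1) := by
          rcases hq with hq | hq
          · exact (hS' _ _ hq).2
          · obtain ⟨h1, h2⟩ := hg' _ _ hq
            have h3 := lev1 q (hmemP h1)
            rw [h2] at h3
            have h4 : (4 : ℝ) ^ (j - 1) ≤ 4 ^ j := zpow_le_zpow_right₀ (by norm_num) (by omega)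
            have := hβm (show q ≤ q + 1 by omega)
            linarith
        have h7 : (4 : ℝ) ^ (i + 2) ≤ 4 ^ (j - 1) := zpow_le_zpow_right₀ (by norm_num) (by omega)
        have := lt_of (hp1.trans_le (h7.trans hq1))
        omega
    refine (hRS _ _ _ hfam fun j hj => hgE j (Finset.mem_filter.1 hj).1).trans ?_
    gcongr
    rw [← Finset.smul_sum, hN.smul, Real.enorm_eq_ofReal_abs, abs_of_nonneg (by positivity)]
    rw [ENNReal.ofReal_mul (by positivity)]
    simp only [ENNReal.ofReal_ofNat, ENNReal.ofReal_coe_nnreal]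
    gcongr
    refine hN.sum_indicator_le _ _ (fun i hi j hj hij => ?_) h
    have aux : ∀ i ∈ L.filter (fun j => j % 3 = r), ∀ j ∈ L.filter (fun j => j % 3 = r), i < j →
        ∀ p ∈ S i, p ∈ S j → False := by
      intro i hi j hj hij p hp hq
      have hij3 : i + 3 ≤ j := by
        have h1 := (Finset.mem_filter.1 hi).2
        have h2 := (Finset.mem_filter.1 hj).2
        omega
      obtain ⟨k, hk, hki⟩ := hLk i (Finset.mem_filter.1 hi).1
      have h1 := lt_of (hp.1.trans_le (hki ▸ lev1 k hk))
      have h2 := hβm (show p + 1 ≤ k by omega)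
      have h3 := lev2 k
      rw [hki] at h3
      have h4 : (4 : ℝ) ^ (i + 1) ≤ 4 ^ (j - 1) := zpow_le_zpow_right₀ (by norm_num) (by omega)
      have := hq.2
      linarith
    rw [Set.disjoint_left]
    intro p hp hq
    rcases lt_or_gt_of_ne hij with h' | h'
    · exact aux i hi j hj h' p hp hq
    · exact aux j hj i hi h' p hq hp
  rw [hsum, ← Finset.sum_fiberwise_of_maps_to (t := Finset.Ico (0 : ℤ) 3) (g := fun j => j % 3)
    (fun j _ => by simp only [Finset.mem_Ico]; omega)]
  refine (hN.sum_le _ _).trans ((Finset.sum_le_sum fun r _ => hclass r).trans (le_of_eq ?_))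
  rw [Finset.sum_const]
  simp only [Int.card_Ico, sub_zero, Int.reduceToNat, nsmul_eq_mul]
  push_cast
  ring

/-- Domination of the initial segments of `a` by those of `b` yields a bounded operator that maps
`b` to `a`, provided that shifts to the right are bounded. -/
theorem exists_operator (hE : IsSeqNorm J E) {a b : ℤ → ℝ} {P : Set ℤ} {K : ℝ≥0} (hPJ : P ⊆ J)
    (hfin : ∀ k, E ((Set.Iio k).indicator b) ≠ ∞)
    (hac : ∀ ε : ℝ≥0∞, 0 < ε → ∃ n, E ((Set.Iio n).indicator b) < ε)
    (hP : ∀ k ∈ P, E ((Set.Iio (k + 1)).indicator a) ≤ K * E ((Set.Iio (k + 1)).indicator b)) :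
    ∃ T : (ℤ → ℝ) →ₗ[ℝ] (ℤ → ℝ), (∀ k ∈ P, T b k = a k) ∧ (∀ k ∉ P, ∀ h, T h k = 0) ∧
      ∀ N C, IsSeqNorm J N → RightShift E N C →
        ∀ h, N (T h) ≤ (33 * C * K + 2 * K : ℝ≥0) * N h := by
  set P₁ := {k | k ∈ P ∧ 2 * E ((Set.Iio k).indicator b) < E ((Set.Iio (k + 1)).indicator b)}
  set P₂ := {k | k ∈ P \ P₁ ∧ E ((Set.Iio k).indicator b) ≠ 0}
  have hnj : ∀ k ∈ P \ P₁,
      E ((Set.Iio (k + 1)).indicator b) ≤ 2 * E ((Set.Iio k).indicator b) :=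
    fun k hk => not_lt.1 fun h => hk.2 ⟨hk.1, h⟩
  obtain ⟨T₁, h1, h1', h1''⟩ := hE.exists_jump_operator (P := P₁) (a := a)
    (fun k hk => hPJ hk.1) hfin (fun k hk => hP k hk.1) (fun k hk => hk.2)
  obtain ⟨T₂, h2, h2', h2''⟩ := hE.exists_shift_operator (P := P₂) (a := a)
    hfin hac (fun k hk => hP k hk.1.1) (fun k hk => hnj k hk.1) (fun k hk => hk.2)
  refine ⟨T₁ + T₂, ?_, ?_, ?_⟩
  · intro k hk
    by_cases hk1 : k ∈ P₁
    · simp [h1 k hk1, h2' k (fun h => h.1.2 hk1)]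
    · by_cases hk2 : k ∈ P₂
      · simp [h1' k hk1, h2 k hk2]
      · have hk0 : E ((Set.Iio k).indicator b) = 0 := by
          by_contra h
          exact hk2 ⟨⟨hk, hk1⟩, h⟩
        have h3 := hnj k ⟨hk, hk1⟩
        rw [hk0, mul_zero, nonpos_iff_eq_zero] at h3
        have h4 := hP k hk
        rw [h3, mul_zero] at h4
        have h5 := (hE.abs_mul_single_le ((Set.Iio (k + 1)).indicator a) k).trans h4
        have h6 : a k = 0 := by
          simpa [hE.single_ne_zero k (hPJ hk)] using h5
        simp [h1' k hk1, h2' k hk2, h6]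
  · intro k hk h
    simp [h1' k (fun h => hk h.1), h2' k (fun h => hk h.1.1)]
  · intro N C hN hRS h
    refine (hN.add_le _ _).trans ((add_le_add (h1'' N hN h) (h2'' N C hN hRS h)).trans (le_of_eq ?_))
    push_cast
    ring

end IsSeqNorm


/-! ### Couples of sequence norms, and reflection of the index set -/

/-- Reflection of two-sided sequences. It interchanges the coordinates `< n` and `≥ -n`. -/
def reflect (x : ℤ → ℝ) : ℤ → ℝ := fun k => x (-1 - k)

@[simp] theorem reflect_apply (x : ℤ → ℝ) (k : ℤ) : reflect x k = x (-1 - k) := rfl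

@[simp] theorem reflect_reflect (x : ℤ → ℝ) : reflect (reflect x) = x := by
  ext k; simp

theorem reflect_add (x y : ℤ → ℝ) : reflect (x + y) = reflect x + reflect y := rfl

theorem reflect_smul (c : ℝ) (x : ℤ → ℝ) : reflect (c • x) = c • reflect x := rfl

theorem reflect_sum {ι : Type*} (s : Finset ι) (f : ι → ℤ → ℝ) :
    reflect (∑ i ∈ s, f i) = ∑ i ∈ s, reflect (f i) := by
  ext k; simp [Finset.sum_apply]

theorem reflect_indicator (S : Set ℤ) (x : ℤ → ℝ) :
    reflect (S.indicator x) = {k | -1 - k ∈ S}.indicator (reflect x) := rfl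

theorem reflect_Iio (n : ℤ) (x : ℤ → ℝ) :
    reflect ((Set.Iio n).indicator x) = (Set.Ici (-n)).indicator (reflect x) := by
  rw [reflect_indicator]; congr 1; ext k; simp only [Set.mem_Iio, Set.mem_ofPred_eq, Set.mem_Ici]
  omega

theorem reflect_Ici (n : ℤ) (x : ℤ → ℝ) :
    reflect ((Set.Ici n).indicator x) = (Set.Iio (-n)).indicator (reflect x) := by
  rw [reflect_indicator]; congr 1; ext k; simp only [Set.mem_Iio, Set.mem_ofPred_eq, Set.mem_Ici]
  omega

/-- Reflection as a linear map. -/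
def reflectₗ : (ℤ → ℝ) →ₗ[ℝ] (ℤ → ℝ) where
  toFun := reflect
  map_add' := reflect_add
  map_smul' := reflect_smul

@[simp] theorem reflectₗ_apply (x : ℤ → ℝ) : reflectₗ x = reflect x := rfl

theorem IsSeqNorm.reflect {J : Set ℤ} {E : (ℤ → ℝ) → ℝ≥0∞} (hE : IsSeqNorm J E) :
    IsSeqNorm {k | -1 - k ∈ J} (fun x => E (reflect x)) where
  smul c x := by rw [reflect_smul, hE.smul]
  add_le x y := by rw [reflect_add]; exact hE.add_le _ _
  mono x y h := hE.mono _ _ fun n hn => h _ (by simpa using hn)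
  fatou x c h := hE.fatou _ _ fun s => by
    have := h (s.image fun k => -1 - k)
    rw [reflect_indicator] at this
    convert this using 3
    ext k
    simp
  single_ne_zero n hn := by
    convert hE.single_ne_zero (-1 - n) hn using 2
    ext k
    by_cases h : k = -1 - n
    · subst h; simp
    · have : -1 - k ≠ n := by omega
      simp [h, this]
  single_ne_top n := by
    convert hE.single_ne_top (-1 - n) using 2
    ext k
    by_cases h : k = -1 - n
    · subst h; simp
    · have : -1 - k ≠ n := by omega
      simp [h, this]

theorem ShiftFamily.reflect {s : Finset ℤ} {h g : ℤ → ℤ → ℝ} (H : ShiftFamily s h g) :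
    ShiftFamily (s.image Neg.neg) (fun j => reflect (g (-j))) (fun j => reflect (h (-j))) := by
  have mem : ∀ {j}, j ∈ s.image Neg.neg → -j ∈ s := by
    intro j hj
    obtain ⟨i, hi, rfl⟩ := Finset.mem_image.1 hj
    simpa using hi
  have fin : ∀ x : ℤ → ℝ, (Function.support x).Finite →
      (Function.support (CalderonRI.reflect x)).Finite := by
    intro x hx
    refine (hx.image fun k => -1 - k).subset fun k hk => ⟨-1 - k, ?_, by simp⟩
    simpa using hk
  constructor
  · exact fun j hj => fin _ (H.finite_right _ (mem hj))
  · exact fun j hj => fin _ (H.finite_left _ (mem hj))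
  · intro j hj a b ha hb
    have := H.lt _ (mem hj) _ _ hb ha
    omega
  · intro i hi j hj hij a b ha hb
    have := H.lt_of_lt _ (mem hj) _ (mem hi) (by omega) _ _ hb.symm ha.symm
    omega

theorem sum_image_neg {s : Finset ℤ} (f : ℤ → ℤ → ℝ) :
    ∑ j ∈ s.image Neg.neg, f (-j) = ∑ j ∈ s, f j := by
  rw [Finset.sum_image (fun a _ b _ h => neg_injective h)]
  simp

theorem LeftShift.reflect {F N : (ℤ → ℝ) → ℝ≥0∞} {C : ℝ≥0} (H : LeftShift F N C) :
    RightShift (fun x => F (reflect x)) (fun x => N (reflect x)) C := by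
  intro s h g hfam hle
  have := H _ (fun j => CalderonRI.reflect (h (-j))) (fun j => CalderonRI.reflect (g (-j)))
    hfam.reflect (by
      intro j hj
      obtain ⟨i, hi, rfl⟩ := Finset.mem_image.1 hj
      simpa using hle i hi)
  rw [sum_image_neg fun j => CalderonRI.reflect (g j),
    sum_image_neg fun j => CalderonRI.reflect (h j)] at this
  simpa only [reflect_sum] using this

theorem RightShift.reflect {E N : (ℤ → ℝ) → ℝ≥0∞} {C : ℝ≥0} (H : RightShift E N C) :
    LeftShift (fun x => E (reflect x)) (fun x => N (reflect x)) C := by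
  intro s h g hfam hle
  have := H _ (fun j => CalderonRI.reflect (h (-j))) (fun j => CalderonRI.reflect (g (-j)))
    hfam.reflect (by
      intro j hj
      obtain ⟨i, hi, rfl⟩ := Finset.mem_image.1 hj
      simpa using hle i hi)
  rw [sum_image_neg fun j => CalderonRI.reflect (g j),
    sum_image_neg fun j => CalderonRI.reflect (h j)] at this
  simpa only [reflect_sum] using this

/-- A couple of sequence norms in which `F` is better than `E` on the right-hand side, on the
scale given by `t`. -/
structure IsCouple (J : Set ℤ) (E F : (ℤ → ℝ) → ℝ≥0∞) (t : ℤ → ℝ≥0) (C : ℝ≥0) : Prop where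
  left : IsSeqNorm J E
  right : IsSeqNorm J F
  pos : ∀ n, 0 < t n
  mono : Monotone t
  succ_le : ∀ n, t (n + 1) ≤ C * t n
  left_le : ∀ n x, E ((Set.Iio n).indicator x) ≤ C * t n * F x
  right_le : ∀ n x, t n * F ((Set.Ici n).indicator x) ≤ C * E x
  rightShift : RightShift E F C
  leftShift : LeftShift F E C

theorem IsCouple.reflect {J : Set ℤ} {E F : (ℤ → ℝ) → ℝ≥0∞} {t : ℤ → ℝ≥0} {C : ℝ≥0}
    (H : IsCouple J E F t C) :
    IsCouple {k | -1 - k ∈ J} (fun x => F (reflect x)) (fun x => E (reflect x))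
      (fun n => (t (-n))⁻¹) C where
  left := H.right.reflect
  right := H.left.reflect
  pos n := inv_pos.2 (H.pos _)
  mono i j hij := by
    have := H.mono (show -j ≤ -i by omega)
    exact inv_anti₀ (H.pos _) this
  succ_le n := by
    have := H.succ_le (-(n + 1))
    rw [show -(n + 1) + 1 = -n by ring] at this
    have h0 := H.pos (-n)
    rw [inv_le_iff_one_le_mul₀ (H.pos _), mul_right_comm, ← div_eq_mul_inv, one_le_div h0]
    exact this
  left_le n x := by
    rw [reflect_Iio]
    have h := H.right_le (-n) (CalderonRI.reflect x)
    have h0 : (t (-n) : ℝ≥0∞) ≠ 0 := by simpa using (H.pos (-n)).ne'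
    calc _ = (t (-n) : ℝ≥0∞)⁻¹ * (t (-n) * F ((Set.Ici (-n)).indicator (CalderonRI.reflect x))) := by
          rw [← mul_assoc, ENNReal.inv_mul_cancel h0 (by simp), one_mul]
      _ ≤ (t (-n) : ℝ≥0∞)⁻¹ * (C * E (CalderonRI.reflect x)) := by gcongr
      _ = _ := by rw [ENNReal.coe_inv (H.pos _).ne']; ring
  right_le n x := by
    rw [reflect_Ici]
    have h := H.left_le (-n) (CalderonRI.reflect x)
    have h0 : (t (-n) : ℝ≥0∞) ≠ 0 := by simpa using (H.pos (-n)).ne'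
    calc _ = (t (-n) : ℝ≥0∞)⁻¹ * E ((Set.Iio (-n)).indicator (CalderonRI.reflect x)) := by
          rw [ENNReal.coe_inv (H.pos _).ne']
      _ ≤ (t (-n) : ℝ≥0∞)⁻¹ * (C * t (-n) * F (CalderonRI.reflect x)) := by gcongr
      _ = ((t (-n) : ℝ≥0∞)⁻¹ * t (-n)) * (C * F (CalderonRI.reflect x)) := by ring
      _ = _ := by rw [ENNReal.inv_mul_cancel h0 (by simp), one_mul]
  rightShift := H.leftShift.reflect
  leftShift := H.rightShift.reflect

/-- The operator that witnesses a uniform Calderón couple, for sequences. -/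
theorem IsCouple.exists_operator {J : Set ℤ} {E F : (ℤ → ℝ) → ℝ≥0∞} {t : ℤ → ℝ≥0} {C : ℝ≥0}
    (H : IsCouple J E F t C) {C₁ C₂ : ℝ≥0} (hE : RightShift E E C₁) (hF : LeftShift F F C₂)
    (hacE : ∀ x, E x ≠ ∞ → ∀ ε : ℝ≥0∞, 0 < ε → ∃ n, E ((Set.Iio n).indicator x) < ε)
    (hacF : ∀ x, F x ≠ ∞ → ∀ ε : ℝ≥0∞, 0 < ε → ∃ n, F ((Set.Ici n).indicator x) < ε) (C₀ : ℝ≥0) :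
    ∃ K : ℝ≥0, ∀ a b : ℤ → ℝ, (∀ k, E ((Set.Iio k).indicator b) ≠ ∞) →
      (∀ k, F ((Set.Ici k).indicator b) ≠ ∞) →
      (∀ k, E ((Set.Iio k).indicator a) + t k * F ((Set.Ici k).indicator a) ≤
        C₀ * (E ((Set.Iio k).indicator b) + t k * F ((Set.Ici k).indicator b))) →
      ∃ T : (ℤ → ℝ) →ₗ[ℝ] (ℤ → ℝ), (∀ h, E (T h) ≤ K * E h) ∧ (∀ h, F (T h) ≤ K * F h) ∧
        ∀ k ∈ J, T b k = a k := by
  set M : ℝ≥0 := C₀ * (2 + C) with hM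
  set D : ℝ≥0 := max C (max C₁ C₂) with hD
  set K : ℝ≥0 := 33 * D * M + 2 * M with hK
  have hDK : ∀ D' ≤ D, 33 * D' * M + 2 * M ≤ K := by intro D' h; rw [hK]; gcongr
  refine ⟨2 * K, fun a b hbE hbF hab => ?_⟩
  set P₁ := {k | k ∈ J ∧ t (k + 1) * F ((Set.Ici (k + 1)).indicator b) ≤
    E ((Set.Iio (k + 1)).indicator b)} with hP₁
  set P₂ := J \ P₁ with hP₂
  have h1 : ∀ k ∈ P₁, E ((Set.Iio (k + 1)).indicator a) ≤
      M * E ((Set.Iio (k + 1)).indicator b) := by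
    intro k hk
    refine le_self_add.trans ((hab (k + 1)).trans ?_)
    calc _ ≤ C₀ * (E ((Set.Iio (k + 1)).indicator b) + E ((Set.Iio (k + 1)).indicator b)) := by
          gcongr; exact hk.2
      _ = C₀ * 2 * E ((Set.Iio (k + 1)).indicator b) := by ring
      _ ≤ _ := by
          gcongr
          rw [hM]
          push_cast
          gcongr
          exact le_self_add
  have h2 : ∀ k ∈ P₂, F ((Set.Ici k).indicator a) ≤ M * F ((Set.Ici k).indicator b) := by
    intro k hk
    have h3 : E ((Set.Iio (k + 1)).indicator b) <
        t (k + 1) * F ((Set.Ici (k + 1)).indicator b) := not_le.1 fun h => hk.2 ⟨hk.1, h⟩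
    have h4 : E ((Set.Iio k).indicator b) ≤ C * (t k * F ((Set.Ici k).indicator b)) := by
      calc _ ≤ E ((Set.Iio (k + 1)).indicator b) :=
            H.left.indicator_mono (Set.Iio_subset_Iio (by omega)) b
        _ ≤ _ := h3.le
        _ ≤ ((C * t k : ℝ≥0) : ℝ≥0∞) * F ((Set.Ici k).indicator b) := by
            gcongr
            · exact H.succ_le k
            · exact H.right.indicator_mono (Set.Ici_subset_Ici.2 (by omega)) b
        _ = _ := by push_cast; ring
    have h5 : t k * F ((Set.Ici k).indicator a) ≤
        t k * (M * F ((Set.Ici k).indicator b)) := by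
      calc _ ≤ _ := le_add_self.trans (hab k)
        _ ≤ C₀ * (C * (t k * F ((Set.Ici k).indicator b)) +
              t k * F ((Set.Ici k).indicator b)) := by gcongr
        _ = C₀ * (1 + C) * (t k * F ((Set.Ici k).indicator b)) := by ring
        _ ≤ M * (t k * F ((Set.Ici k).indicator b)) := by
            gcongr
            rw [hM]
            push_cast
            gcongr
            exact one_le_two
        _ = _ := by ring
    exact (ENNReal.mul_le_mul_iff_right (by simpa using (H.pos k).ne') (by simp)).1 h5
  obtain ⟨T₁, hT₁, hT₁', hT₁''⟩ := H.left.exists_operator (P := P₁) (fun k hk => hk.1) hbE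
    (fun ε hε => by
      obtain ⟨n, hn⟩ := hacE _ (hbE 0) ε hε
      refine ⟨min n 0, lt_of_le_of_lt ?_ hn⟩
      rw [Set.indicator_indicator]
      exact H.left.indicator_mono (fun i hi => by simp at hi ⊢; omega) b) h1
  have H' := H.reflect
  obtain ⟨T₂, hT₂, hT₂', hT₂''⟩ := H'.left.exists_operator (P := {k | -1 - k ∈ P₂})
    (a := CalderonRI.reflect a) (b := CalderonRI.reflect b) (K := M)
    (fun k hk => hk.1) (fun k => by rw [reflect_Iio, reflect_reflect]; exact hbF _)
    (fun ε hε => by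
      obtain ⟨n, hn⟩ := hacF _ (hbF 0) ε hε
      refine ⟨-max n 0, lt_of_le_of_lt ?_ hn⟩
      rw [reflect_Iio, reflect_reflect, neg_neg, Set.indicator_indicator]
      exact H.right.indicator_mono (fun i hi => by simp at hi ⊢; omega) b)
    (fun k hk => by
      simp only [reflect_Iio, reflect_reflect]
      have := h2 _ hk
      rwa [show -1 - k = -(k + 1) by ring] at this)
  refine ⟨T₁ + reflectₗ ∘ₗ T₂ ∘ₗ reflectₗ, ?_, ?_, ?_⟩
  · intro h
    have e1 := hT₁'' E C₁ H.left hE h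
    have e2 := hT₂'' _ C H'.right H'.rightShift (CalderonRI.reflect h)
    rw [reflect_reflect] at e2
    refine (H.left.add_le _ _).trans ((add_le_add e1 e2).trans ?_)
    rw [← add_mul, ← ENNReal.coe_add, two_mul K]
    gcongr ?_ * _
    rw [ENNReal.coe_le_coe]
    exact add_le_add (hDK C₁ (by simp [hD])) (hDK C (by simp [hD]))
  · intro h
    have e1 := hT₁'' F C H.right H.rightShift h
    have e2 := hT₂'' _ C₂ H'.left hF.reflect (CalderonRI.reflect h)
    rw [reflect_reflect] at e2
    refine (H.right.add_le _ _).trans ((add_le_add e1 e2).trans ?_)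
    rw [← add_mul, ← ENNReal.coe_add, two_mul K]
    gcongr ?_ * _
    rw [ENNReal.coe_le_coe]
    exact add_le_add (hDK C (by simp [hD])) (hDK C₂ (by simp [hD]))
  · intro k hk
    by_cases hk1 : k ∈ P₁
    · have : -1 - k ∉ {k | -1 - k ∈ P₂} := by simp [hP₂, hk1]
      simp [hT₁ k hk1, hT₂' _ this]
    · have : -1 - k ∈ {k | -1 - k ∈ P₂} := by simp [hP₂, hk1, hk]
      simp [hT₁' k hk1, hT₂ _ this]


/-! ### Shifts of families that are separated on the scale `t` -/

/-- Consecutive blocks `[lo, mid) ∪ [mid, hi)` in `ℤ`, separated by the factor `Λ` on the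
scale `t`. -/
structure Blocks (J : Set ℤ) (t : ℤ → ℝ≥0) (Λ : ℝ≥0) (s : Finset ℤ) (lo mid hi : ℤ → ℤ) : Prop where
  le_mid : ∀ j ∈ s, lo j ≤ mid j
  mid_lt : ∀ j ∈ s, mid j < hi j
  mem : ∀ j ∈ s, hi j - 1 ∈ J
  le : ∀ i ∈ s, ∀ j ∈ s, i < j → hi i ≤ lo j
  sep : ∀ i ∈ s, ∀ j ∈ s, i < j → Λ * t (hi i) ≤ t (lo j)

/-- A family of pairs that is supported by given blocks, with `E (g j) ≤ E (h j)`. -/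
structure BlockFamily (E : (ℤ → ℝ) → ℝ≥0∞) (s : Finset ℤ) (lo mid hi : ℤ → ℤ)
    (h g : ℤ → ℤ → ℝ) : Prop where
  left : ∀ j ∈ s, ∀ k, h j k ≠ 0 → lo j ≤ k ∧ k < mid j
  right : ∀ j ∈ s, ∀ k, g j k ≠ 0 → mid j ≤ k ∧ k < hi j
  le : ∀ j ∈ s, E (g j) ≤ E (h j)

/-- Boundedness of the shift to the right for `Λ`-separated families. -/
def SepRightShift (J : Set ℤ) (E : (ℤ → ℝ) → ℝ≥0∞) (t : ℤ → ℝ≥0) (Λ C : ℝ≥0) : Prop :=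
  ∀ s lo mid hi h g, Blocks J t Λ s lo mid hi → BlockFamily E s lo mid hi h g →
    E (∑ j ∈ s, g j) ≤ C * E (∑ j ∈ s, h j)

theorem Blocks.subset {J : Set ℤ} {t : ℤ → ℝ≥0} {Λ : ℝ≥0} {s s' : Finset ℤ} {lo mid hi : ℤ → ℤ}
    (B : Blocks J t Λ s lo mid hi) (h : s' ⊆ s) : Blocks J t Λ s' lo mid hi :=
  ⟨fun j hj => B.le_mid j (h hj), fun j hj => B.mid_lt j (h hj), fun j hj => B.mem j (h hj),
    fun i hi j hj => B.le i (h hi) j (h hj), fun i hi j hj => B.sep i (h hi) j (h hj)⟩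

theorem BlockFamily.subset {E : (ℤ → ℝ) → ℝ≥0∞} {s s' : Finset ℤ} {lo mid hi : ℤ → ℤ}
    {f g : ℤ → ℤ → ℝ} (B : BlockFamily E s lo mid hi f g) (h : s' ⊆ s) :
    BlockFamily E s' lo mid hi f g :=
  ⟨fun j hj => B.left j (h hj), fun j hj => B.right j (h hj), fun j hj => B.le j (h hj)⟩

theorem ShiftFamily.subset {s s' : Finset ℤ} {f g : ℤ → ℤ → ℝ} (B : ShiftFamily s f g)
    (h : s' ⊆ s) : ShiftFamily s' f g :=
  ⟨fun j hj => B.finite_left j (h hj), fun j hj => B.finite_right j (h hj),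
    fun j hj => B.lt j (h hj), fun i hi j hj => B.lt_of_lt i (h hi) j (h hj)⟩

theorem BlockFamily.shiftFamily {E : (ℤ → ℝ) → ℝ≥0∞} {J : Set ℤ} {t : ℤ → ℝ≥0} {Λ : ℝ≥0}
    {s : Finset ℤ} {lo mid hi : ℤ → ℤ}
    {f g : ℤ → ℤ → ℝ} (F : BlockFamily E s lo mid hi f g) (B : Blocks J t Λ s lo mid hi) :
    ShiftFamily s f g := by
  constructor
  · intro j hj
    exact (Set.finite_Ico (lo j) (mid j)).subset fun k hk => F.left j hj k hk
  · intro j hj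
    exact (Set.finite_Ico (mid j) (hi j)).subset fun k hk => F.right j hj k hk
  · intro j hj a b ha hb
    have := F.left j hj a ha
    have := F.right j hj b hb
    omega
  · intro i hi' j hj hij a b ha hb
    have h1 := B.le i hi' j hj hij
    have h2 := B.le_mid i hi'
    have h3 := B.mid_lt i hi'
    have h4 := B.le_mid j hj
    have h5 : a < hi i := by
      rcases ha with ha | ha
      · exact (F.left i hi' a ha).2.trans h3
      · exact (F.right i hi' a ha).2
    have h6 : lo j ≤ b := by
      rcases hb with hb | hb
      · exact (F.left j hj b hb).1
      · exact h4.trans (F.right j hj b hb).1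
    omega

namespace IsSeqNorm

variable {J : Set ℤ} {E : (ℤ → ℝ) → ℝ≥0∞} (hE : IsSeqNorm J E)

include hE

theorem smul_coe (c : ℝ≥0) (x : ℤ → ℝ) : E ((c : ℝ) • x) = c * E x := by
  rw [hE.smul]; simp

/-- Partial sums of disjointly supported families have smaller norm. -/
theorem sum_le_sum_of_subset {ι : Type*} {s s' : Finset ι} (hs : s' ⊆ s) {f : ι → ℤ → ℝ}
    (hf : ∀ i ∈ s, ∀ j ∈ s, i ≠ j → ∀ k, f i k ≠ 0 → f j k = 0) :
    E (∑ i ∈ s', f i) ≤ E (∑ i ∈ s, f i) := by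
  refine hE.mono' fun k => ?_
  rw [Finset.sum_apply, Finset.sum_apply]
  by_cases h : ∃ i ∈ s', f i k ≠ 0
  · obtain ⟨i, hi, hk⟩ := h
    rw [Finset.sum_eq_single_of_mem i hi fun j hj hji => hf i (hs hi) j (hs hj) hji.symm k hk,
      Finset.sum_eq_single_of_mem i (hs hi) fun j hj hji => hf i (hs hi) j hj hji.symm k hk]
  · push Not at h
    rw [Finset.sum_eq_zero fun i hi => h i hi]
    simp

end IsSeqNorm

theorem ShiftFamily.disjoint_left {s : Finset ℤ} {f g : ℤ → ℤ → ℝ} (B : ShiftFamily s f g) :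
    ∀ i ∈ s, ∀ j ∈ s, i ≠ j → ∀ k, f i k ≠ 0 → f j k = 0 := by
  intro i hi j hj hij k hk
  by_contra h
  rcases lt_or_gt_of_ne hij with h' | h'
  · exact lt_irrefl k (B.lt_of_lt i hi j hj h' k k (Or.inl hk) (Or.inl h))
  · exact lt_irrefl k (B.lt_of_lt j hj i hi h' k k (Or.inl h) (Or.inl hk))

/-- It suffices to consider families with prescribed blocks. -/
theorem SepRightShift.rightShift {J : Set ℤ} {E : (ℤ → ℝ) → ℝ≥0∞} {t : ℤ → ℝ≥0} {C : ℝ≥0}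
    (hE : IsSeqNorm J E) (H : SepRightShift J E t 0 C) : RightShift E E C := by
  classical
  intro s h g hfam hle
  set h' : ℤ → ℤ → ℝ := fun j => J.indicator (h j) with hh'
  set g' : ℤ → ℤ → ℝ := fun j => J.indicator (g j) with hg'
  have hfam' : ShiftFamily s h' g' := by
    have e1 : ∀ j k, h' j k ≠ 0 → h j k ≠ 0 := fun j k hk h0 => hk (by simp [hh', h0])
    have e2 : ∀ j k, g' j k ≠ 0 → g j k ≠ 0 := fun j k hk h0 => hk (by simp [hg', h0])
    exact ⟨fun j hj => (hfam.finite_left j hj).subset fun k hk => e1 j k hk,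
      fun j hj => (hfam.finite_right j hj).subset fun k hk => e2 j k hk,
      fun j hj a b ha hb => hfam.lt j hj a b (e1 _ _ ha) (e2 _ _ hb),
      fun i hi j hj hij a b ha hb => hfam.lt_of_lt i hi j hj hij a b
        (ha.imp (e1 _ _) (e2 _ _)) (hb.imp (e1 _ _) (e2 _ _))⟩
  have hcongr : ∀ x : ℤ → ℝ, E (J.indicator x) = E x := fun x =>
    hE.congr fun n hn => by simp [hn]
  set s₀ := s.filter fun j => h' j ≠ 0 ∧ g' j ≠ 0 with hs₀
  have hs₀s : s₀ ⊆ s := Finset.filter_subset _ _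
  have hmem : ∀ j ∈ s₀, j ∈ s ∧ (Function.support (h' j)).Nonempty ∧
      (Function.support (g' j)).Nonempty := by
    intro j hj
    have := Finset.mem_filter.1 hj
    exact ⟨this.1, Function.support_nonempty_iff.2 this.2.1,
      Function.support_nonempty_iff.2 this.2.2⟩
  have hwit : ∀ j, ∃ lo mid hi : ℤ, j ∈ s₀ → (lo ≤ mid ∧ mid < hi ∧ hi - 1 ∈ J ∧ h' j lo ≠ 0 ∧
      g' j (hi - 1) ≠ 0 ∧
      (∀ k, h' j k ≠ 0 → lo ≤ k ∧ k < mid) ∧ (∀ k, g' j k ≠ 0 → mid ≤ k ∧ k < hi)) := by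
    intro j
    by_cases hj : j ∈ s₀
    · obtain ⟨hjs, hn1, hn2⟩ := hmem j hj
      obtain ⟨lo, hlo, hlo'⟩ := Set.exists_min_image _ id (hfam'.finite_left j hjs) hn1
      obtain ⟨mid, hmid, hmid'⟩ := Set.exists_min_image _ id (hfam'.finite_right j hjs) hn2
      obtain ⟨hi, hhi, hhi'⟩ := Set.exists_max_image _ id (hfam'.finite_right j hjs) hn2
      refine ⟨lo, mid, hi + 1, fun _ => ⟨(hfam'.lt j hjs _ _ hlo hmid).le, ?_, ?_, hlo, ?_, ?_, ?_⟩⟩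
      · have := hmid' hi hhi; simp at this; omega
      · rw [add_sub_cancel_right]; by_contra h0; exact hhi (by simp [hg', h0])
      · rwa [add_sub_cancel_right]
      · exact fun k hk => ⟨hlo' k hk, hfam'.lt j hjs _ _ hk hmid⟩
      · exact fun k hk => ⟨hmid' k hk, Int.lt_add_one_iff.2 (hhi' k hk)⟩
    · exact ⟨0, 0, 0, fun h => absurd h hj⟩
  choose lo mid hi hw using hwit
  have hB : Blocks J t 0 s₀ lo mid hi := by
    refine ⟨fun j hj => (hw j hj).1, fun j hj => (hw j hj).2.1, fun j hj => (hw j hj).2.2.1, ?_, ?_⟩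
    · intro i hi' j hj hij
      have := hfam'.lt_of_lt i (hs₀s hi') j (hs₀s hj) hij _ _ (Or.inr (hw i hi').2.2.2.2.1)
        (Or.inl (hw j hj).2.2.2.1)
      omega
    · intros; simp
  have hF : BlockFamily E s₀ lo mid hi h' g' :=
    ⟨fun j hj => (hw j hj).2.2.2.2.2.1, fun j hj => (hw j hj).2.2.2.2.2.2,
      fun j hj => by rw [hcongr, hcongr]; exact hle j (hs₀s hj)⟩
  have h1 := H s₀ lo mid hi h' g' hB hF
  have h2 : E (∑ j ∈ s, g j) ≤ E (∑ j ∈ s₀, g' j) := by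
    have e1 : E (∑ j ∈ s, g j) = E (∑ j ∈ s, g' j) := by
      refine hE.congr fun n hn => ?_
      simp [Finset.sum_apply, hg', hn]
    rw [e1, ← Finset.sum_filter_add_sum_filter_not s (fun j => h' j ≠ 0 ∧ g' j ≠ 0)]
    refine (hE.add_le _ _).trans ?_
    refine (add_le_add le_rfl ((hE.sum_le _ _).trans
      (le_of_eq (Finset.sum_eq_zero fun j hj => ?_)))).trans (add_zero _).le
    obtain ⟨hjs, hj⟩ := Finset.mem_filter.1 hj
    by_cases hh : h' j = 0
    · have h3 := hle j hjs
      rw [← hcongr (h j), ← hcongr (g j)] at h3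
      change E (g' j) ≤ E (h' j) at h3
      rw [hh, hE.zero] at h3
      exact nonpos_iff_eq_zero.1 h3
    · have : g' j = 0 := by by_contra h0; exact hj ⟨hh, h0⟩
      rw [this, hE.zero]
  have h3 : E (∑ j ∈ s₀, h' j) ≤ E (∑ j ∈ s, h j) := by
    refine (hE.sum_le_sum_of_subset hs₀s hfam'.disjoint_left).trans (le_of_eq ?_)
    refine hE.congr fun n hn => ?_
    simp [Finset.sum_apply, hh', hn]
  exact h2.trans (h1.trans (by gcongr))

/-- If shifts of `Λ`-separated families are bounded, then all shifts to the right are. -/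
theorem IsCouple.rightShift_of_sep {J : Set ℤ} {E F : (ℤ → ℝ) → ℝ≥0∞} {t : ℤ → ℝ≥0} {C : ℝ≥0}
    (H : IsCouple J E F t C) {Λ C₀ : ℝ≥0} (hS : SepRightShift J E t Λ C₀) :
    ∃ C' : ℝ≥0, RightShift E E C' := by
  classical
  have hE := H.left
  obtain ⟨r, hr⟩ : ∃ r : ℕ, Λ * (C + 1) ≤ 2 ^ r := by
    obtain ⟨r, hr⟩ := pow_unbounded_of_one_lt (Λ * (C + 1)) (one_lt_two : (1 : ℝ≥0) < 2)
    exact ⟨r, hr.le⟩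
  set R : ℕ := r + 2 with hR
  refine ⟨R * C₀ + R * (C₀ * (2 * C ^ 4 * C)), SepRightShift.rightShift (t := t) hE ?_⟩
  intro s lo mid hi h g hB hF
  have hfam := hF.shiftFamily hB
  have lohi : ∀ j ∈ s, lo j < hi j := fun j hj => (hB.le_mid j hj).trans_lt (hB.mid_lt j hj)
  set ℓ : ℤ → ℤ := fun j => Int.log 2 (t (hi j) : ℝ) with hℓ
  have ℓ1 : ∀ j, (2 : ℝ) ^ ℓ j ≤ t (hi j) := fun j => by
    exact_mod_cast Int.zpow_log_le_self (b := 2) (R := ℝ) (by norm_num)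
      (NNReal.coe_pos.2 (H.pos (hi j)))
  have ℓ2 : ∀ j, (t (hi j) : ℝ) < (2 : ℝ) ^ (ℓ j + 1) := fun j => by
    exact_mod_cast Int.lt_zpow_succ_log_self (b := 2) (by norm_num) (t (hi j) : ℝ)
  have ℓmono : ∀ i ∈ s, ∀ j ∈ s, i ≤ j → ℓ i ≤ ℓ j := by
    intro i hi' j hj hij
    rcases hij.eq_or_lt with rfl | hij
    · exact le_rfl
    · exact Int.log_mono_right (NNReal.coe_pos.2 (H.pos _))
        (NNReal.coe_le_coe.2 (H.mono ((hB.le i hi' j hj hij).trans (lohi j hj).le)))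
  have lt_of_ℓ : ∀ i ∈ s, ∀ j ∈ s, ℓ i < ℓ j → i < j := by
    intro i hi' j hj hij
    by_contra h'
    have := ℓmono j hj i hi' (not_lt.1 h')
    omega
  have hpow : ∀ {p q : ℤ}, p + r ≤ q → Λ * (C + 1) * (2 : ℝ) ^ p ≤ 2 ^ q := by
    intro p q hpq
    have h1 : ((Λ : ℝ) * (C + 1)) ≤ 2 ^ r := by exact_mod_cast hr
    calc _ ≤ (2 : ℝ) ^ r * 2 ^ p := by gcongr
      _ = 2 ^ (p + r) := by rw [zpow_add₀ (by norm_num), zpow_natCast, mul_comm]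
      _ ≤ _ := zpow_le_zpow_right₀ (by norm_num) hpq
  set A := s.filter fun j => ∀ i ∈ s, i < j → ℓ i < ℓ j with hA
  set B := s.filter fun j => ¬ ∀ i ∈ s, i < j → ℓ i < ℓ j with hBdef
  have hAs : A ⊆ s := Finset.filter_subset _ _
  have hBs : B ⊆ s := Finset.filter_subset _ _
  have hAinj : Set.InjOn ℓ A := by
    intro i hi' j hj hij
    by_contra hne
    rcases lt_or_gt_of_ne hne with h' | h'
    · exact absurd hij ((Finset.mem_filter.1 hj).2 i (hAs hi') h').ne
    · exact absurd hij ((Finset.mem_filter.1 hi').2 j (hAs hj) h').ne'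
  -- first members of their levels
  have partA : E (∑ j ∈ A, g j) ≤ R * (C₀ * E (∑ j ∈ s, h j)) := by
    set rank : ℤ → ℕ := fun j => (A.filter (· < j)).card with hrank
    rw [← Finset.sum_fiberwise_of_maps_to (t := Finset.range R) (g := fun j => rank j % R)
      (fun j _ => Finset.mem_range.2 (Nat.mod_lt _ (by omega)))]
    refine (hE.sum_le _ _).trans ((Finset.sum_le_card_nsmul _ _ _ fun c _ => ?_).trans
      (by rw [Finset.card_range, nsmul_eq_mul]))
    have hsub : (A.filter fun j => rank j % R = c) ⊆ s := (Finset.filter_subset _ _).trans hAs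
    refine (hS _ lo mid hi h g ?_ (hF.subset hsub)).trans ?_
    · refine ⟨fun j hj => hB.le_mid j (hsub hj), fun j hj => hB.mid_lt j (hsub hj),
        fun j hj => hB.mem j (hsub hj), fun i hi' j hj => hB.le i (hsub hi') j (hsub hj), ?_⟩
      intro i hi' j hj hij
      obtain ⟨hiA, hic⟩ := Finset.mem_filter.1 hi'
      obtain ⟨hjA, hjc⟩ := Finset.mem_filter.1 hj
      set I := A.filter fun a => i ≤ a ∧ a < j with hI
      have hcard : rank j = rank i + I.card := by
        simp only [hrank]
        rw [← Finset.card_union_of_disjoint]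
        · congr 1
          ext a
          simp only [hI, Finset.mem_filter, Finset.mem_union]
          constructor
          · rintro ⟨h1, h2⟩
            by_cases h3 : a < i
            · exact Or.inl ⟨h1, h3⟩
            · exact Or.inr ⟨h1, by omega, h2⟩
          · rintro (⟨h1, h2⟩ | ⟨h1, h2, h3⟩)
            · exact ⟨h1, by omega⟩
            · exact ⟨h1, h3⟩
        · rw [Finset.disjoint_left]
          intro a h1 h2
          simp only [hI, Finset.mem_filter] at h1 h2
          omega
      have hIcard : R ≤ I.card := by
        have h1 : 0 < I.card := Finset.card_pos.2 ⟨i, by simp [hI, hiA, hij]⟩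
        have h2 : (rank i + I.card) % R = rank i % R := by rw [← hcard, hjc, hic]
        have h3 : R ∣ I.card := by
          have := (Nat.modEq_iff_dvd' (Nat.le_add_right (rank i) I.card)).1 h2.symm
          simpa using this
        exact Nat.le_of_dvd h1 h3
      obtain ⟨a, haI, ha⟩ : ∃ a ∈ I, ℓ i + (r + 1) ≤ ℓ a := by
        by_contra hcon
        push Not at hcon
        have h1 : I.image ℓ ⊆ Finset.Ico (ℓ i) (ℓ i + (r + 1)) := by
          intro q hq
          obtain ⟨a, ha, rfl⟩ := Finset.mem_image.1 hq
          have ha' := Finset.mem_filter.1 ha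
          exact Finset.mem_Ico.2 ⟨ℓmono i (hAs hiA) a (hAs ha'.1) ha'.2.1, hcon a ha⟩
        have h2 := (Finset.card_image_of_injOn (s := I)
          (hAinj.mono fun a ha => (Finset.mem_filter.1 ha).1)).symm.trans_le (Finset.card_le_card h1)
        rw [Int.card_Ico] at h2
        omega
      have haI' := Finset.mem_filter.1 haI
      have h1 : t (hi a) ≤ t (lo j) := H.mono (hB.le a (hAs haI'.1) j (hAs hjA) haI'.2.2)
      rw [← NNReal.coe_le_coe] at h1 ⊢
      push_cast
      have h2 := ℓ1 a
      have h3 := ℓ2 i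
      have h4 := hpow (p := ℓ i + 1) (q := ℓ a) (by omega)
      have h5 : (Λ : ℝ) * t (hi i) ≤ Λ * (C + 1) * 2 ^ (ℓ i + 1) := by
        have : (0 : ℝ) ≤ C := C.2
        have h6 : (0 : ℝ) ≤ Λ := Λ.2
        have h7 : (0 : ℝ) < 2 ^ (ℓ i + 1) := by positivity
        calc (Λ : ℝ) * t (hi i) ≤ Λ * (1 * 2 ^ (ℓ i + 1)) := by gcongr; linarith
          _ ≤ Λ * ((C + 1) * 2 ^ (ℓ i + 1)) := by gcongr; linarith
          _ = _ := by ring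
      linarith
    · gcongr
      exact hE.sum_le_sum_of_subset hsub hfam.disjoint_left
  -- the remaining members, merged according to their levels
  have partB : E (∑ j ∈ B, g j) ≤ R * (C₀ * (2 * C ^ 4 * (C * E (∑ j ∈ s, h j)))) := by
    set L := B.image ℓ with hL
    set Bq : ℤ → Finset ℤ := fun q => B.filter fun j => ℓ j = q with hBq
    have hBqs : ∀ q, Bq q ⊆ s := fun q => (Finset.filter_subset _ _).trans hBs
    have hBqℓ : ∀ q, ∀ j ∈ Bq q, ℓ j = q := fun q j hj => (Finset.mem_filter.1 hj).2
    have hfirst : ∀ q ∈ L, ∃ n ∈ s, ℓ n = q ∧ ∀ j ∈ Bq q, n < j := by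
      intro q hq
      obtain ⟨j0, hj0, hj0q⟩ := Finset.mem_image.1 hq
      obtain ⟨n, hn, hn'⟩ := Finset.exists_min_image (s.filter fun j => ℓ j = q) id
        ⟨j0, Finset.mem_filter.2 ⟨hBs hj0, hj0q⟩⟩
      obtain ⟨hns, hnq⟩ := Finset.mem_filter.1 hn
      refine ⟨n, hns, hnq, fun j hj => lt_of_le_of_ne
        (hn' j (Finset.mem_filter.2 ⟨hBqs q hj, hBqℓ q j hj⟩)) ?_⟩
      rintro rfl
      refine (Finset.mem_filter.1 (Finset.mem_filter.1 hj).1).2 fun i hi' hin => ?_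
      refine lt_of_le_of_ne (ℓmono i hi' n hns hin.le) fun h0 => ?_
      have := hn' i (Finset.mem_filter.2 ⟨hi', h0.trans hnq⟩)
      simp at this
      omega
    have hlast : ∀ q ∈ L, ∃ m ∈ Bq q, ∀ j ∈ Bq q, j ≤ m := by
      intro q hq
      obtain ⟨j0, hj0, hj0q⟩ := Finset.mem_image.1 hq
      exact Finset.exists_max_image (Bq q) id ⟨j0, Finset.mem_filter.2 ⟨hj0, hj0q⟩⟩
    choose! n hn1 hn2 hn3 using hfirst
    choose! m hm1 hm2 using hlast
    set U : ℤ → ℤ → ℝ := fun q => ∑ j ∈ Bq q, h j with hU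
    set V : ℤ → ℤ → ℝ := fun q => ∑ j ∈ Bq q, g j with hV
    set k : ℤ → ℤ := fun q => hi (n q) - 1 with hk
    have hkJ : ∀ q ∈ L, k q ∈ J := fun q hq => hB.mem _ (hn1 q hq)
    set z : ℤ → ℤ → ℝ := fun q => Pi.single (k q) (F (U q) / F (Pi.single (k q) 1)).toReal with hz
    have hUne : ∀ q p, U q p ≠ 0 → ∃ j ∈ Bq q, h j p ≠ 0 := by
      intro q p hp
      simp only [hU, Finset.sum_apply] at hp
      exact Finset.exists_ne_zero_of_sum_ne_zero hp
    have hVne : ∀ q p, V q p ≠ 0 → ∃ j ∈ Bq q, g j p ≠ 0 := by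
      intro q p hp
      simp only [hV, Finset.sum_apply] at hp
      exact Finset.exists_ne_zero_of_sum_ne_zero hp
    have hzne : ∀ q p, z q p ≠ 0 → p = k q := by
      intro q p hp
      by_contra h0
      exact hp (by simp [hz, h0])
    have hloU : ∀ q ∈ L, ∀ p, U q p ≠ 0 → k q + 1 ≤ p ∧ p < hi (m q) := by
      intro q hq p hp
      obtain ⟨j, hj, hp⟩ := hUne q p hp
      have h1 := hF.left j (hBqs q hj) p hp
      have h2 := hB.le _ (hn1 q hq) j (hBqs q hj) (hn3 q hq j hj)
      have h3 := hB.mid_lt j (hBqs q hj)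
      have h4 : hi j ≤ hi (m q) := by
        rcases (hm2 q hq j hj).eq_or_lt with h5 | h5
        · rw [h5]
        · exact (hB.le j (hBqs q hj) _ (hBqs q (hm1 q hq)) h5).trans
            (lohi _ (hBqs q (hm1 q hq))).le
      simp only [hk]
      omega
    have hloV : ∀ q ∈ L, ∀ p, V q p ≠ 0 → k q + 1 ≤ p ∧ p < hi (m q) := by
      intro q hq p hp
      obtain ⟨j, hj, hp⟩ := hVne q p hp
      have h1 := hF.right j (hBqs q hj) p hp
      have h2 := hB.le _ (hn1 q hq) j (hBqs q hj) (hn3 q hq j hj)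
      have h3 := hB.le_mid j (hBqs q hj)
      have h4 : hi j ≤ hi (m q) := by
        rcases (hm2 q hq j hj).eq_or_lt with h5 | h5
        · rw [h5]
        · exact (hB.le j (hBqs q hj) _ (hBqs q (hm1 q hq)) h5).trans
            (lohi _ (hBqs q (hm1 q hq))).le
      simp only [hk]
      omega
    have hkm : ∀ q ∈ L, k q + 1 < hi (m q) := by
      intro q hq
      have h2 := hB.le _ (hn1 q hq) _ (hBqs q (hm1 q hq)) (hn3 q hq _ (hm1 q hq))
      have h3 := lohi _ (hBqs q (hm1 q hq))
      simp only [hk]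
      omega
    have hmk : ∀ q ∈ L, ∀ q' ∈ L, q < q' → hi (m q) ≤ k q' := by
      intro q hq q' hq' hqq
      have h1 : m q < n q' := lt_of_ℓ _ (hBqs q (hm1 q hq)) _ (hn1 q' hq')
        (by rw [hBqℓ q _ (hm1 q hq), hn2 q' hq']; exact hqq)
      have h2 := hB.le _ (hBqs q (hm1 q hq)) _ (hn1 q' hq') h1
      have h3 := lohi _ (hn1 q' hq')
      simp only [hk]
      omega
    have hUfin : ∀ q ∈ L, (Function.support (U q)).Finite := fun q hq =>
      (Set.finite_Ico (k q + 1) (hi (m q))).subset fun p hp => hloU q hq p hp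
    have hFz : ∀ q ∈ L, F (z q) = F (U q) := by
      intro q hq
      have h0 := H.right.single_ne_zero _ (hkJ q hq)
      have ht := H.right.single_ne_top (k q)
      have hU' := H.right.ne_top_of_finite (hUfin q hq)
      simp only [hz]
      rw [H.right.single, Real.enorm_eq_ofReal_abs, abs_of_nonneg ENNReal.toReal_nonneg,
        ENNReal.ofReal_toReal (ENNReal.div_ne_top hU' h0), ENNReal.div_mul_cancel h0 ht]
    have hfamz : ShiftFamily L z U := by
      constructor
      · exact fun q _ => (Set.finite_singleton (k q)).subset fun p hp => hzne q p hp
      · exact hUfin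
      · intro q hq a b ha hb
        have := hzne q a ha
        have := hloU q hq b hb
        omega
      · intro q hq q' hq' hqq a b ha hb
        have h1 := hmk q hq q' hq' hqq
        have h2 := hkm q hq
        have h3 : a < hi (m q) := by
          rcases ha with ha | ha
          · have := hzne q a ha; omega
          · exact (hloU q hq a ha).2
        have h4 : k q' ≤ b := by
          rcases hb with hb | hb
          · exact (hzne q' b hb).ge
          · have := (hloU q' hq' b hb).1; omega
        omega
    have htk : ∀ q ∈ L, (2 : ℝ) ^ q ≤ C * t (k q) := by
      intro q hq
      have h1 := ℓ1 (n q)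
      rw [hn2 q hq] at h1
      have h2 := H.succ_le (k q)
      rw [show k q + 1 = hi (n q) by simp [hk]] at h2
      exact h1.trans (by exact_mod_cast h2)
    have hthi : ∀ q ∈ L, (t (hi (m q)) : ℝ) < 2 ^ (q + 1) := by
      intro q hq
      have := ℓ2 (m q)
      rwa [hBqℓ q _ (hm1 q hq)] at this
    have hVz : ∀ q ∈ L, E (V q) ≤ E ((2 * C ^ 4 : ℝ) • z q) := by
      intro q hq
      have h1 : E (V q) ≤ C * t (hi (m q)) * F (V q) := by
        have := H.left_le (hi (m q)) (V q)
        rwa [show (Set.Iio (hi (m q))).indicator (V q) = V q from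
          Set.indicator_eq_self.2 fun p hp => (hloV q hq p hp).2] at this
      have h2 : F (V q) ≤ C * F (U q) :=
        H.rightShift _ h g (hfam.subset (hBqs q)) fun j hj => hF.le j (hBqs q hj)
      have h3 : t (k q) * F (z q) ≤ C * E (z q) := by
        have := H.right_le (k q) (z q)
        rwa [show (Set.Ici (k q)).indicator (z q) = z q from
          Set.indicator_eq_self.2 fun p hp => (hzne q p hp).ge] at this
      have h4 : t (hi (m q)) ≤ 2 * C * t (k q) := by
        rw [← NNReal.coe_le_coe]
        push_cast
        have e1 := hthi q hq
        have e2 := htk q hq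
        rw [zpow_add_one₀ (by norm_num)] at e1
        linarith
      rw [← hFz q hq] at h2
      calc E (V q) ≤ C * t (hi (m q)) * F (V q) := h1
        _ ≤ C * (2 * C * t (k q) : ℝ≥0) * (C * F (z q)) := by gcongr
        _ = 2 * C ^ 3 * (t (k q) * F (z q)) := by push_cast; ring
        _ ≤ 2 * C ^ 3 * (C * E (z q)) := by gcongr
        _ = (2 * C ^ 4 : ℝ≥0) * E (z q) := by push_cast; ring
        _ = _ := by
            rw [show ((2 : ℝ) * C ^ 4) = ((2 * C ^ 4 : ℝ≥0) : ℝ) by push_cast; ring,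
              hE.smul_coe]
    have hsumV : ∑ j ∈ B, g j = ∑ q ∈ L, V q := by
      rw [← Finset.sum_fiberwise_of_maps_to (t := L) (g := ℓ)
        (fun j hj => Finset.mem_image_of_mem _ hj)]
    have hsumU : ∑ j ∈ B, h j = ∑ q ∈ L, U q := by
      rw [← Finset.sum_fiberwise_of_maps_to (t := L) (g := ℓ)
        (fun j hj => Finset.mem_image_of_mem _ hj)]
    have hzU : E (∑ q ∈ L, z q) ≤ C * E (∑ j ∈ s, h j) := by
      refine (H.leftShift L U z hfamz fun q hq => (hFz q hq).le).trans ?_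
      gcongr
      rw [← hsumU]
      exact hE.sum_le_sum_of_subset hBs hfam.disjoint_left
    rw [hsumV, ← Finset.sum_fiberwise_of_maps_to (t := Finset.Ico (0 : ℤ) R)
      (g := fun q => q % R) (fun q _ => Finset.mem_Ico.2
        ⟨Int.emod_nonneg _ (by omega), Int.emod_lt_of_pos _ (by omega)⟩)]
    refine (hE.sum_le _ _).trans ((Finset.sum_le_card_nsmul _ _ _ fun c _ => ?_).trans
      (by rw [Int.card_Ico, sub_zero, Int.toNat_natCast, nsmul_eq_mul]))
    have hsub : (L.filter fun q => q % R = c) ⊆ L := Finset.filter_subset _ _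
    refine (hS _ k (fun q => k q + 1) (fun q => hi (m q)) (fun q => (2 * C ^ 4 : ℝ) • z q) V
      ?_ ?_).trans ?_
    · refine ⟨fun q _ => by simp, fun q hq => hkm q (hsub hq),
        fun q hq => hB.mem _ (hBqs q (hm1 q (hsub hq))),
        fun q hq q' hq' hqq => hmk q (hsub hq) q' (hsub hq') hqq, ?_⟩
      intro q hq q' hq' hqq
      have hqr : q + 1 + r ≤ q' := by
        have h1 := (Finset.mem_filter.1 hq).2
        have h2 := (Finset.mem_filter.1 hq').2
        have h3 : (R : ℤ) ∣ q' - q := Int.ModEq.dvd (h1.trans h2.symm)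
        have := Int.le_of_dvd (by omega) h3
        omega
      have h1 := hpow hqr
      have h2 := htk q' (hsub hq')
      have h3 := hthi q (hsub hq)
      have h4 : (0 : ℝ) < C + 1 := by positivity
      have h5 : (C : ℝ) * t (k q') ≤ (C + 1) * t (k q') := by gcongr; linarith
      have h6 : (C + 1 : ℝ) * (Λ * t (hi (m q))) ≤ (C + 1) * t (k q') := by
        calc (C + 1 : ℝ) * (Λ * t (hi (m q))) ≤ (C + 1) * (Λ * 2 ^ (q + 1)) := by gcongr
          _ = Λ * (C + 1) * 2 ^ (q + 1) := by ring
          _ ≤ _ := by linarith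
      have h7 := le_of_mul_le_mul_left h6 h4
      exact_mod_cast h7
    · refine ⟨?_, ?_, fun q hq => hVz q (hsub hq)⟩
      · intro q _ p hp
        have := hzne q p (fun h0 => hp (by simp [h0]))
        omega
      · intro q hq p hp
        exact hloV q (hsub hq) p hp
    · rw [← Finset.smul_sum, show ((2 : ℝ) * C ^ 4) = ((2 * C ^ 4 : ℝ≥0) : ℝ) by push_cast; ring,
        hE.smul_coe]
      push_cast
      gcongr
      exact (hE.sum_le_sum_of_subset hsub hfamz.disjoint_left).trans hzU
  rw [← Finset.sum_filter_add_sum_filter_not s (fun j => ∀ i ∈ s, i < j → ℓ i < ℓ j)]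
  refine (hE.add_le _ _).trans ((add_le_add partA partB).trans (le_of_eq ?_))
  push_cast
  ring


/-! ### Infinite sums over separated blocks -/

/-- Disjoint blocks `[lo, hi)` in `ℤ` that are separated on the scale `t`. -/
structure Chunks {ι : Type*} (t : ℤ → ℝ≥0) (lo hi : ι → ℤ) (lam : ι → ℝ≥0) : Prop where
  lt : ∀ c, lo c < hi c
  two_le : ∀ c, 2 ≤ lam c
  total : ∀ c d, c ≠ d → hi c ≤ lo d ∨ hi d ≤ lo c
  sep_left : ∀ c d, hi c ≤ lo d → lam c ^ 2 * t (hi c) ≤ t (lo d)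
  sep_right : ∀ c d, hi c ≤ lo d → lam d ^ 2 * t (hi c) ≤ t (lo d)

theorem exists_int_seq_of_ratio (r : ℤ → ℝ) (hr : ∀ i, 0 < r i) :
    ∃ ψ : ℤ → ℝ, (∀ i, 0 < ψ i) ∧ ∀ i, ψ (i + 1) = r i * ψ i := by
  refine ⟨fun k => (∏ i ∈ Finset.Ico 0 k, r i) / ∏ i ∈ Finset.Ico k 0, r i,
    fun k => div_pos (Finset.prod_pos fun i _ => hr i) (Finset.prod_pos fun i _ => hr i), ?_⟩
  intro k
  beta_reduce
  have hk0 := (hr k).ne'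
  rcases le_or_gt 0 k with hk | hk
  · have h1 : Finset.Ico 0 (k + 1) = insert k (Finset.Ico 0 k) := by
      ext i; simp only [Finset.mem_Ico, Finset.mem_insert]; omega
    rw [h1, Finset.prod_insert (by simp), Finset.Ico_eq_empty (by omega : ¬ k + 1 < 0),
      Finset.Ico_eq_empty (by omega : ¬ k < 0)]
    simp
  · have h1 : Finset.Ico k 0 = insert k (Finset.Ico (k + 1) 0) := by
      ext i; simp only [Finset.mem_Ico, Finset.mem_insert]; omega
    rw [h1, Finset.prod_insert (by simp), Finset.Ico_eq_empty (by omega : ¬ 0 < k + 1),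
      Finset.Ico_eq_empty (by omega : ¬ 0 < k)]
    have : ∏ i ∈ Finset.Ico (k + 1) 0, r i ≠ 0 := (Finset.prod_pos fun i _ => hr i).ne'
    simp only [Finset.prod_empty]
    field_simp

theorem le_of_sq_le_sq_real {a b : ℝ} (h : a ^ 2 ≤ b ^ 2) (hb : 0 ≤ b) : a ≤ b :=
  (abs_le_of_sq_le_sq' h hb).2

/-- Weights that grow from block to block, but more slowly than `t`. -/
theorem Chunks.exists_weights {ι : Type*} {t : ℤ → ℝ≥0} {lo hi : ι → ℤ} {lam : ι → ℝ≥0}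
    (H : Chunks t lo hi lam) (tpos : ∀ n, 0 < t n) (tmono : Monotone t) :
    ∃ β : ι → ℝ≥0, (∀ c, 0 < β c) ∧ (∀ c d, hi c ≤ lo d → lam d * β c ≤ β d) ∧
      (∀ c d, hi c ≤ lo d → lam c * (β d * t (hi c)) ≤ β c * t (lo d)) ∧
      (∀ k, ∃ B, ∀ c, lo c < k → β c ≤ B) ∧ (∀ k, ∃ B, ∀ c, k ≤ lo c → β c ≤ B * t (lo c)) := by
  classical
  have tpos' : ∀ n, (0 : ℝ) < t n := fun n => NNReal.coe_pos.2 (tpos n)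
  set r : ℤ → ℝ := fun i => if ∃ c, lo c ≤ i ∧ i < hi c then 1 else √(t (i + 1) / t i) with hr
  have hq : ∀ i, (1 : ℝ) ≤ t (i + 1) / t i := fun i => by
    rw [one_le_div (tpos' i)]; exact_mod_cast tmono (by omega)
  have hr1 : ∀ i, 1 ≤ r i := by
    intro i
    simp only [hr]
    split_ifs
    · exact le_rfl
    · exact Real.one_le_sqrt.2 (hq i)
  have hr2 : ∀ i, r i ^ 2 ≤ t (i + 1) / t i := by
    intro i
    simp only [hr]
    split_ifs
    · simpa using hq i
    · rw [Real.sq_sqrt (by linarith [hq i])]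
  obtain ⟨ψ, ψpos, hψ⟩ := exists_int_seq_of_ratio r fun i => by linarith [hr1 i]
  have ψmono : Monotone ψ := monotone_int_of_le_succ fun i => by
    rw [hψ]; nlinarith [hr1 i, ψpos i]
  have ψanti : Antitone fun i => ψ i ^ 2 / t i := antitone_int_of_succ_le fun i => by
    rw [hψ, mul_pow, div_le_div_iff₀ (tpos' _) (tpos' _)]
    have := hr2 i
    rw [le_div_iff₀ (tpos' i)] at this
    nlinarith [sq_nonneg (ψ i)]
  have ψin : ∀ c, ψ (hi c) = ψ (lo c) := by
    intro c
    have : ∀ k, lo c ≤ k → k ≤ hi c → ψ k = ψ (lo c) := by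
      intro k hk
      induction k, hk using Int.leInduction with
      | base => intro _; rfl
      | succ k hk ih =>
        intro hk'
        rw [hψ, ih (by omega)]
        have : r k = 1 := if_pos ⟨c, hk, by omega⟩
        rw [this, one_mul]
    exact this _ (H.lt c).le le_rfl
  have ψout : ∀ a b, a ≤ b → (∀ i, a ≤ i → i < b → ¬ ∃ c, lo c ≤ i ∧ i < hi c) →
      ψ b ^ 2 / t b = ψ a ^ 2 / t a := by
    intro a b hab
    induction b, hab using Int.leInduction with
    | base => intro _; rfl
    | succ k hk ih =>
      intro hout
      rw [← ih fun i h1 h2 => hout i h1 (by omega), hψ, mul_pow]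
      have : r k = √(t (k + 1) / t k) := if_neg (hout k hk (by omega))
      rw [this, Real.sq_sqrt (by linarith [hq k])]
      have h1 := (tpos' k).ne'
      have h2 := (tpos' (k + 1)).ne'
      field_simp
  refine ⟨fun c => ⟨ψ (lo c), (ψpos _).le⟩, fun c => ψpos _, ?_, ?_, ?_, ?_⟩
  · intro c d hcd
    obtain ⟨_, ⟨⟨e, he, rfl⟩, hemax⟩⟩ := Int.exists_greatest_of_bdd
      (P := fun k => ∃ e, hi e ≤ lo d ∧ hi e = k) ⟨lo d, by rintro z ⟨e, he, rfl⟩; exact he⟩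
      ⟨hi c, c, hcd, rfl⟩
    have h1 := ψout (hi e) (lo d) he (by
      rintro i hi1 hi2 ⟨a, ha1, ha2⟩
      by_cases had : a = d
      · subst had; omega
      · rcases H.total a d had with h' | h'
        · have := hemax (hi a) ⟨a, h', rfl⟩
          omega
        · have := H.lt d; omega)
    have h2 := hemax (hi c) ⟨c, hcd, rfl⟩
    have h3 : (lam d : ℝ) ^ 2 * t (hi e) ≤ t (lo d) := by exact_mod_cast H.sep_right e d he
    have h4 : ψ (lo c) ≤ ψ (hi e) := by rw [← ψin c]; exact ψmono h2
    have h5 : (lam d * ψ (lo c)) ^ 2 ≤ ψ (lo d) ^ 2 := by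
      rw [div_eq_iff (tpos' _).ne'] at h1
      rw [h1, mul_pow]
      calc (lam d : ℝ) ^ 2 * ψ (lo c) ^ 2 ≤ (t (lo d) / t (hi e)) * ψ (hi e) ^ 2 := by
            gcongr
            · rwa [le_div_iff₀ (tpos' _)]
            · exact (ψpos _).le
        _ = _ := by ring
    refine NNReal.coe_le_coe.1 ?_
    exact le_of_sq_le_sq_real h5 (ψpos _).le
  · intro c d hcd
    have h1 := ψanti hcd
    simp only [ψin c] at h1
    have h3 : (lam c : ℝ) ^ 2 * t (hi c) ≤ t (lo d) := by exact_mod_cast H.sep_left c d hcd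
    rw [div_le_div_iff₀ (tpos' _) (tpos' _)] at h1
    refine NNReal.coe_le_coe.1 ?_
    refine le_of_sq_le_sq_real ?_ (mul_nonneg (ψpos _).le (tpos' _).le)
    change (lam c * (ψ (lo d) * t (hi c))) ^ 2 ≤ (ψ (lo c) * t (lo d)) ^ 2
    calc (lam c * (ψ (lo d) * t (hi c))) ^ 2
        = lam c ^ 2 * t (hi c) * (ψ (lo d) ^ 2 * t (hi c)) := by ring
      _ ≤ t (lo d) * (ψ (lo c) ^ 2 * t (lo d)) := by
          gcongr
      _ = _ := by ring
  · intro k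
    exact ⟨⟨ψ k, (ψpos k).le⟩, fun c hc => ψmono hc.le⟩
  · intro k
    refine ⟨⟨ψ k / t k, (div_pos (ψpos k) (tpos' k)).le⟩, fun c hc => ?_⟩
    refine NNReal.coe_le_coe.1 ?_
    change ψ (lo c) ≤ ψ k / t k * t (lo c)
    have h1 := ψanti hc
    have h2 : (t k : ℝ) ≤ t (lo c) := by exact_mod_cast tmono hc
    have h0 := tpos' k
    rw [div_mul_eq_mul_div, le_div_iff₀ h0]
    simp only at h1
    rw [div_le_div_iff₀ (tpos' _) h0] at h1
    refine le_of_sq_le_sq_real ?_ (mul_nonneg (ψpos _).le (tpos' _).le)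
    calc (ψ (lo c) * t k) ^ 2 = ψ (lo c) ^ 2 * t k * t k := by ring
      _ ≤ ψ k ^ 2 * t (lo c) * t (lo c) := by gcongr
      _ = _ := by ring

/-- Geometric summation, for families in which any two terms differ by a factor of at least 2. -/
theorem sum_le_two_mul {ι : Type*} (f : ι → ℝ≥0∞) (G : Finset ι)
    (hf : ∀ c ∈ G, ∀ d ∈ G, c ≠ d → 2 * f c ≤ f d ∨ 2 * f d ≤ f c) (X : ℝ≥0∞)
    (hX : ∀ c ∈ G, f c ≤ X) : ∑ c ∈ G, f c ≤ 2 * X := by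
  classical
  induction G using Finset.strongInduction generalizing X with
  | H G ih =>
    rcases G.eq_empty_or_nonempty with rfl | hne
    · simp
    · obtain ⟨c, hc, hmax⟩ := Finset.exists_max_image G f hne
      rw [← Finset.add_sum_erase G f hc]
      have h1 : ∑ d ∈ G.erase c, f d ≤ 2 * (X / 2) := by
        refine ih _ (Finset.erase_ssubset hc)
          (fun a ha b hb => hf a (Finset.mem_of_mem_erase ha) b (Finset.mem_of_mem_erase hb)) _ ?_
        intro d hd
        have hdG := Finset.mem_of_mem_erase hd
        have h2 : 2 * f d ≤ f c := by
          rcases hf d hdG c hc (Finset.ne_of_mem_erase hd) with h | h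
          · exact h
          · calc 2 * f d ≤ 2 * f c := by gcongr; exact hmax d hdG
              _ ≤ f d := h
              _ ≤ f c := hmax d hdG
        rw [ENNReal.le_div_iff_mul_le (by simp) (by simp), mul_comm]
        exact h2.trans (hX c hc)
      calc f c + ∑ d ∈ G.erase c, f d ≤ X + 2 * (X / 2) := add_le_add (hX c hc) h1
        _ = 2 * X := by rw [ENNReal.mul_div_cancel (by simp) (by simp), two_mul]

/-- The sum of a family of sequences with disjoint supports. -/
noncomputable def blockSum {ι : Type*} (w : ι → ℤ → ℝ) (k : ℤ) : ℝ := ∑ᶠ c, w c k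

section

variable {ι : Type*} {t : ℤ → ℝ≥0} {lo hi : ι → ℤ} {lam : ι → ℝ≥0}

theorem Chunks.eq_of_mem (H : Chunks t lo hi lam) {c d : ι} {k : ℤ} (hc : lo c ≤ k ∧ k < hi c)
    (hd : lo d ≤ k ∧ k < hi d) : c = d := by
  by_contra h
  rcases H.total c d h with h' | h' <;> omega

theorem Chunks.blockSum_eq (H : Chunks t lo hi lam) {w : ι → ℤ → ℝ}
    (hw : ∀ c k, w c k ≠ 0 → lo c ≤ k ∧ k < hi c) {c : ι} {k : ℤ} (hc : lo c ≤ k ∧ k < hi c) :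
    blockSum w k = w c k := by
  refine finsum_eq_single _ c fun d hd => ?_
  by_contra h
  exact hd (H.eq_of_mem (hw d k h) hc)

theorem blockSum_eq_zero {w : ι → ℤ → ℝ} {k : ℤ} (h : ∀ c, w c k = 0) : blockSum w k = 0 := by
  simp [blockSum, h]

theorem Chunks.le_blockSum (H : Chunks t lo hi lam) {J : Set ℤ} {N : (ℤ → ℝ) → ℝ≥0∞}
    (hN : IsSeqNorm J N) {w : ι → ℤ → ℝ} (hw : ∀ c k, w c k ≠ 0 → lo c ≤ k ∧ k < hi c)
    (S : Set ℤ) (c : ι) : N (S.indicator (w c)) ≤ N (S.indicator (blockSum w)) := by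
  refine hN.mono' fun k => ?_
  by_cases hk : k ∈ S
  · by_cases h0 : w c k = 0
    · simp [h0, hk]
    · simp [hk, H.blockSum_eq hw (hw c k h0)]
  · simp [hk]

theorem Chunks.blockSum_le (H : Chunks t lo hi lam) {J : Set ℤ} {N : (ℤ → ℝ) → ℝ≥0∞}
    (hN : IsSeqNorm J N) {w : ι → ℤ → ℝ} (hw : ∀ c k, w c k ≠ 0 → lo c ≤ k ∧ k < hi c)
    (S : Set ℤ) (B : ℝ≥0∞) (hB : ∀ G : Finset ι, (∀ c ∈ G, ∃ k ∈ S, lo c ≤ k ∧ k < hi c) →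
      ∑ c ∈ G, N (S.indicator (w c)) ≤ B) : N (S.indicator (blockSum w)) ≤ B := by
  classical
  refine hN.fatou _ _ fun s => ?_
  set Q := s.filter fun k => k ∈ S ∧ ∃ c, lo c ≤ k ∧ k < hi c with hQ
  have hex : ∀ k ∈ Q, ∃ c, lo c ≤ k ∧ k < hi c := fun k hk => (Finset.mem_filter.1 hk).2.2
  rcases Q.eq_empty_or_nonempty with hQe | ⟨k₀, hk₀⟩
  · refine (hN.mono' (y := 0) fun k => ?_).trans (by simp [hN.zero])
    refine (abs_nonpos_iff.2 ?_).trans (abs_nonneg _)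
    refine Set.indicator_apply_eq_zero.2 fun hks => Set.indicator_apply_eq_zero.2 fun hkS =>
      blockSum_eq_zero fun d => ?_
    by_contra h
    have : k ∈ Q := Finset.mem_filter.2 ⟨hks, hkS, d, hw d k h⟩
    simp [hQe] at this
  have : Nonempty ι := ⟨(hex k₀ hk₀).choose⟩
  choose! c hc using hex
  refine le_trans ?_ (hB (Q.image c) ?_)
  · refine le_trans (hN.mono' fun k => ?_) (hN.sum_le _ _)
    rw [Finset.sum_apply]
    by_cases hk : k ∈ Q
    · have hk' := Finset.mem_filter.1 hk
      rw [Finset.sum_eq_single_of_mem (c k) (Finset.mem_image_of_mem c hk)]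
      · simp [hk'.1, hk'.2.1, H.blockSum_eq hw (hc k hk)]
      · intro d _ hd
        refine Set.indicator_apply_eq_zero.2 fun _ => ?_
        by_contra h
        exact hd (H.eq_of_mem (hw d k h) (hc k hk))
    · have h0 : (s : Set ℤ).indicator (S.indicator (blockSum w)) k = 0 := by
        refine Set.indicator_apply_eq_zero.2 fun hks => Set.indicator_apply_eq_zero.2 fun hkS => ?_
        refine blockSum_eq_zero fun d => ?_
        by_contra h
        exact hk (Finset.mem_filter.2 ⟨hks, hkS, d, hw d k h⟩)
      rw [h0, abs_zero]
      exact abs_nonneg _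
  · intro d hd
    obtain ⟨k, hk, rfl⟩ := Finset.mem_image.1 hd
    exact ⟨k, (Finset.mem_filter.1 hk).2.1, hc k hk⟩

end

/-- The gap functional of a pair that is supported by one block. -/
theorem IsCouple.gap_le {J : Set ℤ} {E F : (ℤ → ℝ) → ℝ≥0∞} {t : ℤ → ℝ≥0} {C : ℝ≥0}
    (H : IsCouple J E F t C) {mid : ℤ} {h g : ℤ → ℝ} (hh : ∀ k, h k ≠ 0 → k < mid)
    (hg : ∀ k, g k ≠ 0 → mid ≤ k) (hle : E g ≤ E h) (k : ℤ) :
    E ((Set.Iio k).indicator g) + t k * F ((Set.Ici k).indicator g) ≤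
      (1 + C + C ^ 2 : ℝ≥0) *
        (E ((Set.Iio k).indicator h) + t k * F ((Set.Ici k).indicator h)) := by
  have hE := H.left
  have hF := H.right
  rcases le_or_gt k mid with hk | hk
  · have h1 : (Set.Iio k).indicator g = 0 := by
      ext p
      by_cases hp : p < k
      · have : g p = 0 := by by_contra h0; have := hg p h0; omega
        simp [this]
      · simp [hp]
    have h2 : t mid * F g ≤ C * E g := by
      have := H.right_le mid g
      rwa [show (Set.Ici mid).indicator g = g from Set.indicator_eq_self.2 hg] at this
    have h3 : E h ≤ E ((Set.Iio k).indicator h) + C * t mid * F ((Set.Ici k).indicator h) := by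
      have e1 : E h ≤ E ((Set.Iio k).indicator h) + E ((Set.Ici k).indicator h) := by
        have := hE.le_indicator_add (S := Set.univ) (T := Set.Iio k) (U := Set.Ici k)
          (fun p _ => lt_or_ge p k) h
        simpa using this
      have e2 := H.left_le mid ((Set.Ici k).indicator h)
      rw [show (Set.Iio mid).indicator ((Set.Ici k).indicator h) = (Set.Ici k).indicator h from
        Set.indicator_eq_self.2 fun p hp => hh p fun h0 => hp (by simp [h0])] at e2
      exact e1.trans (by gcongr)
    have hm0 : (t mid : ℝ≥0∞) ≠ 0 := by simpa using (H.pos mid).ne'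
    have hkm : (t k : ℝ≥0∞) ≤ t mid := by exact_mod_cast H.mono hk
    have h4 : t mid * (t k * F ((Set.Ici k).indicator g)) ≤ t mid *
        (C * E ((Set.Iio k).indicator h) + C ^ 2 * (t k * F ((Set.Ici k).indicator h))) := by
      calc _ ≤ t mid * (t k * F g) := by gcongr; exact hF.indicator_le _ _
        _ = t k * (t mid * F g) := by ring
        _ ≤ t k * (C * (E ((Set.Iio k).indicator h) +
              C * t mid * F ((Set.Ici k).indicator h))) := by
            refine mul_le_mul_right (h2.trans (mul_le_mul_right (hle.trans h3) _)) _
        _ = t k * (C * E ((Set.Iio k).indicator h)) +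
              t mid * (C ^ 2 * (t k * F ((Set.Ici k).indicator h))) := by ring
        _ ≤ t mid * (C * E ((Set.Iio k).indicator h)) +
              t mid * (C ^ 2 * (t k * F ((Set.Ici k).indicator h))) := by gcongr
        _ = _ := by ring
    have h5 := (ENNReal.mul_le_mul_iff_right hm0 (by simp)).1 h4
    rw [h1, hE.zero, zero_add]
    refine h5.trans ?_
    rw [mul_add]
    push_cast
    refine add_le_add (mul_le_mul_left ?_ _) (mul_le_mul_left ?_ _)
    · rw [add_assoc, add_left_comm]; exact le_self_add
    · exact le_add_self
  · have h1 : (Set.Iio k).indicator h = h :=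
      Set.indicator_eq_self.2 fun p hp => (hh p hp).trans hk
    rw [h1]
    calc _ ≤ E h + C * E h := by
          refine add_le_add ?_ ?_
          · exact (hE.indicator_le _ _).trans hle
          · exact (H.right_le k g).trans (mul_le_mul_right hle _)
      _ = (1 + C) * E h := by ring
      _ ≤ (1 + C + C ^ 2 : ℝ≥0) * E h := by gcongr; push_cast; exact le_self_add
      _ ≤ _ := by gcongr; exact le_self_add


/-! ### Gluing separated families into one pair of sequences -/

/-- Two families `x`, `y` that are supported by separated blocks, with `E (y c) ≤ E (x c) = β c`
and weights that grow, but more slowly than `t`. -/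
structure WeightedFamily {ι : Type*} (J : Set ℤ) (E F : (ℤ → ℝ) → ℝ≥0∞) (t : ℤ → ℝ≥0) (C : ℝ≥0)
    (lo mid hi : ι → ℤ) (lam β : ι → ℝ≥0) (x y : ι → ℤ → ℝ) : Prop where
  couple : IsCouple J E F t C
  chunks : Chunks t lo hi lam
  left : ∀ c k, x c k ≠ 0 → lo c ≤ k ∧ k < mid c
  right : ∀ c k, y c k ≠ 0 → mid c ≤ k ∧ k < hi c
  lo_le : ∀ c, lo c ≤ mid c
  le_hi : ∀ c, mid c ≤ hi c
  le : ∀ c, E (y c) ≤ E (x c)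
  norm_eq : ∀ c, E (x c) = β c
  grow : ∀ c d, hi c ≤ lo d → lam d * β c ≤ β d
  decay : ∀ c d, hi c ≤ lo d → lam c * (β d * t (hi c)) ≤ β c * t (lo d)
  bdd_left : ∀ k, ∃ B, ∀ c, lo c < k → β c ≤ B
  bdd_right : ∀ k, ∃ B, ∀ c, k ≤ lo c → β c ≤ B * t (lo c)

theorem sum_le_of_subsingleton {ι : Type*} (G : Finset ι) (f : ι → ℝ≥0∞) (B : ℝ≥0∞)
    (h : ∀ c ∈ G, ∀ d ∈ G, c = d) (hB : ∀ c ∈ G, f c ≤ B) : ∑ c ∈ G, f c ≤ B := by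
  refine (Finset.sum_le_card_nsmul _ _ _ hB).trans ?_
  have : G.card ≤ 1 := Finset.card_le_one.2 h
  calc G.card • B ≤ 1 • B := by gcongr
    _ = B := one_smul _ _

namespace WeightedFamily

variable {ι : Type*} {J : Set ℤ} {E F : (ℤ → ℝ) → ℝ≥0∞} {t : ℤ → ℝ≥0} {C : ℝ≥0}
  {lo mid hi : ι → ℤ} {lam β : ι → ℝ≥0} {x y : ι → ℤ → ℝ}

theorem left' (W : WeightedFamily J E F t C lo mid hi lam β x y) (c : ι) (k : ℤ) (h : x c k ≠ 0) :
    lo c ≤ k ∧ k < hi c :=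
  ⟨(W.left c k h).1, (W.left c k h).2.trans_le (W.le_hi c)⟩

theorem right' (W : WeightedFamily J E F t C lo mid hi lam β x y) (c : ι) (k : ℤ) (h : y c k ≠ 0) :
    lo c ≤ k ∧ k < hi c :=
  ⟨(W.lo_le c).trans (W.right c k h).1, (W.right c k h).2⟩

theorem two_mul_weight_le (W : WeightedFamily J E F t C lo mid hi lam β x y) (c d : ι)
    (h : c ≠ d) : 2 * (β c : ℝ≥0∞) ≤ β d ∨ 2 * (β d : ℝ≥0∞) ≤ β c := by
  rcases W.chunks.total c d h with h' | h'
  · left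
    have := (mul_le_mul_left (W.chunks.two_le d) (β c)).trans (W.grow c d h')
    exact_mod_cast this
  · right
    have := (mul_le_mul_left (W.chunks.two_le c) (β d)).trans (W.grow d c h')
    exact_mod_cast this

theorem ratio_le (W : WeightedFamily J E F t C lo mid hi lam β x y) {c d : ι} (h : hi c ≤ lo d) :
    lam c * (β d / t (lo d)) ≤ β c / t (hi c) := by
  rw [le_div_iff₀ (W.couple.pos _), mul_assoc, div_mul_eq_mul_div, ← mul_div_assoc,
    div_le_iff₀ (W.couple.pos _)]
  exact W.decay c d h

theorem two_mul_ratio_le (W : WeightedFamily J E F t C lo mid hi lam β x y) (c d : ι)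
    (h : c ≠ d) : 2 * ((β c / t (lo c) : ℝ≥0) : ℝ≥0∞) ≤ (β d / t (lo d) : ℝ≥0) ∨
      2 * ((β d / t (lo d) : ℝ≥0) : ℝ≥0∞) ≤ (β c / t (lo c) : ℝ≥0) := by
  have key : ∀ c d, hi c ≤ lo d → 2 * ((β d / t (lo d) : ℝ≥0) : ℝ≥0∞) ≤ (β c / t (lo c) : ℝ≥0) := by
    intro c d h
    have h1 := (mul_le_mul_left (W.chunks.two_le c) (β d / t (lo d))).trans (W.ratio_le h)
    have h2 : β c / t (hi c) ≤ β c / t (lo c) :=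
      div_le_div_of_nonneg_left (by positivity) (W.couple.pos _)
        (W.couple.mono (W.chunks.lt c).le)
    exact_mod_cast h1.trans h2
  rcases W.chunks.total c d h with h' | h'
  · exact Or.inr (key c d h')
  · exact Or.inl (key d c h')

theorem right_norm_le (W : WeightedFamily J E F t C lo mid hi lam β x y) (c : ι) {z : ℤ → ℝ}
    (hz : ∀ k, z k ≠ 0 → lo c ≤ k) (hle : E z ≤ β c) :
    F z ≤ C * (β c / t (lo c) : ℝ≥0) := by
  have h1 := (W.couple.right_le (lo c) z).trans (mul_le_mul_right hle _)
  rw [show (Set.Ici (lo c)).indicator z = z from Set.indicator_eq_self.2 hz] at h1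
  have h0 := (W.couple.pos (lo c)).ne'
  rw [ENNReal.coe_div h0, ← mul_div_assoc,
    ENNReal.le_div_iff_mul_le (by simp [h0]) (by simp), mul_comm]
  exact h1

theorem weight_div_le (W : WeightedFamily J E F t C lo mid hi lam β x y) (c : ι) :
    ((β c / t (hi c) : ℝ≥0) : ℝ≥0∞) ≤ C * F (x c) := by
  have h1 := W.couple.left_le (hi c) (x c)
  rw [show (Set.Iio (hi c)).indicator (x c) = x c from
    Set.indicator_eq_self.2 fun k hk => (W.left' c k hk).2, W.norm_eq] at h1
  have h0 := (W.couple.pos (hi c)).ne'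
  rw [ENNReal.coe_div h0, ENNReal.div_le_iff (by simp [h0]) (by simp)]
  calc _ ≤ _ := h1
    _ = _ := by ring

theorem sum_left_le (W : WeightedFamily J E F t C lo mid hi lam β x y) {z : ι → ℤ → ℝ}
    (hz : ∀ c, E (z c) ≤ β c) (G : Finset ι) (S : Set ℤ) (X : ℝ≥0∞) (hX : ∀ c ∈ G, (β c : ℝ≥0∞) ≤ X) :
    ∑ c ∈ G, E (S.indicator (z c)) ≤ 2 * X := by
  refine (Finset.sum_le_sum fun c _ => (W.couple.left.indicator_le S (z c)).trans (hz c)).trans ?_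
  exact sum_le_two_mul _ G (fun c _ d _ h => W.two_mul_weight_le c d h) X hX

theorem sum_right_le (W : WeightedFamily J E F t C lo mid hi lam β x y) {z : ι → ℤ → ℝ}
    (hz : ∀ c, E (z c) ≤ β c) (hz' : ∀ c k, z c k ≠ 0 → lo c ≤ k) (G : Finset ι) (S : Set ℤ)
    (X : ℝ≥0∞) (hX : ∀ c ∈ G, ((β c / t (lo c) : ℝ≥0) : ℝ≥0∞) ≤ X) :
    ∑ c ∈ G, F (S.indicator (z c)) ≤ C * (2 * X) := by
  refine (Finset.sum_le_sum fun c _ => (W.couple.right.indicator_le S (z c)).trans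
    (W.right_norm_le c (hz' c) (hz c))).trans ?_
  rw [← Finset.mul_sum]
  gcongr
  exact sum_le_two_mul _ G (fun c _ d _ h => W.two_mul_ratio_le c d h) X hX

theorem left_ne_top (W : WeightedFamily J E F t C lo mid hi lam β x y) (k : ℤ) :
    E ((Set.Iio k).indicator (blockSum x)) ≠ ∞ := by
  obtain ⟨B, hB⟩ := W.bdd_left k
  refine ne_top_of_le_ne_top (b := 2 * (B : ℝ≥0∞)) (by finiteness) ?_
  refine W.chunks.blockSum_le W.couple.left W.left' _ _ fun G hG => ?_
  refine W.sum_left_le (fun c => (W.norm_eq c).le) G _ _ fun c hc => ?_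
  obtain ⟨p, hp, h1, -⟩ := hG c hc
  exact_mod_cast hB c (h1.trans_lt hp)

theorem right_ne_top (W : WeightedFamily J E F t C lo mid hi lam β x y) (k : ℤ) :
    F ((Set.Ici k).indicator (blockSum x)) ≠ ∞ := by
  have key : ∀ k, (∀ c, ¬ (lo c < k ∧ k < hi c)) → F ((Set.Ici k).indicator (blockSum x)) ≠ ∞ := by
    intro k hk
    obtain ⟨B, hB⟩ := W.bdd_right k
    refine ne_top_of_le_ne_top (b := C * (2 * (B : ℝ≥0∞))) (by finiteness) ?_
    refine W.chunks.blockSum_le W.couple.right W.left' _ _ fun G hG => ?_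
    refine W.sum_right_le (fun c => (W.norm_eq c).le) (fun c k h => (W.left c k h).1) G _ _
      fun c hc => ?_
    obtain ⟨p, hp, h1, h2⟩ := hG c hc
    have hlt : k < hi c := lt_of_le_of_lt hp h2
    have : k ≤ lo c := by
      by_contra h'
      exact hk c ⟨by omega, hlt⟩
    have h3 := hB c this
    rw [← div_le_iff₀ (W.couple.pos _)] at h3
    exact_mod_cast h3
  by_cases h : ∃ c, lo c < k ∧ k < hi c
  · obtain ⟨c, h1, h2⟩ := h
    have h3 := key (hi c) (by
      rintro d ⟨h3, h4⟩
      by_cases hdc : d = c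
      · subst hdc; omega
      · have := W.chunks.lt c
        rcases W.chunks.total d c hdc with h | h <;> omega)
    refine ne_top_of_le_ne_top (ENNReal.add_ne_top.2 ⟨W.couple.right.indicator_ne_top
      (Set.finite_Ico k (hi c)) (blockSum x), h3⟩) (W.couple.right.le_indicator_add ?_ _)
    intro p hp
    rcases lt_or_ge p (hi c) with h | h
    · exact Or.inl ⟨hp, h⟩
    · exact Or.inr h
  · exact key k fun c hc => h ⟨c, hc⟩

/-- The gap functional of the first glued sequence dominates that of the second one. -/
theorem gap_le (W : WeightedFamily J E F t C lo mid hi lam β x y) (k : ℤ) :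
    E ((Set.Iio k).indicator (blockSum y)) + t k * F ((Set.Ici k).indicator (blockSum y)) ≤
      (2 + 3 * (1 + C + C ^ 2) + 2 * C ^ 2 : ℝ≥0) * (E ((Set.Iio k).indicator (blockSum x)) +
        t k * F ((Set.Ici k).indicator (blockSum x))) := by
  classical
  have hE := W.couple.left
  have hF := W.couple.right
  set D : ℝ≥0 := 1 + C + C ^ 2 with hD
  set A := E ((Set.Iio k).indicator (blockSum x)) with hA
  set B := F ((Set.Ici k).indicator (blockSum x)) with hB
  have hstr : ∀ c, E ((Set.Iio k).indicator (y c)) + t k * F ((Set.Ici k).indicator (y c)) ≤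
      D * (A + t k * B) := by
    intro c
    refine (W.couple.gap_le (fun p hp => (W.left c p hp).2) (fun p hp => (W.right c p hp).1)
      (W.le c) k).trans ?_
    have h1 := W.chunks.le_blockSum hE W.left' (Set.Iio k) c
    have h2 := W.chunks.le_blockSum hF W.left' (Set.Ici k) c
    gcongr
  have hsub : ∀ c d, lo c < k → k < hi c → lo d < k → k < hi d → c = d := by
    intro c d h1 h2 h3 h4
    by_contra h
    rcases W.chunks.total c d h with h' | h' <;> omega
  have hEv : E ((Set.Iio k).indicator (blockSum y)) ≤ 2 * A + D * (A + t k * B) := by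
    refine W.chunks.blockSum_le hE W.right' _ _ fun G hG => ?_
    rw [← Finset.sum_filter_add_sum_filter_not G (fun c => hi c ≤ k)]
    refine add_le_add ?_ ?_
    · refine W.sum_left_le (fun c => (W.le c).trans (W.norm_eq c).le) _ _ _ fun c hc => ?_
      have hc' := (Finset.mem_filter.1 hc).2
      rw [← W.norm_eq]
      have := W.chunks.le_blockSum hE W.left' (Set.Iio k) c
      rwa [show (Set.Iio k).indicator (x c) = x c from
        Set.indicator_eq_self.2 fun p hp => (W.left' c p hp).2.trans_le hc'] at this
    · refine sum_le_of_subsingleton _ _ _ ?_ fun c _ => le_self_add.trans (hstr c)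
      intro c hc d hd
      obtain ⟨hc1, hc2⟩ := Finset.mem_filter.1 hc
      obtain ⟨hd1, hd2⟩ := Finset.mem_filter.1 hd
      obtain ⟨p, hp, hp1, -⟩ := hG c hc1
      obtain ⟨q, hq, hq1, -⟩ := hG d hd1
      exact hsub c d (hp1.trans_lt hp) (by omega) (hq1.trans_lt hq) (by omega)
  have hfar : ∀ G : Finset ι, (∀ c ∈ G, k ≤ lo c) →
      ∑ c ∈ G, F ((Set.Ici k).indicator (y c)) ≤ D * B + C * (2 * (C * B)) := by
    intro G hG
    rcases G.eq_empty_or_nonempty with rfl | hne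
    · simp
    obtain ⟨c₁, hc₁, hmin⟩ := Finset.exists_min_image G lo hne
    have hxB : F (x c₁) ≤ B := by
      have := W.chunks.le_blockSum hF W.left' (Set.Ici k) c₁
      rwa [show (Set.Ici k).indicator (x c₁) = x c₁ from
        Set.indicator_eq_self.2 fun p hp => (hG c₁ hc₁).trans (W.left c₁ p hp).1] at this
    rw [← Finset.add_sum_erase G _ hc₁]
    refine add_le_add ?_ ?_
    · have h1 := W.couple.gap_le (fun p hp => (W.left c₁ p hp).2)
        (fun p hp => (W.right c₁ p hp).1) (W.le c₁) (lo c₁)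
      rw [show (Set.Iio (lo c₁)).indicator (x c₁) = 0 from ?_, hE.zero, zero_add,
        show (Set.Ici (lo c₁)).indicator (x c₁) = x c₁ from
          Set.indicator_eq_self.2 fun p hp => (W.left c₁ p hp).1,
        show (Set.Ici (lo c₁)).indicator (y c₁) = y c₁ from
          Set.indicator_eq_self.2 fun p hp => (W.right' c₁ p hp).1, mul_left_comm] at h1
      · have h2 := le_add_self.trans h1
        have h0 : (t (lo c₁) : ℝ≥0∞) ≠ 0 := by simpa using (W.couple.pos _).ne'
        rw [ENNReal.mul_le_mul_iff_right h0 (by simp)] at h2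
        exact (hF.indicator_le _ _).trans (h2.trans (mul_le_mul_right hxB _))
      · refine Set.indicator_eq_zero.2 (Set.disjoint_left.2 fun p hp hp' => ?_)
        have := (W.left c₁ p hp).1
        simp at hp'
        omega
    · refine W.sum_right_le (fun c => (W.le c).trans (W.norm_eq c).le)
        (fun c p hp => (W.right' c p hp).1) _ _ _ fun d hd => ?_
      have hdG := Finset.mem_of_mem_erase hd
      have hne := Finset.ne_of_mem_erase hd
      have hcd : hi c₁ ≤ lo d := by
        rcases W.chunks.total d c₁ hne with h | h
        · have := hmin d hdG; have := W.chunks.lt d; omega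
        · exact h
      have h1 : β d / t (lo d) ≤ β c₁ / t (hi c₁) := by
        refine le_trans ?_ (W.ratio_le hcd)
        exact le_mul_of_one_le_left (by positivity) (one_le_two.trans (W.chunks.two_le c₁))
      calc ((β d / t (lo d) : ℝ≥0) : ℝ≥0∞) ≤ (β c₁ / t (hi c₁) : ℝ≥0) := by exact_mod_cast h1
        _ ≤ C * F (x c₁) := W.weight_div_le c₁
        _ ≤ C * B := by gcongr
  have hFv : t k * F ((Set.Ici k).indicator (blockSum y)) ≤
      t k * (D * B + C * (2 * (C * B))) + D * (A + t k * B) := by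
    have h0 : (t k : ℝ≥0∞) ≠ 0 := by simpa using (W.couple.pos k).ne'
    have : F ((Set.Ici k).indicator (blockSum y)) ≤
        D * B + C * (2 * (C * B)) + D * (A + t k * B) / t k := by
      refine W.chunks.blockSum_le hF W.right' _ _ fun G hG => ?_
      rw [← Finset.sum_filter_add_sum_filter_not G (fun c => k ≤ lo c)]
      refine add_le_add (hfar _ fun c hc => (Finset.mem_filter.1 hc).2) ?_
      refine sum_le_of_subsingleton _ _ _ ?_ fun c _ => ?_
      · intro c hc d hd
        obtain ⟨hc1, hc2⟩ := Finset.mem_filter.1 hc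
        obtain ⟨hd1, hd2⟩ := Finset.mem_filter.1 hd
        obtain ⟨p, hp, -, hp1⟩ := hG c hc1
        obtain ⟨q, hq, -, hq1⟩ := hG d hd1
        exact hsub c d (by omega) (lt_of_le_of_lt hp hp1) (by omega) (lt_of_le_of_lt hq hq1)
      · rw [ENNReal.le_div_iff_mul_le (Or.inl h0) (by simp), mul_comm]
        exact le_add_self.trans (hstr c)
    refine (mul_le_mul_right this _).trans ?_
    rw [mul_add _ _ (_ / _), ENNReal.mul_div_cancel h0 (by simp)]
  calc _ ≤ (2 * A + D * (A + t k * B)) +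
        (t k * (D * B + C * (2 * (C * B))) + D * (A + t k * B)) := add_le_add hEv hFv
    _ = 2 * A + (D + 2 * C ^ 2) * (t k * B) + 2 * D * (A + t k * B) := by ring
    _ ≤ (2 + D + 2 * C ^ 2) * A + (2 + D + 2 * C ^ 2) * (t k * B) + 2 * D * (A + t k * B) := by
        gcongr
        · rw [add_assoc]; exact le_self_add
        · exact le_add_self
    _ = _ := by push_cast; ring

/-- An operator that maps the first glued sequence to the second one almost maps the members of the
families to each other. -/
theorem error_le (W : WeightedFamily J E F t C lo mid hi lam β x y)
    {T : (ℤ → ℝ) →ₗ[ℝ] (ℤ → ℝ)} {K : ℝ≥0} (hTE : ∀ z, E (T z) ≤ K * E z)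
    (hTF : ∀ z, F (T z) ≤ K * F z) (hT : ∀ k ∈ J, T (blockSum x) k = blockSum y k) (c : ι) :
    lam c * E ((Set.Ico (mid c) (hi c)).indicator (T (x c) - y c)) ≤
      (2 * K * (1 + C ^ 2) : ℝ≥0) * β c := by
  have hE := W.couple.left
  have hF := W.couple.right
  set u := blockSum x with hu
  set a := (Set.Iio (lo c)).indicator u with ha
  set b := (Set.Ici (hi c)).indicator u with hb
  have hdec : u = a + x c + b := by
    ext p
    simp only [Pi.add_apply, ha, hb, Set.indicator_apply, Set.mem_Iio, Set.mem_Ici]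
    have hlt := W.chunks.lt c
    rcases lt_or_ge p (lo c) with h1 | h1
    · have : x c p = 0 := by by_contra h; have := W.left' c p h; omega
      simp [h1, this, show ¬ hi c ≤ p by omega]
    · rcases lt_or_ge p (hi c) with h2 | h2
      · simp [not_le.2 h2, not_lt.2 h1, hu, W.chunks.blockSum_eq W.left' ⟨h1, h2⟩]
      · have : x c p = 0 := by by_contra h; have := W.left' c p h; omega
        simp [not_lt.2 h1, this, h2]
  have h1 : E ((Set.Ico (mid c) (hi c)).indicator (T (x c) - y c)) ≤
      E (T a) + E ((Set.Iio (hi c)).indicator (T b)) := by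
    refine le_trans ?_ (hE.add_le _ _)
    refine hE.mono _ _ fun p hp => ?_
    by_cases hps : p ∈ Set.Ico (mid c) (hi c)
    · have h2 := hT p hp
      rw [hdec, map_add, map_add, W.chunks.blockSum_eq W.right'
        ⟨(W.lo_le c).trans hps.1, hps.2⟩] at h2
      simp only [Pi.add_apply] at h2
      rw [Set.indicator_of_mem hps, Pi.add_apply, Set.indicator_of_mem (Set.mem_Iio.2 hps.2),
        Pi.sub_apply, show T (x c) p - y c p = -(T a p + T b p) by linarith, abs_neg]
    · simp [hps]
  have hlam0 : (lam c : ℝ≥0∞) ≠ 0 := by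
    have := W.chunks.two_le c
    have : 0 < lam c := lt_of_lt_of_le two_pos this
    simpa using this.ne'
  have h2 : E a ≤ 2 * (β c / lam c) := by
    refine W.chunks.blockSum_le hE W.left' _ _ fun G hG => ?_
    refine W.sum_left_le (fun d => (W.norm_eq d).le) _ _ _ fun d hd => ?_
    obtain ⟨p, hp, hp1, hp2⟩ := hG d hd
    have hp' : p < lo c := hp
    have hlt := W.chunks.lt c
    have hdc : hi d ≤ lo c := by
      have hne : d ≠ c := by rintro rfl; omega
      rcases W.chunks.total d c hne with h | h <;> omega
    rw [ENNReal.le_div_iff_mul_le (Or.inl hlam0) (by simp), mul_comm]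
    exact_mod_cast W.grow d c hdc
  have h3 : F b ≤ C * (2 * ((β c / t (hi c) : ℝ≥0) / lam c)) := by
    refine W.chunks.blockSum_le hF W.left' _ _ fun G hG => ?_
    refine W.sum_right_le (fun d => (W.norm_eq d).le) (fun d p hp => (W.left d p hp).1) _ _ _
      fun d hd => ?_
    obtain ⟨p, hp, hp1, hp2⟩ := hG d hd
    have hp' : hi c ≤ p := hp
    have hlt := W.chunks.lt c
    have hdc : hi c ≤ lo d := by
      have hne : d ≠ c := by rintro rfl; omega
      rcases W.chunks.total d c hne with h | h <;> omega
    rw [ENNReal.le_div_iff_mul_le (Or.inl hlam0) (by simp), mul_comm]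
    exact_mod_cast W.ratio_le hdc
  have h0 : (t (hi c) : ℝ≥0∞) ≠ 0 := by simpa using (W.couple.pos _).ne'
  calc lam c * E ((Set.Ico (mid c) (hi c)).indicator (T (x c) - y c))
      ≤ lam c * (K * (2 * (β c / lam c)) +
          C * t (hi c) * (K * (C * (2 * ((β c / t (hi c) : ℝ≥0) / lam c))))) := by
        gcongr
        refine h1.trans (add_le_add ((hTE a).trans (by gcongr)) ?_)
        exact (W.couple.left_le _ _).trans (mul_le_mul_right ((hTF b).trans (by gcongr)) _)
    _ = 2 * K * (lam c * (β c / lam c)) + 2 * K * C ^ 2 *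
          (t (hi c) * (lam c * ((β c / t (hi c) : ℝ≥0) / lam c))) := by ring
    _ = _ := by
        rw [ENNReal.mul_div_cancel hlam0 (by simp), ENNReal.mul_div_cancel hlam0 (by simp),
          ENNReal.coe_div (W.couple.pos _).ne', ENNReal.mul_div_cancel h0 (by simp)]
        push_cast
        ring

end WeightedFamily

/-- The sequence form of the Calderón property. -/
def SeqCalderon (J : Set ℤ) (E F : (ℤ → ℝ) → ℝ≥0∞) (t : ℤ → ℝ≥0) : Prop :=
  ∀ (C₀ : ℝ≥0) (u v : ℤ → ℝ), (∀ k, E ((Set.Iio k).indicator u) ≠ ∞) →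
    (∀ k, F ((Set.Ici k).indicator u) ≠ ∞) →
    (∀ k, E ((Set.Iio k).indicator v) + t k * F ((Set.Ici k).indicator v) ≤
      C₀ * (E ((Set.Iio k).indicator u) + t k * F ((Set.Ici k).indicator u))) →
    ∃ (T : (ℤ → ℝ) →ₗ[ℝ] (ℤ → ℝ)) (K : ℝ≥0), (∀ z, E (T z) ≤ K * E z) ∧
      (∀ z, F (T z) ≤ K * F z) ∧ ∀ k ∈ J, T u k = v k

/-- One operator that almost maps the members of separated families to each other. -/
theorem IsCouple.exists_operator_of_chunks {ι : Type*} {J : Set ℤ} {E F : (ℤ → ℝ) → ℝ≥0∞}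
    {t : ℤ → ℝ≥0} {C : ℝ≥0} (H : IsCouple J E F t C) (hCal : SeqCalderon J E F t)
    {lo mid hi : ι → ℤ} {lam : ι → ℝ≥0} (hch : Chunks t lo hi lam) {h g : ι → ℤ → ℝ}
    (left : ∀ c k, h c k ≠ 0 → lo c ≤ k ∧ k < mid c)
    (right : ∀ c k, g c k ≠ 0 → mid c ≤ k ∧ k < hi c)
    (lo_le : ∀ c, lo c ≤ mid c) (le_hi : ∀ c, mid c ≤ hi c)
    (le : ∀ c, E (g c) ≤ E (h c)) (ne_zero : ∀ c, E (h c) ≠ 0) :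
    ∃ (T : (ℤ → ℝ) →ₗ[ℝ] (ℤ → ℝ)) (K K' : ℝ≥0), (∀ z, E (T z) ≤ K * E z) ∧
      ∀ c, lam c * E ((Set.Ico (mid c) (hi c)).indicator (T (h c) - g c)) ≤ K' * E (h c) := by
  obtain ⟨β, βpos, h1, h2, h3, h4⟩ := hch.exists_weights H.pos H.mono
  have hfin : ∀ c, E (h c) ≠ ∞ := fun c => H.left.ne_top_of_finite
    ((Set.finite_Ico (lo c) (mid c)).subset fun k hk => left c k hk)
  set γ : ι → ℝ≥0 := fun c => β c / (E (h c)).toNNReal with hγ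
  have γpos : ∀ c, 0 < γ c := fun c => div_pos (βpos c) (ENNReal.toNNReal_pos (ne_zero c) (hfin c))
  have hsm : ∀ c (z : ℤ → ℝ), E ((γ c : ℝ) • z) = γ c * E z := fun c z => by
    rw [H.left.smul]; simp
  have W : WeightedFamily J E F t C lo mid hi lam β (fun c => (γ c : ℝ) • h c)
      (fun c => (γ c : ℝ) • g c) :=
    { couple := H
      chunks := hch
      left := fun c k hk => left c k fun h0 => hk (by simp [h0])
      right := fun c k hk => right c k fun h0 => hk (by simp [h0])
      lo_le := lo_le
      le_hi := le_hi
      le := fun c => by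
        rw [hsm, hsm]
        exact mul_le_mul_right (le c) _
      norm_eq := fun c => by
        rw [hsm, ← ENNReal.coe_toNNReal (hfin c), ← ENNReal.coe_mul, ENNReal.coe_inj]
        exact div_mul_cancel₀ _ (ENNReal.toNNReal_pos (ne_zero c) (hfin c)).ne'
      grow := h1
      decay := h2
      bdd_left := h3
      bdd_right := h4 }
  obtain ⟨T, K, hTE, hTF, hT⟩ := hCal _ _ _ W.left_ne_top W.right_ne_top W.gap_le
  refine ⟨T, K, 2 * K * (1 + C ^ 2), hTE, fun c => ?_⟩
  have h5 := W.error_le hTE hTF hT c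
  rw [← W.norm_eq c, hsm, map_smul, ← smul_sub] at h5
  have h6 : (Set.Ico (mid c) (hi c)).indicator ((γ c : ℝ) • (T (h c) - g c)) =
      (γ c : ℝ) • (Set.Ico (mid c) (hi c)).indicator (T (h c) - g c) := by
    ext p; by_cases hp : p ∈ Set.Ico (mid c) (hi c) <;> simp [hp]
  rw [h6, hsm, mul_left_comm, mul_left_comm _ (γ c : ℝ≥0∞)] at h5
  exact (ENNReal.mul_le_mul_iff_right (by simpa using (γpos c).ne') (by simp)).1 h5


/-! ### Boundedness of shifts from the Calderón property -/

/-- Restriction of sequences to a set of coordinates. -/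
noncomputable def restrictₗ (A : Set ℤ) : (ℤ → ℝ) →ₗ[ℝ] (ℤ → ℝ) where
  toFun z := A.indicator z
  map_add' _ _ := Set.indicator_add' _ _ _
  map_smul' c x := by
    ext k; by_cases hk : k ∈ A <;> simp [hk]

/-- The block-diagonal part of a bounded operator is bounded. -/
theorem IsSeqNorm.blockDiagonal_le {ι : Type*} {J : Set ℤ} {E : (ℤ → ℝ) → ℝ≥0∞}
    (hE : IsSeqNorm J E) (G : Finset ι) (R : ι → Set ℤ)
    (hR : ∀ c ∈ G, ∀ d ∈ G, c ≠ d → Disjoint (R c) (R d)) {T : (ℤ → ℝ) →ₗ[ℝ] (ℤ → ℝ)} {K : ℝ≥0}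
    (hT : ∀ z, E (T z) ≤ K * E z) (w : ℤ → ℝ) :
    E (∑ c ∈ G, (R c).indicator (T ((R c).indicator w))) ≤ K * E w := by
  classical
  suffices h : E (∑ c ∈ G, (R c).indicator (T ((R c).indicator w)) +
      (⋃ c ∈ G, R c)ᶜ.indicator (T ((⋃ c ∈ G, R c)ᶜ.indicator w))) ≤ K * E w by
    refine le_trans (hE.mono' fun k => ?_) h
    by_cases hk : k ∈ ⋃ c ∈ G, R c
    · rw [Pi.add_apply, Set.indicator_of_notMem (show k ∉ (⋃ c ∈ G, R c)ᶜ from fun h => h hk),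
        add_zero]
    · have : ∀ c ∈ G, (R c).indicator (T ((R c).indicator w)) k = 0 := fun c hc =>
        Set.indicator_of_notMem (fun h => hk (Set.mem_biUnion hc h)) _
      rw [Finset.sum_apply, Finset.sum_eq_zero this, abs_zero]
      exact abs_nonneg _
  induction G using Finset.induction_on generalizing T with
  | empty => simpa using hT w
  | insert d G hd ih =>
    set A := R d with hA
    have hflip : ∀ z : ℤ → ℝ, E (A.indicator z - Aᶜ.indicator z) = E z := fun z =>
      hE.congr fun k _ => by by_cases hk : k ∈ A <;> simp [hk]
    set P := restrictₗ A with hP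
    set Q := restrictₗ Aᶜ with hQ
    have hPQ : ∀ z, P z + Q z = z := fun z => Set.indicator_self_add_compl A z
    set T' : (ℤ → ℝ) →ₗ[ℝ] (ℤ → ℝ) := P ∘ₗ T ∘ₗ P + Q ∘ₗ T ∘ₗ Q with hT'
    have hT'z : ∀ z, T' z = A.indicator (T (A.indicator z)) + Aᶜ.indicator (T (Aᶜ.indicator z)) :=
      fun z => rfl
    have hbound : ∀ z, E (T' z) ≤ K * E z := by
      intro z
      have h1 : (2 : ℝ) • T' z = T z + (P (T (P z - Q z)) - Q (T (P z - Q z))) := by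
        have e1 : T z = P (T (P z)) + P (T (Q z)) + (Q (T (P z)) + Q (T (Q z))) := by
          conv_lhs => rw [← hPQ (T z), ← hPQ z, map_add, map_add, map_add]
        rw [e1]
        simp only [map_sub, hT', LinearMap.add_apply, LinearMap.comp_apply]
        module
      have h2 : 2 * E (T' z) ≤ 2 * (K * E z) := by
        have h22 : ‖(2 : ℝ)‖ₑ = 2 := by rw [Real.enorm_eq_ofReal (by norm_num)]; simp
        calc 2 * E (T' z) = E ((2 : ℝ) • T' z) := by rw [hE.smul, h22]
          _ ≤ E (T z) + E (P (T (P z - Q z)) - Q (T (P z - Q z))) := by rw [h1]; exact hE.add_le _ _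
          _ ≤ K * E z + K * E z := by
              refine add_le_add (hT z) ?_
              refine (hflip _).le.trans ((hT _).trans (mul_le_mul_right (hflip z).le _))
          _ = _ := (two_mul _).symm
      exact (ENNReal.mul_le_mul_iff_right (by simp) (by simp)).1 h2
    have h3 := ih (fun c hc d hd => hR c (Finset.mem_insert_of_mem hc) d (Finset.mem_insert_of_mem hd))
      hbound
    refine le_trans (le_of_eq (congrArg E ?_)) h3
    have hdis : ∀ c ∈ G, Disjoint A (R c) := fun c hc =>
      hR d (Finset.mem_insert_self _ _) c (Finset.mem_insert_of_mem hc) (by rintro rfl; exact hd hc)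
    have h4 : ∀ c ∈ G, (R c).indicator (T' ((R c).indicator w)) =
        (R c).indicator (T ((R c).indicator w)) := by
      intro c hc
      have hd' := hdis c hc
      have e1 : A.indicator ((R c).indicator w) = 0 := by
        rw [Set.indicator_indicator, hd'.inter_eq, Set.indicator_empty]; rfl
      have e2 : Aᶜ.indicator ((R c).indicator w) = (R c).indicator w := by
        rw [Set.indicator_indicator, Set.inter_eq_right.2 (Set.subset_compl_iff_disjoint_left.2 hd')]
      rw [hT'z, e1, e2, map_zero]
      ext k
      by_cases hk : k ∈ R c
      · have : k ∉ A := fun h => hd'.le_bot ⟨h, hk⟩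
        simp [hk, this]
      · simp [hk]
    have hsub : A ⊆ (⋃ c ∈ G, R c)ᶜ := by
      intro k hk hk'
      obtain ⟨c, hc, hkc⟩ := Set.mem_iUnion₂.1 hk'
      exact (hdis c hc).le_bot ⟨hk, hkc⟩
    have hU : ⋃ c ∈ insert d G, R c = A ∪ ⋃ c ∈ G, R c := Finset.set_biUnion_insert _ _ _
    rw [Finset.sum_congr rfl h4, Finset.sum_insert hd, hU, add_comm ((R d).indicator _), add_assoc,
      hT'z]
    congr 1
    change A.indicator (T (A.indicator w)) + _ = _
    generalize (⋃ c ∈ G, R c) = S at hsub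
    have e1 : A.indicator (Sᶜ.indicator w) = A.indicator w := by
      rw [Set.indicator_indicator, Set.inter_eq_left.2 hsub]
    have e2 : Aᶜ.indicator (Sᶜ.indicator w) = (A ∪ S)ᶜ.indicator w := by
      rw [Set.indicator_indicator, Set.compl_union]
    rw [e1, e2]
    generalize T (A.indicator w) = x
    generalize T ((A ∪ S)ᶜ.indicator w) = y
    ext k
    by_cases hk : k ∈ A
    · have : k ∉ S := hsub hk
      simp [hk, this]
    · by_cases hk' : k ∈ S <;> simp [hk, hk']

/-- A separated family that stays away from the interval `[a, b)`, for which the shift to the right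
is nearly as bad as its blocks permit, and worse than `C`. The family lives in `[a', b')`. -/
structure ExtremalFamily (J : Set ℤ) (E : (ℤ → ℝ) → ℝ≥0∞) (t : ℤ → ℝ≥0) (Λ C : ℝ≥0) (a b : ℤ) where
  /-- the index set -/
  s : Finset ℤ
  /-- left end points -/
  lo : ℤ → ℤ
  /-- middle points -/
  mid : ℤ → ℤ
  /-- right end points -/
  hi : ℤ → ℤ
  /-- left members -/
  h : ℤ → ℤ → ℝ
  /-- right members -/
  g : ℤ → ℤ → ℝ
  /-- lower bound of the whole -/
  a' : ℤ
  /-- upper bound of the whole -/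
  b' : ℤ
  blocks : Blocks J t Λ s lo mid hi
  family : BlockFamily E s lo mid hi h g
  ne_zero : ∀ j ∈ s, E (h j) ≠ 0
  extremal : ∀ g', BlockFamily E s lo mid hi h g' → E (∑ j ∈ s, g' j) ≤ 2 * E (∑ j ∈ s, g j)
  bad : C * E (∑ j ∈ s, h j) < E (∑ j ∈ s, g j)
  far : ∀ j ∈ s, (b ≤ lo j ∧ Λ * t b ≤ t (lo j)) ∨ (hi j ≤ a ∧ Λ * t (hi j) ≤ t a)
  le_a : a' ≤ a
  le_b : b ≤ b'
  a_le : ∀ j ∈ s, a' ≤ lo j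
  hi_le : ∀ j ∈ s, hi j ≤ b'

theorem IsCouple.nonempty_extremalFamily {J : Set ℤ} {E F : (ℤ → ℝ) → ℝ≥0∞} {t : ℤ → ℝ≥0} {C : ℝ≥0}
    (H : IsCouple J E F t C) (hbad : ∀ Λ C, ¬ SepRightShift J E t Λ C) (Λ C₁ : ℝ≥0) {a b : ℤ}
    (hab : a ≤ b) :
    Nonempty (ExtremalFamily J E t Λ C₁ a b) := by
  classical
  have hE := H.left
  set n : ℕ := (b + 1 - a).toNat + 2 with hn
  have h1 := hbad Λ (2 * C₁ + n)
  simp only [SepRightShift] at h1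
  push Not at h1
  obtain ⟨s, lo, mid, hi, h, g, hB, hF, hlt⟩ := h1
  have hltj : ∀ j ∈ s, lo j < hi j := fun j hj => (hB.le_mid j hj).trans_lt (hB.mid_lt j hj)
  set good : ℤ → Prop := fun j =>
    (b ≤ lo j ∧ Λ * t b ≤ t (lo j)) ∨ (hi j ≤ a ∧ Λ * t (hi j) ≤ t a) with hgood
  set s₁ := s.filter good with hs₁
  set s₂ := s₁.filter fun j => E (h j) ≠ 0 with hs₂
  have hs₁s : s₁ ⊆ s := Finset.filter_subset _ _
  have hs₂s : s₂ ⊆ s := (Finset.filter_subset _ _).trans hs₁s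
  have hB₂ := hB.subset hs₂s
  have hF₂ := hF.subset hs₂s
  have hdisj := (hF.shiftFamily hB)
  have hsub : ∀ s' ⊆ s, E (∑ j ∈ s', h j) ≤ E (∑ j ∈ s, h j) := fun s' hs' =>
    hE.sum_le_sum_of_subset hs' fun i hi' j hj hij => hdisj.disjoint_left i hi' j hj hij
  have hcard : (s.filter fun j => ¬ good j).card ≤ n := by
    have hc1 : (s.filter fun j => a < hi j ∧ lo j < b).card ≤ (b + 1 - a).toNat := by
      rw [← Int.card_Ico]
      refine Finset.card_le_card_of_injOn (fun j => max (lo j) a) ?_ ?_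
      · intro j hj
        obtain ⟨hj1, hj2, hj3⟩ := Finset.mem_filter.1 hj
        simp only [Finset.coe_Ico, Set.mem_Ico]
        have := hltj j hj1
        exact ⟨le_max_right _ _, max_lt (by omega) (by omega)⟩
      · have key : ∀ i ∈ s, ∀ j ∈ s, a < hi i → i < j → max (lo i) a ≠ max (lo j) a := by
          intro i hi' j hj hai hij
          have h1 := hB.le i hi' j hj hij
          have h2 := hltj i hi'
          have : max (lo i) a < hi i := max_lt h2 hai
          exact (this.trans_le (h1.trans (le_max_left _ _))).ne
        intro i hi' j hj hij
        obtain ⟨hi1, hi2, hi3⟩ := Finset.mem_filter.1 hi'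
        obtain ⟨hj1, hj2, hj3⟩ := Finset.mem_filter.1 hj
        by_contra hne
        rcases lt_or_gt_of_ne hne with h | h
        · exact key i hi1 j hj1 hi2 h hij
        · exact key j hj1 i hi1 hj2 h hij.symm
    have hc2 : (s.filter fun j => b ≤ lo j ∧ ¬ Λ * t b ≤ t (lo j)).card ≤ 1 := by
      have key : ∀ i ∈ s, ∀ j ∈ s, b ≤ lo i → ¬ Λ * t b ≤ t (lo j) → ¬ i < j := by
        intro i hi' j hj h1 h2 hij
        refine h2 ((mul_le_mul_right (H.mono ?_) Λ).trans (hB.sep i hi' j hj hij))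
        exact h1.trans (hltj i hi').le
      refine Finset.card_le_one.2 fun i hi' j hj => ?_
      obtain ⟨hi1, hi2, hi3⟩ := Finset.mem_filter.1 hi'
      obtain ⟨hj1, hj2, hj3⟩ := Finset.mem_filter.1 hj
      have := key i hi1 j hj1 hi2 hj3
      have := key j hj1 i hi1 hj2 hi3
      omega
    have hc3 : (s.filter fun j => hi j ≤ a ∧ ¬ Λ * t (hi j) ≤ t a).card ≤ 1 := by
      have key : ∀ i ∈ s, ∀ j ∈ s, hi j ≤ a → ¬ Λ * t (hi i) ≤ t a → ¬ i < j := by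
        intro i hi' j hj h1 h2 hij
        refine h2 ((hB.sep i hi' j hj hij).trans (H.mono ?_))
        exact (hltj j hj).le.trans h1
      refine Finset.card_le_one.2 fun i hi' j hj => ?_
      obtain ⟨hi1, hi2, hi3⟩ := Finset.mem_filter.1 hi'
      obtain ⟨hj1, hj2, hj3⟩ := Finset.mem_filter.1 hj
      have := key i hi1 j hj1 hj2 hi3
      have := key j hj1 i hi1 hi2 hj3
      omega
    calc (s.filter fun j => ¬ good j).card
        ≤ ((s.filter fun j => a < hi j ∧ lo j < b) ∪
            ((s.filter fun j => b ≤ lo j ∧ ¬ Λ * t b ≤ t (lo j)) ∪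
              s.filter fun j => hi j ≤ a ∧ ¬ Λ * t (hi j) ≤ t a)).card := by
          refine Finset.card_le_card fun j hj => ?_
          obtain ⟨hj1, hj2⟩ := Finset.mem_filter.1 hj
          simp only [hgood] at hj2
          simp only [Finset.mem_union, Finset.mem_filter]
          by_cases e1 : a < hi j
          · by_cases e2 : lo j < b
            · exact Or.inl ⟨hj1, e1, e2⟩
            · exact Or.inr (Or.inl ⟨hj1, not_lt.1 e2, fun h => hj2 (Or.inl ⟨not_lt.1 e2, h⟩)⟩)
          · exact Or.inr (Or.inr ⟨hj1, not_lt.1 e1, fun h => hj2 (Or.inr ⟨not_lt.1 e1, h⟩)⟩)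
      _ ≤ _ := by
          refine (Finset.card_union_le _ _).trans ?_
          have := Finset.card_union_le (s.filter fun j => b ≤ lo j ∧ ¬ Λ * t b ≤ t (lo j))
            (s.filter fun j => hi j ≤ a ∧ ¬ Λ * t (hi j) ≤ t a)
          omega
  have hbad₂ : 2 * C₁ * E (∑ j ∈ s₂, h j) < E (∑ j ∈ s₂, g j) := by
    have hg1 : E (∑ j ∈ s, g j) ≤ E (∑ j ∈ s₂, g j) + n * E (∑ j ∈ s, h j) := by
      rw [← Finset.sum_filter_add_sum_filter_not s good]
      refine (hE.add_le _ _).trans (add_le_add ?_ ?_)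
      · rw [← Finset.sum_filter_add_sum_filter_not s₁ fun j => E (h j) ≠ 0]
        refine (hE.add_le _ _).trans ?_
        have : E (∑ j ∈ s₁ with ¬ E (h j) ≠ 0, g j) ≤ 0 := by
          refine (hE.sum_le _ _).trans (Finset.sum_nonpos fun j hj => ?_)
          obtain ⟨hj1, hj2⟩ := Finset.mem_filter.1 hj
          rw [not_not] at hj2
          exact hj2 ▸ hF.le j (hs₁s hj1)
        calc _ ≤ E (∑ j ∈ s₂, g j) + 0 := add_le_add le_rfl this
          _ = _ := add_zero _
      · refine (hE.sum_le _ _).trans ?_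
        refine (Finset.sum_le_card_nsmul _ _ (E (∑ j ∈ s, h j)) fun j hj => ?_).trans ?_
        · have hjs := (Finset.mem_filter.1 hj).1
          refine (hF.le j hjs).trans ?_
          simpa using hsub {j} (by simpa using hjs)
        · rw [nsmul_eq_mul]
          gcongr
    by_contra hcon
    rw [not_lt] at hcon
    refine absurd hlt (not_lt.2 (hg1.trans ?_))
    calc _ ≤ 2 * C₁ * E (∑ j ∈ s, h j) + n * E (∑ j ∈ s, h j) :=
          add_le_add (hcon.trans (mul_le_mul_right (hsub s₂ hs₂s) _)) le_rfl
      _ = _ := by push_cast; ring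
  have hfin : ∀ g', BlockFamily E s₂ lo mid hi h g' → E (∑ j ∈ s₂, g' j) ≤ ∑ j ∈ s₂, E (h j) :=
    fun g' hg' => (hE.sum_le _ _).trans (Finset.sum_le_sum hg'.le)
  have hfin' : ∑ j ∈ s₂, E (h j) ≠ ∞ := by
    refine (ENNReal.sum_lt_top.2 fun j hj => ?_).ne
    exact (hE.ne_top_of_finite (hdisj.finite_left j (hs₂s hj))).lt_top
  set S : ℝ≥0∞ := ⨆ (g') (_ : BlockFamily E s₂ lo mid hi h g'), E (∑ j ∈ s₂, g' j) with hS
  have hSle : ∀ g', BlockFamily E s₂ lo mid hi h g' → E (∑ j ∈ s₂, g' j) ≤ S := fun g' hg' =>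
    le_iSup₂ (f := fun g' (_ : BlockFamily E s₂ lo mid hi h g') => E (∑ j ∈ s₂, g' j)) g' hg'
  have hStop : S ≠ ∞ := ne_top_of_le_ne_top hfin' (iSup₂_le hfin)
  have hS0 : S ≠ 0 := ((zero_le.trans_lt hbad₂).trans_le (hSle g hF₂)).ne'
  obtain ⟨g', hg', hgS⟩ : ∃ g', ∃ _ : BlockFamily E s₂ lo mid hi h g', S / 2 < E (∑ j ∈ s₂, g' j) := by
    have := ENNReal.half_lt_self hS0 hStop
    simpa only [hS, lt_iSup_iff] using this
  have hS2 : S ≤ 2 * E (∑ j ∈ s₂, g' j) := by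
    rw [ENNReal.div_lt_iff (by simp) (by simp), mul_comm] at hgS
    exact hgS.le
  obtain ⟨a', ha'⟩ := (insert a (s₂.image lo)).bddBelow
  obtain ⟨b', hb'⟩ := (insert b (s₂.image hi)).bddAbove
  exact ⟨{
    s := s₂, lo := lo, mid := mid, hi := hi, h := h, g := g', a' := a', b' := b'
    blocks := hB₂
    family := hg'
    ne_zero := fun j hj => (Finset.mem_filter.1 hj).2
    extremal := fun g'' hg'' => (hSle g'' hg'').trans hS2
    bad := by
      have h1 : 2 * (C₁ * E (∑ j ∈ s₂, h j)) < 2 * E (∑ j ∈ s₂, g' j) := by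
        rw [← mul_assoc]
        exact hbad₂.trans_le ((hSle g hF₂).trans hS2)
      exact lt_of_mul_lt_mul_left h1 zero_le
    far := fun j hj => (Finset.mem_filter.1 (Finset.mem_filter.1 hj).1).2
    le_a := ha' (by simp)
    le_b := hb' (by simp)
    a_le := fun j hj => ha' (by simpa using Or.inr ⟨j, hj, rfl⟩)
    hi_le := fun j hj => hb' (by simpa using Or.inr ⟨j, hj, rfl⟩) }⟩

/-- If the couple has the sequence form of the Calderón property, then shifts to the right are
bounded. -/
theorem IsCouple.exists_rightShift {J : Set ℤ} {E F : (ℤ → ℝ) → ℝ≥0∞} {t : ℤ → ℝ≥0} {C : ℝ≥0}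
    (H : IsCouple J E F t C) (hCal : SeqCalderon J E F t) : ∃ C', RightShift E E C' := by
  classical
  by_contra hcon
  have hE := H.left
  have hbad : ∀ Λ C, ¬ SepRightShift J E t Λ C := fun Λ C h => hcon (H.rightShift_of_sep h)
  have hex : ∀ (n : ℕ) (p : {p : ℤ × ℤ // p.1 ≤ p.2}),
      Nonempty (ExtremalFamily J E t ((n + 2 : ℕ) ^ 2) n p.1.1 p.1.2) := fun n p =>
    H.nonempty_extremalFamily hbad _ _ p.2
  obtain ⟨Φ⟩ : Nonempty (∀ (n : ℕ) (p : {p : ℤ × ℤ // p.1 ≤ p.2}),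
      ExtremalFamily J E t ((n + 2 : ℕ) ^ 2) n p.1.1 p.1.2) := ⟨fun n p => (hex n p).some⟩
  let seq : ℕ → {p : ℤ × ℤ // p.1 ≤ p.2} := fun n => Nat.rec ⟨(0, 0), le_rfl⟩
    (fun n p => ⟨((Φ n p).a', (Φ n p).b'), (Φ n p).le_a.trans (p.2.trans (Φ n p).le_b)⟩) n
  have hseq : ∀ n, (seq (n + 1)).1.1 = (Φ n (seq n)).a' ∧ (seq (n + 1)).1.2 = (Φ n (seq n)).b' :=
    fun n => ⟨rfl, rfl⟩
  generalize seq = seq at hseq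
  have hanti : Antitone fun n => (seq n).1.1 := antitone_nat_of_succ_le fun n => by
    rw [(hseq n).1]; exact (Φ n (seq n)).le_a
  have hmono : Monotone fun n => (seq n).1.2 := monotone_nat_of_le_succ fun n => by
    rw [(hseq n).2]; exact (Φ n (seq n)).le_b
  set f := fun n => Φ n (seq n) with hf
  let ι := Σ n, {j // j ∈ (f n).s}
  let lo : ι → ℤ := fun c => (f c.1).lo c.2
  let mid : ι → ℤ := fun c => (f c.1).mid c.2
  let hi : ι → ℤ := fun c => (f c.1).hi c.2
  have le_mid : ∀ c, lo c ≤ mid c := fun c => (f c.1).blocks.le_mid c.2 c.2.2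
  have mid_lt : ∀ c, mid c < hi c := fun c => (f c.1).blocks.mid_lt c.2 c.2.2
  have lo_lt : ∀ c, lo c < hi c := fun c => (le_mid c).trans_lt (mid_lt c)
  have hfar : ∀ c d : ι, c.1 < d.1 →
      (hi c ≤ lo d ∧ ((d.1 + 2 : ℕ) : ℝ≥0) ^ 2 * t (hi c) ≤ t (lo d)) ∨
      (hi d ≤ lo c ∧ ((d.1 + 2 : ℕ) : ℝ≥0) ^ 2 * t (hi d) ≤ t (lo c)) := by
    intro c d hcd
    have h1 : (seq d.1).1.1 ≤ lo c := by
      refine (hanti (Nat.succ_le_of_lt hcd)).trans ?_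
      exact (hseq c.1).1.le.trans ((f c.1).a_le c.2 c.2.2)
    have h2 : hi c ≤ (seq d.1).1.2 := by
      refine le_trans ?_ (hmono (Nat.succ_le_of_lt hcd))
      exact ((f c.1).hi_le c.2 c.2.2).trans (hseq c.1).2.ge
    rcases (f d.1).far d.2 d.2.2 with ⟨h3, h4⟩ | ⟨h3, h4⟩
    · exact Or.inl ⟨h2.trans h3, (mul_le_mul_right (H.mono h2) _).trans h4⟩
    · exact Or.inr ⟨h3.trans h1, h4.trans (H.mono h1)⟩
  have hsq : ∀ {m n : ℕ}, m < n → ((m + 2 : ℕ) : ℝ≥0) ^ 2 ≤ ((n + 2 : ℕ) : ℝ≥0) ^ 2 := by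
    intro m n hmn
    gcongr
  have hsep : ∀ c d : ι, hi c ≤ lo d → ((c.1 + 2 : ℕ) : ℝ≥0) ^ 2 * t (hi c) ≤ t (lo d) ∧
      ((d.1 + 2 : ℕ) : ℝ≥0) ^ 2 * t (hi c) ≤ t (lo d) := by
    intro c d hcd
    have l1 := lo_lt c
    have l2 := lo_lt d
    rcases lt_trichotomy c.1 d.1 with h | h | h
    · rcases hfar c d h with h' | h'
      · exact ⟨(mul_le_mul_left (hsq h) _).trans h'.2, h'.2⟩
      · omega
    · obtain ⟨n, i⟩ := c
      obtain ⟨m, j⟩ := d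
      obtain rfl : n = m := h
      have hij : (i : ℤ) < j := by
        rcases lt_trichotomy (i : ℤ) j with h | h | h
        · exact h
        · obtain rfl := Subtype.ext h; omega
        · have : hi ⟨n, j⟩ ≤ lo ⟨n, i⟩ := (f n).blocks.le j j.2 i i.2 h
          omega
      have := (f n).blocks.sep i i.2 j j.2 hij
      exact ⟨this, this⟩
    · rcases hfar d c h with h' | h'
      · omega
      · exact ⟨h'.2, (mul_le_mul_left (hsq h) _).trans h'.2⟩
  have hch : Chunks t lo hi fun c => ((c.1 + 2 : ℕ) : ℝ≥0) :=
    { lt := lo_lt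
      two_le := fun c => by push_cast; exact le_add_self
      total := by
        intro c d hcd
        rcases lt_trichotomy c.1 d.1 with h | h | h
        · exact (hfar c d h).imp And.left And.left
        · obtain ⟨n, i⟩ := c
          obtain ⟨m, j⟩ := d
          obtain rfl : n = m := h
          rcases lt_trichotomy (i : ℤ) j with h | h | h
          · exact Or.inl ((f n).blocks.le i i.2 j j.2 h)
          · exact absurd (congrArg (Sigma.mk n) (Subtype.ext h)) hcd
          · exact Or.inr ((f n).blocks.le j j.2 i i.2 h)
        · exact ((hfar d c h).imp And.left And.left).symm
      sep_left := fun c d h => (hsep c d h).1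
      sep_right := fun c d h => (hsep c d h).2 }
  obtain ⟨T, K, K', hT, hK'⟩ := H.exists_operator_of_chunks hCal hch
    (h := fun c : ι => (f c.1).h c.2) (g := fun c : ι => (f c.1).g c.2)
    (fun c => (f c.1).family.left c.2 c.2.2) (fun c => (f c.1).family.right c.2 c.2.2) le_mid
    (fun c => (mid_lt c).le) (fun c => (f c.1).family.le c.2 c.2.2)
    (fun c => (f c.1).ne_zero c.2 c.2.2)
  obtain ⟨n, hn⟩ := exists_nat_ge (max (2 * K) (4 * (K' + 1)))
  set A := f n with hA
  set R : ℤ → Set ℤ := fun j => Set.Ico (A.mid j) (A.hi j) with hR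
  have herr : ∀ j ∈ A.s, E ((4 : ℝ) • (R j).indicator (T (A.h j) - A.g j)) ≤ E (A.h j) := by
    intro j hj
    have h1 := hK' ⟨n, j, hj⟩
    have h2 : ((K' + 1 : ℝ≥0) : ℝ≥0∞) * (4 * E ((R j).indicator (T (A.h j) - A.g j))) ≤
        ((K' + 1 : ℝ≥0) : ℝ≥0∞) * E (A.h j) := by
      calc _ = ((4 * (K' + 1) : ℝ≥0) : ℝ≥0∞) * E ((R j).indicator (T (A.h j) - A.g j)) := by
            push_cast; ring
        _ ≤ ((n + 2 : ℕ) : ℝ≥0) * E ((R j).indicator (T (A.h j) - A.g j)) := by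
            gcongr
            refine (le_max_right _ _).trans (hn.trans ?_)
            push_cast
            exact le_self_add
        _ ≤ K' * E (A.h j) := h1
        _ ≤ _ := by gcongr; exact le_self_add
    have h3 := (ENNReal.mul_le_mul_iff_right (by simp) (by simp)).1 h2
    rw [hE.smul]
    refine le_trans (le_of_eq ?_) h3
    congr 1
    rw [Real.enorm_eq_ofReal (by norm_num)]
    simp
  have h4 : 4 * E (∑ j ∈ A.s, (R j).indicator (T (A.h j) - A.g j)) ≤ 2 * E (∑ j ∈ A.s, A.g j) := by
    have := A.extremal (fun j => (4 : ℝ) • (R j).indicator (T (A.h j) - A.g j))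
      { left := A.family.left
        right := fun j _ k hk => by
          by_contra h
          exact hk (by simp [Set.indicator_of_notMem (show k ∉ R j from h)])
        le := herr }
    rw [← Finset.smul_sum, hE.smul] at this
    refine le_trans (le_of_eq ?_) this
    congr 1
    rw [Real.enorm_eq_ofReal (by norm_num)]
    simp
  have hdis : ∀ i ∈ A.s, ∀ j ∈ A.s, i ≠ j →
      Disjoint (Set.Ico (A.lo i) (A.hi i)) (Set.Ico (A.lo j) (A.hi j)) := by
    intro i hi' j hj hij
    refine Set.disjoint_left.2 fun k hk hk' => ?_
    obtain ⟨h1, h2⟩ := hk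
    obtain ⟨h3, h4⟩ := hk'
    rcases lt_or_gt_of_ne hij with h | h
    · have := A.blocks.le i hi' j hj h; omega
    · have := A.blocks.le j hj i hi' h; omega
  have h5 : E (∑ j ∈ A.s, (R j).indicator (T (A.h j))) ≤ K * E (∑ j ∈ A.s, A.h j) := by
    refine le_trans ?_ (hE.blockDiagonal_le A.s (fun j => Set.Ico (A.lo j) (A.hi j)) hdis hT
      (∑ j ∈ A.s, A.h j))
    have hind : ∀ j ∈ A.s, (Set.Ico (A.lo j) (A.hi j)).indicator (∑ i ∈ A.s, A.h i) = A.h j := by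
      intro j hj
      ext k
      by_cases hk : k ∈ Set.Ico (A.lo j) (A.hi j)
      · rw [Set.indicator_of_mem hk, Finset.sum_apply, Finset.sum_eq_single_of_mem j hj]
        intro i hi' hij
        by_contra h0
        have h1 := A.family.left i hi' k h0
        have h2 := A.blocks.mid_lt i hi'
        exact (hdis i hi' j hj hij).le_bot ⟨⟨h1.1, h1.2.trans h2⟩, hk⟩
      · rw [Set.indicator_of_notMem hk]
        by_contra h0
        have h1 := A.family.left j hj k (Ne.symm h0)
        have h2 := A.blocks.mid_lt j hj
        exact hk ⟨h1.1, h1.2.trans h2⟩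
    have hsum : ∑ j ∈ A.s, (Set.Ico (A.lo j) (A.hi j)).indicator
        (T ((Set.Ico (A.lo j) (A.hi j)).indicator (∑ i ∈ A.s, A.h i))) =
        ∑ j ∈ A.s, (Set.Ico (A.lo j) (A.hi j)).indicator (T (A.h j)) :=
      Finset.sum_congr rfl fun j hj => by rw [hind j hj]
    rw [hsum]
    refine hE.mono' fun k => ?_
    have hsub : ∀ j ∈ A.s, R j ⊆ Set.Ico (A.lo j) (A.hi j) := fun j hj =>
      Set.Ico_subset_Ico_left (A.blocks.le_mid j hj)
    rw [Finset.sum_apply, Finset.sum_apply]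
    by_cases hk : ∃ j ∈ A.s, k ∈ Set.Ico (A.lo j) (A.hi j)
    · obtain ⟨j, hj, hk⟩ := hk
      have hz : ∀ i ∈ A.s, i ≠ j → k ∉ Set.Ico (A.lo i) (A.hi i) := fun i hi' hij hki =>
        (hdis i hi' j hj hij).le_bot ⟨hki, hk⟩
      rw [Finset.sum_eq_single_of_mem j hj fun i hi' hij =>
          Set.indicator_of_notMem (fun h => hz i hi' hij (hsub i hi' h)) _,
        Finset.sum_eq_single_of_mem j hj fun i hi' hij =>
          Set.indicator_of_notMem (hz i hi' hij) _, Set.indicator_of_mem hk]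
      by_cases hkR : k ∈ R j
      · rw [Set.indicator_of_mem hkR]
      · rw [Set.indicator_of_notMem hkR, abs_zero]
        exact abs_nonneg _
    · push Not at hk
      rw [Finset.sum_eq_zero fun j hj => Set.indicator_of_notMem (fun h => hk j hj (hsub j hj h)) _,
        abs_zero]
      exact abs_nonneg _
  have h6 : E (∑ j ∈ A.s, A.g j) ≤ E (∑ j ∈ A.s, (R j).indicator (T (A.h j))) +
      E (∑ j ∈ A.s, (R j).indicator (T (A.h j) - A.g j)) := by
    have hdec : ∑ j ∈ A.s, A.g j = ∑ j ∈ A.s, (R j).indicator (T (A.h j)) +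
        -∑ j ∈ A.s, (R j).indicator (T (A.h j) - A.g j) := by
      rw [← sub_eq_add_neg, ← Finset.sum_sub_distrib]
      refine Finset.sum_congr rfl fun j hj => ?_
      rw [← Set.indicator_sub', sub_sub_cancel]
      exact (Set.indicator_eq_self.2 fun k hk => A.family.right j hj k hk).symm
    rw [hdec]
    exact (hE.add_le _ _).trans_eq (by rw [hE.neg])
  have hfin : E (∑ j ∈ A.s, A.g j) ≠ ∞ := by
    refine ne_top_of_le_ne_top ?_ (hE.sum_le _ _)
    exact (ENNReal.sum_lt_top.2 fun j hj => (hE.ne_top_of_finite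
      ((A.family.shiftFamily A.blocks).finite_right j hj)).lt_top).ne
  refine absurd A.bad (not_lt.2 ?_)
  have h7 : 2 * E (∑ j ∈ A.s, A.g j) ≤
      2 * K * E (∑ j ∈ A.s, A.h j) + E (∑ j ∈ A.s, A.g j) := by
    have h8 : 2 * E (∑ j ∈ A.s, (R j).indicator (T (A.h j) - A.g j)) ≤ E (∑ j ∈ A.s, A.g j) := by
      refine (ENNReal.mul_le_mul_iff_right (a := 2) (by simp) (by simp)).1 ?_
      rw [← mul_assoc, show (2 : ℝ≥0∞) * 2 = 4 by norm_num]
      exact h4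
    calc _ ≤ 2 * (K * E (∑ j ∈ A.s, A.h j) +
          E (∑ j ∈ A.s, (R j).indicator (T (A.h j) - A.g j))) :=
            mul_le_mul_right (h6.trans (add_le_add h5 le_rfl)) _
      _ = 2 * K * E (∑ j ∈ A.s, A.h j) +
          2 * E (∑ j ∈ A.s, (R j).indicator (T (A.h j) - A.g j)) := by ring
      _ ≤ _ := add_le_add le_rfl h8
  rw [two_mul (E _)] at h7
  refine ((ENNReal.add_le_add_iff_right hfin).1 h7).trans ?_
  gcongr
  have := (le_max_left (2 * K) _).trans hn
  exact_mod_cast this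


theorem SeqCalderon.reflect {J : Set ℤ} {E F : (ℤ → ℝ) → ℝ≥0∞} {t : ℤ → ℝ≥0}
    (tpos : ∀ n, 0 < t n) (h : SeqCalderon J E F t) :
    SeqCalderon {k | -1 - k ∈ J} (fun x => F (CalderonRI.reflect x))
      (fun x => E (CalderonRI.reflect x)) fun n => (t (-n))⁻¹ := by
  intro C₀ u v hF hE hgap
  have hgap' : ∀ k, E ((Set.Iio k).indicator (CalderonRI.reflect v)) +
      t k * F ((Set.Ici k).indicator (CalderonRI.reflect v)) ≤
      C₀ * (E ((Set.Iio k).indicator (CalderonRI.reflect u)) +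
        t k * F ((Set.Ici k).indicator (CalderonRI.reflect u))) := by
    intro k
    have h1 := hgap (-k)
    simp only [reflect_Iio, reflect_Ici, neg_neg] at h1
    have h0 : (t k : ℝ≥0∞) ≠ 0 := by simpa using (tpos k).ne'
    rw [ENNReal.coe_inv (tpos k).ne'] at h1
    have hr : ∀ A B : ℝ≥0∞, (t k : ℝ≥0∞) * (B + (t k : ℝ≥0∞)⁻¹ * A) = A + t k * B := by
      intro A B
      rw [mul_add, ← mul_assoc, ENNReal.mul_inv_cancel h0 (by simp), one_mul, add_comm]
    rw [← hr, ← hr, mul_left_comm]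
    exact mul_le_mul_right h1 _
  obtain ⟨T, K, hTE, hTF, hT⟩ := h C₀ (CalderonRI.reflect u) (CalderonRI.reflect v)
    (fun k => by simpa [reflect_Ici] using hE (-k))
    (fun k => by simpa [reflect_Iio] using hF (-k)) hgap'
  refine ⟨reflectₗ ∘ₗ T ∘ₗ reflectₗ, K, fun z => by simpa using hTF (CalderonRI.reflect z),
    fun z => by simpa using hTE (CalderonRI.reflect z), fun k hk => ?_⟩
  have := hT _ hk
  simpa using this

theorem IsCouple.exists_leftShift {J : Set ℤ} {E F : (ℤ → ℝ) → ℝ≥0∞} {t : ℤ → ℝ≥0} {C : ℝ≥0}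
    (H : IsCouple J E F t C) (hCal : SeqCalderon J E F t) : ∃ C', LeftShift F F C' := by
  obtain ⟨C', h⟩ := H.reflect.exists_rightShift (hCal.reflect H.pos)
  refine ⟨C', ?_⟩
  simpa only [reflect_reflect] using h.reflect

/-! ### Shift properties of norms on sequences indexed by `J` -/

/-- A norm for sequences on `J`, regarded as a norm for two-sided sequences. -/
def extendNorm {J : Set ℤ} (N : (J → ℝ) → ℝ≥0∞) (x : ℤ → ℝ) : ℝ≥0∞ := N fun k => x k

/-- Extension of a sequence on `J` by zero. -/
noncomputable def extendZero {J : Set ℤ} (x : J → ℝ) : ℤ → ℝ := Function.extend Subtype.val x 0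

@[simp] theorem extendZero_coe {J : Set ℤ} (x : J → ℝ) (k : J) : extendZero x k = x k :=
  Subtype.val_injective.extend_apply _ _ _

theorem extendZero_ne_zero {J : Set ℤ} {x : J → ℝ} {k : ℤ} (h : extendZero x k ≠ 0) :
    ∃ hk : k ∈ J, x ⟨k, hk⟩ ≠ 0 := by
  by_cases hk : k ∈ J
  · exact ⟨hk, by simpa using (extendZero_coe x ⟨k, hk⟩) ▸ h⟩
  · refine absurd (Function.extend_apply' _ _ _ ?_) h
    rintro ⟨a, rfl⟩
    exact hk a.2

theorem ShiftFamily.disjoint_right {s : Finset ℤ} {f g : ℤ → ℤ → ℝ} (B : ShiftFamily s f g) :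
    ∀ i ∈ s, ∀ j ∈ s, i ≠ j → ∀ k, g i k ≠ 0 → g j k = 0 := by
  intro i hi j hj hij k hk
  by_contra h
  rcases lt_or_gt_of_ne hij with h' | h'
  · exact lt_irrefl _ (B.lt_of_lt i hi j hj h' k k (Or.inr hk) (Or.inr h))
  · exact lt_irrefl _ (B.lt_of_lt j hj i hi h' k k (Or.inr h) (Or.inr hk))

theorem ShiftFamily.exists_interlaced {J : Set ℤ} {E : (ℤ → ℝ) → ℝ≥0∞} (hE : IsSeqNorm J E)
    {s : Finset ℤ} {u v : ℤ → ℤ → ℝ} (H : ShiftFamily s u v) (hu : ∀ j ∈ s, E (u j) ≠ 0)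
    (hv : ∀ j ∈ s, E (v j) ≠ 0) :
    ∃ (S : Finset ℤ) (idx : ℤ → ℤ), (S : Set ℤ).OrdConnected ∧ (∀ m ∈ S, idx m ∈ s) ∧
      (∀ f : ℤ → ℤ → ℝ, ∑ m ∈ S, f (idx m) = ∑ j ∈ s, f j) ∧
      ∀ c : ℤ → ℝ, (∀ j ∈ s, c j ≠ 0) → Interlaced (J := J) S
        (fun m k => c (idx m) * u (idx m) k) fun m k => c (idx m) * v (idx m) k := by
  classical
  set e := s.orderEmbOfFin rfl with he
  set idx : ℤ → ℤ := fun m => if hm : m.toNat < s.card then e ⟨m.toNat, hm⟩ else 0 with hidx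
  have hidx' : ∀ i : Fin s.card, idx (i : ℕ) = e i := fun i => by simp [hidx]
  set S : Finset ℤ := Finset.Ico 0 (s.card : ℤ) with hS
  have hmem : ∀ m ∈ S, ∃ i : Fin s.card, m = ((i : ℕ) : ℤ) := by
    intro m hm
    rw [hS, Finset.mem_Ico] at hm
    exact ⟨⟨m.toNat, by omega⟩, by simp; omega⟩
  have hidxs : ∀ m ∈ S, idx m ∈ s := by
    intro m hm
    obtain ⟨i, rfl⟩ := hmem m hm
    rw [hidx']
    exact Finset.orderEmbOfFin_mem _ _ _
  have hne : ∀ (z : ℤ → ℝ) (c : ℝ), c ≠ 0 → E z ≠ 0 → (fun k : J => c * z k) ≠ 0 := by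
    intro z c hc hz h0
    refine hz ?_
    rw [← hE.zero]
    refine hE.congr fun k hk => ?_
    have := congrFun h0 ⟨k, hk⟩
    simp only [Pi.zero_apply, mul_eq_zero, hc, false_or] at this
    simp [this]
  have hfin : ∀ (z : ℤ → ℝ) (c : ℝ), (Function.support z).Finite →
      (Function.support fun k : J => c * z k).Finite := by
    intro z c hz
    refine Set.Finite.subset (hz.preimage Subtype.val_injective.injOn) fun k hk => ?_
    exact right_ne_zero_of_mul hk
  refine ⟨S, idx, ?_, hidxs, ?_, ?_⟩
  · rw [hS, Finset.coe_Ico]; exact Set.ordConnected_Ico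
  · intro f
    have h1 : S = Finset.univ.image fun i : Fin s.card => ((i : ℕ) : ℤ) := by
      ext m
      constructor
      · intro hm
        obtain ⟨i, rfl⟩ := hmem m hm
        exact Finset.mem_image_of_mem _ (Finset.mem_univ i)
      · intro hm
        obtain ⟨i, -, rfl⟩ := Finset.mem_image.1 hm
        simp [hS]
    have h2 : s = Finset.univ.image e := (Finset.image_orderEmbOfFin_univ s rfl).symm
    rw [h1, Finset.sum_image fun i _ j _ h => Fin.ext (by exact_mod_cast h)]
    conv_rhs => rw [h2]
    rw [Finset.sum_image fun i _ j _ h => e.injective h]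
    exact Finset.sum_congr rfl fun i _ => by rw [hidx']
  · intro c hc
    exact {
      finite_left := fun m hm => hfin _ _ (H.finite_left _ (hidxs m hm))
      finite_right := fun m hm => hfin _ _ (H.finite_right _ (hidxs m hm))
      ne_zero_left := fun m hm => hne _ _ (hc _ (hidxs m hm)) (hu _ (hidxs m hm))
      ne_zero_right := fun m hm => hne _ _ (hc _ (hidxs m hm)) (hv _ (hidxs m hm))
      lt := fun m hm a ha b hb => H.lt _ (hidxs m hm) a b (right_ne_zero_of_mul ha)
        (right_ne_zero_of_mul hb)
      lt_succ := by
        intro m hm hm' a ha b hb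
        refine H.lt_of_lt _ (hidxs m hm) _ (hidxs _ hm') ?_ a b
          (Or.inr (right_ne_zero_of_mul ha)) (Or.inl (right_ne_zero_of_mul hb))
        obtain ⟨i, hi⟩ := hmem m hm
        obtain ⟨j, hj⟩ := hmem _ hm'
        rw [hj, hi, hidx', hidx']
        refine e.strictMono (Fin.lt_def.2 ?_)
        omega }

theorem Interlaced.shiftFamily {J I : Set ℤ} {x y : ℤ → J → ℝ} (H : Interlaced I x y)
    (hI : I.OrdConnected) {s : Finset ℤ} (hs : (s : Set ℤ) ⊆ I) (α : ℤ → ℝ) :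
    ShiftFamily s (fun j => α j • extendZero (x j)) fun j => α j • extendZero (y j) := by
  have hfin : ∀ (z : J → ℝ) (c : ℝ), (Function.support z).Finite →
      (Function.support (c • extendZero z)).Finite := by
    intro z c hz
    refine Set.Finite.subset (hz.image Subtype.val) fun k hk => ?_
    obtain ⟨hk1, hk2⟩ := extendZero_ne_zero (x := z) (k := k) (by
      intro h; exact hk (by simp [h]))
    exact ⟨⟨k, hk1⟩, hk2, rfl⟩
  have hsup : ∀ (z : J → ℝ) (c : ℝ) (k : ℤ), (c • extendZero z) k ≠ 0 →
      ∃ a : J, a ∈ Function.support z ∧ k = a := by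
    intro z c k hk
    obtain ⟨hk1, hk2⟩ := extendZero_ne_zero (x := z) (k := k) (by
      intro h; exact hk (by simp [h]))
    exact ⟨⟨k, hk1⟩, hk2, rfl⟩
  have hxy : ∀ i ∈ I, ∀ j ∈ I, i < j → SuppLT (y i) (x j) := by
    intro i hi' j hj hij
    obtain ⟨n, rfl⟩ : ∃ n : ℕ, j = i + 1 + n := ⟨(j - (i + 1)).toNat, by omega⟩
    clear hij
    induction n with
    | zero => simpa using H.lt_succ i hi' (by simpa using hj)
    | succ n ih =>
      have hj' : i + 1 + n ∈ I := hI.out hi' hj ⟨by omega, by push_cast; omega⟩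
      obtain ⟨b, hb⟩ := Function.ne_iff.1 (H.ne_zero_left _ hj')
      obtain ⟨c, hc⟩ := Function.ne_iff.1 (H.ne_zero_right _ hj')
      intro a ha d hd
      have e : i + 1 + ((n + 1 : ℕ) : ℤ) = i + 1 + n + 1 := by push_cast; ring
      rw [e] at hd hj
      exact (ih hj' a ha b hb).trans ((H.lt _ hj' b hb c hc).trans (H.lt_succ _ hj' hj c hc d hd))
  refine ⟨fun j hj => hfin _ _ (H.finite_left j (hs hj)),
    fun j hj => hfin _ _ (H.finite_right j (hs hj)), ?_, ?_⟩
  · intro j hj a b ha hb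
    obtain ⟨a, ha', rfl⟩ := hsup _ _ _ ha
    obtain ⟨b, hb', rfl⟩ := hsup _ _ _ hb
    exact H.lt j (hs hj) a ha' b hb'
  · intro i hi' j hj hij a b ha hb
    obtain ⟨c, hc⟩ := Function.ne_iff.1 (H.ne_zero_right _ (hs hi'))
    obtain ⟨d, hd⟩ := Function.ne_iff.1 (H.ne_zero_left _ (hs hj))
    have h1 : a ≤ c ∨ ∃ a', a' ∈ Function.support (y i) ∧ a = a' := by
      rcases ha with ha | ha
      · obtain ⟨a, ha', rfl⟩ := hsup _ _ _ ha
        exact Or.inl (H.lt i (hs hi') a ha' c hc).le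
      · exact Or.inr (hsup _ _ _ ha)
    have h2 : (d : ℤ) ≤ b ∨ ∃ b', b' ∈ Function.support (x j) ∧ b = b' := by
      rcases hb with hb | hb
      · exact Or.inr (hsup _ _ _ hb)
      · obtain ⟨b, hb', rfl⟩ := hsup _ _ _ hb
        exact Or.inl (H.lt j (hs hj) d hd b hb').le
    have key := hxy i (hs hi') j (hs hj) hij
    obtain ⟨a', ha', haa⟩ : ∃ a' : J, a' ∈ Function.support (y i) ∧ a ≤ a' := by
      rcases h1 with h | ⟨a', h, rfl⟩
      · exact ⟨c, hc, h⟩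
      · exact ⟨a', h, le_rfl⟩
    obtain ⟨b', hb', hbb⟩ : ∃ b' : J, b' ∈ Function.support (x j) ∧ (b' : ℤ) ≤ b := by
      rcases h2 with h | ⟨b', h, rfl⟩
      · exact ⟨d, hd, h⟩
      · exact ⟨b', h, le_rfl⟩
    have h3 : (a' : ℤ) < b' := key a' ha' b' hb'
    omega

section

variable {J : Set ℤ} {N : (J → ℝ) → ℝ≥0∞} (hN : IsSeqNorm J (extendNorm N))

theorem extendNorm_extendZero (x : J → ℝ) : extendNorm N (extendZero x) = N x := by
  simp [extendNorm]

theorem extendNorm_sum_smul (s : Finset ℤ) (α : ℤ → ℝ) (x : ℤ → J → ℝ) :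
    extendNorm N (∑ n ∈ s, α n • extendZero (x n)) = N (∑ n ∈ s, α n • x n) := by
  refine congrArg N (funext fun k => ?_)
  simp [Finset.sum_apply]

include hN

theorem IsSeqNorm.sum_filter_ne_zero_le {s : Finset ℤ} (g : ℤ → ℤ → ℝ) [DecidablePred fun j => extendNorm N (g j) ≠ 0] :
    extendNorm N (∑ j ∈ s, g j) ≤ extendNorm N (∑ j ∈ s with extendNorm N (g j) ≠ 0, g j) := by
  rw [← Finset.sum_filter_add_sum_filter_not s fun j => extendNorm N (g j) ≠ 0]
  refine (hN.add_le _ _).trans ?_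
  have : extendNorm N (∑ j ∈ s with ¬ extendNorm N (g j) ≠ 0, g j) ≤ 0 :=
    (hN.sum_le _ _).trans (Finset.sum_nonpos fun j hj => (not_not.1 (Finset.mem_filter.1 hj).2).le)
  calc _ ≤ _ + 0 := add_le_add le_rfl this
    _ = _ := add_zero _

theorem extendNorm_inv_mul {z : ℤ → ℝ} (w : ℤ → ℝ) (hz : extendNorm N z ≠ 0)
    (hz' : extendNorm N z ≠ ∞) :
    N (fun k => (extendNorm N z).toReal⁻¹ * w k) = (extendNorm N z)⁻¹ * extendNorm N w := by
  have := hN.smul (extendNorm N z).toReal⁻¹ w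
  refine this.trans ?_
  congr 1
  rw [Real.enorm_eq_ofReal (by positivity), ENNReal.ofReal_inv_of_pos (ENNReal.toReal_pos hz hz'),
    ENNReal.ofReal_toReal hz']

theorem hasRSP_iff : HasRSP N ↔ ∃ C, RightShift (extendNorm N) (extendNorm N) C := by
  classical
  constructor
  · rintro ⟨C, hC⟩
    refine ⟨C, fun s h g hfam hle => ?_⟩
    set s' := s.filter fun j => extendNorm N (g j) ≠ 0 with hs'
    have hs's : s' ⊆ s := Finset.filter_subset _ _
    have hfam' := hfam.subset hs's
    have hg0 : ∀ j ∈ s', extendNorm N (g j) ≠ 0 := fun j hj => (Finset.mem_filter.1 hj).2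
    have hh0 : ∀ j ∈ s', extendNorm N (h j) ≠ 0 := fun j hj h0 =>
      hg0 j hj (le_antisymm (h0 ▸ hle j (hs's hj)) zero_le)
    have htop : ∀ j ∈ s', extendNorm N (h j) ≠ ∞ := fun j hj =>
      hN.ne_top_of_finite (hfam'.finite_left j hj)
    refine (hN.sum_filter_ne_zero_le g).trans (le_trans ?_ (mul_le_mul_right
      (hN.sum_le_sum_of_subset hs's fun i hi' j hj hij => hfam.disjoint_left i hi' j hj hij) _))
    obtain ⟨S, idx, hS, hidx, hsum, hint⟩ := hfam'.exists_interlaced hN hh0 hg0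
    have h1 := hC S hS _ _ (hint (fun j => (extendNorm N (h j)).toReal⁻¹) fun j hj =>
      inv_ne_zero (ENNReal.toReal_pos (hh0 j hj) (htop j hj)).ne') (by
        intro m hm
        have hj := hidx m hm
        rw [extendNorm_inv_mul hN _ (hh0 _ hj) (htop _ hj),
          extendNorm_inv_mul hN _ (hh0 _ hj) (htop _ hj)]
        exact ⟨mul_le_mul_right (hle _ (hs's hj)) _,
          ENNReal.inv_mul_cancel (hh0 _ hj) (htop _ hj)⟩) S
      (fun m => (extendNorm N (h (idx m))).toReal) le_rfl
    have e : ∀ w : ℤ → ℤ → ℝ, ∑ m ∈ S, (extendNorm N (h (idx m))).toReal •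
        (fun k : J => (extendNorm N (h (idx m))).toReal⁻¹ * w (idx m) k) =
        fun k : J => (∑ j ∈ s', w j) k := by
      intro w
      ext k
      rw [← hsum w, Finset.sum_apply, Finset.sum_apply]
      refine Finset.sum_congr rfl fun m hm => ?_
      have := (ENNReal.toReal_pos (hh0 _ (hidx m hm)) (htop _ (hidx m hm))).ne'
      simp [mul_inv_cancel_left₀ this]
    rw [e, e] at h1
    exact h1
  · rintro ⟨C, hC⟩
    refine ⟨C, fun I hI x y hxy hle s α hs => ?_⟩
    have := hC s _ _ (hxy.shiftFamily hI hs α) fun j hj => by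
      rw [hN.smul, hN.smul, extendNorm_extendZero, extendNorm_extendZero]
      exact mul_le_mul_right ((hle j (hs hj)).1) _
    rwa [extendNorm_sum_smul, extendNorm_sum_smul] at this

theorem hasLSP_iff : HasLSP N ↔ ∃ C, LeftShift (extendNorm N) (extendNorm N) C := by
  classical
  constructor
  · rintro ⟨C, hC⟩
    refine ⟨C, fun s h g hfam hle => ?_⟩
    set s' := s.filter fun j => extendNorm N (g j) ≠ 0 with hs'
    have hs's : s' ⊆ s := Finset.filter_subset _ _
    have hfam' := hfam.subset hs's
    have hg0 : ∀ j ∈ s', extendNorm N (g j) ≠ 0 := fun j hj => (Finset.mem_filter.1 hj).2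
    have hh0 : ∀ j ∈ s', extendNorm N (h j) ≠ 0 := fun j hj h0 =>
      hg0 j hj (le_antisymm (h0 ▸ hle j (hs's hj)) zero_le)
    have htop : ∀ j ∈ s', extendNorm N (h j) ≠ ∞ := fun j hj =>
      hN.ne_top_of_finite (hfam'.finite_right j hj)
    refine (hN.sum_filter_ne_zero_le g).trans (le_trans ?_ (mul_le_mul_right
      (hN.sum_le_sum_of_subset hs's fun i hi' j hj hij => hfam.disjoint_right i hi' j hj hij) _))
    obtain ⟨S, idx, hS, hidx, hsum, hint⟩ := hfam'.exists_interlaced hN hg0 hh0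
    have h1 := hC S hS _ _ (hint (fun j => (extendNorm N (h j)).toReal⁻¹) fun j hj =>
      inv_ne_zero (ENNReal.toReal_pos (hh0 j hj) (htop j hj)).ne') (by
        intro m hm
        have hj := hidx m hm
        rw [extendNorm_inv_mul hN _ (hh0 _ hj) (htop _ hj),
          extendNorm_inv_mul hN _ (hh0 _ hj) (htop _ hj)]
        exact ⟨mul_le_mul_right (hle _ (hs's hj)) _,
          ENNReal.inv_mul_cancel (hh0 _ hj) (htop _ hj)⟩) S
      (fun m => (extendNorm N (h (idx m))).toReal) le_rfl
    have e : ∀ w : ℤ → ℤ → ℝ, ∑ m ∈ S, (extendNorm N (h (idx m))).toReal •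
        (fun k : J => (extendNorm N (h (idx m))).toReal⁻¹ * w (idx m) k) =
        fun k : J => (∑ j ∈ s', w j) k := by
      intro w
      ext k
      rw [← hsum w, Finset.sum_apply, Finset.sum_apply]
      refine Finset.sum_congr rfl fun m hm => ?_
      have := (ENNReal.toReal_pos (hh0 _ (hidx m hm)) (htop _ (hidx m hm))).ne'
      simp [mul_inv_cancel_left₀ this]
    rw [e, e] at h1
    exact h1
  · rintro ⟨C, hC⟩
    refine ⟨C, fun I hI x y hxy hle s α hs => ?_⟩
    have := hC s _ _ (hxy.shiftFamily hI hs α) fun j hj => by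
      rw [hN.smul, hN.smul, extendNorm_extendZero, extendNorm_extendZero]
      exact mul_le_mul_right ((hle j (hs hj)).1) _
    rwa [extendNorm_sum_smul, extendNorm_sum_smul] at this

end


/-! ### The three underlying measure spaces -/

namespace Domain

theorem naturals_measure_apply {S : Set ℝ} (hS : MeasurableSet S) :
    naturals.measure S = ((fun n : ℕ => (n : ℝ) + 1) ⁻¹' S).encard := by
  have h : naturals.measure = Measure.map (fun n : ℕ => (n : ℝ) + 1) Measure.count := by
    ext T hT
    rw [Measure.map_apply (by fun_prop) hT, measure, Measure.sum_apply _ hT, Measure.count,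
      Measure.sum_apply _ (by measurability)]
    congr 1
    ext n
    rw [Measure.dirac_apply' _ hT, Measure.dirac_apply' _ (by measurability)]
    rfl
  rw [h, Measure.map_apply (by fun_prop) hS, Measure.count_apply (by measurability)]

theorem measure_Iio_zero (D : Domain) : D.measure (Set.Iio 0) = 0 := by
  cases D with
  | unitInterval =>
    rw [measure, Measure.restrict_apply measurableSet_Iio]
    convert measure_empty (μ := volume)
    ext x; simp only [Set.mem_inter_iff, Set.mem_Iio, Set.mem_Icc, Set.mem_empty_iff_false]
    constructor
    · rintro ⟨h1, h2, -⟩; linarith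
    · exact False.elim
  | halfLine =>
    rw [measure, Measure.restrict_apply measurableSet_Iio]
    convert measure_empty (μ := volume)
    ext x; simp only [Set.mem_inter_iff, Set.mem_Iio, Set.mem_Ici, Set.mem_empty_iff_false]
    constructor
    · rintro ⟨h1, h2⟩; linarith
    · exact False.elim
  | naturals =>
    rw [naturals_measure_apply measurableSet_Iio]
    have : (fun n : ℕ => (n : ℝ) + 1) ⁻¹' Set.Iio 0 = ∅ := by
      ext n; simp; positivity
    simp [this]

theorem measure_Iio_lt_top (D : Domain) (x : ℝ) : D.measure (Set.Iio x) < ∞ := by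
  cases D with
  | unitInterval =>
    rw [measure, Measure.restrict_apply measurableSet_Iio]
    exact (measure_mono Set.inter_subset_right).trans_lt (by simp)
  | halfLine =>
    rw [measure, Measure.restrict_apply measurableSet_Iio]
    exact (measure_mono (show _ ⊆ Set.Icc 0 x from fun y hy => ⟨hy.2, le_of_lt hy.1⟩)).trans_lt
      (by simp)
  | naturals =>
    rw [naturals_measure_apply measurableSet_Iio]
    have : ((fun n : ℕ => (n : ℝ) + 1) ⁻¹' Set.Iio x).Finite := by
      refine (Set.finite_Iio ⌈x⌉₊).subset fun n hn => ?_
      have h1 : (n : ℝ) + 1 < x := hn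
      have h2 := Nat.le_ceil x
      have : (n : ℝ) < ⌈x⌉₊ := by linarith
      exact_mod_cast this
    rw [← this.cast_ncard_eq]
    simp

instance (D : Domain) : SigmaFinite D.measure :=
  ⟨⟨{ set := fun n => Set.Iio (n : ℝ)
      set_mem := fun _ => trivial
      finite := fun n => D.measure_Iio_lt_top n
      spanning := by
        ext x
        obtain ⟨n, hn⟩ := exists_nat_gt x
        simp only [Set.mem_iUnion, Set.mem_Iio, Set.mem_univ, iff_true]
        exact ⟨n, hn⟩ }⟩⟩

/-- Numbers that occur as measures of initial segments of every set that is large enough. -/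
def Admissible (D : Domain) (c : ℝ≥0∞) : Prop :=
  ∀ H : Set ℝ, MeasurableSet H → ∀ a, D.measure (H ∩ Set.Iio a) < c →
    D.measure (H ∩ Set.Iio a) + D.measure {a} ≤ c

theorem admissible_of_ne (D : Domain) (hD : D ≠ naturals) (c : ℝ≥0∞) : D.Admissible c := by
  intro H _ a h
  have : D.measure {a} = 0 := by
    cases D with
    | unitInterval => simp [measure]
    | halfLine => simp [measure]
    | naturals => exact absurd rfl hD
  rw [this, add_zero]
  exact h.le

theorem naturals_admissible (n : ℕ) : naturals.Admissible n := by
  intro H hH a h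
  have h1 : naturals.measure {a} ≤ 1 := by
    rw [naturals_measure_apply (measurableSet_singleton a)]
    have : ((fun n : ℕ => (n : ℝ) + 1) ⁻¹' {a}).encard ≤ 1 := by
      refine Set.encard_le_one_iff.2 fun i j hi hj => ?_
      have h1 : (i : ℝ) + 1 = a := hi
      have h2 : (j : ℝ) + 1 = a := hj
      have : (i : ℝ) = j := by linarith
      exact_mod_cast this
    exact_mod_cast this
  rw [naturals_measure_apply (hH.inter measurableSet_Iio)] at h ⊢
  refine (add_le_add le_rfl h1).trans ?_
  have h2 : (((fun n : ℕ => (n : ℝ) + 1) ⁻¹' (H ∩ Set.Iio a)).encard : ENat) < (n : ENat) := by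
    exact_mod_cast h
  have h3 := Order.add_one_le_of_lt h2
  exact_mod_cast h3

/-- The initial segment of measure `c` of a set. -/
def initial (D : Domain) (H : Set ℝ) (c : ℝ≥0∞) : Set ℝ := {x ∈ H | D.measure (H ∩ Set.Iio x) < c}

theorem initial_subset (D : Domain) (H : Set ℝ) (c : ℝ≥0∞) : D.initial H c ⊆ H := fun _ h => h.1

theorem initial_mono (D : Domain) (H : Set ℝ) : Monotone (D.initial H) :=
  fun _ _ h _ hx => ⟨hx.1, hx.2.trans_le h⟩

/-- An initial segment is cut off by a half-line. -/
theorem initial_eq (D : Domain) (H : Set ℝ) {c : ℝ≥0∞} (hc : c ≠ 0) :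
    (D.initial H c = H ∧ ∀ x, D.measure (H ∩ Set.Iio x) < c) ∨
    ∃ a, (∀ x < a, D.measure (H ∩ Set.Iio x) < c) ∧ (∀ x, a < x → c ≤ D.measure (H ∩ Set.Iio x)) ∧
      ((D.initial H c = H ∩ Set.Iic a ∧ D.measure (H ∩ Set.Iio a) < c) ∨
        (D.initial H c = H ∩ Set.Iio a ∧ c ≤ D.measure (H ∩ Set.Iio a))) := by
  set S := {x | D.measure (H ∩ Set.Iio x) < c} with hS
  have hini : D.initial H c = H ∩ S := rfl
  have hlow : ∀ x y, x ≤ y → y ∈ S → x ∈ S := fun x y hxy hy =>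
    (measure_mono (Set.inter_subset_inter_right _ (Set.Iio_subset_Iio hxy))).trans_lt hy
  have h0 : (0 : ℝ) ∈ S := by
    have : D.measure (H ∩ Set.Iio 0) = 0 :=
      measure_mono_null Set.inter_subset_right D.measure_Iio_zero
    change _ < c
    rw [this]
    exact pos_iff_ne_zero.2 hc
  by_cases hb : BddAbove S
  · right
    refine ⟨sSup S, ?_, ?_, ?_⟩
    · intro x hx
      obtain ⟨y, hy, hxy⟩ := exists_lt_of_lt_csSup ⟨0, h0⟩ hx
      exact hlow x y hxy.le hy
    · intro x hx
      by_contra h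
      exact absurd (le_csSup hb (show x ∈ S from not_le.1 h)) (not_le.2 hx)
    · have hlt : ∀ x < sSup S, x ∈ S := by
        intro x hx
        obtain ⟨y, hy, hxy⟩ := exists_lt_of_lt_csSup ⟨0, h0⟩ hx
        exact hlow x y hxy.le hy
      by_cases ha : sSup S ∈ S
      · left
        refine ⟨?_, ha⟩
        rw [hini]
        congr 1
        ext x
        exact ⟨fun h => le_csSup hb h, fun h => hlow x _ h ha⟩
      · right
        refine ⟨?_, not_lt.1 ha⟩
        rw [hini]
        congr 1
        ext x
        exact ⟨fun h => lt_of_le_of_ne (le_csSup hb h) (by rintro rfl; exact ha h), fun h => hlt x h⟩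
  · left
    have hall : ∀ x, x ∈ S := by
      intro x
      obtain ⟨y, hy, hxy⟩ := not_bddAbove_iff.1 hb x
      exact hlow x y hxy.le hy
    exact ⟨by rw [hini]; ext x; simp [hall x], hall⟩

theorem measurableSet_initial (D : Domain) {H : Set ℝ} (hH : MeasurableSet H) (c : ℝ≥0∞) :
    MeasurableSet (D.initial H c) := by
  by_cases hc : c = 0
  · have : D.initial H c = ∅ := by ext x; simp [initial, hc]
    rw [this]; exact MeasurableSet.empty
  rcases D.initial_eq H hc with h | ⟨a, -, -, h | h⟩
  · rw [h.1]; exact hH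
  · rw [h.1]; exact hH.inter measurableSet_Iic
  · rw [h.1]; exact hH.inter measurableSet_Iio

theorem measure_Iio_le_of_forall_lt (D : Domain) {H : Set ℝ} {c : ℝ≥0∞} {a : ℝ}
    (h : ∀ x < a, D.measure (H ∩ Set.Iio x) < c) : D.measure (H ∩ Set.Iio a) ≤ c := by
  obtain ⟨u, hu, hlt, htend⟩ := exists_seq_strictMono_tendsto a
  have : H ∩ Set.Iio a = ⋃ n, H ∩ Set.Iio (u n) := by
    rw [← Set.inter_iUnion]
    congr 1
    ext x
    simp only [Set.mem_Iio, Set.mem_iUnion]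
    exact ⟨fun hx => (htend.eventually_const_lt hx).exists, fun ⟨n, hn⟩ => hn.trans (hlt n)⟩
  rw [this, Monotone.measure_iUnion
    (fun i j hij => Set.inter_subset_inter_right _ (Set.Iio_subset_Iio (hu.monotone hij)))]
  exact iSup_le fun n => (h _ (hlt n)).le

theorem measure_initial (D : Domain) {H : Set ℝ} (hH : MeasurableSet H) {c : ℝ≥0∞}
    (hc : D.Admissible c) (hle : c ≤ D.measure H) : D.measure (D.initial H c) = c := by
  by_cases hc0 : c = 0
  · have : D.initial H c = ∅ := by ext x; simp [initial, hc0]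
    rw [this, hc0, measure_empty]
  rcases D.initial_eq H hc0 with h | ⟨a, h1, h2, h | h⟩
  · rw [h.1]
    refine le_antisymm ?_ hle
    have : H = ⋃ n : ℕ, H ∩ Set.Iio (n : ℝ) := by
      rw [← Set.inter_iUnion]
      ext x
      obtain ⟨n, hn⟩ := exists_nat_gt x
      simp only [Set.mem_inter_iff, Set.mem_iUnion, Set.mem_Iio]
      exact ⟨fun hx => ⟨hx, n, hn⟩, fun hx => hx.1⟩
    rw [this, Monotone.measure_iUnion
      (fun i j hij => Set.inter_subset_inter_right _ (Set.Iio_subset_Iio (by exact_mod_cast hij)))]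
    exact iSup_le fun n => (h.2 _).le
  · rw [h.1]
    refine le_antisymm ?_ ?_
    · refine le_trans ?_ (hc H hH a h.2)
      refine (measure_mono ?_).trans (measure_union_le _ _)
      rintro x ⟨hx1, hx2⟩
      rcases lt_or_eq_of_le (show x ≤ a from hx2) with h | h
      · exact Or.inl ⟨hx1, h⟩
      · exact Or.inr h
    · obtain ⟨u, hu, hlt, htend⟩ := exists_seq_strictAnti_tendsto a
      have : H ∩ Set.Iic a = ⋂ n, H ∩ Set.Iio (u n) := by
        rw [← Set.inter_iInter]
        congr 1
        ext x
        simp only [Set.mem_Iic, Set.mem_iInter, Set.mem_Iio]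
        refine ⟨fun hx n => hx.trans_lt (hlt n), fun hx => ?_⟩
        exact ge_of_tendsto' htend fun n => (hx n).le
      rw [this, Antitone.measure_iInter
        (fun i j hij => Set.inter_subset_inter_right _ (Set.Iio_subset_Iio (hu.antitone hij)))
        (fun n => (hH.inter measurableSet_Iio).nullMeasurableSet)
        ⟨0, ((measure_mono Set.inter_subset_right).trans_lt (D.measure_Iio_lt_top _)).ne⟩]
      exact le_iInf fun n => h2 _ (hlt n)
  · rw [h.1]
    exact le_antisymm (D.measure_Iio_le_of_forall_lt h1) h.2

theorem admissible_mul (D : Domain) {m : ℤ} (hm : m ∈ D.index) (k : ℕ) :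
    D.Admissible (k * ENNReal.ofReal (2 ^ m)) := by
  by_cases hD : D = naturals
  · subst hD
    have h0 : 0 ≤ m := hm
    obtain ⟨j, rfl⟩ := Int.eq_ofNat_of_zero_le h0
    have : (k * ENNReal.ofReal (2 ^ (j : ℤ)) : ℝ≥0∞) = ((k * 2 ^ j : ℕ) : ℝ≥0∞) := by
      rw [zpow_natCast, ENNReal.ofReal_pow (by norm_num)]
      simp
    rw [this]
    exact naturals_admissible _
  · exact D.admissible_of_ne hD _

/-- A set contains as many disjoint sets of measure `2 ^ m` as its measure permits. -/
theorem exists_cells (D : Domain) {m : ℤ} (hm : m ∈ D.index) {S : Set ℝ} (hS : MeasurableSet S)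
    (N : ℕ) (hN : N * ENNReal.ofReal (2 ^ m) ≤ D.measure S) :
    ∃ A : Fin N → Set ℝ, (∀ i, MeasurableSet (A i)) ∧ (∀ i, A i ⊆ S) ∧
      (∀ i j, i ≠ j → Disjoint (A i) (A j)) ∧ ∀ i, D.measure (A i) = ENNReal.ofReal (2 ^ m) := by
  set δ := ENNReal.ofReal (2 ^ m) with hδ
  have hmono : ∀ {i j : ℕ}, i ≤ j → (i : ℝ≥0∞) * δ ≤ j * δ := fun h => by gcongr
  have hmeas : ∀ i : ℕ, i ≤ N → D.measure (D.initial S (i * δ)) = i * δ := fun i hi =>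
    D.measure_initial hS (D.admissible_mul hm i) ((hmono hi).trans hN)
  refine ⟨fun i => D.initial S ((i + 1 : ℕ) * δ) \ D.initial S ((i : ℕ) * δ), fun i =>
    (D.measurableSet_initial hS _).diff (D.measurableSet_initial hS _),
    fun i => Set.sdiff_subset.trans (D.initial_subset _ _), ?_, ?_⟩
  · have key : ∀ i j : Fin N, i < j → Disjoint
        (D.initial S ((i + 1 : ℕ) * δ) \ D.initial S ((i : ℕ) * δ))
        (D.initial S ((j + 1 : ℕ) * δ) \ D.initial S ((j : ℕ) * δ)) := by
      intro i j hij
      refine Set.disjoint_left.2 fun x hx hx' => hx'.2 ?_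
      exact D.initial_mono S (hmono (Nat.succ_le_of_lt hij)) hx.1
    intro i j hij
    rcases lt_or_gt_of_ne hij with h | h
    · exact key i j h
    · exact (key j i h).symm
  · intro i
    rw [measure_sdiff (D.initial_mono S (hmono (Nat.le_succ _)))
      (D.measurableSet_initial hS _).nullMeasurableSet (by
        rw [hmeas _ i.2.le]; exact ENNReal.mul_ne_top (by simp) (by simp [hδ])),
      hmeas _ i.2, hmeas _ i.2.le]
    push_cast
    rw [add_mul, one_mul]
    exact ENNReal.add_sub_cancel_left (ENNReal.mul_ne_top (by simp) (by simp [hδ]))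

/-- Measures are nearly multiples of `2 ^ m`. -/
theorem exists_scale (D : Domain) {ε : ℝ≥0∞} (hε : 0 < ε) :
    ∃ m₀ ∈ D.index, ∀ m ∈ D.index, m ≤ m₀ → ∀ S, MeasurableSet S → D.measure S ≠ ∞ →
      ∃ N : ℕ, N * ENNReal.ofReal (2 ^ m) ≤ D.measure S ∧
        D.measure S ≤ N * ENNReal.ofReal (2 ^ m) + ε := by
  by_cases hD : D = naturals
  · subst hD
    refine ⟨0, Set.self_mem_Ici, fun m hm hm0 S hS hfin => ?_⟩
    obtain rfl : m = 0 := le_antisymm hm0 hm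
    rw [naturals_measure_apply hS] at hfin ⊢
    have : ((fun n : ℕ => (n : ℝ) + 1) ⁻¹' S).Finite := by
      rw [← Set.encard_lt_top_iff]
      rw [lt_top_iff_ne_top]
      intro h
      rw [h] at hfin
      simp at hfin
    rw [← this.cast_ncard_eq]
    exact ⟨((fun n : ℕ => (n : ℝ) + 1) ⁻¹' S).ncard, by simp, by simp⟩
  · obtain ⟨m₀, hm₀, hle⟩ : ∃ m₀ ∈ D.index, ENNReal.ofReal (2 ^ m₀) ≤ ε := by
      have htend : Tendsto (fun n : ℕ => ENNReal.ofReal ((2 : ℝ)⁻¹ ^ (n + 1))) atTop (𝓝 0) := by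
        rw [← ENNReal.ofReal_zero]
        refine ENNReal.tendsto_ofReal ?_
        exact (tendsto_pow_atTop_nhds_zero_of_lt_one (by norm_num) (by norm_num)).comp
          (tendsto_add_atTop_nat 1)
      obtain ⟨n, hn⟩ := (htend.eventually_lt_const hε).exists
      refine ⟨-(n + 1 : ℕ), ?_, ?_⟩
      · cases D with
        | unitInterval => simp only [index, Set.mem_Iio]; push_cast; omega
        | halfLine => trivial
        | naturals => exact absurd rfl hD
      · rw [zpow_neg, zpow_natCast, ← inv_pow]
        exact hn.le
    refine ⟨m₀, hm₀, fun m hm hmm S hS hfin => ?_⟩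
    have hpos : (0 : ℝ) < 2 ^ m := by positivity
    refine ⟨⌊(D.measure S).toReal / 2 ^ m⌋₊, ?_, ?_⟩
    · rw [← ENNReal.ofReal_natCast, ← ENNReal.ofReal_mul (by positivity)]
      refine ENNReal.ofReal_le_of_le_toReal ?_
      rw [← le_div_iff₀ hpos]
      exact Nat.floor_le (by positivity)
    · have h1 : ENNReal.ofReal (2 ^ m) ≤ ε := by
        refine le_trans (ENNReal.ofReal_le_ofReal ?_) hle
        exact zpow_le_zpow_right₀ (by norm_num) hmm
      refine le_trans ?_ (add_le_add le_rfl h1)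
      rw [← ENNReal.ofReal_natCast, ← ENNReal.ofReal_mul (by positivity),
        ← ENNReal.ofReal_add (by positivity) (by positivity)]
      refine ENNReal.le_ofReal_iff_toReal_le hfin (by positivity) |>.2 ?_
      have := (Nat.lt_floor_add_one ((D.measure S).toReal / 2 ^ m)).le
      rw [div_le_iff₀ hpos] at this
      linarith

theorem measure_Ico (D : Domain) {k m : ℤ} (hk : k ∈ D.index) (hm : m ∈ D.index) (hmk : m ≤ k)
    {i j : ℕ} (hij : i ≤ j) (hj : j ≤ 2 ^ (k - m).toNat) :
    D.measure (Set.Ico ((2 : ℝ) ^ k + i * 2 ^ m) (2 ^ k + j * 2 ^ m)) =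
      ENNReal.ofReal ((j - i : ℕ) * 2 ^ m) := by
  have hkm : (2 : ℝ) ^ k = 2 ^ (k - m).toNat * 2 ^ m := by
    rw [← zpow_natCast, ← zpow_add₀ (by norm_num)]
    congr 1
    omega
  have hlen : (2 : ℝ) ^ k + j * 2 ^ m - (2 ^ k + i * 2 ^ m) = (j - i : ℕ) * 2 ^ m := by
    rw [Nat.cast_sub hij]; ring
  have h0 : (0 : ℝ) ≤ 2 ^ k + i * 2 ^ m := by positivity
  have hjr : (j : ℝ) * 2 ^ m ≤ 2 ^ k := by
    rw [hkm]
    gcongr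
    exact_mod_cast hj
  cases D with
  | unitInterval =>
    have hk1 : (2 : ℝ) ^ k ≤ 2⁻¹ := by
      rw [← zpow_neg_one]
      refine zpow_le_zpow_right₀ (by norm_num) ?_
      have : k < 0 := hk
      omega
    rw [measure, Measure.restrict_apply measurableSet_Ico, Set.inter_eq_left.2, Real.volume_Ico,
      hlen]
    intro x hx
    exact ⟨h0.trans hx.1, by have := hx.2; norm_num at hk1; linarith⟩
  | halfLine =>
    rw [measure, Measure.restrict_apply measurableSet_Ico, Set.inter_eq_left.2, Real.volume_Ico,
      hlen]
    intro x hx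
    exact h0.trans hx.1
  | naturals =>
    rw [naturals_measure_apply measurableSet_Ico]
    have hm' : 0 ≤ m := hm
    have hk' : 0 ≤ k := hk
    obtain ⟨m, rfl⟩ := Int.eq_ofNat_of_zero_le hm'
    obtain ⟨k, rfl⟩ := Int.eq_ofNat_of_zero_le hk'
    have h1 : ∀ n : ℕ, (n : ℝ) + 1 ∈ Set.Ico ((2 : ℝ) ^ (k : ℤ) + i * 2 ^ (m : ℤ))
        (2 ^ (k : ℤ) + j * 2 ^ (m : ℤ)) ↔ n + 1 ∈ Set.Ico (2 ^ k + i * 2 ^ m) (2 ^ k + j * 2 ^ m) := by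
      intro n
      simp only [Set.mem_Ico, zpow_natCast]
      norm_cast
    have h2 : (fun n : ℕ => (n : ℝ) + 1) ⁻¹' Set.Ico ((2 : ℝ) ^ (k : ℤ) + i * 2 ^ (m : ℤ))
        (2 ^ (k : ℤ) + j * 2 ^ (m : ℤ)) =
        (Finset.Ico (2 ^ k + i * 2 ^ m - 1) (2 ^ k + j * 2 ^ m - 1) : Finset ℕ) := by
      ext n
      rw [Set.mem_preimage, h1]
      have : 0 < 2 ^ k := by positivity
      simp only [Set.mem_Ico, Finset.coe_Ico]
      generalize 2 ^ k = a at *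
      generalize i * 2 ^ m = b
      generalize j * 2 ^ m = c
      omega
    rw [h2, Set.encard_coe_eq_coe_finsetCard, Nat.card_Ico]
    have h3 : 2 ^ k + j * 2 ^ m - 1 - (2 ^ k + i * 2 ^ m - 1) = (j - i) * 2 ^ m := by
      have : 0 < 2 ^ k := by positivity
      rw [Nat.sub_mul]
      generalize 2 ^ k = a at *
      generalize i * 2 ^ m = b
      generalize j * 2 ^ m = c
      omega
    rw [h3, zpow_natCast]
    have : (((j - i) * 2 ^ m : ℕ) : ℝ) = ((j - i : ℕ) : ℝ) * 2 ^ m := by push_cast; ring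
    rw [← this, ENNReal.ofReal_natCast]
    simp

/-- The dyadic intervals `[2ᵏ, 2ᵏ⁺¹)`. -/
def dyadic (k : ℤ) : Set ℝ := Set.Ico ((2 : ℝ) ^ k) (2 ^ (k + 1))

theorem measurableSet_dyadic (k : ℤ) : MeasurableSet (dyadic k) := measurableSet_Ico

theorem eq_of_mem_dyadic {i j : ℤ} {x : ℝ} (hi : x ∈ dyadic i) (hj : x ∈ dyadic j) : i = j := by
  have h1 := (zpow_lt_zpow_iff_right₀ (one_lt_two : (1 : ℝ) < 2)).1 (hi.1.trans_lt hj.2)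
  have h2 := (zpow_lt_zpow_iff_right₀ (one_lt_two : (1 : ℝ) < 2)).1 (hj.1.trans_lt hi.2)
  omega

theorem measure_dyadic (D : Domain) {k : ℤ} (hk : k ∈ D.index) :
    D.measure (dyadic k) = ENNReal.ofReal (2 ^ k) := by
  have := D.measure_Ico hk hk le_rfl (i := 0) (j := 1) (by norm_num) (by simp)
  simp only [Nat.cast_zero, zero_mul, add_zero, Nat.cast_one, one_mul, tsub_zero] at this
  rw [← this, dyadic, zpow_add_one₀ (by norm_num), mul_two]

end Domain


namespace KotheSpace

/-! ### Norms of functions -/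

variable {Ω : Type*} [MeasurableSpace Ω] {μ : Measure Ω}

open Classical in
/-- The norm of the class of a function; it is `∞` for functions that are not measurable. -/
noncomputable def fnorm (X : KotheSpace μ) (f : Ω → ℝ) : ℝ≥0∞ :=
  if h : AEStronglyMeasurable f μ then X.nrm (AEEqFun.mk f h) else ∞

variable (X : KotheSpace μ)

theorem nrm_mk {f : Ω → ℝ} (h : AEStronglyMeasurable f μ) : X.nrm (AEEqFun.mk f h) = X.fnorm f := by
  rw [fnorm, dif_pos h]

theorem fnorm_coe (f : L0 μ) : X.fnorm f = X.nrm f := by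
  rw [← X.nrm_mk f.aestronglyMeasurable, AEEqFun.mk_coeFn]

theorem fnorm_mono {f g : Ω → ℝ} (hf : AEStronglyMeasurable f μ) (h : ∀ᵐ ω ∂μ, |f ω| ≤ |g ω|) :
    X.fnorm f ≤ X.fnorm g := by
  by_cases hg : AEStronglyMeasurable g μ
  · rw [← X.nrm_mk hf, ← X.nrm_mk hg]
    refine X.mono _ _ ?_
    filter_upwards [AEEqFun.coeFn_mk f hf, AEEqFun.coeFn_mk g hg, h] with ω h1 h2 h3
    rwa [h1, h2]
  · rw [fnorm, fnorm, dif_neg hg]; exact le_top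

theorem fnorm_congr {f g : Ω → ℝ} (h : f =ᵐ[μ] g) : X.fnorm f = X.fnorm g := by
  by_cases hf : AEStronglyMeasurable f μ
  · have hg : AEStronglyMeasurable g μ := hf.congr h
    exact le_antisymm (X.fnorm_mono hf (h.mono fun ω h => by rw [h]))
      (X.fnorm_mono hg (h.mono fun ω h => by rw [h]))
  · have hg : ¬ AEStronglyMeasurable g μ := fun hg => hf (hg.congr h.symm)
    rw [fnorm, fnorm, dif_neg hf, dif_neg hg]

theorem fnorm_zero : X.fnorm (fun _ => 0) = 0 := by
  have h : AEStronglyMeasurable (fun _ : Ω => (0 : ℝ)) μ := aestronglyMeasurable_const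
  rw [← X.nrm_mk h, X.eq_zero_iff]
  rfl

theorem fnorm_smul {f : Ω → ℝ} (hf : AEStronglyMeasurable f μ) (c : ℝ) :
    X.fnorm (fun ω => c * f ω) = ‖c‖ₑ * X.fnorm f := by
  rw [← X.nrm_mk hf, ← X.smul, ← X.nrm_mk (hf.const_mul c)]
  rfl

theorem fnorm_add_le {f g : Ω → ℝ} (hf : AEStronglyMeasurable f μ) (hg : AEStronglyMeasurable g μ) :
    X.fnorm (fun ω => f ω + g ω) ≤ X.fnorm f + X.fnorm g := by
  rw [← X.nrm_mk hf, ← X.nrm_mk hg]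
  exact (X.nrm_mk (f := fun ω => f ω + g ω) (hf.add hg)).symm.le.trans (X.add_le _ _)

theorem fnorm_sum_le {ι : Type*} (s : Finset ι) {f : ι → Ω → ℝ}
    (hf : ∀ i ∈ s, AEStronglyMeasurable (f i) μ) :
    X.fnorm (fun ω => ∑ i ∈ s, f i ω) ≤ ∑ i ∈ s, X.fnorm (f i) := by
  classical
  induction s using Finset.induction_on with
  | empty => simp [fnorm_zero]
  | insert a s ha ih =>
    have hf' := fun i hi => hf i (Finset.mem_insert_of_mem hi)
    simp only [Finset.sum_insert ha]
    exact (X.fnorm_add_le (hf a (Finset.mem_insert_self _ _))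
      (Finset.aestronglyMeasurable_fun_sum _ hf')).trans (by gcongr; exact ih hf')

theorem fnorm_eq_zero {f : Ω → ℝ} (hf : AEStronglyMeasurable f μ) : X.fnorm f = 0 ↔ f =ᵐ[μ] 0 := by
  rw [← X.nrm_mk hf, X.eq_zero_iff]
  exact AEEqFun.mk_eq_mk

/-- The Fatou property, for sequences that converge almost everywhere. -/
theorem fnorm_le_of_tendsto {f : ℕ → Ω → ℝ} {g : Ω → ℝ} (hf : ∀ n, AEStronglyMeasurable (f n) μ)
    (h : ∀ᵐ ω ∂μ, Tendsto (fun n => f n ω) atTop (𝓝 (g ω))) {c : ℝ≥0∞}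
    (hc : ∀ n, X.fnorm (f n) ≤ c) : X.fnorm g ≤ c := by
  have hg : AEStronglyMeasurable g μ := aestronglyMeasurable_of_tendsto_ae _ hf h
  rcases eq_or_ne c ∞ with rfl | htop
  · exact le_top
  rcases eq_or_ne c 0 with rfl | h0
  · have h1 : ∀ᵐ ω ∂μ, ∀ n, f n ω = 0 := ae_all_iff.2 fun n =>
      (X.fnorm_eq_zero (hf n)).1 (le_antisymm (hc n) zero_le)
    refine ((X.fnorm_eq_zero hg).2 ?_).le
    filter_upwards [h, h1] with ω h2 h3
    simp only [h3] at h2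
    exact tendsto_nhds_unique h2 tendsto_const_nhds
  · have hcpos : 0 < c.toReal := ENNReal.toReal_pos h0 htop
    set r := c.toReal⁻¹ with hr
    have hrn : ‖r‖ₑ = c⁻¹ := by
      rw [Real.enorm_eq_ofReal (by positivity), hr, ENNReal.ofReal_inv_of_pos hcpos,
        ENNReal.ofReal_toReal htop]
    have key := X.fatou (fun n => AEEqFun.mk (fun ω => r * f n ω) ((hf n).const_mul r))
      (AEEqFun.mk (fun ω => r * g ω) (hg.const_mul r)) (fun n => by
        rw [X.nrm_mk, X.fnorm_smul (hf n), hrn]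
        calc _ ≤ c⁻¹ * c := by gcongr; exact hc n
          _ = 1 := ENNReal.inv_mul_cancel h0 htop) (by
        intro B hB hBfin
        have : IsFiniteMeasure (μ.restrict B) := ⟨by simpa using hBfin⟩
        refine tendstoInMeasure_of_tendsto_ae (fun n =>
          (AEEqFun.aestronglyMeasurable _).restrict) (ae_restrict_of_ae ?_)
        have h1 : ∀ᵐ ω ∂μ, ∀ n, AEEqFun.mk (fun ω => r * f n ω) ((hf n).const_mul r) ω =
            r * f n ω := ae_all_iff.2 fun n => AEEqFun.coeFn_mk _ _
        filter_upwards [h, h1, AEEqFun.coeFn_mk (fun ω => r * g ω) (hg.const_mul r)] with ω h2 h3 h4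
        simp only [h3, h4]
        exact h2.const_mul r)
    rw [X.nrm_mk, X.fnorm_smul hg, hrn] at key
    calc X.fnorm g = c * (c⁻¹ * X.fnorm g) := by
          rw [← mul_assoc, ENNReal.mul_inv_cancel h0 htop, one_mul]
      _ ≤ c * 1 := by gcongr
      _ = c := mul_one c

theorem fnorm_indicator_lt_top {B : Set Ω} (hB : MeasurableSet B) (h : μ B < ∞) :
    X.fnorm (B.indicator fun _ => (1 : ℝ)) < ∞ := by
  rw [← X.nrm_mk (measurable_const.indicator hB).aestronglyMeasurable]
  exact X.charFn_lt_top B hB h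

/-- `p`-convexity with constant `M`, for functions with arbitrary finite index sets. -/
def PConvexWith (p : ℝ) (M : ℝ≥0) : Prop :=
  ∀ (ι : Type) [Fintype ι] (f : ι → Ω → ℝ), (∀ i, AEStronglyMeasurable (f i) μ) →
    (∀ i, X.fnorm (f i) ≠ ∞) →
    X.fnorm (fun ω => (∑ i, |f i ω| ^ p) ^ (1 / p)) ≤ M * (∑ i, X.fnorm (f i) ^ p) ^ (1 / p)

/-- `p`-concavity with constant `M`, for functions with arbitrary finite index sets. -/
def PConcaveWith (p : ℝ) (M : ℝ≥0) : Prop :=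
  ∀ (ι : Type) [Fintype ι] (f : ι → Ω → ℝ), (∀ i, AEStronglyMeasurable (f i) μ) →
    (∀ i, X.fnorm (f i) ≠ ∞) →
    (∑ i, X.fnorm (f i) ^ p) ^ (1 / p) ≤ M * X.fnorm (fun ω => (∑ i, |f i ω| ^ p) ^ (1 / p))

variable {X}

theorem nrm_pSum {ι : Type} [Fintype ι] {p : ℝ} {f : ι → Ω → ℝ}
    (hf : ∀ i, AEStronglyMeasurable (f i) μ) :
    X.nrm (pSum p fun k => AEEqFun.mk (f ((Fintype.equivFin ι).symm k)) (hf _)) =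
      X.fnorm (fun ω => (∑ i, |f i ω| ^ p) ^ (1 / p)) := by
  rw [pSum, nrm_mk]
  refine X.fnorm_congr ?_
  have : ∀ᵐ ω ∂μ, ∀ k, AEEqFun.mk (f ((Fintype.equivFin ι).symm k)) (hf _) ω =
      f ((Fintype.equivFin ι).symm k) ω := ae_all_iff.2 fun k => AEEqFun.coeFn_mk _ _
  filter_upwards [this] with ω h
  simp only [h]
  congr 1
  exact Equiv.sum_comp (Fintype.equivFin ι).symm fun i => |f i ω| ^ p

theorem sum_nrm_rpow {ι : Type} [Fintype ι] {p : ℝ} {f : ι → Ω → ℝ}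
    (hf : ∀ i, AEStronglyMeasurable (f i) μ) :
    ∑ k, X.nrm (AEEqFun.mk (f ((Fintype.equivFin ι).symm k)) (hf _)) ^ p =
      ∑ i, X.fnorm (f i) ^ p := by
  simp only [nrm_mk]
  exact Equiv.sum_comp (Fintype.equivFin ι).symm fun i => X.fnorm (f i) ^ p

theorem IsPConvex.exists_with {p : ℝ} (h : X.IsPConvex p) : ∃ M, X.PConvexWith p M := by
  obtain ⟨M, hM⟩ := h
  refine ⟨M, fun ι _ f hf hfin => ?_⟩
  have := hM _ (fun k => AEEqFun.mk (f ((Fintype.equivFin ι).symm k)) (hf _)) fun k => by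
    change X.nrm _ < ∞
    rw [nrm_mk]
    exact (hfin _).lt_top
  rwa [nrm_pSum, sum_nrm_rpow] at this

theorem IsPConcave.exists_with {p : ℝ} (h : X.IsPConcave p) : ∃ M, X.PConcaveWith p M := by
  obtain ⟨M, hM⟩ := h
  refine ⟨M, fun ι _ f hf hfin => ?_⟩
  have := hM _ (fun k => AEEqFun.mk (f ((Fintype.equivFin ι).symm k)) (hf _)) fun k => by
    change X.nrm _ < ∞
    rw [nrm_mk]
    exact (hfin _).lt_top
  rwa [nrm_pSum, sum_nrm_rpow] at this

variable (X) in
theorem pConvexWith_one : X.PConvexWith 1 1 := by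
  intro ι _ f hf _
  simp only [Real.rpow_one, ENNReal.rpow_one, div_one, ENNReal.coe_one, one_mul]
  refine (X.fnorm_sum_le _ fun i _ => (hf i).norm).trans (Finset.sum_le_sum fun i _ => ?_)
  exact X.fnorm_mono (hf i).norm (ae_of_all _ fun ω => by simp)

theorem IsRearrangementInvariant.fnorm_eq (hX : X.IsRearrangementInvariant) {f g : Ω → ℝ}
    (hf : AEStronglyMeasurable f μ) (hg : AEStronglyMeasurable g μ)
    (h : ∀ s : ℝ, 0 ≤ s → μ {ω | s < |f ω|} = μ {ω | s < |g ω|}) : X.fnorm f = X.fnorm g := by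
  rw [← X.nrm_mk hf, ← X.nrm_mk hg]
  refine hX _ _ fun s hs => ?_
  have e : ∀ {u : Ω → ℝ} (hu : AEStronglyMeasurable u μ),
      μ {ω | s < |AEEqFun.mk u hu ω|} = μ {ω | s < |u ω|} := fun hu =>
    measure_congr ((AEEqFun.coeFn_mk _ hu).mono fun ω h => by
      change (s < |_|) = (s < |_|)
      rw [h])
  rw [e hf, e hg, h s hs]

end KotheSpace

/-! ### Functions that are constant on cells of equal measure -/

section

variable {Ω ι κ : Type*} [MeasurableSpace Ω] {μ : Measure Ω} [Fintype ι] [Fintype κ]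

/-- Disjoint measurable sets of measure `δ`. -/
structure IsCells (μ : Measure Ω) (δ : ℝ≥0∞) (A : ι → Set Ω) : Prop where
  measurable : ∀ i, MeasurableSet (A i)
  disjoint : ∀ i j, i ≠ j → Disjoint (A i) (A j)
  measure : ∀ i, μ (A i) = δ

/-- The function with value `v i` on `A i`. -/
noncomputable def cellFn (A : ι → Set Ω) (v : ι → ℝ) (ω : Ω) : ℝ :=
  ∑ i, (A i).indicator (fun _ => v i) ω

variable {A : ι → Set Ω} {B : κ → Set Ω} {δ : ℝ≥0∞}

theorem IsCells.cellFn_eq (hA : IsCells μ δ A) (v : ι → ℝ) {i : ι} {ω : Ω} (h : ω ∈ A i) :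
    cellFn A v ω = v i := by
  rw [cellFn, Finset.sum_eq_single_of_mem i (Finset.mem_univ i), Set.indicator_of_mem h]
  intro j _ hj
  exact Set.indicator_of_notMem (fun h' => (hA.disjoint j i hj).le_bot ⟨h', h⟩) _

theorem cellFn_eq_zero (v : ι → ℝ) {ω : Ω} (h : ∀ i, ω ∉ A i) : cellFn A v ω = 0 :=
  Finset.sum_eq_zero fun i _ => Set.indicator_of_notMem (h i) _

theorem IsCells.measurable_cellFn (hA : IsCells μ δ A) (v : ι → ℝ) : Measurable (cellFn A v) :=
  Finset.measurable_fun_sum _ fun i _ => measurable_const.indicator (hA.measurable i)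

theorem IsCells.aestronglyMeasurable (hA : IsCells μ δ A) (v : ι → ℝ) :
    AEStronglyMeasurable (cellFn A v) μ := (hA.measurable_cellFn v).aestronglyMeasurable

theorem IsCells.distribution (hA : IsCells μ δ A) (v : ι → ℝ) {s : ℝ} (hs : 0 ≤ s) :
    μ {ω | s < |cellFn A v ω|} = (Finset.univ.filter fun i => s < |v i|).card * δ := by
  have : {ω | s < |cellFn A v ω|} = ⋃ i ∈ Finset.univ.filter fun i => s < |v i|, A i := by
    ext ω
    simp only [Set.mem_ofPred_eq, Set.mem_iUnion, Finset.mem_filter, Finset.mem_univ, true_and,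
      exists_prop]
    constructor
    · intro h
      by_cases h' : ∃ i, ω ∈ A i
      · obtain ⟨i, hi⟩ := h'
        exact ⟨i, by rwa [hA.cellFn_eq v hi] at h, hi⟩
      · push Not at h'
        rw [cellFn_eq_zero v h', abs_zero] at h
        exact absurd h (not_lt.2 hs)
    · rintro ⟨i, h, hi⟩
      rwa [hA.cellFn_eq v hi]
  rw [this, measure_biUnion_finset (fun i _ j _ h => hA.disjoint i j h) fun i _ => hA.measurable i,
    Finset.sum_congr rfl fun i _ => hA.measure i, Finset.sum_const, nsmul_eq_mul]

variable {X : KotheSpace μ}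

theorem KotheSpace.IsRearrangementInvariant.cellFn_congr (hX : X.IsRearrangementInvariant)
    (hA : IsCells μ δ A) (hB : IsCells μ δ B) {v : ι → ℝ} {w : κ → ℝ}
    (h : ∀ s : ℝ, 0 ≤ s → (Finset.univ.filter fun i => s < |v i|).card =
      (Finset.univ.filter fun i => s < |w i|).card) :
    X.fnorm (cellFn A v) = X.fnorm (cellFn B w) :=
  hX.fnorm_eq (hA.aestronglyMeasurable v) (hB.aestronglyMeasurable w) fun s hs => by
    rw [hA.distribution v hs, hB.distribution w hs, h s hs]

theorem KotheSpace.IsRearrangementInvariant.cellFn_perm (hX : X.IsRearrangementInvariant)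
    (hA : IsCells μ δ A) (v : ι → ℝ) (σ : Equiv.Perm ι) :
    X.fnorm (cellFn A fun i => v (σ i)) = X.fnorm (cellFn A v) :=
  hX.cellFn_congr hA hA fun s _ => by
    rw [← Finset.card_map σ.toEmbedding]
    congr 1
    ext i
    simp only [Finset.mem_map, Finset.mem_filter, Finset.mem_univ, true_and, Equiv.coe_toEmbedding]
    exact ⟨fun ⟨j, hj, h⟩ => h ▸ hj, fun h => ⟨σ.symm i, by simpa using h, by simp⟩⟩

theorem IsCells.cellFn_ne_top (hA : IsCells μ δ A) (hδ : δ ≠ ∞) (v : ι → ℝ) :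
    X.fnorm (cellFn A v) ≠ ∞ := by
  refine ne_top_of_le_ne_top ?_ (X.fnorm_sum_le _ fun i _ =>
    (measurable_const.indicator (hA.measurable i)).aestronglyMeasurable)
  refine (ENNReal.sum_lt_top.2 fun i _ => ?_).ne
  have : (A i).indicator (fun _ => v i) = fun ω => v i * (A i).indicator (fun _ => (1 : ℝ)) ω := by
    ext ω; by_cases h : ω ∈ A i <;> simp [h]
  rw [this, X.fnorm_smul (measurable_const.indicator (hA.measurable i)).aestronglyMeasurable]
  exact ENNReal.mul_lt_top (by simp) (X.fnorm_indicator_lt_top (hA.measurable i)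
    (by rw [hA.measure i]; exact hδ.lt_top))

/-- A doubly substochastic matrix is dominated by an average of permutations. -/
theorem exists_perm_weights [DecidableEq ι] (T : ι → ι → ℝ) (h0 : ∀ i j, 0 ≤ T i j)
    (hrow : ∀ i, ∑ j, T i j ≤ 1) (hcol : ∀ j, ∑ i, T i j ≤ 1) :
    ∃ w : Equiv.Perm ι → ℝ, (∀ σ, 0 ≤ w σ) ∧ ∑ σ, w σ = 1 ∧ ∀ u : ι → ℝ, (∀ i, 0 ≤ u i) →
      (∀ i, ∑ j, T i j * u j ≤ ∑ σ, w σ * u (σ i)) ∧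
      ((∀ j, u j ≠ 0 → ∑ i, T i j = 1) → ∀ i, ∑ j, T i j * u j = ∑ σ, w σ * u (σ i)) := by
  set r : ι → ℝ := fun i => 1 - ∑ j, T i j with hr
  set c : ι → ℝ := fun j => 1 - ∑ i, T i j with hc
  have hr0 : ∀ i, 0 ≤ r i := fun i => sub_nonneg.2 (hrow i)
  have hc0 : ∀ i, 0 ≤ c i := fun i => sub_nonneg.2 (hcol i)
  set ρ := ∑ i, r i with hρ
  have hρc : ∑ j, c j = ρ := by
    simp only [hρ, hr, hc, Finset.sum_sub_distrib]
    rw [Finset.sum_comm]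
  set S : Matrix ι ι ℝ := fun i j => T i j + r i * c j / ρ with hS
  have hρ0 : 0 ≤ ρ := Finset.sum_nonneg fun i _ => hr0 i
  have hmem : S ∈ doublyStochastic ℝ ι := by
    rw [mem_doublyStochastic_iff_sum]
    refine ⟨fun i j => add_nonneg (h0 i j) (div_nonneg (mul_nonneg (hr0 i) (hc0 j)) hρ0), ?_, ?_⟩
    · intro i
      simp only [hS, Finset.sum_add_distrib]
      rw [← Finset.sum_div, ← Finset.mul_sum, hρc]
      rcases eq_or_ne ρ 0 with h | h
      · have : r i = 0 := (Finset.sum_eq_zero_iff_of_nonneg fun i _ => hr0 i).1 h i (Finset.mem_univ i)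
        simp only [this, zero_mul, zero_div, add_zero]
        simp only [hr] at this
        linarith
      · rw [mul_div_cancel_right₀ _ h]
        simp [hr]
    · intro j
      simp only [hS, Finset.sum_add_distrib]
      rw [← Finset.sum_div, ← Finset.sum_mul]
      rcases eq_or_ne ρ 0 with h | h
      · have : c j = 0 := (Finset.sum_eq_zero_iff_of_nonneg fun i _ => hc0 i).1 (hρc.trans h) j
          (Finset.mem_univ j)
        simp only [this, mul_zero, zero_div, add_zero]
        simp only [hc] at this
        linarith
      · rw [← hρ, mul_div_cancel_left₀ _ h]
        simp [hc]
  obtain ⟨w, hw0, hw1, hwS⟩ := exists_eq_sum_perm_of_mem_doublyStochastic hmem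
  have hSu : ∀ (u : ι → ℝ) i, ∑ j, S i j * u j = ∑ σ, w σ * u (σ i) := by
    intro u i
    have : ∑ j, S i j * u j = (S.mulVec u) i := rfl
    rw [this, ← hwS, Matrix.sum_mulVec, Finset.sum_apply]
    refine Finset.sum_congr rfl fun σ _ => ?_
    rw [Matrix.smul_mulVec, Pi.smul_apply, Matrix.permMatrix_mulVec]
    rfl
  refine ⟨w, hw0, hw1, fun u hu => ⟨fun i => ?_, fun hcol' i => ?_⟩⟩
  · rw [← hSu]
    refine Finset.sum_le_sum fun j _ => ?_
    refine mul_le_mul_of_nonneg_right ?_ (hu j)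
    exact le_add_of_nonneg_right (div_nonneg (mul_nonneg (hr0 i) (hc0 j)) hρ0)
  · rw [← hSu]
    refine Finset.sum_congr rfl fun j _ => ?_
    by_cases h : u j = 0
    · simp [h]
    · have : c j = 0 := by simp only [hc, hcol' j h, sub_self]
      simp [hS, this]

theorem IsCells.sum_rpow (hA : IsCells μ δ A) {κ : Type*} [Fintype κ] {p : ℝ} (hp : 1 ≤ p)
    {a : κ → ι → ℝ} (ha : ∀ k i, 0 ≤ a k i) :
    (fun ω => (∑ k, |cellFn A (fun i => a k i ^ (1 / p)) ω| ^ p) ^ (1 / p)) =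
      cellFn A fun i => (∑ k, a k i) ^ (1 / p) := by
  have hp0 : p ≠ 0 := by positivity
  ext ω
  by_cases h : ∃ i, ω ∈ A i
  · obtain ⟨i, hi⟩ := h
    simp only [hA.cellFn_eq _ hi]
    congr 1
    refine Finset.sum_congr rfl fun k _ => ?_
    rw [abs_of_nonneg (Real.rpow_nonneg (ha k i) _), ← Real.rpow_mul (ha k i),
      one_div_mul_cancel hp0, Real.rpow_one]
  · push Not at h
    simp only [cellFn_eq_zero _ h, abs_zero, Real.zero_rpow hp0, Finset.sum_const_zero]
    exact Real.zero_rpow (by positivity)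

theorem sum_fnorm_weights (hX : X.IsRearrangementInvariant) [DecidableEq ι] (hA : IsCells μ δ A)
    {p : ℝ} (hp : 1 ≤ p) {w : Equiv.Perm ι → ℝ} (hw0 : ∀ σ, 0 ≤ w σ) (hw1 : ∑ σ, w σ = 1)
    {u : ι → ℝ} (hu : ∀ i, 0 ≤ u i) :
    (∑ σ, X.fnorm (cellFn A fun i => (w σ * u (σ i)) ^ (1 / p)) ^ p) ^ (1 / p) =
      X.fnorm (cellFn A fun i => u i ^ (1 / p)) := by
  have hp0 : p ≠ 0 := by positivity
  have hp1 : 0 ≤ p := by positivity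
  have h1 : ∀ σ, X.fnorm (cellFn A fun i => (w σ * u (σ i)) ^ (1 / p)) ^ p =
      ENNReal.ofReal (w σ) * X.fnorm (cellFn A fun i => u i ^ (1 / p)) ^ p := by
    intro σ
    have h2 : (cellFn A fun i => (w σ * u (σ i)) ^ (1 / p)) =
        fun ω => w σ ^ (1 / p) * cellFn A (fun i => u (σ i) ^ (1 / p)) ω := by
      ext ω
      rw [cellFn, cellFn, Finset.mul_sum]
      refine Finset.sum_congr rfl fun i _ => ?_
      by_cases h : ω ∈ A i <;> simp [h, Real.mul_rpow (hw0 σ) (hu _)]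
    rw [h2, X.fnorm_smul (hA.aestronglyMeasurable _),
      hX.cellFn_perm hA (fun i => u i ^ (1 / p)) σ, ENNReal.mul_rpow_of_nonneg _ _ hp1,
      Real.enorm_eq_ofReal (Real.rpow_nonneg (hw0 σ) _),
      ← ENNReal.ofReal_rpow_of_nonneg (hw0 σ) (by positivity), ← ENNReal.rpow_mul,
      one_div_mul_cancel hp0, ENNReal.rpow_one]
  rw [Finset.sum_congr rfl fun σ _ => h1 σ, ← Finset.sum_mul,
    ← ENNReal.ofReal_sum_of_nonneg fun σ _ => hw0 σ, hw1, ENNReal.ofReal_one, one_mul,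
    ← ENNReal.rpow_mul, mul_one_div_cancel hp0, ENNReal.rpow_one]

end

section

variable {Ω : Type*} {ι : Type} [MeasurableSpace Ω] {μ : Measure Ω} [Fintype ι] {X : KotheSpace μ}
  {A : ι → Set Ω} {δ : ℝ≥0∞}

theorem KotheSpace.PConvexWith.cellFn_le {p : ℝ} {M : ℝ≥0} (hM : X.PConvexWith p M) (hp : 1 ≤ p)
    (hX : X.IsRearrangementInvariant) (hA : IsCells μ δ A) (hδ : δ ≠ ∞) {T : ι → ι → ℝ}
    (h0 : ∀ i j, 0 ≤ T i j) (hrow : ∀ i, ∑ j, T i j ≤ 1) (hcol : ∀ j, ∑ i, T i j ≤ 1)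
    {u : ι → ℝ} (hu : ∀ i, 0 ≤ u i) :
    X.fnorm (cellFn A fun i => (∑ j, T i j * u j) ^ (1 / p)) ≤
      M * X.fnorm (cellFn A fun i => u i ^ (1 / p)) := by
  classical
  obtain ⟨w, hw0, hw1, hw⟩ := exists_perm_weights T h0 hrow hcol
  have h1 := hM (Equiv.Perm ι) (fun σ => cellFn A fun i => (w σ * u (σ i)) ^ (1 / p))
    (fun σ => hA.aestronglyMeasurable _) fun σ => hA.cellFn_ne_top hδ _
  rw [hA.sum_rpow hp (fun σ i => mul_nonneg (hw0 σ) (hu _)),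
    sum_fnorm_weights hX hA hp hw0 hw1 hu] at h1
  refine le_trans (X.fnorm_mono (hA.aestronglyMeasurable _) (ae_of_all _ fun ω => ?_)) h1
  have hT : ∀ i, 0 ≤ ∑ j, T i j * u j := fun i =>
    Finset.sum_nonneg fun j _ => mul_nonneg (h0 i j) (hu j)
  by_cases h : ∃ i, ω ∈ A i
  · obtain ⟨i, hi⟩ := h
    rw [hA.cellFn_eq _ hi, hA.cellFn_eq _ hi, abs_of_nonneg (Real.rpow_nonneg (hT i) _)]
    exact (Real.rpow_le_rpow (hT i) ((hw u hu).1 i) (by positivity)).trans (le_abs_self _)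
  · push Not at h
    rw [cellFn_eq_zero _ h, cellFn_eq_zero _ h]

theorem KotheSpace.PConcaveWith.le_cellFn {p : ℝ} {M : ℝ≥0} (hM : X.PConcaveWith p M) (hp : 1 ≤ p)
    (hX : X.IsRearrangementInvariant) (hA : IsCells μ δ A) (hδ : δ ≠ ∞) {T : ι → ι → ℝ}
    (h0 : ∀ i j, 0 ≤ T i j) (hrow : ∀ i, ∑ j, T i j ≤ 1) (hcol : ∀ j, ∑ i, T i j ≤ 1)
    {u : ι → ℝ} (hu : ∀ i, 0 ≤ u i) (hcol' : ∀ j, u j ≠ 0 → ∑ i, T i j = 1) :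
    X.fnorm (cellFn A fun i => u i ^ (1 / p)) ≤
      M * X.fnorm (cellFn A fun i => (∑ j, T i j * u j) ^ (1 / p)) := by
  classical
  obtain ⟨w, hw0, hw1, hw⟩ := exists_perm_weights T h0 hrow hcol
  have h1 := hM (Equiv.Perm ι) (fun σ => cellFn A fun i => (w σ * u (σ i)) ^ (1 / p))
    (fun σ => hA.aestronglyMeasurable _) fun σ => hA.cellFn_ne_top hδ _
  rw [hA.sum_rpow hp (fun σ i => mul_nonneg (hw0 σ) (hu _)),
    sum_fnorm_weights hX hA hp hw0 hw1 hu] at h1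
  simpa only [(hw u hu).2 hcol'] using h1

end


/-! ### Functions that are glued together from disjoint pieces -/

/-- Disjoint measurable sets `A k`, `k ∈ I`, of measure `2ᵏ`. -/
structure IsPieces (D : Domain) (I : Set ℤ) (A : ℤ → Set ℝ) : Prop where
  measurable : ∀ k, MeasurableSet (A k)
  disjoint : ∀ i j, i ≠ j → Disjoint (A i) (A j)
  measure : ∀ k ∈ I, D.measure (A k) = ENNReal.ofReal (2 ^ k)
  empty : ∀ k ∉ I, A k = ∅

/-- The function that coincides with `f k` on `A k`. -/
noncomputable def glue (A : ℤ → Set ℝ) (f : ℤ → ℝ → ℝ) (ω : ℝ) : ℝ :=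
  ∑' k, (A k).indicator (f k) ω

open Classical in
/-- The dyadic pieces. -/
noncomputable def dyadicPieces (I : Set ℤ) (k : ℤ) : Set ℝ := if k ∈ I then Domain.dyadic k else ∅

section

variable {D : Domain} {I : Set ℤ} {A B : ℤ → Set ℝ}

theorem isPieces_dyadic (hI : I ⊆ D.index) : IsPieces D I (dyadicPieces I) where
  measurable k := by
    rw [dyadicPieces]; split_ifs
    · exact Domain.measurableSet_dyadic k
    · exact MeasurableSet.empty
  disjoint i j hij := by
    rw [dyadicPieces, dyadicPieces]
    split_ifs
    · exact Set.disjoint_left.2 fun x hx hx' => hij (Domain.eq_of_mem_dyadic hx hx')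
    all_goals simp
  measure k hk := by rw [dyadicPieces, if_pos hk, D.measure_dyadic (hI hk)]
  empty k hk := by rw [dyadicPieces, if_neg hk]

theorem glue_eq (hA : ∀ i j, i ≠ j → Disjoint (A i) (A j)) (f : ℤ → ℝ → ℝ) {k : ℤ} {ω : ℝ}
    (h : ω ∈ A k) : glue A f ω = f k ω := by
  rw [glue, tsum_eq_single k, Set.indicator_of_mem h]
  intro j hj
  exact Set.indicator_of_notMem (fun h' => (hA j k hj).le_bot ⟨h', h⟩) _

theorem glue_eq_zero (f : ℤ → ℝ → ℝ) {ω : ℝ} (h : ∀ k, ω ∉ A k) : glue A f ω = 0 := by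
  simp [glue, h]

theorem measurable_glue (hA : ∀ i j, i ≠ j → Disjoint (A i) (A j)) (hm : ∀ k, MeasurableSet (A k))
    {f : ℤ → ℝ → ℝ} (hf : ∀ k, Measurable (f k)) : Measurable (glue A f) := by
  refine measurable_of_tendsto_metrizable' (atTop : Filter (Finset ℤ))
    (f := fun s ω => ∑ k ∈ s, (A k).indicator (f k) ω) ?_ ?_
  · intro s
    exact Finset.measurable_fun_sum _ fun k _ => (hf k).indicator (hm k)
  · have hs : ∀ ω, Summable fun k => (A k).indicator (f k) ω := by
      intro ω
      refine summable_of_hasFiniteSupport (Set.Subsingleton.finite ?_)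
      intro i hi j hj
      by_contra h
      exact (hA i j h).le_bot ⟨Set.mem_of_indicator_ne_zero (Function.mem_support.1 hi),
        Set.mem_of_indicator_ne_zero (Function.mem_support.1 hj)⟩
    exact tendsto_pi_nhds.2 fun ω => (hs ω).hasSum

/-- The step function with value `x k` on `A k`. -/
noncomputable def stepFn (A : ℤ → Set ℝ) (x : ℤ → ℝ) : ℝ → ℝ := glue A fun k _ => x k

theorem IsPieces.measurable_stepFn (hA : IsPieces D I A) (x : ℤ → ℝ) : Measurable (stepFn A x) :=
  measurable_glue hA.disjoint hA.measurable fun _ => measurable_const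

theorem IsPieces.aesm (hA : IsPieces D I A) (x : ℤ → ℝ) :
    AEStronglyMeasurable (stepFn A x) D.measure := (hA.measurable_stepFn x).aestronglyMeasurable

theorem IsPieces.stepFn_eq (hA : IsPieces D I A) (x : ℤ → ℝ) {k : ℤ} {ω : ℝ} (h : ω ∈ A k) :
    stepFn A x ω = x k := glue_eq hA.disjoint _ h

theorem stepFn_eq_zero (x : ℤ → ℝ) {ω : ℝ} (h : ∀ k, ω ∉ A k) : stepFn A x ω = 0 :=
  glue_eq_zero _ h

theorem IsPieces.mem (hA : IsPieces D I A) {k : ℤ} {ω : ℝ} (h : ω ∈ A k) : k ∈ I := by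
  by_contra hk
  rw [hA.empty k hk] at h
  exact h

theorem IsPieces.distribution (hA : IsPieces D I A) (x : ℤ → ℝ) {s : ℝ} (hs : 0 ≤ s) :
    D.measure {ω | s < |stepFn A x ω|} =
      ∑' k : {k | k ∈ I ∧ s < |x k|}, ENNReal.ofReal (2 ^ (k : ℤ)) := by
  have : {ω | s < |stepFn A x ω|} = ⋃ k ∈ {k | k ∈ I ∧ s < |x k|}, A k := by
    ext ω
    simp only [Set.mem_ofPred_eq, Set.mem_iUnion, exists_prop]
    constructor
    · intro h
      by_cases h' : ∃ k, ω ∈ A k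
      · obtain ⟨k, hk⟩ := h'
        exact ⟨k, ⟨hA.mem hk, by rwa [hA.stepFn_eq x hk] at h⟩, hk⟩
      · push Not at h'
        rw [stepFn_eq_zero x h', abs_zero] at h
        exact absurd h (not_lt.2 hs)
    · rintro ⟨k, h, hk⟩
      rw [hA.stepFn_eq x hk]
      exact h.2
  rw [this, measure_biUnion (Set.to_countable _) (fun i _ j _ h => hA.disjoint i j h)
    fun i _ => hA.measurable i]
  exact tsum_congr fun k => hA.measure k k.2.1

variable {X : RISpace D}

theorem RISpace.fnorm_stepFn_congr (X : RISpace D) (hA : IsPieces D I A) (hB : IsPieces D I B)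
    (x : ℤ → ℝ) : X.fnorm (stepFn A x) = X.fnorm (stepFn B x) :=
  X.rearrangement_invariant.fnorm_eq (hA.aesm x) (hB.aesm x) fun s hs => by
    rw [hA.distribution x hs, hB.distribution x hs]

end

variable {D : Domain}

namespace RISpace

variable (X : RISpace D)

/-- The norm of `E_X`, for two-sided sequences. -/
noncomputable def eNorm (x : ℤ → ℝ) : ℝ≥0∞ := X.fnorm (stepFn (dyadicPieces D.index) x)

theorem extendNorm_seqNrm : extendNorm X.seqNrm = X.eNorm := by
  ext x
  rw [extendNorm, seqNrm, KotheSpace.nrm_mk, eNorm]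
  congr 1
  ext ω
  have hP := isPieces_dyadic (D := D) (subset_refl D.index)
  by_cases h : ∃ k, ω ∈ dyadicPieces D.index k
  · obtain ⟨k, hk⟩ := h
    have hkI := hP.mem hk
    rw [hP.stepFn_eq x hk]
    rw [dyadicPieces, if_pos hkI] at hk
    rw [dyadicStep, tsum_eq_single ⟨k, hkI⟩]
    · exact Set.indicator_of_mem (show ω ∈ Set.Ico ((2 : ℝ) ^ k) (2 ^ (k + 1)) from hk) _
    intro j hj
    refine Set.indicator_of_notMem (fun h' => hj (Subtype.ext ?_)) _
    exact Domain.eq_of_mem_dyadic h' hk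
  · push Not at h
    rw [stepFn_eq_zero x h, dyadicStep]
    have : ∀ k : D.index, (Set.Ico ((2 : ℝ) ^ (k : ℤ)) (2 ^ ((k : ℤ) + 1))).indicator
        (fun _ => x k) ω = 0 := fun k => Set.indicator_of_notMem (fun h' => h k (by
          rw [dyadicPieces, if_pos k.2]; exact h')) _
    simp only [this, tsum_zero]

theorem fnorm_stepFn {A : ℤ → Set ℝ} (hA : IsPieces D D.index A) (x : ℤ → ℝ) :
    X.fnorm (stepFn A x) = X.eNorm x :=
  X.fnorm_stepFn_congr hA (isPieces_dyadic (subset_refl _)) x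

theorem fnorm_stepFn_le {I : Set ℤ} (hI : I ⊆ D.index) {A : ℤ → Set ℝ} (hA : IsPieces D I A)
    (x : ℤ → ℝ) : X.fnorm (stepFn A x) ≤ X.eNorm x := by
  have hP := isPieces_dyadic (D := D) hI
  have hP' := isPieces_dyadic (D := D) (subset_refl D.index)
  rw [X.fnorm_stepFn_congr hA hP]
  refine X.fnorm_mono (hP.aesm x) (ae_of_all _ fun ω => ?_)
  by_cases h : ∃ k, ω ∈ dyadicPieces I k
  · obtain ⟨k, hk⟩ := h
    have hkI := hP.mem hk
    have hk' : ω ∈ dyadicPieces D.index k := by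
      rw [dyadicPieces, if_pos (hI hkI)]
      rwa [dyadicPieces, if_pos hkI] at hk
    rw [hP.stepFn_eq x hk, hP'.stepFn_eq x hk']
  · push Not at h
    rw [stepFn_eq_zero x h, abs_zero]
    exact abs_nonneg _

theorem stepFn_add {I : Set ℤ} {A : ℤ → Set ℝ} (hA : IsPieces D I A) (x y : ℤ → ℝ) (ω : ℝ) :
    stepFn A (x + y) ω = stepFn A x ω + stepFn A y ω := by
  by_cases h : ∃ k, ω ∈ A k
  · obtain ⟨k, hk⟩ := h
    simp [hA.stepFn_eq _ hk]
  · push Not at h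
    simp [stepFn_eq_zero _ h]

theorem stepFn_smul {I : Set ℤ} {A : ℤ → Set ℝ} (hA : IsPieces D I A) (c : ℝ) (x : ℤ → ℝ) (ω : ℝ) :
    stepFn A (c • x) ω = c * stepFn A x ω := by
  by_cases h : ∃ k, ω ∈ A k
  · obtain ⟨k, hk⟩ := h
    simp [hA.stepFn_eq _ hk]
  · push Not at h
    simp [stepFn_eq_zero _ h]

theorem stepFn_single {k : ℤ} (hk : k ∈ D.index) (c : ℝ) :
    stepFn (dyadicPieces D.index) (Pi.single k c) = (Domain.dyadic k).indicator fun _ => c := by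
  have hP := isPieces_dyadic (D := D) (subset_refl D.index)
  ext ω
  by_cases h : ∃ j, ω ∈ dyadicPieces D.index j
  · obtain ⟨j, hj⟩ := h
    rw [hP.stepFn_eq _ hj]
    rw [dyadicPieces, if_pos (hP.mem hj)] at hj
    by_cases hjk : j = k
    · subst hjk; simp [hj]
    · rw [Pi.single_eq_of_ne hjk, Set.indicator_of_notMem fun h => hjk (Domain.eq_of_mem_dyadic hj h)]
  · push Not at h
    rw [stepFn_eq_zero _ h, Set.indicator_of_notMem]
    have := h k
    rwa [dyadicPieces, if_pos hk] at this

theorem isSeqNorm : IsSeqNorm D.index X.eNorm := by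
  have hP := isPieces_dyadic (D := D) (subset_refl D.index)
  have hmono : ∀ x y : ℤ → ℝ, (∀ n ∈ D.index, |x n| ≤ |y n|) → X.eNorm x ≤ X.eNorm y := by
    intro x y h
    refine X.fnorm_mono (hP.aesm x) (ae_of_all _ fun ω => ?_)
    by_cases h' : ∃ k, ω ∈ dyadicPieces D.index k
    · obtain ⟨k, hk⟩ := h'
      rw [hP.stepFn_eq x hk, hP.stepFn_eq y hk]
      exact h k (hP.mem hk)
    · push Not at h'
      rw [stepFn_eq_zero x h', stepFn_eq_zero y h']
  constructor
  · intro c x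
    rw [eNorm, eNorm, ← X.fnorm_smul (hP.aesm x)]
    congr 1
    ext ω
    exact stepFn_smul hP c x ω
  · intro x y
    refine le_trans (le_of_eq ?_) (X.fnorm_add_le (hP.aesm x) (hP.aesm y))
    rw [eNorm]
    congr 1
    ext ω
    exact stepFn_add hP x y ω
  · exact hmono
  · intro x c h
    refine X.fnorm_le_of_tendsto (f := fun n : ℕ => stepFn (dyadicPieces D.index)
      ((Finset.Icc (-n : ℤ) n : Set ℤ).indicator x)) (fun n => hP.aesm _) (ae_of_all _ fun ω => ?_)
      fun n => h (Finset.Icc (-n : ℤ) n)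
    refine tendsto_const_nhds.congr' ?_
    by_cases h' : ∃ k, ω ∈ dyadicPieces D.index k
    · obtain ⟨k, hk⟩ := h'
      filter_upwards [eventually_ge_atTop k.natAbs] with n hn
      rw [hP.stepFn_eq _ hk, hP.stepFn_eq _ hk, Set.indicator_of_mem]
      simp only [Finset.coe_Icc, Set.mem_Icc]
      omega
    · push Not at h'
      exact Eventually.of_forall fun n => (stepFn_eq_zero _ h').trans (stepFn_eq_zero _ h').symm
  · intro n hn
    rw [eNorm, stepFn_single hn]
    intro h
    rw [X.fnorm_eq_zero
      (measurable_const.indicator (Domain.measurableSet_dyadic n)).aestronglyMeasurable] at h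
    have h1 : D.measure (Domain.dyadic n) = 0 := by
      refine measure_mono_null (fun ω hω => ?_) h
      change _ ≠ _
      simp [hω]
    rw [D.measure_dyadic hn] at h1
    have : (0 : ℝ) < 2 ^ n := by positivity
    simp at h1
    linarith
  · intro n
    by_cases hn : n ∈ D.index
    · rw [eNorm, stepFn_single hn]
      refine (X.fnorm_indicator_lt_top (Domain.measurableSet_dyadic n) ?_).ne
      rw [D.measure_dyadic hn]
      exact ENNReal.ofReal_lt_top
    · have : X.eNorm (Pi.single n 1) ≤ X.eNorm 0 := hmono _ _ fun k hk => by
        have : k ≠ n := by rintro rfl; exact hn hk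
        simp [this]
      refine ne_top_of_le_ne_top ?_ this
      have h0 : X.eNorm 0 = 0 := by
        rw [eNorm, ← X.fnorm_zero]
        congr 1
        ext ω
        simp [stepFn, glue]
      simp [h0]

end RISpace

theorem Domain.dyadic_half {k : ℤ} (hk : k ∈ D.index) (hk' : k + 1 ∈ D.index) :
    ∃ A B : Set ℝ, MeasurableSet A ∧ MeasurableSet B ∧ A ∪ B = Domain.dyadic (k + 1) ∧
      D.measure A = ENNReal.ofReal (2 ^ k) ∧ D.measure B = ENNReal.ofReal (2 ^ k) := by
  have h1 := D.measure_Ico hk' hk (by omega) (i := 0) (j := 1) (by norm_num) (by simp)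
  have h2 := D.measure_Ico hk' hk (by omega) (i := 1) (j := 2) (by norm_num) (by simp)
  refine ⟨Set.Ico (2 ^ (k + 1)) (2 ^ (k + 1) + 2 ^ k),
    Set.Ico (2 ^ (k + 1) + 2 ^ k) (2 ^ (k + 1) + 2 * 2 ^ k), measurableSet_Ico, measurableSet_Ico, ?_,
    by simpa using h1, by simpa using h2⟩
  have e1 : (2 : ℝ) ^ (k + 1) = 2 * 2 ^ k := by rw [zpow_add_one₀ (by norm_num)]; ring
  have e2 : (2 : ℝ) ^ (k + 1 + 1) = 4 * 2 ^ k := by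
    rw [zpow_add_one₀ (by norm_num), e1]; ring
  have e3 : (0 : ℝ) < 2 ^ k := by positivity
  rw [Domain.dyadic, e1, e2]
  rw [Set.Ico_union_Ico_eq_Ico (by linarith) (by linarith)]
  congr 1
  ring

/-- The sequence `x (n - 1)`, at the places `n` with `n - 1 ∈ J`. -/
noncomputable def shiftSeq (J : Set ℤ) (x : ℤ → ℝ) : ℤ → ℝ :=
  {n | n - 1 ∈ J}.indicator fun n => x (n - 1)

theorem RISpace.eNorm_shiftSeq_le (X : RISpace D) (x : ℤ → ℝ) :
    X.eNorm (shiftSeq D.index x) ≤ 2 * X.eNorm x := by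
  classical
  set I : Set ℤ := {k | k ∈ D.index ∧ k + 1 ∈ D.index} with hI
  have hex : ∀ k : ℤ, ∃ A B : Set ℝ, k ∈ I → MeasurableSet A ∧ MeasurableSet B ∧
      A ∪ B = Domain.dyadic (k + 1) ∧
      D.measure A = ENNReal.ofReal (2 ^ k) ∧ D.measure B = ENNReal.ofReal (2 ^ k) := by
    intro k
    by_cases hk : k ∈ I
    · obtain ⟨A, B, h⟩ := Domain.dyadic_half hk.1 hk.2
      exact ⟨A, B, fun _ => h⟩
    · exact ⟨∅, ∅, fun h => absurd h hk⟩
  choose A B hAB using hex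
  have key : ∀ C : ℤ → Set ℝ, (∀ k ∈ I, MeasurableSet (C k) ∧ C k ⊆ Domain.dyadic (k + 1) ∧
      D.measure (C k) = ENNReal.ofReal (2 ^ k)) → IsPieces D I fun k => if k ∈ I then C k else ∅ := by
    intro C hC
    constructor
    · intro k
      split_ifs with h
      · exact (hC k h).1
      · exact MeasurableSet.empty
    · intro i j hij
      split_ifs with h1 h2
      · refine Set.disjoint_left.2 fun ω h3 h4 => hij ?_
        have := Domain.eq_of_mem_dyadic ((hC i h1).2.1 h3) ((hC j h2).2.1 h4)
        omega
      all_goals simp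
    · intro k hk
      rw [if_pos hk]
      exact (hC k hk).2.2
    · intro k hk
      rw [if_neg hk]
  have hA := key A fun k hk => ⟨(hAB k hk).1, (hAB k hk).2.2.1 ▸ Set.subset_union_left,
    (hAB k hk).2.2.2.1⟩
  have hB := key B fun k hk => ⟨(hAB k hk).2.1, (hAB k hk).2.2.1 ▸ Set.subset_union_right,
    (hAB k hk).2.2.2.2⟩
  have hIJ : I ⊆ D.index := fun k hk => hk.1
  have hP := isPieces_dyadic (D := D) (subset_refl D.index)
  set y : ℤ → ℝ := fun k => |x k| with hy
  have hxy : X.eNorm y = X.eNorm x := X.isSeqNorm.congr fun n _ => abs_abs _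
  have hnn : ∀ (C : ℤ → Set ℝ) (hC : IsPieces D I C) ω, 0 ≤ stepFn C y ω := by
    intro C hC ω
    by_cases h : ∃ k, ω ∈ C k
    · obtain ⟨k, hk⟩ := h
      rw [hC.stepFn_eq y hk]
      exact abs_nonneg _
    · push Not at h
      rw [stepFn_eq_zero y h]
  calc X.eNorm (shiftSeq D.index x)
      ≤ X.fnorm (fun ω => stepFn (fun k => if k ∈ I then A k else ∅) y ω +
          stepFn (fun k => if k ∈ I then B k else ∅) y ω) := by
        refine X.fnorm_mono (hP.aesm _) (ae_of_all _ fun ω => ?_)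
        rw [abs_of_nonneg (add_nonneg (hnn _ hA ω) (hnn _ hB ω))]
        by_cases h : ∃ k, ω ∈ dyadicPieces D.index k
        · obtain ⟨k, hk⟩ := h
          rw [hP.stepFn_eq _ hk]
          by_cases hk1 : k - 1 ∈ D.index
          · have hkI : k - 1 ∈ I := ⟨hk1, by simpa using hP.mem hk⟩
            have hkk : ω ∈ A (k - 1) ∪ B (k - 1) := by
              rw [(hAB _ hkI).2.2.1, sub_add_cancel]
              rwa [dyadicPieces, if_pos (hP.mem hk)] at hk
            rw [shiftSeq, Set.indicator_of_mem (show k ∈ {n | n - 1 ∈ D.index} from hk1)]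
            rcases hkk with h | h
            · rw [hA.stepFn_eq y (k := k - 1) (by simpa [hkI] using h)]
              exact le_add_of_nonneg_right (hnn _ hB ω)
            · rw [hB.stepFn_eq y (k := k - 1) (by simpa [hkI] using h)]
              exact le_add_of_nonneg_left (hnn _ hA ω)
          · rw [shiftSeq, Set.indicator_of_notMem (show k ∉ {n | n - 1 ∈ D.index} from hk1), abs_zero]
            exact add_nonneg (hnn _ hA ω) (hnn _ hB ω)
        · push Not at h
          rw [stepFn_eq_zero _ h, abs_zero]
          exact add_nonneg (hnn _ hA ω) (hnn _ hB ω)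
    _ ≤ X.eNorm y + X.eNorm y := (X.fnorm_add_le (hA.aesm _) (hB.aesm _)).trans
        (add_le_add (X.fnorm_stepFn_le hIJ hA y) (X.fnorm_stepFn_le hIJ hB y))
    _ = 2 * X.eNorm x := by rw [hxy, two_mul]

theorem RISpace.eNorm_single_succ_le (X : RISpace D) {k : ℤ} (hk : k ∈ D.index) :
    X.eNorm (Pi.single (k + 1) 1) ≤ 2 * X.eNorm (Pi.single k 1) := by
  refine le_trans (X.isSeqNorm.mono _ _ fun n _ => ?_) (X.eNorm_shiftSeq_le (Pi.single k 1))
  by_cases h : n = k + 1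
  · subst h; simp [shiftSeq, hk]
  · simp [h]

theorem RISpace.fnorm_indicator (X : RISpace D) {k : ℤ} (hk : k ∈ D.index) {S : Set ℝ}
    (hS : MeasurableSet S) (hμ : D.measure S = ENNReal.ofReal (2 ^ k)) :
    X.fnorm (S.indicator fun _ => (1 : ℝ)) = X.eNorm (Pi.single k 1) := by
  rw [eNorm, stepFn_single hk]
  refine X.rearrangement_invariant.fnorm_eq
    (measurable_const.indicator hS).aestronglyMeasurable
    (measurable_const.indicator (Domain.measurableSet_dyadic k)).aestronglyMeasurable fun s hs => ?_
  have e : ∀ S : Set ℝ, {ω | s < |S.indicator (fun _ => (1 : ℝ)) ω|} = if s < 1 then S else ∅ := by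
    intro S
    ext ω
    split_ifs with h <;> by_cases hω : ω ∈ S <;> simp [hω, h, not_lt.2 hs]
  rw [e, e]
  split_ifs
  · rw [hμ, D.measure_dyadic hk]
  · rfl

theorem RISpace.eNorm_single_le_succ (X : RISpace D) {k : ℤ} (hk : k ∈ D.index)
    (hk' : k + 1 ∈ D.index) : X.eNorm (Pi.single k 1) ≤ X.eNorm (Pi.single (k + 1) 1) := by
  obtain ⟨A, B, hA, -, hAB, hμ, -⟩ := Domain.dyadic_half hk hk'
  rw [← X.fnorm_indicator hk hA hμ, eNorm, stepFn_single hk']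
  refine X.fnorm_mono (measurable_const.indicator hA).aestronglyMeasurable (ae_of_all _ fun ω => ?_)
  have hsub : A ⊆ Domain.dyadic (k + 1) := hAB ▸ Set.subset_union_left
  by_cases h : ω ∈ A
  · simp [h, hsub h]
  · simp [h]


variable {D : Domain}

/-! ### Spreading out to the right -/

/-- The cells of length `2ᵐ` of the dyadic intervals with indices in `K`. -/
def dyadicCell (K : Finset ℤ) (m : ℤ) (c : Σ k : K, Fin (2 ^ ((k : ℤ) - m).toNat)) : Set ℝ :=
  Set.Ico ((2 : ℝ) ^ (c.1 : ℤ) + (c.2 : ℕ) * 2 ^ m) (2 ^ (c.1 : ℤ) + ((c.2 : ℕ) + 1 : ℕ) * 2 ^ m)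

theorem two_zpow_eq_mul {k m : ℤ} (h : m ≤ k) : (2 : ℝ) ^ k = 2 ^ (k - m).toNat * 2 ^ m := by
  rw [← zpow_natCast, ← zpow_add₀ (by norm_num)]
  congr 1
  omega

theorem dyadicCell_subset {K : Finset ℤ} {m : ℤ} (hmK : ∀ k ∈ K, m ≤ k)
    (c : Σ k : K, Fin (2 ^ ((k : ℤ) - m).toNat)) : dyadicCell K m c ⊆ Domain.dyadic c.1 := by
  refine Set.Ico_subset_Ico (le_add_of_nonneg_right (by positivity)) ?_
  rw [zpow_add_one₀ (by norm_num), mul_two]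
  have := two_zpow_eq_mul (hmK c.1 c.1.2)
  conv_rhs => rw [this]
  rw [this]
  gcongr
  exact_mod_cast c.2.2

theorem isCells_dyadicCell {K : Finset ℤ} (hK : (K : Set ℤ) ⊆ D.index) {m : ℤ} (hm : m ∈ D.index)
    (hmK : ∀ k ∈ K, m ≤ k) :
    IsCells D.measure (ENNReal.ofReal (2 ^ m)) (dyadicCell K m) where
  measurable _ := measurableSet_Ico
  disjoint := by
    rintro ⟨k, i⟩ ⟨l, j⟩ hne
    refine Set.disjoint_left.2 fun ω h1 h2 => hne ?_
    obtain rfl : k = l := Subtype.ext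
      (Domain.eq_of_mem_dyadic (dyadicCell_subset hmK _ h1) (dyadicCell_subset hmK _ h2))
    congr 1
    have h3 := h1.1.trans_lt h2.2
    have h4 := h2.1.trans_lt h1.2
    have hpos : (0 : ℝ) < 2 ^ m := by positivity
    have h5 : ((i : ℕ) : ℝ) < ((j : ℕ) + 1 : ℕ) :=
      lt_of_mul_lt_mul_right (lt_of_add_lt_add_left h3) hpos.le
    have h6 : ((j : ℕ) : ℝ) < ((i : ℕ) + 1 : ℕ) :=
      lt_of_mul_lt_mul_right (lt_of_add_lt_add_left h4) hpos.le
    refine Fin.ext ?_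
    have h7 : (i : ℕ) < j + 1 := by exact_mod_cast h5
    have h8 : (j : ℕ) < i + 1 := by exact_mod_cast h6
    omega
  measure c := by
    have := D.measure_Ico (hK c.1.2) hm (hmK _ c.1.2) (i := c.2) (j := c.2 + 1) (by omega) c.2.2
    simpa [dyadicCell] using this

theorem exists_mem_dyadicCell {K : Finset ℤ} {m : ℤ} (hmK : ∀ k ∈ K, m ≤ k) {k : ℤ} (hk : k ∈ K)
    {ω : ℝ} (h : ω ∈ Domain.dyadic k) : ∃ i, ω ∈ dyadicCell K m ⟨⟨k, hk⟩, i⟩ := by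
  have hpos : (0 : ℝ) < 2 ^ m := by positivity
  have h0 : 0 ≤ (ω - 2 ^ k) / 2 ^ m := div_nonneg (sub_nonneg.2 h.1) hpos.le
  have h1 := Nat.floor_le h0
  have h2 := Nat.lt_floor_add_one ((ω - 2 ^ k) / 2 ^ m)
  rw [le_div_iff₀ hpos] at h1
  rw [div_lt_iff₀ hpos] at h2
  have h3 : ⌊(ω - 2 ^ k) / 2 ^ m⌋₊ < 2 ^ (k - m).toNat := by
    have h4 := h.2
    rw [zpow_add_one₀ (by norm_num), mul_two] at h4
    have h5 : (⌊(ω - 2 ^ k) / 2 ^ m⌋₊ : ℝ) * 2 ^ m < 2 ^ (k - m).toNat * 2 ^ m := by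
      rw [← two_zpow_eq_mul (hmK k hk)]
      linarith
    exact_mod_cast lt_of_mul_lt_mul_right h5 hpos.le
  refine ⟨⟨_, h3⟩, ?_, ?_⟩
  · simp only
    linarith
  · simp only
    push_cast
    linarith

theorem RISpace.fnorm_dyadicCell (X : RISpace D) {K : Finset ℤ} (hK : (K : Set ℤ) ⊆ D.index)
    {m : ℤ} (hm : m ∈ D.index) (hmK : ∀ k ∈ K, m ≤ k) {v : ℤ → ℝ} (hv : ∀ k, v k ≠ 0 → k ∈ K) :
    X.fnorm (cellFn (dyadicCell K m) fun c => v c.1) = X.eNorm v := by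
  have hP := isPieces_dyadic (D := D) (subset_refl D.index)
  have hC := isCells_dyadicCell hK hm hmK
  rw [eNorm]
  congr 1
  ext ω
  by_cases h : ∃ k ∈ K, ω ∈ Domain.dyadic k
  · obtain ⟨k, hk, hω⟩ := h
    obtain ⟨i, hi⟩ := exists_mem_dyadicCell hmK hk hω
    rw [hC.cellFn_eq _ hi, hP.stepFn_eq v (k := k)]
    rw [dyadicPieces, if_pos (hK hk)]
    exact hω
  · push Not at h
    rw [cellFn_eq_zero _ fun c hc => h c.1 c.1.2 (dyadicCell_subset hmK c hc)]
    by_cases h' : ∃ k, ω ∈ dyadicPieces D.index k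
    · obtain ⟨k, hk⟩ := h'
      rw [hP.stepFn_eq v hk]
      by_contra h0
      have hkK := hv k (Ne.symm h0)
      rw [dyadicPieces, if_pos (hP.mem hk)] at hk
      exact h k hkK hk
    · push Not at h'
      rw [stepFn_eq_zero v h']

/-- Shifting to the right with preservation of the weighted `ℓ_p`-norms is bounded for `F`, and its
inverse is bounded for `E`. -/
def SpreadBound (J : Set ℤ) (E F : (ℤ → ℝ) → ℝ≥0∞) (p : ℝ) (M : ℝ≥0) : Prop :=
  ∀ (s : Finset ℤ) (f g : ℤ → ℤ → ℝ) (K : Finset ℤ), (K : Set ℤ) ⊆ J → ShiftFamily s f g →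
    (∀ j ∈ s, ∀ k, f j k ≠ 0 → k ∈ K) → (∀ j ∈ s, ∀ k, g j k ≠ 0 → k ∈ K) →
    (∀ j ∈ s, ∑ k ∈ K, 2 ^ k * |f j k| ^ p = ∑ k ∈ K, 2 ^ k * |g j k| ^ p) →
    F (∑ j ∈ s, g j) ≤ M * F (∑ j ∈ s, f j) ∧ E (∑ j ∈ s, f j) ≤ M * E (∑ j ∈ s, g j)

theorem abs_sum_rpow {s : Finset ℤ} {f : ℤ → ℤ → ℝ}
    (hf : ∀ i ∈ s, ∀ j ∈ s, i ≠ j → ∀ k, f i k ≠ 0 → f j k = 0) {p : ℝ} (hp : p ≠ 0) (k : ℤ) :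
    |(∑ j ∈ s, f j) k| ^ p = ∑ j ∈ s, |f j k| ^ p := by
  rw [Finset.sum_apply]
  by_cases h : ∃ j ∈ s, f j k ≠ 0
  · obtain ⟨j, hj, hjk⟩ := h
    rw [Finset.sum_eq_single_of_mem j hj fun i hi hij => hf j hj i hi hij.symm k hjk,
      Finset.sum_eq_single_of_mem j hj]
    intro i hi hij
    rw [hf j hj i hi hij.symm k hjk, abs_zero, Real.zero_rpow hp]
  · push Not at h
    rw [Finset.sum_eq_zero h, Finset.sum_eq_zero fun j hj => by
      rw [h j hj, abs_zero, Real.zero_rpow hp], abs_zero, Real.zero_rpow hp]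

theorem sum_two_pow_le {L : Finset ℤ} {m k : ℤ} (hm : ∀ l ∈ L, m ≤ l) (hk : ∀ l ∈ L, l < k) :
    ∑ l ∈ L, (2 : ℝ) ^ (l - m).toNat ≤ 2 ^ (k - m).toNat := by
  have h1 : ∑ l ∈ L, (2 : ℝ) ^ (l - m).toNat = ∑ n ∈ L.image fun l => (l - m).toNat, (2 : ℝ) ^ n := by
    rw [Finset.sum_image]
    intro a ha b hb h
    have := hm a ha
    have := hm b hb
    simp only at h
    omega
  rw [h1]
  have h2 : (L.image fun l => (l - m).toNat) ⊆ Finset.range (k - m).toNat := by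
    intro n hn
    obtain ⟨l, hl, rfl⟩ := Finset.mem_image.1 hn
    have := hm l hl
    have := hk l hl
    rw [Finset.mem_range]
    omega
  refine (Finset.sum_le_sum_of_subset_of_nonneg h2 fun _ _ _ => by positivity).trans ?_
  rw [geom_sum_eq (by norm_num)]
  norm_num

theorem sum_cells (K : Finset ℤ) (m : ℤ) (φ : ℤ → ℝ) :
    ∑ c : Σ k : K, Fin (2 ^ ((k : ℤ) - m).toNat), φ c.1 =
      ∑ k ∈ K, (2 : ℝ) ^ (k - m).toNat * φ k := by
  rw [Fintype.sum_sigma, ← Finset.sum_coe_sort K]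
  refine Finset.sum_congr rfl fun k _ => ?_
  simp

theorem RISpace.spreadBound {X Y : RISpace D} {p : ℝ} (hp : 1 ≤ p) {M₁ M₂ : ℝ≥0}
    (hX : X.PConcaveWith p M₁) (hY : Y.PConvexWith p M₂) :
    SpreadBound D.index X.eNorm Y.eNorm p (max M₁ M₂) := by
  classical
  have hp0 : p ≠ 0 := by positivity
  intro s f g K hK hfam hfK hgK heq
  rcases K.eq_empty_or_nonempty with rfl | hKne
  · have hf : ∑ j ∈ s, f j = 0 := Finset.sum_eq_zero fun j hj => by
      ext k; by_contra h; exact absurd (hfK j hj k h) (Finset.notMem_empty k)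
    have hg : ∑ j ∈ s, g j = 0 := Finset.sum_eq_zero fun j hj => by
      ext k; by_contra h; exact absurd (hgK j hj k h) (Finset.notMem_empty k)
    rw [hf, hg, X.isSeqNorm.zero, Y.isSeqNorm.zero]
    simp
  set m := K.min' hKne with hm
  have hmJ : m ∈ D.index := hK (K.min'_mem hKne)
  have hmK : ∀ k ∈ K, m ≤ k := fun k hk => K.min'_le k hk
  set n : ℤ → ℝ := fun k => 2 ^ (k - m).toNat with hn
  have hn0 : ∀ k, 0 < n k := fun k => by positivity
  set S : ℤ → ℝ := fun j => ∑ k ∈ K, n k * |f j k| ^ p with hS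
  have hSg : ∀ j ∈ s, S j = ∑ k ∈ K, n k * |g j k| ^ p := by
    intro j hj
    have hpos : (0 : ℝ) < 2 ^ m := by positivity
    have h1 := heq j hj
    rw [Finset.sum_congr rfl fun k hk => by rw [two_zpow_eq_mul (hmK k hk), mul_right_comm],
      ← Finset.sum_mul] at h1
    conv_rhs at h1 => rw [Finset.sum_congr rfl fun k hk => by
      rw [two_zpow_eq_mul (hmK k hk), mul_right_comm], ← Finset.sum_mul]
    exact mul_right_cancel₀ hpos.ne' h1
  have hS0 : ∀ j, 0 ≤ S j := fun j => Finset.sum_nonneg fun k _ => by positivity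
  have habs : ∀ x : ℝ, 0 ≤ |x| ^ p := fun x => Real.rpow_nonneg (abs_nonneg x) p
  have hSf : ∀ j ∈ s, ∀ k, f j k ≠ 0 → 0 < S j := by
    intro j hj k hk
    refine lt_of_lt_of_le (mul_pos (hn0 k) (Real.rpow_pos_of_pos (abs_pos.2 hk) p))
      (Finset.single_le_sum (f := fun k => n k * |f j k| ^ p) (fun k _ => ?_) (hfK j hj k hk))
    positivity
  have hSg' : ∀ j ∈ s, ∀ k, n k * |g j k| ^ p ≤ S j := by
    intro j hj k
    by_cases hk : g j k = 0
    · rw [hk, abs_zero, Real.zero_rpow hp0, mul_zero]; exact hS0 j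
    · rw [hSg j hj]
      refine Finset.single_le_sum (f := fun k => n k * |g j k| ^ p) (fun k _ => ?_) (hgK j hj k hk)
      positivity
  set χ : ℤ → ℤ → ℝ := fun j l => if f j l = 0 then 0 else 1 with hχ
  have hχ0 : ∀ j l, 0 ≤ χ j l := fun j l => by simp only [hχ]; split_ifs <;> norm_num
  set T : ℤ → ℤ → ℝ := fun k l => ∑ j ∈ s, |g j k| ^ p * χ j l / S j with hT
  set u : ℤ → ℝ := fun l => |(∑ j ∈ s, f j) l| ^ p with hu
  have hdf := hfam.disjoint_left
  have hdg := hfam.disjoint_right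
  have hT0 : ∀ k l, 0 ≤ T k l := fun k l => Finset.sum_nonneg fun j _ =>
    div_nonneg (mul_nonneg (habs _) (hχ0 j l)) (hS0 j)
  have hrow : ∀ k, ∑ l ∈ K, n l * T k l ≤ 1 := by
    intro k
    have h1 : ∑ l ∈ K, n l * T k l = ∑ j ∈ s, |g j k| ^ p / S j * ∑ l ∈ K, n l * χ j l := by
      simp only [hT, Finset.mul_sum]
      rw [Finset.sum_comm]
      refine Finset.sum_congr rfl fun j _ => Finset.sum_congr rfl fun l _ => ?_
      ring
    rw [h1]
    by_cases h : ∃ j ∈ s, g j k ≠ 0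
    · obtain ⟨j, hj, hjk⟩ := h
      rw [Finset.sum_eq_single_of_mem j hj]
      · have h2 : ∑ l ∈ K, n l * χ j l ≤ n k := by
          have : ∑ l ∈ K, n l * χ j l = ∑ l ∈ K with f j l ≠ 0, n l := by
            rw [Finset.sum_filter]
            refine Finset.sum_congr rfl fun l _ => ?_
            simp only [hχ]
            split_ifs <;> simp_all
          rw [this]
          refine sum_two_pow_le (fun l hl => hmK l (Finset.mem_filter.1 hl).1) fun l hl => ?_
          exact hfam.lt j hj l k (Finset.mem_filter.1 hl).2 hjk
        rw [div_mul_eq_mul_div]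
        refine div_le_one_of_le₀ ?_ (hS0 j)
        calc |g j k| ^ p * ∑ l ∈ K, n l * χ j l ≤ |g j k| ^ p * n k := by
              gcongr
          _ = n k * |g j k| ^ p := mul_comm _ _
          _ ≤ S j := hSg' j hj k
      · intro i hi hij
        rw [hdg j hj i hi hij.symm k hjk, abs_zero, Real.zero_rpow hp0, zero_div, zero_mul]
    · push Not at h
      rw [Finset.sum_eq_zero fun j hj => by
        rw [h j hj, abs_zero, Real.zero_rpow hp0, zero_div, zero_mul]]
      exact zero_le_one
  have hcolsum : ∀ l, ∑ k ∈ K, n k * T k l = ∑ j ∈ s, χ j l * (S j / S j) := by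
    intro l
    have h1 : ∑ k ∈ K, n k * T k l = ∑ j ∈ s, ∑ k ∈ K, χ j l / S j * (n k * |g j k| ^ p) := by
      simp only [hT, Finset.mul_sum]
      rw [Finset.sum_comm]
      refine Finset.sum_congr rfl fun j _ => Finset.sum_congr rfl fun k _ => ?_
      ring
    rw [h1]
    refine Finset.sum_congr rfl fun j hj => ?_
    rw [← Finset.mul_sum, ← hSg j hj]
    ring
  have hcol1 : ∀ l, (∑ j ∈ s, f j) l ≠ 0 → ∑ k ∈ K, n k * T k l = 1 := by
    intro l hl
    rw [hcolsum]
    obtain ⟨j, hj, hjl⟩ : ∃ j ∈ s, f j l ≠ 0 := by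
      by_contra h
      push Not at h
      exact hl (by rw [Finset.sum_apply]; exact Finset.sum_eq_zero h)
    rw [Finset.sum_eq_single_of_mem j hj, div_self (hSf j hj l hjl).ne']
    · simp [hχ, hjl]
    · intro i hi hij
      simp [hχ, hdf j hj i hi hij.symm l hjl]
  have hcol : ∀ l, ∑ k ∈ K, n k * T k l ≤ 1 := by
    intro l
    by_cases hl : (∑ j ∈ s, f j) l = 0
    · rw [hcolsum]
      rw [Finset.sum_eq_zero]
      · exact zero_le_one
      · intro j hj
        have : f j l = 0 := by
          by_contra h
          have h1 := Finset.sum_apply l s f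
          rw [hl, Finset.sum_eq_single_of_mem j hj fun i hi hij => hdf j hj i hi hij.symm l h] at h1
          exact h h1.symm
        simp [hχ, this]
    · exact (hcol1 l hl).le
  have hprod : ∀ k, ∑ l ∈ K, n l * (T k l * u l) = |(∑ j ∈ s, g j) k| ^ p := by
    intro k
    have h1 : ∑ l ∈ K, n l * (T k l * u l) =
        ∑ j ∈ s, |g j k| ^ p / S j * ∑ l ∈ K, n l * (χ j l * u l) := by
      simp only [hT, Finset.mul_sum, Finset.sum_mul]
      rw [Finset.sum_comm]
      refine Finset.sum_congr rfl fun j _ => Finset.sum_congr rfl fun l _ => ?_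
      ring
    rw [h1, abs_sum_rpow hdg hp0]
    refine Finset.sum_congr rfl fun j hj => ?_
    have h2 : ∑ l ∈ K, n l * (χ j l * u l) = S j := by
      refine Finset.sum_congr rfl fun l _ => ?_
      congr 1
      by_cases h : f j l = 0
      · simp [hχ, h, Real.zero_rpow hp0]
      · simp only [hχ, if_neg h, one_mul, hu, Finset.sum_apply]
        rw [Finset.sum_eq_single_of_mem j hj fun i hi hij => hdf j hj i hi hij.symm l h]
    rw [h2]
    rcases eq_or_ne (S j) 0 with h0 | h0
    · have h3 := hSg' j hj k
      rw [h0] at h3 ⊢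
      have h4 : |g j k| ^ p ≤ 0 := by
        by_contra h
        exact absurd h3 (not_le.2 (mul_pos (hn0 k) (not_le.1 h)))
      rw [le_antisymm h4 (habs _)]
      simp
    · exact div_mul_cancel₀ _ h0
  have hu0 : ∀ l, 0 ≤ u l := fun l => habs _
  have hC := isCells_dyadicCell hK hmJ hmK
  have hrow' : ∀ c : Σ k : K, Fin (2 ^ ((k : ℤ) - m).toNat),
      ∑ d : Σ k : K, Fin (2 ^ ((k : ℤ) - m).toNat), T c.1 d.1 ≤ 1 := fun c =>
    (sum_cells K m fun l => T c.1 l).trans_le (hrow c.1)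
  have hcol' : ∀ d : Σ k : K, Fin (2 ^ ((k : ℤ) - m).toNat),
      ∑ c : Σ k : K, Fin (2 ^ ((k : ℤ) - m).toNat), T c.1 d.1 ≤ 1 := fun d =>
    (sum_cells K m fun k => T k d.1).trans_le (hcol d.1)
  have hcol1' : ∀ d : Σ k : K, Fin (2 ^ ((k : ℤ) - m).toNat), u d.1 ≠ 0 →
      ∑ c : Σ k : K, Fin (2 ^ ((k : ℤ) - m).toNat), T c.1 d.1 = 1 := fun d hd =>
    (sum_cells K m fun k => T k d.1).trans (hcol1 d.1 fun h => hd (by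
      simp only [hu, h, abs_zero, Real.zero_rpow hp0]))
  have hTu : (fun c : Σ k : K, Fin (2 ^ ((k : ℤ) - m).toNat) =>
      (∑ d : Σ k : K, Fin (2 ^ ((k : ℤ) - m).toNat), T c.1 d.1 * u d.1) ^ (1 / p)) =
      fun c => |(∑ j ∈ s, g j) c.1| := by
    ext c
    rw [sum_cells K m fun l => T c.1 l * u l, hprod, ← Real.rpow_mul (abs_nonneg _),
      mul_one_div_cancel hp0, Real.rpow_one]
  have huu : (fun c : Σ k : K, Fin (2 ^ ((k : ℤ) - m).toNat) => u c.1 ^ (1 / p)) =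
      fun c => |(∑ j ∈ s, f j) c.1| := by
    ext c
    rw [← Real.rpow_mul (abs_nonneg _), mul_one_div_cancel hp0, Real.rpow_one]
  have hnorm : ∀ (Z : RISpace D) (h : ℤ → ℤ → ℝ), (∀ j ∈ s, ∀ k, h j k ≠ 0 → k ∈ K) →
      Z.fnorm (cellFn (dyadicCell K m) fun c => |(∑ j ∈ s, h j) c.1|) = Z.eNorm (∑ j ∈ s, h j) := by
    intro Z h hh
    rw [Z.fnorm_dyadicCell hK hmJ hmK (v := fun k => |(∑ j ∈ s, h j) k|)]
    · exact Z.isSeqNorm.congr fun k _ => abs_abs _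
    · intro k hk
      have hk' : (∑ j ∈ s, h j) k ≠ 0 := fun h0 => hk (by simp only [h0, abs_zero])
      by_contra hkK
      refine hk' ?_
      rw [Finset.sum_apply]
      refine Finset.sum_eq_zero fun j hj => ?_
      by_contra h0
      exact hkK (hh j hj k h0)
  constructor
  · have h1 := hY.cellFn_le hp Y.rearrangement_invariant hC ENNReal.ofReal_ne_top
      (T := fun c d => T c.1 d.1) (fun c d => hT0 _ _) hrow' hcol' (u := fun c => u c.1)
      fun c => hu0 _
    rw [hTu, huu, hnorm Y g hgK, hnorm Y f hfK] at h1
    exact h1.trans (mul_le_mul_left (ENNReal.coe_le_coe.2 (le_max_right _ _)) _)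
  · have h1 := hX.le_cellFn hp X.rearrangement_invariant hC ENNReal.ofReal_ne_top
      (T := fun c d => T c.1 d.1) (fun c d => hT0 _ _) hrow' hcol' (u := fun c => u c.1)
      (fun c => hu0 _) hcol1'
    rw [hTu, huu, hnorm X g hgK, hnorm X f hfK] at h1
    exact h1.trans (mul_le_mul_left (ENNReal.coe_le_coe.2 (le_max_left _ _)) _)


/-! ### Pairs of sequence norms with bounded spreading -/

section

variable {J : Set ℤ} {E F : (ℤ → ℝ) → ℝ≥0∞} {p : ℝ} {M : ℝ≥0}

theorem exists_smul_sum_eq {p : ℝ} (hp : 0 < p) {K : Finset ℤ} {f g : ℤ → ℝ}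
    (hf : ∀ k, f k ≠ 0 → k ∈ K) (hg : ∀ k, g k ≠ 0 → k ∈ K) (hf0 : f ≠ 0) (hg0 : g ≠ 0) :
    ∃ c : ℝ≥0, c ≠ 0 ∧
      ∑ k ∈ K, 2 ^ k * |f k| ^ p = ∑ k ∈ K, 2 ^ k * |((c : ℝ) • g) k| ^ p := by
  have hpos : ∀ h : ℤ → ℝ, (∀ k, h k ≠ 0 → k ∈ K) → h ≠ 0 → 0 < ∑ k ∈ K, 2 ^ k * |h k| ^ p := by
    intro h hh h0
    obtain ⟨k, hk⟩ := Function.ne_iff.1 h0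
    refine Finset.sum_pos' (fun k _ => by positivity) ⟨k, hh k hk, ?_⟩
    have := Real.rpow_pos_of_pos (abs_pos.2 hk) p
    positivity
  set a := ∑ k ∈ K, 2 ^ k * |f k| ^ p
  set b := ∑ k ∈ K, 2 ^ k * |g k| ^ p with hb
  have ha0 : 0 < a := hpos f hf hf0
  have hb0 : 0 < b := hpos g hg hg0
  have hc : 0 < (a / b) ^ (1 / p) := Real.rpow_pos_of_pos (div_pos ha0 hb0) _
  refine ⟨((a / b) ^ (1 / p)).toNNReal, by simpa using hc, ?_⟩
  rw [Real.coe_toNNReal _ hc.le]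
  have : ∀ k ∈ K, (2 : ℝ) ^ k * |((a / b) ^ (1 / p) • g) k| ^ p = a / b * (2 ^ k * |g k| ^ p) := by
    intro k _
    rw [Pi.smul_apply, smul_eq_mul, abs_mul, abs_of_pos hc,
      Real.mul_rpow hc.le (abs_nonneg _), ← Real.rpow_mul (div_pos ha0 hb0).le,
      one_div_mul_cancel hp.ne', Real.rpow_one]
    ring
  rw [Finset.sum_congr rfl this, ← Finset.mul_sum, ← hb, div_mul_cancel₀ _ hb0.ne']

theorem SpreadBound.exists_smul (H : SpreadBound J E F p M) (hp : 0 < p) (hE : IsSeqNorm J E)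
    (hF : IsSeqNorm J F) {s : Finset ℤ} {f g : ℤ → ℤ → ℝ} (hfam : ShiftFamily s f g)
    (hf : ∀ j ∈ s, ∀ k, f j k ≠ 0 → k ∈ J) (hg : ∀ j ∈ s, ∀ k, g j k ≠ 0 → k ∈ J)
    (hf0 : ∀ j ∈ s, f j ≠ 0) (hg0 : ∀ j ∈ s, g j ≠ 0) :
    ∃ c : ℤ → ℝ≥0, (∀ j ∈ s, c j ≠ 0) ∧ (∀ j ∈ s, c j * F (g j) ≤ M * F (f j)) ∧
      (∀ j ∈ s, E (f j) ≤ M * (c j * E (g j))) ∧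
      F (∑ j ∈ s, (c j : ℝ) • g j) ≤ M * F (∑ j ∈ s, f j) ∧
      E (∑ j ∈ s, f j) ≤ M * E (∑ j ∈ s, (c j : ℝ) • g j) := by
  classical
  have hfin : (⋃ j ∈ s, Function.support (f j) ∪ Function.support (g j)).Finite :=
    s.finite_toSet.biUnion fun j hj => (hfam.finite_left j hj).union (hfam.finite_right j hj)
  set K := hfin.toFinset with hK
  have hfK : ∀ j ∈ s, ∀ k, f j k ≠ 0 → k ∈ K := by
    intro j hj k hk
    simp only [hK, Set.Finite.mem_toFinset, Set.mem_iUnion]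
    exact ⟨j, hj, Or.inl hk⟩
  have hgK : ∀ j ∈ s, ∀ k, g j k ≠ 0 → k ∈ K := by
    intro j hj k hk
    simp only [hK, Set.Finite.mem_toFinset, Set.mem_iUnion]
    exact ⟨j, hj, Or.inr hk⟩
  have hKJ : (K : Set ℤ) ⊆ J := by
    intro k hk
    simp only [hK, Set.Finite.coe_toFinset, Set.mem_iUnion] at hk
    obtain ⟨j, hj, h | h⟩ := hk
    exacts [hf j hj k h, hg j hj k h]
  have hex : ∀ j, ∃ c : ℝ≥0, j ∈ s → c ≠ 0 ∧
      ∑ k ∈ K, 2 ^ k * |f j k| ^ p = ∑ k ∈ K, 2 ^ k * |((c : ℝ) • g j) k| ^ p := by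
    intro j
    by_cases hj : j ∈ s
    · obtain ⟨c, hc⟩ := exists_smul_sum_eq hp (hfK j hj) (hgK j hj) (hf0 j hj) (hg0 j hj)
      exact ⟨c, fun _ => hc⟩
    · exact ⟨0, fun h => absurd h hj⟩
  choose c hc using hex
  have hsm : ∀ j k, ((c j : ℝ) • g j) k ≠ 0 → g j k ≠ 0 := fun j k h h' => h (by simp [h'])
  have hfam' : ShiftFamily s f fun j => (c j : ℝ) • g j :=
    ⟨hfam.finite_left, fun j hj => (hfam.finite_right j hj).subset fun k hk => hsm j k hk,
      fun j hj a b ha hb => hfam.lt j hj a b ha (hsm j b hb),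
      fun i hi j hj hij a b ha hb => hfam.lt_of_lt i hi j hj hij a b (ha.imp_right (hsm i a))
        (hb.imp_right (hsm j b))⟩
  have key : ∀ s' ⊆ s, _ := fun s' hs' => H s' f (fun j => (c j : ℝ) • g j) K hKJ
    (hfam'.subset hs') (fun j hj => hfK j (hs' hj)) (fun j hj k hk => hgK j (hs' hj) k (hsm j k hk))
    fun j hj => (hc j (hs' hj)).2
  have hone : ∀ j ∈ s, F ((c j : ℝ) • g j) ≤ M * F (f j) ∧ E (f j) ≤ M * E ((c j : ℝ) • g j) := by
    intro j hj
    simpa using key {j} (by simpa using hj)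
  refine ⟨c, fun j hj => (hc j hj).1, fun j hj => ?_, fun j hj => ?_, key s subset_rfl⟩
  · rw [← hF.smul_coe]; exact (hone j hj).1
  · rw [← hE.smul_coe]; exact (hone j hj).2

theorem SpreadBound.exists_smul_single (H : SpreadBound J E F p M) (hp : 0 < p)
    (hE : IsSeqNorm J E) (hF : IsSeqNorm J F) {f g : ℤ → ℝ} (hfin : (Function.support f).Finite)
    (hgin : (Function.support g).Finite)
    (hf : ∀ k, f k ≠ 0 → k ∈ J) (hg : ∀ k, g k ≠ 0 → k ∈ J)
    (hlt : ∀ a b, f a ≠ 0 → g b ≠ 0 → a < b) (hf0 : f ≠ 0) (hg0 : g ≠ 0) :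
    ∃ c : ℝ≥0, c ≠ 0 ∧ c * F g ≤ M * F f ∧ E f ≤ M * (c * E g) := by
  obtain ⟨c, h0, h1, h2, -⟩ := H.exists_smul hp hE hF (s := {0}) (f := fun _ => f) (g := fun _ => g)
    ⟨fun _ _ => hfin, fun _ _ => hgin, fun _ _ => hlt, fun i hi j hj hij => by
      rw [Finset.mem_singleton] at hi hj
      omega⟩ (fun _ _ => hf) (fun _ _ => hg) (fun _ _ => hf0) fun _ _ => hg0
  exact ⟨c 0, h0 0 (by simp), h1 0 (by simp), h2 0 (by simp)⟩

/-- Restricting a shift family to `J` and to the indices where the second sequence is nonzero. -/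
theorem ShiftFamily.restrict {s s' : Finset ℤ} {f g : ℤ → ℤ → ℝ} (H : ShiftFamily s f g)
    (hs : s' ⊆ s) (J : Set ℤ) :
    ShiftFamily s' (fun j => J.indicator (f j)) fun j => J.indicator (g j) := by
  have h : ∀ (u : ℤ → ℝ) k, J.indicator u k ≠ 0 → u k ≠ 0 := fun u k hk h' => hk (by
    by_cases hkJ : k ∈ J <;> simp [hkJ, h'])
  exact ⟨fun j hj => (H.finite_left j (hs hj)).subset fun k hk => h _ k hk,
    fun j hj => (H.finite_right j (hs hj)).subset fun k hk => h _ k hk,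
    fun j hj a b ha hb => H.lt j (hs hj) a b (h _ _ ha) (h _ _ hb),
    fun i hi j hj hij a b ha hb => H.lt_of_lt i (hs hi) j (hs hj) hij a b
      (ha.imp (h _ _) (h _ _)) (hb.imp (h _ _) (h _ _))⟩

theorem IsSeqNorm.sum_indicator_self (hE : IsSeqNorm J E) (s : Finset ℤ) (f : ℤ → ℤ → ℝ) :
    E (∑ j ∈ s, J.indicator (f j)) = E (∑ j ∈ s, f j) :=
  hE.congr fun k hk => by simp [Finset.sum_apply, hk]

theorem IsSeqNorm.indicator_self (hE : IsSeqNorm J E) (f : ℤ → ℝ) :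
    E (J.indicator f) = E f :=
  hE.congr fun k hk => by simp [hk]

theorem IsSeqNorm.indicator_self_ne_zero (hE : IsSeqNorm J E) {f : ℤ → ℝ} (h : J.indicator f ≠ 0) :
    E f ≠ 0 := by
  obtain ⟨k, hk⟩ := Function.ne_iff.1 h
  have hkJ : k ∈ J := Set.mem_of_indicator_ne_zero hk
  rw [Set.indicator_of_mem hkJ] at hk
  refine ne_bot_of_le_ne_bot ?_ (hE.abs_mul_single_le f k)
  exact mul_ne_zero (by simpa using hk) (hE.single_ne_zero k hkJ)

theorem IsSeqNorm.sum_le_smul_sum (hE : IsSeqNorm J E) {s : Finset ℤ} {g : ℤ → ℤ → ℝ}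
    (hd : ∀ i ∈ s, ∀ j ∈ s, i ≠ j → ∀ k, g i k ≠ 0 → g j k = 0) {a b : ℤ → ℝ≥0} {M : ℝ≥0}
    (hab : ∀ j ∈ s, a j ≤ M * b j) :
    E (∑ j ∈ s, (a j : ℝ) • g j) ≤ M * E (∑ j ∈ s, (b j : ℝ) • g j) := by
  rw [← hE.smul_coe]
  refine hE.mono' fun k => ?_
  simp only [Pi.smul_apply, Finset.sum_apply, smul_eq_mul]
  by_cases h : ∃ j ∈ s, g j k ≠ 0
  · obtain ⟨j, hj, hjk⟩ := h
    have h0 : ∀ i ∈ s, i ≠ j → g i k = 0 := fun i hi hij => hd j hj i hi hij.symm k hjk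
    rw [Finset.sum_eq_single_of_mem j hj fun i hi hij => by rw [h0 i hi hij, mul_zero],
      Finset.sum_eq_single_of_mem j hj fun i hi hij => by rw [h0 i hi hij, mul_zero],
      ← mul_assoc, abs_mul, abs_mul]
    refine mul_le_mul_of_nonneg_right ?_ (abs_nonneg _)
    rw [abs_of_nonneg (by positivity), abs_of_nonneg (by positivity)]
    exact_mod_cast hab j hj
  · push Not at h
    rw [Finset.sum_eq_zero fun j hj => by rw [h j hj, mul_zero], abs_zero]
    exact abs_nonneg _

theorem SpreadBound.rightShift (H : SpreadBound J E F p M) (hp : 0 < p) (hE : IsSeqNorm J E)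
    (hF : IsSeqNorm J F) : RightShift E F (M * M) := by
  classical
  intro s f g hfam hle
  set s' := s.filter fun j => J.indicator (g j) ≠ 0 with hs'
  have hs : s' ⊆ s := Finset.filter_subset _ _
  have hfam' := hfam.restrict hs J
  have hg0 : ∀ j ∈ s', J.indicator (g j) ≠ 0 := fun j hj => (Finset.mem_filter.1 hj).2
  have hf1 : ∀ j ∈ s', E (f j) ≠ 0 := fun j hj =>
    ne_bot_of_le_ne_bot (hE.indicator_self_ne_zero (hg0 j hj)) (hle j (hs hj))
  have hf0 : ∀ j ∈ s', J.indicator (f j) ≠ 0 := fun j hj h => hf1 j hj (by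
    rw [← hE.indicator_self, h, hE.zero])
  obtain ⟨c, hc0, hcF, hcE, hcS, -⟩ := H.exists_smul hp hE hF hfam'
    (fun j _ k hk => Set.mem_of_indicator_ne_zero hk)
    (fun j _ k hk => Set.mem_of_indicator_ne_zero hk) hf0 hg0
  have hc1 : ∀ j ∈ s', (1 : ℝ≥0) ≤ M * c j := by
    intro j hj
    have h1 := hcE j hj
    rw [hE.indicator_self, hE.indicator_self] at h1
    have h2 : E (f j) * 1 ≤ E (f j) * (M * c j) := by
      rw [mul_one]
      refine h1.trans ?_
      rw [← mul_assoc, mul_comm]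
      exact mul_le_mul_left (hle j (hs hj)) _
    have h3 := (ENNReal.mul_le_mul_iff_right (hf1 j hj)
      (hE.ne_top_of_finite (hfam.finite_left j (hs hj)))).1 h2
    exact_mod_cast h3
  calc F (∑ j ∈ s, g j) = F (∑ j ∈ s', J.indicator (g j)) := by
        rw [hs', Finset.sum_filter_ne_zero, hF.sum_indicator_self]
    _ = F (∑ j ∈ s', ((1 : ℝ≥0) : ℝ) • J.indicator (g j)) := by simp
    _ ≤ M * F (∑ j ∈ s', (c j : ℝ) • J.indicator (g j)) :=
        hF.sum_le_smul_sum hfam'.disjoint_right hc1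
    _ ≤ M * (M * F (∑ j ∈ s', J.indicator (f j))) := mul_le_mul_right hcS _
    _ ≤ M * (M * F (∑ j ∈ s, f j)) := by
        rw [hF.sum_indicator_self]
        exact mul_le_mul_right (mul_le_mul_right
          (hF.sum_le_sum_of_subset hs hfam.disjoint_left) _) _
    _ = (M * M : ℝ≥0) * F (∑ j ∈ s, f j) := by rw [ENNReal.coe_mul, mul_assoc]

theorem SpreadBound.leftShift (H : SpreadBound J E F p M) (hp : 0 < p) (hE : IsSeqNorm J E)
    (hF : IsSeqNorm J F) : LeftShift F E (M * M) := by
  classical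
  intro s g f hfam hle
  set s' := s.filter fun j => J.indicator (f j) ≠ 0 with hs'
  have hs : s' ⊆ s := Finset.filter_subset _ _
  have hfam' := hfam.restrict hs J
  have hf0 : ∀ j ∈ s', J.indicator (f j) ≠ 0 := fun j hj => (Finset.mem_filter.1 hj).2
  have hg1 : ∀ j ∈ s', F (g j) ≠ 0 := fun j hj =>
    ne_bot_of_le_ne_bot (hF.indicator_self_ne_zero (hf0 j hj)) (hle j (hs hj))
  have hg0 : ∀ j ∈ s', J.indicator (g j) ≠ 0 := fun j hj h => hg1 j hj (by
    rw [← hF.indicator_self, h, hF.zero])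
  obtain ⟨c, hc0, hcF, hcE, -, hcS⟩ := H.exists_smul hp hE hF hfam'
    (fun j _ k hk => Set.mem_of_indicator_ne_zero hk)
    (fun j _ k hk => Set.mem_of_indicator_ne_zero hk) hf0 hg0
  have hc1 : ∀ j ∈ s', c j ≤ M * 1 := by
    intro j hj
    have h1 := hcF j hj
    rw [hF.indicator_self, hF.indicator_self] at h1
    have h2 : F (g j) * c j ≤ F (g j) * M := by
      rw [mul_comm, mul_comm (F (g j))]
      exact h1.trans (mul_le_mul_right (hle j (hs hj)) _)
    have h3 := (ENNReal.mul_le_mul_iff_right (hg1 j hj)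
      (hF.ne_top_of_finite (hfam.finite_right j (hs hj)))).1 h2
    rw [mul_one]
    exact_mod_cast h3
  calc E (∑ j ∈ s, f j) = E (∑ j ∈ s', J.indicator (f j)) := by
        rw [hs', Finset.sum_filter_ne_zero, hE.sum_indicator_self]
    _ ≤ M * E (∑ j ∈ s', (c j : ℝ) • J.indicator (g j)) := hcS
    _ ≤ M * (M * E (∑ j ∈ s', ((1 : ℝ≥0) : ℝ) • J.indicator (g j))) :=
        mul_le_mul_right (hE.sum_le_smul_sum hfam'.disjoint_right (b := fun _ => 1) hc1) _
    _ ≤ M * (M * E (∑ j ∈ s, g j)) := by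
        simp only [NNReal.coe_one, one_smul]
        rw [hE.sum_indicator_self]
        exact mul_le_mul_right (mul_le_mul_right
          (hE.sum_le_sum_of_subset hs hfam.disjoint_right) _) _
    _ = (M * M : ℝ≥0) * E (∑ j ∈ s, g j) := by rw [ENNReal.coe_mul, mul_assoc]

/-- A monotone retraction of `ℤ` onto `J` that moves by at most one step at a time. -/
structure IsClamp (J : Set ℤ) (cl : ℤ → ℤ) : Prop where
  mem : ∀ n, cl n ∈ J
  mono : Monotone cl
  fix : ∀ n ∈ J, cl n = n
  succ_le : ∀ n, cl (n + 1) ≤ cl n + 1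

variable {cl : ℤ → ℤ}

/-- The ratio `‖eₙ‖_E / ‖eₙ‖_F`, for `n` clamped to `J`. -/
noncomputable def clampRatio (E F : (ℤ → ℝ) → ℝ≥0∞) (cl : ℤ → ℤ) (n : ℤ) : ℝ≥0 :=
  (E (Pi.single (cl n) 1)).toNNReal / (F (Pi.single (cl n) 1)).toNNReal

theorem clampRatio_mul (hE : IsSeqNorm J E) (hF : IsSeqNorm J F) (hcl : IsClamp J cl) (n : ℤ) :
    clampRatio E F cl n * F (Pi.single (cl n) 1) = E (Pi.single (cl n) 1) := by
  have hF0 := hF.single_ne_zero _ (hcl.mem n)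
  have hF1 := hF.single_ne_top (cl n)
  rw [clampRatio, ENNReal.coe_div (by simp [ENNReal.toNNReal_eq_zero_iff, hF0, hF1]),
    ENNReal.coe_toNNReal hF1, ENNReal.coe_toNNReal (hE.single_ne_top _),
    ENNReal.div_mul_cancel hF0 hF1]

theorem clampRatio_pos (hE : IsSeqNorm J E) (hF : IsSeqNorm J F) (hcl : IsClamp J cl) (n : ℤ) :
    0 < clampRatio E F cl n :=
  div_pos (ENNReal.toNNReal_pos (hE.single_ne_zero _ (hcl.mem n)) (hE.single_ne_top _))
    (ENNReal.toNNReal_pos (hF.single_ne_zero _ (hcl.mem n)) (hF.single_ne_top _))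

theorem single_support_finite (n : ℤ) : (Function.support (Pi.single n (1 : ℝ))).Finite :=
  (Set.finite_singleton n).subset (by simp)

theorem single_one_ne_zero (n : ℤ) : (Pi.single n (1 : ℝ) : ℤ → ℝ) ≠ 0 := by simp

theorem eq_of_single_ne_zero {n k : ℤ} (h : (Pi.single n (1 : ℝ) : ℤ → ℝ) k ≠ 0) : k = n := by
  by_contra h'
  exact h (by simp [h'])

theorem SpreadBound.clampRatio_le (H : SpreadBound J E F p M) (hp : 0 < p) (hE : IsSeqNorm J E)
    (hF : IsSeqNorm J F) (hcl : IsClamp J cl) (hM : 1 ≤ M) {i j : ℤ} (hij : i ≤ j) :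
    clampRatio E F cl i ≤ M * M * clampRatio E F cl j := by
  rcases (hcl.mono hij).eq_or_lt with h | h
  · rw [clampRatio, h]
    exact le_mul_of_one_le_left zero_le (one_le_mul hM hM)
  obtain ⟨c, hc0, h1, h2⟩ := H.exists_smul_single hp hE hF (single_support_finite (cl i))
    (single_support_finite (cl j)) (fun k hk => eq_of_single_ne_zero hk ▸ hcl.mem i)
    (fun k hk => eq_of_single_ne_zero hk ▸ hcl.mem j)
    (fun a b ha hb => by rwa [eq_of_single_ne_zero ha, eq_of_single_ne_zero hb])
    (single_one_ne_zero _) (single_one_ne_zero _)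
  rw [← clampRatio_mul hE hF hcl, ← clampRatio_mul hE hF hcl] at h2
  have h3 : F (Pi.single (cl i) 1) * clampRatio E F cl i ≤
      F (Pi.single (cl i) 1) * (M * M * clampRatio E F cl j : ℝ≥0) := by
    rw [mul_comm]
    refine h2.trans ?_
    calc (M : ℝ≥0∞) * (c * (clampRatio E F cl j * F (Pi.single (cl j) 1)))
        = M * clampRatio E F cl j * (c * F (Pi.single (cl j) 1)) := by ring
      _ ≤ M * clampRatio E F cl j * (M * F (Pi.single (cl i) 1)) := mul_le_mul_right h1 _
      _ = _ := by push_cast; ring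
  have h4 := (ENNReal.mul_le_mul_iff_right (hF.single_ne_zero _ (hcl.mem i))
    (hF.single_ne_top _)).1 h3
  exact_mod_cast h4

/-- The increasing majorant of the ratios `‖eₙ‖_E / ‖eₙ‖_F`. -/
noncomputable def coupleScale (E F : (ℤ → ℝ) → ℝ≥0∞) (cl : ℤ → ℤ) (n : ℤ) : ℝ≥0 :=
  ⨆ i : Set.Iic n, clampRatio E F cl i

theorem SpreadBound.isCouple (H : SpreadBound J E F p M) (hp : 0 < p) (hE : IsSeqNorm J E)
    (hF : IsSeqNorm J F) (hcl : IsClamp J cl) (hM : 1 ≤ M)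
    (hE2 : ∀ k ∈ J, k + 1 ∈ J → E (Pi.single (k + 1) 1) ≤ 2 * E (Pi.single k 1))
    (hF2 : ∀ k ∈ J, k + 1 ∈ J → F (Pi.single k 1) ≤ F (Pi.single (k + 1) 1)) :
    ∃ C, IsCouple J E F (coupleScale E F cl) C := by
  set τ := clampRatio E F cl with hτ
  set t := coupleScale E F cl with ht
  have hbdd : ∀ n, BddAbove (Set.range fun i : Set.Iic n => τ i) := fun n =>
    ⟨M * M * τ n, by
      rintro _ ⟨i, rfl⟩
      exact H.clampRatio_le hp hE hF hcl hM i.2⟩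
  have hτt : ∀ n, τ n ≤ t n := fun n => le_ciSup (hbdd n) ⟨n, Set.self_mem_Iic⟩
  have htτ : ∀ n, t n ≤ M * M * τ n := fun n =>
    ciSup_le' fun i => H.clampRatio_le hp hE hF hcl hM i.2
  have hstep : ∀ n, τ (n + 1) ≤ 2 * τ n := by
    intro n
    have hc := hcl.succ_le n
    rcases (hcl.mono (Int.le_add_one (le_refl n))).eq_or_lt with h | h
    · rw [hτ, clampRatio, clampRatio, ← h]
      exact le_mul_of_one_le_left zero_le (by norm_num)
    · have h' : cl (n + 1) = cl n + 1 := by omega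
      have h0 := hcl.mem (n + 1)
      rw [h'] at h0
      rw [hτ, clampRatio, clampRatio, ← mul_div_assoc]
      refine div_le_div₀ zero_le ?_ (ENNReal.toNNReal_pos (hF.single_ne_zero _ (hcl.mem n))
        (hF.single_ne_top _)) ?_
      · rw [h']
        have := ENNReal.toNNReal_mono (ENNReal.mul_ne_top (by simp) (hE.single_ne_top _))
          (hE2 _ (hcl.mem n) h0)
        rwa [ENNReal.toNNReal_mul] at this
      · rw [h']
        exact ENNReal.toNNReal_mono (hF.single_ne_top _) (hF2 _ (hcl.mem n) h0)
  have hM2 : (1 : ℝ≥0) ≤ M * M := one_le_mul hM hM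
  have hmul := clampRatio_mul hE hF hcl
  have hτtop : ∀ n, (τ n : ℝ≥0∞) ≠ ∞ := fun n => ENNReal.coe_ne_top
  have htτ' : ∀ n, (t n : ℝ≥0∞) ≤ M * M * τ n := fun n => by exact_mod_cast htτ n
  have hfin : ∀ (s : Finset ℤ) (S : Set ℤ) (x : ℤ → ℝ),
      (Function.support (((s : Set ℤ) ∩ S).indicator x)).Finite := fun s S x =>
    s.finite_toSet.subset fun k hk => (Set.mem_of_indicator_ne_zero hk).1
  have hleft : ∀ n x, E ((Set.Iio n).indicator x) ≤ (M * M + 1 : ℝ≥0) * t n * F x := by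
    intro n x
    refine hE.fatou _ _ fun s => ?_
    set m := cl n with hm
    set y := ((s : Set ℤ) ∩ {k | k ∈ J ∧ k < m}).indicator x with hy
    have hyF : F y ≤ F x := hF.indicator_le _ _
    have h1 : E ((s : Set ℤ).indicator ((Set.Iio n).indicator x)) ≤ E (y + Pi.single m (x m)) := by
      refine hE.mono _ _ fun k hk => ?_
      by_cases hs : k ∈ (s : Set ℤ)
      · by_cases hkn : k < n
        · have hkm : k ≤ m := by
            rw [← hcl.fix k hk]; exact hcl.mono hkn.le
          rcases hkm.eq_or_lt with rfl | h
          · simp [hs, hkn, hy]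
          · simp [hs, hkn, hy, hk, h, h.ne]
        · rw [Set.indicator_of_mem hs, Set.indicator_of_notMem (show k ∉ Set.Iio n from hkn), abs_zero]
          exact abs_nonneg _
      · rw [Set.indicator_of_notMem hs, abs_zero]; exact abs_nonneg _
    have h2 : E y ≤ M * M * (τ n * F y) := by
      by_cases hy0 : y = 0
      · rw [hy0, hE.zero]; exact zero_le
      obtain ⟨c, hc0, h3, h4⟩ := H.exists_smul_single hp hE hF (hfin s _ x)
        (single_support_finite m) (fun k hk => (Set.mem_of_indicator_ne_zero hk).2.1)
        (fun k hk => eq_of_single_ne_zero hk ▸ hcl.mem n)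
        (fun a b ha hb => eq_of_single_ne_zero hb ▸ (Set.mem_of_indicator_ne_zero ha).2.2)
        hy0 (single_one_ne_zero _)
      calc E y ≤ M * (c * E (Pi.single m 1)) := h4
        _ = M * τ n * (c * F (Pi.single m 1)) := by rw [hm, ← hmul]; ring
        _ ≤ M * τ n * (M * F y) := mul_le_mul_right h3 _
        _ = _ := by ring
    have h3 : E (Pi.single m (x m)) ≤ τ n * F x := by
      rw [hE.single, hm, ← hmul, mul_left_comm]
      exact mul_le_mul_right (hF.abs_mul_single_le x _) _
    have h4 : (τ n : ℝ≥0∞) ≤ t n := by exact_mod_cast hτt n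
    calc _ ≤ E y + E (Pi.single m (x m)) := h1.trans (hE.add_le _ _)
      _ ≤ M * M * (t n * F x) + t n * F x :=
        add_le_add (h2.trans (mul_le_mul_right (mul_le_mul' h4 hyF) _))
          (h3.trans (mul_le_mul_left h4 _))
      _ = _ := by push_cast; ring
  have hright : ∀ n x, t n * F ((Set.Ici n).indicator x) ≤ (M * M * (M * M + 1) : ℝ≥0) * E x := by
    intro n x
    have ht0 : (t n : ℝ≥0∞) ≠ 0 := by
      have := (clampRatio_pos hE hF hcl n).trans_le (hτt n)
      exact_mod_cast this.ne'
    rw [mul_comm, ← ENNReal.le_div_iff_mul_le (Or.inl ht0) (Or.inl ENNReal.coe_ne_top)]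
    refine hF.fatou _ _ fun s => ?_
    rw [ENNReal.le_div_iff_mul_le (Or.inl ht0) (Or.inl ENNReal.coe_ne_top), mul_comm]
    set m := cl n with hm
    set y := ((s : Set ℤ) ∩ {k | k ∈ J ∧ m < k}).indicator x with hy
    have hyE : E y ≤ E x := hE.indicator_le _ _
    have h1 : F ((s : Set ℤ).indicator ((Set.Ici n).indicator x)) ≤ F (y + Pi.single m (x m)) := by
      refine hF.mono _ _ fun k hk => ?_
      by_cases hs : k ∈ (s : Set ℤ)
      · by_cases hkn : n ≤ k
        · have hkm : m ≤ k := by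
            rw [← hcl.fix k hk]; exact hcl.mono hkn
          rcases hkm.eq_or_lt with rfl | h
          · simp [hs, hkn, hy]
          · simp [hs, hkn, hy, hk, h, h.ne']
        · rw [Set.indicator_of_mem hs, Set.indicator_of_notMem (show k ∉ Set.Ici n from hkn), abs_zero]
          exact abs_nonneg _
      · rw [Set.indicator_of_notMem hs, abs_zero]; exact abs_nonneg _
    have h2 : τ n * F y ≤ M * M * E y := by
      by_cases hy0 : y = 0
      · rw [hy0, hF.zero, mul_zero]; exact zero_le
      obtain ⟨c, hc0, h3, h4⟩ := H.exists_smul_single hp hE hF (single_support_finite m)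
        (hfin s _ x) (fun k hk => eq_of_single_ne_zero hk ▸ hcl.mem n)
        (fun k hk => (Set.mem_of_indicator_ne_zero hk).2.1)
        (fun a b ha hb => eq_of_single_ne_zero ha ▸ (Set.mem_of_indicator_ne_zero hb).2.2)
        (single_one_ne_zero _) hy0
      have hc : (c : ℝ≥0∞) ≠ 0 := by exact_mod_cast hc0
      refine (ENNReal.mul_le_mul_iff_right hc ENNReal.coe_ne_top).1 ?_
      calc c * (τ n * F y) = τ n * (c * F y) := by ring
        _ ≤ τ n * (M * F (Pi.single m 1)) := mul_le_mul_right h3 _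
        _ = M * E (Pi.single m 1) := by rw [hm, ← hmul]; ring
        _ ≤ M * (M * (c * E y)) := mul_le_mul_right h4 _
        _ = _ := by ring
    have h3 : τ n * F (Pi.single m (x m)) ≤ E x := by
      rw [hF.single, mul_left_comm, hm, hmul]
      exact hE.abs_mul_single_le x _
    calc t n * F ((s : Set ℤ).indicator ((Set.Ici n).indicator x))
        ≤ M * M * τ n * (F y + F (Pi.single m (x m))) :=
          mul_le_mul' (htτ' n) (h1.trans (hF.add_le _ _))
      _ = M * M * (τ n * F y + τ n * F (Pi.single m (x m))) := by ring
      _ ≤ M * M * (M * M * E x + E x) := mul_le_mul_right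
          (add_le_add (h2.trans (mul_le_mul_right hyE _)) h3) _
      _ = _ := by push_cast; ring
  have hC1 : M * M ≤ 2 * (M * M * (M * M + 1)) := by nlinarith
  have hC2 : M * M + 1 ≤ 2 * (M * M * (M * M + 1)) := by nlinarith
  have hC3 : M * M * (M * M + 1) ≤ 2 * (M * M * (M * M + 1)) := by nlinarith
  have hC4 : 2 * (M * M) ≤ 2 * (M * M * (M * M + 1)) := by nlinarith
  refine ⟨2 * (M * M * (M * M + 1)), hE, hF, fun n => (clampRatio_pos hE hF hcl n).trans_le (hτt n),
    fun i j hij => ciSup_le' fun k => le_ciSup (hbdd j) ⟨k, le_trans k.2 hij⟩, fun n => ?_,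
    fun n x => (hleft n x).trans (mul_le_mul_left (mul_le_mul_left (by exact_mod_cast hC2) _) _),
    fun n x => (hright n x).trans (mul_le_mul_left (by exact_mod_cast hC3) _),
    fun s h g h1 h2 => (H.rightShift hp hE hF s h g h1 h2).trans
      (mul_le_mul_left (by exact_mod_cast hC1) _),
    fun s h g h1 h2 => (H.leftShift hp hE hF s h g h1 h2).trans
      (mul_le_mul_left (by exact_mod_cast hC1) _)⟩
  calc t (n + 1) ≤ M * M * τ (n + 1) := htτ _
    _ ≤ M * M * (2 * τ n) := by gcongr; exact hstep n
    _ ≤ M * M * (2 * t n) := by gcongr; exact hτt n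
    _ = 2 * (M * M) * t n := by ring
    _ ≤ _ := by gcongr

end

/-- The retraction of `ℤ` onto the index set of the dyadic intervals. -/
def Domain.clamp : Domain → ℤ → ℤ
  | unitInterval => fun n => min n (-1)
  | halfLine => id
  | naturals => fun n => max n 0

theorem Domain.isClamp (D : Domain) : IsClamp D.index D.clamp := by
  cases D
  · refine ⟨fun n => ?_, fun i j h => ?_, fun n hn => ?_, fun n => ?_⟩
    · change min n (-1) < 0; omega
    · change min i (-1) ≤ min j (-1); omega
    · change n < 0 at hn; change min n (-1) = n; omega
    · change min (n + 1) (-1) ≤ min n (-1) + 1; omega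
  · exact ⟨fun n => Set.mem_univ _, fun i j h => h, fun n _ => rfl, fun n => le_rfl⟩
  · refine ⟨fun n => ?_, fun i j h => ?_, fun n hn => ?_, fun n => ?_⟩
    · change 0 ≤ max n 0; omega
    · change max i 0 ≤ max j 0; omega
    · change 0 ≤ n at hn; change max n 0 = n; omega
    · change max (n + 1) 0 ≤ max n 0 + 1; omega

theorem RISpace.exists_isCouple {D : Domain} {X Y : RISpace D} {p : ℝ} (hp : 1 ≤ p)
    (hX : X.IsPConcave p) (hY : Y.IsPConvex p) :
    ∃ C, IsCouple D.index X.eNorm Y.eNorm (coupleScale X.eNorm Y.eNorm D.clamp) C := by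
  obtain ⟨M₁, h1⟩ := hX.exists_with
  obtain ⟨M₂, h2⟩ := hY.exists_with
  have h3 := RISpace.spreadBound hp h1 h2
  have h4 : SpreadBound D.index X.eNorm Y.eNorm p (max 1 (max M₁ M₂)) := by
    intro s f g K hK hfam hf hg heq
    have hle : ((max M₁ M₂ : ℝ≥0) : ℝ≥0∞) ≤ (max 1 (max M₁ M₂) : ℝ≥0) :=
      ENNReal.coe_le_coe.2 (le_max_right _ _)
    exact ⟨(h3 s f g K hK hfam hf hg heq).1.trans (mul_le_mul_left hle _),
      (h3 s f g K hK hfam hf hg heq).2.trans (mul_le_mul_left hle _)⟩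
  exact h4.isCouple (by positivity) X.isSeqNorm Y.isSeqNorm D.isClamp (le_max_left _ _)
    (fun k hk _ => X.eNorm_single_succ_le hk) fun k hk hk' => Y.eNorm_single_le_succ hk hk'


variable {D : Domain}

/-! ### Averaging over pieces -/

/-- A function can be approximated from below by functions that are constant on cells. -/
theorem Domain.exists_cell_values (D : Domain) {S : Set ℝ} (hS : MeasurableSet S)
    (hfin : D.measure S ≠ ∞) {h : ℝ → ℝ} {L : ℝ≥0∞} (hL : L < ∫⁻ ω in S, ‖h ω‖ₑ ∂D.measure) :
    ∃ m₀ ∈ D.index, ∀ m ∈ D.index, m ≤ m₀ → ∃ (n : ℕ) (B : Fin n → Set ℝ) (v : Fin n → ℝ≥0),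
      IsCells D.measure (ENNReal.ofReal (2 ^ m)) B ∧ (∀ i, B i ⊆ S) ∧
      (∀ i, ∀ ω ∈ B i, (v i : ℝ) ≤ |h ω|) ∧ L < (∑ i, (v i : ℝ≥0∞)) * ENNReal.ofReal (2 ^ m) := by
  classical
  obtain ⟨g, hg, -, hgL⟩ := exists_lt_lintegral_simpleFunc_of_lt_lintegral
    (μ := D.measure.restrict S) (f := fun ω => ‖h ω‖₊) hL
  have hsum : ∫⁻ ω in S, g ω ∂D.measure =
      ∑ x ∈ g.range, (x : ℝ≥0∞) * D.measure (g ⁻¹' {x} ∩ S) := by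
    have h1 := SimpleFunc.lintegral_eq_lintegral (g.map ((↑) : ℝ≥0 → ℝ≥0∞)) (D.measure.restrict S)
    rw [SimpleFunc.map_lintegral] at h1
    refine h1.trans ?_
    refine Finset.sum_congr rfl fun x _ => ?_
    rw [Measure.restrict_apply (g.measurableSet_fiber x)]
  rw [hsum] at hgL
  set σ := ∑ x ∈ g.range, (x : ℝ≥0∞) with hσ
  have hσfin : σ ≠ ∞ := (ENNReal.sum_lt_top.2 fun x _ => ENNReal.coe_lt_top).ne
  obtain ⟨ε, hε, hεσ⟩ := ENNReal.exists_nnreal_pos_mul_lt hσfin (tsub_pos_of_lt hgL).ne'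
  rw [lt_tsub_iff_left] at hεσ
  obtain ⟨m₀, hm₀, hscale⟩ := D.exists_scale (ε := ε) (by exact_mod_cast hε)
  refine ⟨m₀, hm₀, fun m hm hmm => ?_⟩
  have hmeas : ∀ x, MeasurableSet (g ⁻¹' {x} ∩ S) := fun x => (g.measurableSet_fiber x).inter hS
  choose N hN hN' using fun x => hscale m hm hmm _ (hmeas x)
    (ne_top_of_le_ne_top hfin (measure_mono Set.inter_subset_right))
  choose B hB hBS hBd hBμ using fun x => D.exists_cells hm (hmeas x) (N x) (hN x)
  set δ := ENNReal.ofReal (2 ^ m)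
  set ι := Σ x : g.range, Fin (N x)
  set e : Fin (Fintype.card ι) ≃ ι := (Fintype.equivFin ι).symm
  have hcells : IsCells D.measure δ fun i : ι => B i.1 i.2 := by
    refine ⟨fun i => hB _ _, ?_, fun i => hBμ _ _⟩
    rintro ⟨x, i⟩ ⟨y, j⟩ hne
    by_cases hxy : x = y
    · subst hxy
      exact hBd x i j fun h => hne (by rw [h])
    · refine Set.disjoint_left.2 fun ω h1 h2 => hxy (Subtype.ext ?_)
      have h3 : g ω = x := (hBS _ _ h1).1
      have h4 : g ω = y := (hBS _ _ h2).1
      exact h3.symm.trans h4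
  refine ⟨Fintype.card ι, fun i => B (e i).1 (e i).2, fun i => (e i).1,
    ⟨fun i => hcells.measurable _, fun i j hij => hcells.disjoint _ _ (e.injective.ne hij),
      fun i => hcells.measure _⟩, fun i => (hBS _ _).trans Set.inter_subset_right, ?_, ?_⟩
  · intro i ω hω
    have h1 : g ω = (e i).1 := (hBS _ _ hω).1
    change (((e i).1 : ℝ≥0) : ℝ) ≤ |h ω|
    rw [← h1]
    exact_mod_cast hg ω
  · rw [Equiv.sum_comp e fun i => (((i.1 : ℝ≥0) : ℝ≥0∞))]
    by_contra hcon
    refine absurd hεσ (not_lt.2 ?_)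
    calc ∑ x ∈ g.range, (x : ℝ≥0∞) * D.measure (g ⁻¹' {x} ∩ S)
        ≤ ∑ x ∈ g.range, (x : ℝ≥0∞) * (N x * δ + ε) :=
          Finset.sum_le_sum fun x _ => mul_le_mul_right (hN' x) _
      _ = (∑ x ∈ g.range, (N x : ℝ≥0∞) * x) * δ + ε * σ := by
          rw [hσ, Finset.sum_mul, Finset.mul_sum, ← Finset.sum_add_distrib]
          exact Finset.sum_congr rfl fun x _ => by ring
      _ = (∑ i : ι, (((i.1 : ℝ≥0) : ℝ≥0∞))) * δ + ε * σ := by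
          congr 2
          rw [Fintype.sum_sigma, ← Finset.sum_coe_sort g.range]
          exact Finset.sum_congr rfl fun x _ => by simp
      _ ≤ L + ε * σ := by gcongr; exact not_lt.1 hcon

theorem KotheSpace.IsRearrangementInvariant.cellFn_embedding {Ω ι κ : Type*} [MeasurableSpace Ω]
    {μ : Measure Ω} [Fintype ι] [Fintype κ] {X : KotheSpace μ} (hX : X.IsRearrangementInvariant)
    {A : ι → Set Ω} {B : κ → Set Ω} {δ : ℝ≥0∞} (hA : IsCells μ δ A) (hB : IsCells μ δ B)
    (e : ι ↪ κ) {v : ι → ℝ} {w : κ → ℝ} (hw : ∀ i, w (e i) = v i)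
    (hw0 : ∀ j, j ∉ Set.range e → w j = 0) : X.fnorm (cellFn A v) = X.fnorm (cellFn B w) := by
  refine hX.cellFn_congr hA hB fun s hs => ?_
  rw [← Finset.card_map e]
  congr 1
  ext j
  simp only [Finset.mem_map, Finset.mem_filter, Finset.mem_univ, true_and]
  constructor
  · rintro ⟨i, hi, rfl⟩
    rwa [hw]
  · intro h
    by_cases hj : j ∈ Set.range e
    · obtain ⟨i, rfl⟩ := hj
      exact ⟨i, by rwa [hw] at h, rfl⟩
    · rw [hw0 j hj, abs_zero] at h
      exact absurd h (not_lt.2 hs)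

/-- Replacing a function by step functions below its averages does not increase the norm. -/
theorem RISpace.eNorm_le_of_lt_lintegral (X : RISpace D) {A : ℤ → Set ℝ}
    (hA : IsPieces D D.index A) {h : ℝ → ℝ} (K : Finset ℤ)
    (hK : (K : Set ℤ) ⊆ D.index) {c : ℤ → ℝ} (hc0 : ∀ k ∈ K, 0 ≤ c k)
    (hc : ∀ k ∈ K, ENNReal.ofReal (c k * 2 ^ k) < ∫⁻ ω in A k, ‖h ω‖ₑ ∂D.measure) :
    X.eNorm ((K : Set ℤ).indicator c) ≤ X.fnorm h := by
  classical
  rcases K.eq_empty_or_nonempty with rfl | hKne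
  · have : ((∅ : Finset ℤ) : Set ℤ).indicator c = 0 := by simp; rfl
    rw [this, X.isSeqNorm.zero]
    exact zero_le
  have hex : ∀ k : ℤ, ∃ m₀ : ℤ, k ∈ K → m₀ ∈ D.index ∧ ∀ m ∈ D.index, m ≤ m₀ →
      ∃ (n : ℕ) (B : Fin n → Set ℝ) (v : Fin n → ℝ≥0),
      IsCells D.measure (ENNReal.ofReal (2 ^ m)) B ∧ (∀ i, B i ⊆ A k) ∧
      (∀ i, ∀ ω ∈ B i, (v i : ℝ) ≤ |h ω|) ∧
      ENNReal.ofReal (c k * 2 ^ k) < (∑ i, (v i : ℝ≥0∞)) * ENNReal.ofReal (2 ^ m) := by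
    intro k
    by_cases hk : k ∈ K
    · obtain ⟨m₀, h1, h2⟩ := D.exists_cell_values (hA.measurable k)
        (by rw [hA.measure k (hK hk)]; exact ENNReal.ofReal_ne_top) (hc k hk)
      exact ⟨m₀, fun _ => ⟨h1, h2⟩⟩
    · exact ⟨0, fun h => absurd h hk⟩
  choose m₀ hm₀ using hex
  obtain ⟨k₀, hk₀, hmin⟩ := K.exists_min_image (fun k => min k (m₀ k)) hKne
  set m := min k₀ (m₀ k₀) with hm
  have hmJ : m ∈ D.index := by
    rcases min_choice k₀ (m₀ k₀) with h | h
    · rw [hm, h]; exact hK hk₀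
    · rw [hm, h]; exact (hm₀ k₀ hk₀).1
  have hmK : ∀ k ∈ K, m ≤ k := fun k hk => (hmin k hk).trans (min_le_left _ _)
  choose n B v hB hBA hBv hBL using fun k : K =>
    (hm₀ k k.2).2 m hmJ ((hmin k k.2).trans (min_le_right _ _))
  set δ := ENNReal.ofReal (2 ^ m) with hδ
  have hpos : (0 : ℝ) < 2 ^ m := by positivity
  have hδ0 : δ ≠ 0 := by simpa [hδ] using hpos
  have h2k : ∀ k ∈ K, ENNReal.ofReal (2 ^ k) = (2 ^ (k - m).toNat : ℕ) * δ := by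
    intro k hk
    rw [two_zpow_eq_mul (hmK k hk), ENNReal.ofReal_mul (by positivity)]
    congr 1
    rw [ENNReal.ofReal_pow (by norm_num)]
    simp
  have hn : ∀ k : K, n k ≤ 2 ^ ((k : ℤ) - m).toNat := by
    intro k
    have h1 : D.measure (⋃ i, B k i) ≤ D.measure (A k) :=
      measure_mono (Set.iUnion_subset (hBA k))
    rw [measure_iUnion (fun i j hij => (hB k).disjoint i j hij) fun i => (hB k).measurable i,
      hA.measure k (hK k.2), h2k k k.2, tsum_fintype,
      Finset.sum_congr rfl fun i _ => (hB k).measure i, Finset.sum_const, nsmul_eq_mul,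
      Finset.card_univ, Fintype.card_fin] at h1
    rw [ENNReal.mul_le_mul_iff_left hδ0 ENNReal.ofReal_ne_top] at h1
    exact_mod_cast h1
  set w : (Σ k : K, Fin (2 ^ ((k : ℤ) - m).toNat)) → ℝ := fun d =>
    if h : (d.2 : ℕ) < n d.1 then v d.1 ⟨d.2, h⟩ else 0 with hw
  have hw0 : ∀ d, 0 ≤ w d := fun d => by
    simp only [hw]; split_ifs
    exacts [NNReal.coe_nonneg _, le_rfl]
  have hcells : IsCells D.measure δ fun i : (Σ k : K, Fin (n k)) => B i.1 i.2 := by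
    refine ⟨fun i => (hB _).measurable _, ?_, fun i => (hB _).measure _⟩
    rintro ⟨x, i⟩ ⟨y, j⟩ hne
    by_cases hxy : x = y
    · subst hxy
      exact (hB x).disjoint i j fun h => hne (by rw [h])
    · exact (hA.disjoint x y fun h => hxy (Subtype.ext h)).mono (hBA _ _) (hBA _ _)
  have hC := isCells_dyadicCell hK hmJ hmK
  set e : (Σ k : K, Fin (n k)) ↪ Σ k : K, Fin (2 ^ ((k : ℤ) - m).toNat) :=
    ⟨fun i => ⟨i.1, Fin.castLE (hn i.1) i.2⟩, by
      rintro ⟨x, i⟩ ⟨y, j⟩ hxy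
      simp only [Sigma.mk.injEq] at hxy
      obtain ⟨rfl, h2⟩ := hxy
      rw [Fin.castLE_injective (hn x) (eq_of_heq h2)]⟩ with he
  have h1 : X.fnorm (cellFn (fun i : (Σ k : K, Fin (n k)) => B i.1 i.2) fun i => (v i.1 i.2 : ℝ)) =
      X.fnorm (cellFn (dyadicCell K m) w) := by
    refine X.rearrangement_invariant.cellFn_embedding hcells hC e ?_ ?_
    · rintro ⟨k, i⟩
      exact dif_pos (show ((Fin.castLE (hn k) i : Fin _) : ℕ) < n k from i.2)
    · rintro ⟨k, i⟩ hi
      simp only [hw]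
      split_ifs with h
      · exact absurd ⟨⟨k, ⟨i, h⟩⟩, rfl⟩ hi
      · rfl
  have h2 : X.fnorm (cellFn (fun i : (Σ k : K, Fin (n k)) => B i.1 i.2) fun i => (v i.1 i.2 : ℝ)) ≤
      X.fnorm h := by
    refine X.fnorm_mono (hcells.aestronglyMeasurable _) (ae_of_all _ fun ω => ?_)
    by_cases hω : ∃ i : (Σ k : K, Fin (n k)), ω ∈ B i.1 i.2
    · obtain ⟨i, hi⟩ := hω
      rw [hcells.cellFn_eq _ (i := i) hi, NNReal.abs_eq]
      exact hBv _ _ ω hi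
    · push Not at hω
      rw [cellFn_eq_zero _ hω, abs_zero]
      exact abs_nonneg _
  set q : ℤ → ℝ := fun k => 2 ^ (k - m).toNat with hq
  have hq0 : ∀ k, 0 < q k := fun k => by positivity
  set T : (Σ k : K, Fin (2 ^ ((k : ℤ) - m).toNat)) → (Σ k : K, Fin (2 ^ ((k : ℤ) - m).toNat)) → ℝ :=
    fun c d => if c.1 = d.1 then (q c.1)⁻¹ else 0 with hT
  have hTsum : ∀ (c : Σ k : K, Fin (2 ^ ((k : ℤ) - m).toNat))
      (u : (Σ k : K, Fin (2 ^ ((k : ℤ) - m).toNat)) → ℝ),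
      ∑ d, T c d * u d = (q c.1)⁻¹ * ∑ i, u ⟨c.1, i⟩ := by
    intro c u
    rw [Fintype.sum_sigma, Finset.sum_eq_single_of_mem c.1 (Finset.mem_univ _)]
    · simp only [hT, if_true, Finset.mul_sum]
    · intro k _ hk
      exact Finset.sum_eq_zero fun i _ => by simp [hT, hk.symm]
  have hT0 : ∀ c d, 0 ≤ T c d := fun c d => by
    simp only [hT]; split_ifs
    exacts [(inv_pos.2 (hq0 _)).le, le_rfl]
  have hrow : ∀ c, ∑ d, T c d ≤ 1 := by
    intro c
    have := hTsum c fun _ => 1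
    simp only [mul_one] at this
    rw [this]
    simp [hq]
  have hsymm : ∀ c d, T c d = T d c := by
    intro c d
    simp only [hT]
    by_cases h : c.1 = d.1
    · rw [if_pos h, if_pos h.symm, h]
    · rw [if_neg h, if_neg fun h' => h h'.symm]
  have hcol : ∀ d, ∑ c, T c d ≤ 1 := fun d => by
    rw [Finset.sum_congr rfl fun c _ => hsymm c d]; exact hrow d
  have h3 := X.pConvexWith_one.cellFn_le le_rfl X.rearrangement_invariant hC ENNReal.ofReal_ne_top
    hT0 hrow hcol hw0
  simp only [div_one, Real.rpow_one, hTsum, ENNReal.coe_one, one_mul] at h3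
  set a : ℤ → ℝ := fun k => if hk : k ∈ K then (q k)⁻¹ * ∑ i, w ⟨⟨k, hk⟩, i⟩ else 0 with ha
  have h4 : X.fnorm (cellFn (dyadicCell K m) fun c => (q c.1)⁻¹ * ∑ i, w ⟨c.1, i⟩) = X.eNorm a := by
    rw [← X.fnorm_dyadicCell hK hmJ hmK (v := a) fun k hk => by
      by_contra h
      exact hk (by simp [ha, h])]
    congr 1
    ext ω
    refine Finset.sum_congr rfl fun i _ => ?_
    simp only [ha, dif_pos i.1.2]
  have h5 : X.eNorm ((K : Set ℤ).indicator c) ≤ X.eNorm a := by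
    refine X.isSeqNorm.mono' fun k => ?_
    by_cases hk : k ∈ K
    · rw [Set.indicator_of_mem (by exact_mod_cast hk), abs_of_nonneg (hc0 k hk)]
      refine le_trans ?_ (le_abs_self _)
      simp only [ha, dif_pos hk]
      have h6 : ∑ i, w ⟨⟨k, hk⟩, i⟩ = ∑ i, (v ⟨k, hk⟩ i : ℝ) := by
        symm
        refine Finset.sum_of_injOn (Fin.castLE (hn ⟨k, hk⟩))
          (fun i _ j _ h => Fin.castLE_injective _ h) (fun i _ => Finset.mem_coe.2 (Finset.mem_univ _)) ?_ ?_
        · intro j _ hj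
          simp only [hw]
          split_ifs with h
          · exact absurd ⟨⟨j, h⟩, by simp, rfl⟩ hj
          · rfl
        · intro i _
          simp [hw]
      have h7 := hBL ⟨k, hk⟩
      rw [h6, ← div_eq_inv_mul, le_div_iff₀ (hq0 k)]
      have h8 : (∑ i, (v ⟨k, hk⟩ i : ℝ≥0∞)) = ENNReal.ofReal (∑ i, (v ⟨k, hk⟩ i : ℝ)) := by
        rw [ENNReal.ofReal_sum_of_nonneg fun i _ => NNReal.coe_nonneg _]
        simp
      rw [h8, hδ, ← ENNReal.ofReal_mul (Finset.sum_nonneg fun i _ => NNReal.coe_nonneg _)] at h7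
      have h9 := (ENNReal.ofReal_lt_ofReal_iff_of_nonneg
        (mul_nonneg (hc0 k hk) (by positivity))).1 h7
      simp only [two_zpow_eq_mul (hmK k hk), ← mul_assoc] at h9
      exact (lt_of_mul_lt_mul_right h9 hpos.le).le
    · rw [Set.indicator_of_notMem (by exact_mod_cast hk), abs_zero]
      exact abs_nonneg _
  calc _ ≤ X.eNorm a := h5
    _ ≤ X.fnorm (cellFn (dyadicCell K m) w) := h4 ▸ h3
    _ ≤ X.fnorm h := h1 ▸ h2


variable {D : Domain} {A : ℤ → Set ℝ} {σ : ℝ → ℝ}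

/-! ### Averages and the `K`-functional -/

theorem RISpace.eNorm_le_of_le_lintegral (X : RISpace D) (hA : IsPieces D D.index A) {h : ℝ → ℝ}
    {c : ℤ → ℝ}
    (hc : ∀ k ∈ D.index, ENNReal.ofReal (|c k| * 2 ^ k) ≤ ∫⁻ ω in A k, ‖h ω‖ₑ ∂D.measure) :
    X.eNorm c ≤ 2 * X.fnorm h := by
  classical
  have hN := X.isSeqNorm
  refine hN.fatou _ _ fun s => ?_
  set K := s.filter fun k => k ∈ D.index ∧ c k ≠ 0 with hK
  have h1 := X.eNorm_le_of_lt_lintegral hA (h := h) K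
    (fun k hk => (Finset.mem_filter.1 hk).2.1) (c := fun k => |c k| / 2)
    (fun k _ => by positivity) fun k hk => by
      have hk' := (Finset.mem_filter.1 hk).2
      refine lt_of_lt_of_le ?_ (hc k hk'.1)
      have h0 : 0 < |c k| * 2 ^ k := mul_pos (abs_pos.2 hk'.2) (by positivity)
      rw [ENNReal.ofReal_lt_ofReal_iff h0]
      linarith
  have h2 : X.eNorm ((s : Set ℤ).indicator c) ≤
      X.eNorm ((2 : ℝ) • (K : Set ℤ).indicator fun k => |c k| / 2) := by
    refine hN.mono _ _ fun k hk => ?_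
    by_cases hs : k ∈ (s : Set ℤ)
    · by_cases h0 : c k = 0
      · simp [hs, h0]
      · have : k ∈ (K : Set ℤ) := Finset.mem_coe.2 (Finset.mem_filter.2 ⟨hs, hk, h0⟩)
        rw [Set.indicator_of_mem hs, Pi.smul_apply, Set.indicator_of_mem this, smul_eq_mul,
          mul_div_cancel₀ _ two_ne_zero, abs_abs]
    · rw [Set.indicator_of_notMem hs, abs_zero]
      exact abs_nonneg _
  refine h2.trans ?_
  rw [hN.smul, Real.enorm_eq_ofReal (by norm_num), ENNReal.ofReal_ofNat]
  gcongr

theorem RISpace.lintegral_ne_top (X : RISpace D) (hA : IsPieces D D.index A) {h : ℝ → ℝ}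
    (hfin : X.fnorm h ≠ ∞) (k : ℤ) : ∫⁻ ω in A k, ‖h ω‖ₑ ∂D.measure ≠ ∞ := by
  by_cases hk : k ∈ D.index
  · intro htop
    have hN := X.isSeqNorm
    have h1 : ∀ c : ℝ≥0, (c : ℝ≥0∞) * X.eNorm (Pi.single k 1) ≤ 2 * X.fnorm h := by
      intro c
      rw [← hN.smul_coe]
      refine X.eNorm_le_of_le_lintegral hA fun j _ => ?_
      by_cases hj : j = k
      · subst hj; rw [htop]; exact le_top
      · simp [hj]
    have h0 := hN.single_ne_zero k hk
    have h2 : (2 * X.fnorm h) ≠ ∞ := ENNReal.mul_ne_top (by simp) hfin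
    obtain ⟨n, hn⟩ := ENNReal.exists_nat_mul_gt h0 h2
    exact absurd (h1 n) (not_le.2 (by exact_mod_cast hn))
  · rw [hA.empty k hk]; simp

/-- The averages of `h * σ` over the pieces. -/
noncomputable def avg (D : Domain) (A : ℤ → Set ℝ) (σ h : ℝ → ℝ) (k : ℤ) : ℝ :=
  (2 ^ k)⁻¹ * ∫ ω in A k, h ω * σ ω ∂D.measure

theorem avg_congr {h h' : ℝ → ℝ} (hh : h =ᵐ[D.measure] h') : avg D A σ h = avg D A σ h' := by
  ext k
  rw [avg, avg]
  congr 1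
  refine integral_congr_ae (ae_restrict_of_ae ?_)
  filter_upwards [hh] with ω hω
  rw [hω]

theorem avg_smul (c : ℝ) (h : ℝ → ℝ) : avg D A σ (fun ω => c * h ω) = c • avg D A σ h := by
  ext k
  rw [Pi.smul_apply, avg, avg, smul_eq_mul]
  simp only [mul_assoc]
  rw [integral_const_mul, mul_left_comm]

variable (hσ : Measurable σ) (hσ1 : ∀ ω, |σ ω| ≤ 1) (hA : IsPieces D D.index A)

include hσ hσ1 in
theorem integrableOn_mul_sign {h : ℝ → ℝ} {S : Set ℝ} (hh : IntegrableOn h S D.measure) :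
    IntegrableOn (fun ω => h ω * σ ω) S D.measure :=
  Integrable.mono hh (hh.aestronglyMeasurable.mul hσ.aestronglyMeasurable) (ae_of_all _ fun ω => by
    rw [norm_mul]
    exact mul_le_of_le_one_right (norm_nonneg _) (hσ1 ω))

include hσ hσ1 in
theorem avg_add {h h' : ℝ → ℝ} (hh : ∀ k, IntegrableOn h (A k) D.measure)
    (hh' : ∀ k, IntegrableOn h' (A k) D.measure) :
    avg D A σ (fun ω => h ω + h' ω) = avg D A σ h + avg D A σ h' := by
  ext k
  rw [Pi.add_apply, avg, avg, avg, ← mul_add, ← integral_add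
    (integrableOn_mul_sign hσ hσ1 (hh k)) (integrableOn_mul_sign hσ hσ1 (hh' k))]
  simp only [add_mul]

include hA in
theorem RISpace.integrableOn (X : RISpace D) {h : ℝ → ℝ} (hm : AEStronglyMeasurable h D.measure)
    (hfin : X.fnorm h ≠ ∞) (k : ℤ) : IntegrableOn h (A k) D.measure :=
  ⟨hm.restrict, (X.lintegral_ne_top hA hfin k).lt_top⟩

include hσ1 hA in
theorem RISpace.eNorm_avg_le (X : RISpace D) (h : ℝ → ℝ) :
    X.eNorm (avg D A σ h) ≤ 2 * X.fnorm h := by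
  refine X.eNorm_le_of_le_lintegral hA fun k _ => ?_
  have hpos : (0 : ℝ) < 2 ^ k := by positivity
  rw [avg, abs_mul, abs_of_pos (inv_pos.2 hpos), mul_comm, ← mul_assoc, mul_inv_cancel₀ hpos.ne',
    one_mul]
  have h1 := enorm_integral_le_lintegral_enorm (μ := D.measure.restrict (A k)) fun ω => h ω * σ ω
  rw [Real.enorm_eq_ofReal_abs] at h1
  refine h1.trans (lintegral_mono fun ω => ?_)
  rw [enorm_mul]
  refine mul_le_of_le_one_right zero_le ?_
  rw [Real.enorm_eq_ofReal_abs]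
  exact ENNReal.ofReal_le_one.2 (hσ1 ω)

section pair

variable {X Y : RISpace D}

theorem exists_decomposition {h : L0 D.measure} (hh : h ∈ KotheSpace.sumSpace X.toKotheSpace Y.toKotheSpace) :
    ∃ x y, X.nrm x ≠ ∞ ∧ Y.nrm y ≠ ∞ ∧ x + y = h := by
  obtain ⟨x, hx, y, hy, rfl⟩ := Submodule.mem_sup.1 hh
  exact ⟨x, y, hx.ne, hy.ne, rfl⟩

theorem mem_sumSpace {x y : L0 D.measure} (hx : X.nrm x ≠ ∞) (hy : Y.nrm y ≠ ∞) :
    x + y ∈ KotheSpace.sumSpace X.toKotheSpace Y.toKotheSpace :=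
  Submodule.add_mem_sup hx.lt_top hy.lt_top

include hA in
theorem integrableOn_of_mem {h : L0 D.measure}
    (hh : h ∈ KotheSpace.sumSpace X.toKotheSpace Y.toKotheSpace) (k : ℤ) :
    IntegrableOn h (A k) D.measure := by
  obtain ⟨x, y, hx, hy, rfl⟩ := exists_decomposition hh
  have h1 := (X.integrableOn hA x.aestronglyMeasurable (by rwa [X.fnorm_coe]) k).add
    (Y.integrableOn hA y.aestronglyMeasurable (by rwa [Y.fnorm_coe]) k)
  exact h1.congr (ae_restrict_of_ae (AEEqFun.coeFn_add x y).symm)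

include hσ hσ1 hA in
theorem avg_coe_add {h h' : L0 D.measure}
    (hh : h ∈ KotheSpace.sumSpace X.toKotheSpace Y.toKotheSpace)
    (hh' : h' ∈ KotheSpace.sumSpace X.toKotheSpace Y.toKotheSpace) :
    avg D A σ (h + h' : L0 D.measure) = avg D A σ h + avg D A σ h' := by
  rw [avg_congr (AEEqFun.coeFn_add h h')]
  exact avg_add hσ hσ1 (integrableOn_of_mem hA hh) (integrableOn_of_mem hA hh')

variable (X Y) in
/-- The averages, as a linear map on `X + Y`. -/
noncomputable def avgₗ : KotheSpace.sumSpace X.toKotheSpace Y.toKotheSpace →ₗ[ℝ] (ℤ → ℝ) where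
  toFun h := avg D A σ h
  map_add' h h' := avg_coe_add hσ hσ1 hA h.2 h'.2
  map_smul' c h := (avg_congr (AEEqFun.coeFn_smul c h.1)).trans (avg_smul c h.1)

include hσ hσ1 hA in
theorem exists_avg_decomposition {h : L0 D.measure} {a : ℝ≥0∞} {t : ℝ≥0}
    (ht : t ≠ 0)
    (H : ∀ x y : L0 D.measure, X.eNorm (avg D A σ x) ≤ 2 * X.nrm x →
      Y.eNorm (avg D A σ y) ≤ 2 * Y.nrm y →
      avg D A σ h = avg D A σ x + avg D A σ y → a ≤ X.nrm x + t * Y.nrm y) :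
    a ≤ KotheSpace.K X.toKotheSpace Y.toKotheSpace t h := by
  refine le_iInf fun x => le_iInf fun y => le_iInf fun hxy => ?_
  by_cases hx : X.nrm x = ∞
  · rw [hx, top_add]; exact le_top
  by_cases hy : Y.nrm y = ∞
  · rw [hy, ENNReal.mul_top (by exact_mod_cast ht), add_top]; exact le_top
  refine H x y ?_ ?_ ?_
  · rw [← X.fnorm_coe]; exact X.eNorm_avg_le hσ1 hA x
  · rw [← Y.fnorm_coe]; exact Y.eNorm_avg_le hσ1 hA y
  · rw [← hxy]
    exact avg_coe_add hσ hσ1 hA (Submodule.mem_sup_left (lt_top_iff_ne_top.2 hx))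
      (Submodule.mem_sup_right (lt_top_iff_ne_top.2 hy))

variable {τ : ℤ → ℝ≥0} {C : ℝ≥0}

include hσ hσ1 hA in
theorem eNorm_avg_le_K (H : IsCouple D.index X.eNorm Y.eNorm τ C) (h : L0 D.measure) (k : ℤ) :
    X.eNorm ((Set.Iio k).indicator (avg D A σ h)) +
      τ k * Y.eNorm ((Set.Ici k).indicator (avg D A σ h)) ≤
      (2 + 2 * C : ℝ≥0) * KotheSpace.K X.toKotheSpace Y.toKotheSpace (τ k) h := by
  have hc : ((2 + 2 * C : ℝ≥0) : ℝ≥0∞) ≠ 0 := by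
    exact_mod_cast (show (2 + 2 * C : ℝ≥0) ≠ 0 by positivity)
  rw [mul_comm ((2 + 2 * C : ℝ≥0) : ℝ≥0∞),
    ← ENNReal.div_le_iff_le_mul (Or.inl hc) (Or.inl ENNReal.coe_ne_top)]
  refine exists_avg_decomposition hσ hσ1 hA (H.pos k).ne' fun x y hx hy hxy => ?_
  rw [ENNReal.div_le_iff_le_mul (Or.inl hc) (Or.inl ENNReal.coe_ne_top), hxy, Set.indicator_add',
    Set.indicator_add']
  set x' := avg D A σ x
  set y' := avg D A σ y
  calc _ ≤ (X.eNorm ((Set.Iio k).indicator x') + X.eNorm ((Set.Iio k).indicator y')) +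
        τ k * (Y.eNorm ((Set.Ici k).indicator x') + Y.eNorm ((Set.Ici k).indicator y')) :=
        add_le_add (H.left.add_le _ _) (mul_le_mul_right (H.right.add_le _ _) _)
    _ = X.eNorm ((Set.Iio k).indicator x') + τ k * Y.eNorm ((Set.Ici k).indicator x') +
        (X.eNorm ((Set.Iio k).indicator y') + τ k * Y.eNorm ((Set.Ici k).indicator y')) := by ring
    _ ≤ X.eNorm x' + C * X.eNorm x' + (C * τ k * Y.eNorm y' + τ k * Y.eNorm y') :=
        add_le_add (add_le_add (H.left.indicator_le _ _) (H.right_le k x'))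
          (add_le_add (H.left_le k y') (mul_le_mul_right (H.right.indicator_le _ _) _))
    _ ≤ 2 * X.nrm x + C * (2 * X.nrm x) + (C * τ k * (2 * Y.nrm y) + τ k * (2 * Y.nrm y)) :=
        add_le_add (add_le_add hx (mul_le_mul_right hx _))
          (add_le_add (mul_le_mul_right hy _) (mul_le_mul_right hy _))
    _ = _ := by push_cast; ring

include hσ hσ1 hA in
theorem eNorm_avg_le_K_of_le (H : IsCouple D.index X.eNorm Y.eNorm τ C) (h : L0 D.measure)
    {t : ℝ≥0} (ht : ∀ k, τ k ≤ t) :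
    X.eNorm (avg D A σ h) ≤
      (2 + 2 * C : ℝ≥0) * KotheSpace.K X.toKotheSpace Y.toKotheSpace t h := by
  have hc : ((2 + 2 * C : ℝ≥0) : ℝ≥0∞) ≠ 0 := by
    exact_mod_cast (show (2 + 2 * C : ℝ≥0) ≠ 0 by positivity)
  rw [mul_comm, ← ENNReal.div_le_iff_le_mul (Or.inl hc) (Or.inl ENNReal.coe_ne_top)]
  refine exists_avg_decomposition hσ hσ1 hA ((H.pos 0).trans_le (ht 0)).ne' fun x y hx hy hxy => ?_
  rw [ENNReal.div_le_iff_le_mul (Or.inl hc) (Or.inl ENNReal.coe_ne_top), hxy]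
  have hfat : X.eNorm (avg D A σ y) ≤ C * t * (2 * Y.nrm y) := by
    refine H.left.fatou _ _ fun s => ?_
    obtain ⟨n, hn⟩ : ∃ n : ℤ, (s : Set ℤ) ⊆ Set.Iio n := by
      obtain ⟨b, hb⟩ := s.bddAbove
      exact ⟨b + 1, fun k hk => Int.lt_add_one_of_le (hb hk)⟩
    refine (H.left.indicator_mono hn _).trans ((H.left_le n _).trans ?_)
    exact mul_le_mul' (mul_le_mul_right (by exact_mod_cast ht n) _) hy
  calc _ ≤ X.eNorm (avg D A σ x) + X.eNorm (avg D A σ y) := H.left.add_le _ _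
    _ ≤ 2 * X.nrm x + C * t * (2 * Y.nrm y) := add_le_add hx hfat
    _ ≤ 2 * X.nrm x + 2 * C * X.nrm x + (2 * t * Y.nrm y + C * t * (2 * Y.nrm y)) :=
        add_le_add le_self_add le_add_self
    _ = _ := by push_cast; ring

include hσ hσ1 hA in
theorem eNorm_avg_le_K_of_ge (H : IsCouple D.index X.eNorm Y.eNorm τ C) (h : L0 D.measure)
    {t : ℝ≥0} (ht0 : t ≠ 0) (ht : ∀ k, t ≤ τ k) :
    t * Y.eNorm (avg D A σ h) ≤
      (2 + 2 * C : ℝ≥0) * KotheSpace.K X.toKotheSpace Y.toKotheSpace t h := by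
  have hc : ((2 + 2 * C : ℝ≥0) : ℝ≥0∞) ≠ 0 := by
    exact_mod_cast (show (2 + 2 * C : ℝ≥0) ≠ 0 by positivity)
  have ht1 : (t : ℝ≥0∞) ≠ 0 := by exact_mod_cast ht0
  rw [mul_comm ((2 + 2 * C : ℝ≥0) : ℝ≥0∞),
    ← ENNReal.div_le_iff_le_mul (Or.inl hc) (Or.inl ENNReal.coe_ne_top)]
  refine exists_avg_decomposition hσ hσ1 hA ht0 fun x y hx hy hxy => ?_
  rw [ENNReal.div_le_iff_le_mul (Or.inl hc) (Or.inl ENNReal.coe_ne_top), hxy]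
  have hfat : t * Y.eNorm (avg D A σ x) ≤ C * (2 * X.nrm x) := by
    rw [mul_comm, ← ENNReal.le_div_iff_mul_le (Or.inl ht1) (Or.inl ENNReal.coe_ne_top)]
    refine H.right.fatou _ _ fun s => ?_
    rw [ENNReal.le_div_iff_mul_le (Or.inl ht1) (Or.inl ENNReal.coe_ne_top), mul_comm]
    obtain ⟨n, hn⟩ := s.bddBelow
    calc _ ≤ τ n * Y.eNorm ((Set.Ici n).indicator (avg D A σ x)) :=
          mul_le_mul' (by exact_mod_cast ht n) (H.right.indicator_mono (fun k hk => hn hk) _)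
      _ ≤ C * X.eNorm (avg D A σ x) := H.right_le n _
      _ ≤ _ := mul_le_mul_right hx _
  calc _ ≤ t * (Y.eNorm (avg D A σ x) + Y.eNorm (avg D A σ y)) :=
        mul_le_mul_right (H.right.add_le _ _) _
    _ = t * Y.eNorm (avg D A σ x) + t * Y.eNorm (avg D A σ y) := mul_add _ _ _
    _ ≤ C * (2 * X.nrm x) + t * (2 * Y.nrm y) := add_le_add hfat (mul_le_mul_right hy _)
    _ ≤ 2 * X.nrm x + C * (2 * X.nrm x) + (t * (2 * Y.nrm y) + 2 * C * t * Y.nrm y) :=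
        add_le_add le_add_self le_self_add
    _ = _ := by push_cast; ring

end pair


/-! ### From operators on `X + Y` to operators on sequences -/

section

variable {Ω : Type*} [MeasurableSpace Ω] {μ : Measure Ω} (X Y : KotheSpace μ)

theorem KotheSpace.nrm_zero : X.nrm 0 = 0 := (X.eq_zero_iff 0).2 rfl

theorem KotheSpace.nrm_apply_le {V : Submodule ℝ (L0 μ)} (T : V →ₗ[ℝ] V) {h : V}
    (hh : X.nrm h ≠ ∞) : X.nrm (T h) ≤ X.opNrm T * X.nrm h := by
  rcases eq_or_ne (X.nrm h) 0 with h0 | h0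
  · have : h = 0 := Subtype.ext ((X.eq_zero_iff _).1 h0)
    rw [this, map_zero, Submodule.coe_zero, X.nrm_zero]
    exact zero_le
  have hpos : 0 < (X.nrm h).toReal := ENNReal.toReal_pos h0 hh
  have hc : ‖(X.nrm h).toReal⁻¹‖ₑ = (X.nrm h)⁻¹ := by
    rw [Real.enorm_eq_ofReal (by positivity), ENNReal.ofReal_inv_of_pos hpos,
      ENNReal.ofReal_toReal hh]
  have h1 : X.nrm (T ((X.nrm h).toReal⁻¹ • h)) ≤ X.opNrm T := by
    refine le_iSup₂_of_le ((X.nrm h).toReal⁻¹ • h) ?_ le_rfl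
    rw [Submodule.coe_smul, X.smul, hc, ENNReal.inv_mul_cancel h0 hh]
  rw [map_smul, Submodule.coe_smul, X.smul, hc] at h1
  rwa [← ENNReal.div_le_iff_le_mul (Or.inl h0) (Or.inl hh), div_eq_mul_inv, mul_comm]

theorem KotheSpace.opNrm_le {V : Submodule ℝ (L0 μ)} {T : V →ₗ[ℝ] V} {C : ℝ≥0∞}
    (hT : ∀ h : V, X.nrm (T h) ≤ C * X.nrm h) : X.opNrm T ≤ C :=
  iSup₂_le fun h hh => (hT h).trans ((mul_le_mul_right hh _).trans (mul_one C).le)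

variable {X Y}

theorem KotheSpace.K_le_add {t : ℝ≥0} {x y : L0 μ} : K X Y t (x + y) ≤ X.nrm x + t * Y.nrm y :=
  iInf₂_le_of_le x y (iInf_le_of_le rfl le_rfl)

theorem KotheSpace.K_mono {s t : ℝ≥0} (h : s ≤ t) (f : L0 μ) : K X Y s f ≤ K X Y t f :=
  iInf_mono fun x => iInf_mono fun y => iInf_mono fun _ =>
    add_le_add le_rfl (mul_le_mul_left (by exact_mod_cast h) _)

end

variable {D : Domain} {X Y : RISpace D} {τ : ℤ → ℝ≥0} {C : ℝ≥0}

variable (D) in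
/-- The class of the step function with value `x k` on `[2ᵏ, 2ᵏ⁺¹)`. -/
noncomputable def stepₗ : (ℤ → ℝ) →ₗ[ℝ] L0 D.measure where
  toFun x := AEEqFun.mk (stepFn (dyadicPieces D.index) x) ((isPieces_dyadic (subset_refl _)).aesm x)
  map_add' x y := by
    have hP := isPieces_dyadic (D := D) (subset_refl D.index)
    rw [AEEqFun.mk_add_mk]
    congr 1
    ext ω
    exact RISpace.stepFn_add hP x y ω
  map_smul' c x := by
    have hP := isPieces_dyadic (D := D) (subset_refl D.index)
    rw [RingHom.id_apply, AEEqFun.smul_mk]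
    congr 1
    ext ω
    exact RISpace.stepFn_smul hP c x ω

theorem RISpace.nrm_stepₗ (X : RISpace D) (x : ℤ → ℝ) : X.nrm (stepₗ D x) = X.eNorm x :=
  X.nrm_mk _

theorem avg_stepₗ (x : ℤ → ℝ) {k : ℤ} (hk : k ∈ D.index) :
    avg D (dyadicPieces D.index) (fun _ => 1) (stepₗ D x) k = x k := by
  have hP := isPieces_dyadic (D := D) (subset_refl D.index)
  have hpos : (0 : ℝ) < 2 ^ k := by positivity
  rw [stepₗ, LinearMap.coe_mk, AddHom.coe_mk, avg_congr (AEEqFun.coeFn_mk _ _), avg]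
  have h1 : ∫ ω in dyadicPieces D.index k, stepFn (dyadicPieces D.index) x ω * 1 ∂D.measure =
      ∫ _ in dyadicPieces D.index k, x k ∂D.measure :=
    setIntegral_congr_fun (hP.measurable k) fun ω hω => by
      simp only [mul_one]
      exact hP.stepFn_eq x hω
  rw [h1, setIntegral_const, measureReal_def, hP.measure k hk, ENNReal.toReal_ofReal hpos.le,
    smul_eq_mul, inv_mul_cancel_left₀ hpos.ne']

theorem indicator_smul_seq (S : Set ℤ) (c : ℝ) (x : ℤ → ℝ) :
    S.indicator (c • x) = c • S.indicator x := by
  ext k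
  by_cases h : k ∈ S <;> simp [h]

theorem IsSeqNorm.indicator_congr {J : Set ℤ} {E : (ℤ → ℝ) → ℝ≥0∞} (hE : IsSeqNorm J E) (S : Set ℤ)
    {x y : ℤ → ℝ} (h : ∀ k ∈ J, x k = y k) : E (S.indicator x) = E (S.indicator y) :=
  hE.congr fun k hk => by by_cases hS : k ∈ S <;> simp [hS, h k hk]

theorem K_stepₗ_le (t : ℝ≥0) (k : ℤ) (x : ℤ → ℝ) :
    KotheSpace.K X.toKotheSpace Y.toKotheSpace t (stepₗ D x) ≤
      X.eNorm ((Set.Iio k).indicator x) + t * Y.eNorm ((Set.Ici k).indicator x) := by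
  rw [← X.nrm_stepₗ, ← Y.nrm_stepₗ]
  refine le_of_eq_of_le ?_ KotheSpace.K_le_add
  congr 1
  rw [← map_add]
  congr 1
  have := Set.indicator_self_add_compl (Set.Iio k) x
  rw [Set.compl_Iio] at this
  exact this.symm

theorem IsCouple.K_stepₗ_le_K (H : IsCouple D.index X.eNorm Y.eNorm τ C) {C₀ : ℝ≥0} {u v : ℤ → ℝ}
    (huv : ∀ k, X.eNorm ((Set.Iio k).indicator v) + τ k * Y.eNorm ((Set.Ici k).indicator v) ≤
      C₀ * (X.eNorm ((Set.Iio k).indicator u) + τ k * Y.eNorm ((Set.Ici k).indicator u)))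
    {t : ℝ≥0} (ht : 0 < t) :
    KotheSpace.K X.toKotheSpace Y.toKotheSpace t (stepₗ D v) ≤
      ((1 + C) * C₀ * (2 + 2 * C) : ℝ≥0) *
        KotheSpace.K X.toKotheSpace Y.toKotheSpace t (stepₗ D u) := by
  have hP := isPieces_dyadic (D := D) (subset_refl D.index)
  have hone : ∀ ω : ℝ, |(fun _ => (1 : ℝ)) ω| ≤ 1 := fun ω => by simp
  have hav : ∀ k ∈ D.index, avg D (dyadicPieces D.index) (fun _ => 1) (stepₗ D u) k = u k :=
    fun k hk => avg_stepₗ u hk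
  have hEu : X.eNorm (avg D (dyadicPieces D.index) (fun _ => 1) (stepₗ D u)) = X.eNorm u :=
    H.left.congr fun k hk => by rw [hav k hk]
  have hFu : Y.eNorm (avg D (dyadicPieces D.index) (fun _ => 1) (stepₗ D u)) = Y.eNorm u :=
    H.right.congr fun k hk => by rw [hav k hk]
  set Ku := KotheSpace.K X.toKotheSpace Y.toKotheSpace t (stepₗ D u) with hKu
  by_cases h1 : ∀ k, τ k ≤ t
  · have h2 : X.eNorm v ≤ C₀ * (X.eNorm u + C * X.eNorm u) := by
      refine H.left.fatou _ _ fun s => ?_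
      obtain ⟨n, hn⟩ : ∃ n : ℤ, (s : Set ℤ) ⊆ Set.Iio n := by
        obtain ⟨b, hb⟩ := s.bddAbove
        exact ⟨b + 1, fun k hk => Int.lt_add_one_of_le (hb hk)⟩
      refine (H.left.indicator_mono hn _).trans (le_self_add.trans ((huv n).trans ?_))
      exact mul_le_mul_right (add_le_add (H.left.indicator_le _ _) (H.right_le n u)) _
    have h3 := eNorm_avg_le_K_of_le measurable_const hone hP H (stepₗ D u) h1
    rw [hEu] at h3
    have h4 : KotheSpace.K X.toKotheSpace Y.toKotheSpace t (stepₗ D v) ≤ X.eNorm v := by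
      have := KotheSpace.K_le_add (X := X.toKotheSpace) (Y := Y.toKotheSpace) (t := t)
        (x := stepₗ D v) (y := 0)
      rwa [add_zero, Y.nrm_zero, mul_zero, add_zero, X.nrm_stepₗ] at this
    calc _ ≤ C₀ * (X.eNorm u + C * X.eNorm u) := h4.trans h2
      _ = (1 + C) * C₀ * X.eNorm u := by ring
      _ ≤ (1 + C) * C₀ * ((2 + 2 * C : ℝ≥0) * Ku) := mul_le_mul_right h3 _
      _ = _ := by push_cast; ring
  by_cases h2 : ∀ k, t ≤ τ k
  · have hmul : ∀ n, τ n * Y.eNorm ((Set.Ici n).indicator v) ≤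
        τ n * (C₀ * (1 + C) * Y.eNorm u) := by
      intro n
      calc _ ≤ C₀ * (X.eNorm ((Set.Iio n).indicator u) + τ n * Y.eNorm ((Set.Ici n).indicator u)) :=
            le_add_self.trans (huv n)
        _ ≤ C₀ * (C * τ n * Y.eNorm u + τ n * Y.eNorm u) := mul_le_mul_right
            (add_le_add (H.left_le n u) (mul_le_mul_right (H.right.indicator_le _ _) _)) _
        _ = _ := by ring
    have h3 : Y.eNorm v ≤ C₀ * (1 + C) * Y.eNorm u := by
      refine H.right.fatou _ _ fun s => ?_
      obtain ⟨n, hn⟩ := s.bddBelow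
      refine (H.right.indicator_mono (fun k hk => hn hk : (s : Set ℤ) ⊆ Set.Ici n) _).trans ?_
      exact (ENNReal.mul_le_mul_iff_right (by exact_mod_cast (H.pos n).ne') ENNReal.coe_ne_top).1
        (hmul n)
    have h4 := eNorm_avg_le_K_of_ge measurable_const hone hP H (stepₗ D u) ht.ne' h2
    rw [hFu] at h4
    have h5 : KotheSpace.K X.toKotheSpace Y.toKotheSpace t (stepₗ D v) ≤ t * Y.eNorm v := by
      have := KotheSpace.K_le_add (X := X.toKotheSpace) (Y := Y.toKotheSpace) (t := t)
        (x := 0) (y := stepₗ D v)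
      rwa [zero_add, X.nrm_zero, zero_add, Y.nrm_stepₗ] at this
    calc _ ≤ t * (C₀ * (1 + C) * Y.eNorm u) := h5.trans (mul_le_mul_right h3 _)
      _ = (1 + C) * C₀ * (t * Y.eNorm u) := by ring
      _ ≤ (1 + C) * C₀ * ((2 + 2 * C : ℝ≥0) * Ku) := mul_le_mul_right h4 _
      _ = _ := by push_cast; ring
  · push Not at h1 h2
    obtain ⟨b, hb⟩ := h1
    obtain ⟨a, ha⟩ := h2
    obtain ⟨k, hk, hmax⟩ := Int.exists_greatest_of_bdd (P := fun k => τ k ≤ t)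
      ⟨b, fun z hz => le_of_lt (by
        by_contra h
        exact absurd (H.mono (not_lt.1 h)) (not_le.2 (lt_of_le_of_lt hz hb)))⟩ ⟨a, ha.le⟩
    have hk1 : t ≤ C * τ k := by
      refine le_trans ?_ (H.succ_le k)
      by_contra h
      have := hmax (k + 1) (not_le.1 h).le
      omega
    have h3 := eNorm_avg_le_K measurable_const hone hP H (stepₗ D u) k
    rw [H.left.indicator_congr _ hav, H.right.indicator_congr _ hav] at h3
    have hk2 : (t : ℝ≥0∞) ≤ (1 + C) * τ k := by
      have : t ≤ (1 + C) * τ k := hk1.trans (mul_le_mul_left le_add_self _)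
      exact_mod_cast this
    set Ev := X.eNorm ((Set.Iio k).indicator v)
    set Fv := Y.eNorm ((Set.Ici k).indicator v)
    calc _ ≤ Ev + t * Fv := K_stepₗ_le t k v
      _ ≤ (1 + C) * Ev + (1 + C) * τ k * Fv :=
          add_le_add (le_mul_of_one_le_left zero_le le_self_add) (mul_le_mul_left hk2 _)
      _ = (1 + C) * (Ev + τ k * Fv) := by ring
      _ ≤ (1 + C) * (C₀ * ((2 + 2 * C : ℝ≥0) *
          KotheSpace.K X.toKotheSpace Y.toKotheSpace (τ k) (stepₗ D u))) :=
          mul_le_mul_right ((huv k).trans (mul_le_mul_right h3 _)) _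
      _ ≤ (1 + C) * (C₀ * ((2 + 2 * C : ℝ≥0) * Ku)) :=
          mul_le_mul_right (mul_le_mul_right (mul_le_mul_right (KotheSpace.K_mono hk _) _) _) _
      _ = _ := by push_cast; ring

theorem stepₗ_mem {x : ℤ → ℝ} (k : ℤ) (hE : X.eNorm ((Set.Iio k).indicator x) ≠ ∞)
    (hF : Y.eNorm ((Set.Ici k).indicator x) ≠ ∞) :
    stepₗ D x ∈ KotheSpace.sumSpace X.toKotheSpace Y.toKotheSpace := by
  have h := Set.indicator_self_add_compl (Set.Iio k) x
  rw [Set.compl_Iio] at h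
  rw [← h, map_add]
  exact mem_sumSpace (by rwa [X.nrm_stepₗ]) (by rwa [Y.nrm_stepₗ])

theorem IsCouple.seqCalderon (H : IsCouple D.index X.eNorm Y.eNorm τ C)
    (hcal : KotheSpace.IsCalderonCouple X.toKotheSpace Y.toKotheSpace) :
    SeqCalderon D.index X.eNorm Y.eNorm τ := by
  intro C₀ u v huE huF huv
  set V := KotheSpace.sumSpace X.toKotheSpace Y.toKotheSpace with hV
  have hP := isPieces_dyadic (D := D) (subset_refl D.index)
  have hone : ∀ ω : ℝ, |(fun _ => (1 : ℝ)) ω| ≤ 1 := fun ω => by simp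
  set L : ℝ≥0 := (1 + C) * (C₀ + 1) * (2 + 2 * C) with hL
  have hL0 : L ≠ 0 := by positivity
  have hLinv : ((L⁻¹ : ℝ≥0) : ℝ) ≠ 0 := by exact_mod_cast inv_ne_zero hL0
  set v' : ℤ → ℝ := ((L⁻¹ : ℝ≥0) : ℝ) • v with hv'
  have hv'E : ∀ k, X.eNorm ((Set.Iio k).indicator v') =
      (L⁻¹ : ℝ≥0) * X.eNorm ((Set.Iio k).indicator v) := fun k => by
    rw [hv', indicator_smul_seq, H.left.smul_coe]
  have hv'F : ∀ k, Y.eNorm ((Set.Ici k).indicator v') =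
      (L⁻¹ : ℝ≥0) * Y.eNorm ((Set.Ici k).indicator v) := fun k => by
    rw [hv', indicator_smul_seq, H.right.smul_coe]
  have hdom : ∀ k, X.eNorm ((Set.Iio k).indicator v') + τ k * Y.eNorm ((Set.Ici k).indicator v') ≤
      (L⁻¹ * C₀ : ℝ≥0) *
        (X.eNorm ((Set.Iio k).indicator u) + τ k * Y.eNorm ((Set.Ici k).indicator u)) := by
    intro k
    rw [hv'E, hv'F, ENNReal.coe_mul, mul_assoc, mul_left_comm, ← mul_add]
    exact mul_le_mul_right (huv k) _
  have hfin : ∀ k, X.eNorm ((Set.Iio k).indicator v') ≠ ∞ ∧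
      Y.eNorm ((Set.Ici k).indicator v') ≠ ∞ := by
    intro k
    have h1 := ne_top_of_le_ne_top (ENNReal.mul_ne_top ENNReal.coe_ne_top (ENNReal.add_ne_top.2
      ⟨huE k, ENNReal.mul_ne_top ENNReal.coe_ne_top (huF k)⟩)) (hdom k)
    have h2 := ENNReal.add_ne_top.1 h1
    refine ⟨h2.1, fun h => h2.2 ?_⟩
    rw [h, ENNReal.mul_top (by exact_mod_cast (H.pos k).ne')]
  have hum : stepₗ D u ∈ V := stepₗ_mem 0 (huE 0) (huF 0)
  have hvm : stepₗ D v' ∈ V := stepₗ_mem 0 (hfin 0).1 (hfin 0).2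
  obtain ⟨T, hTX, hTY, hT⟩ := hcal ⟨stepₗ D v', hvm⟩ ⟨stepₗ D u, hum⟩ fun t ht => by
    refine (H.K_stepₗ_le_K hdom ht).trans (mul_le_of_le_one_left zero_le ?_)
    have h1 : (1 + C) * (L⁻¹ * C₀) * (2 + 2 * C) ≤ 1 := by
      calc (1 + C) * (L⁻¹ * C₀) * (2 + 2 * C) = L⁻¹ * ((1 + C) * C₀ * (2 + 2 * C)) := by ring
        _ ≤ L⁻¹ * L := by
            rw [hL]
            gcongr
            exact le_self_add
        _ = 1 := inv_mul_cancel₀ hL0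
    exact_mod_cast h1
  set W : Submodule ℝ (ℤ → ℝ) := V.comap (stepₗ D) with hW
  set S : W →ₗ[ℝ] (ℤ → ℝ) := (avgₗ measurable_const hone hP X Y).comp
    (T.comp (((stepₗ D).comp W.subtype).codRestrict V fun w => w.2)) with hS
  obtain ⟨S', hS'⟩ := S.exists_extend
  have hSx : ∀ x (hx : stepₗ D x ∈ V), S' x =
      avg D (dyadicPieces D.index) (fun _ => 1) (T ⟨stepₗ D x, hx⟩) := by
    intro x hx
    exact LinearMap.congr_fun hS' ⟨x, hx⟩
  have hXK : X.opNrm T ≠ ∞ := hTX.ne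
  have hYK : Y.opNrm T ≠ ∞ := hTY.ne
  set K : ℝ≥0 := L * (2 * max (X.opNrm T).toNNReal (Y.opNrm T).toNNReal + 1) with hK
  have hK0 : K ≠ 0 := by positivity
  have key : ∀ (Z : RISpace D), Z.opNrm T ≠ ∞ →
      (Z.opNrm T).toNNReal ≤ max (X.opNrm T).toNNReal (Y.opNrm T).toNNReal →
      Z.toKotheSpace.space ≤ V →
      ∀ z, Z.eNorm (((L : ℝ) • S') z) ≤ K * Z.eNorm z := by
    intro Z hZ hZm hZV z
    by_cases hz : Z.eNorm z = ∞
    · rw [hz, ENNReal.mul_top (by exact_mod_cast hK0)]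
      exact le_top
    have hzm : stepₗ D z ∈ V := hZV (by
      change Z.nrm _ < ∞
      rw [Z.nrm_stepₗ]
      exact lt_top_iff_ne_top.2 hz)
    rw [LinearMap.smul_apply, Z.isSeqNorm.smul_coe, hSx z hzm]
    have h1 := Z.nrm_apply_le T (h := ⟨stepₗ D z, hzm⟩) (by rwa [Z.nrm_stepₗ])
    rw [Z.nrm_stepₗ, ← ENNReal.coe_toNNReal hZ] at h1
    calc L * Z.eNorm (avg D (dyadicPieces D.index) (fun _ => 1) (T ⟨stepₗ D z, hzm⟩))
        ≤ L * (2 * Z.nrm (T ⟨stepₗ D z, hzm⟩)) := by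
          rw [← Z.fnorm_coe]
          exact mul_le_mul_right (Z.eNorm_avg_le hone hP _) _
      _ ≤ L * (2 * ((Z.opNrm T).toNNReal * Z.eNorm z)) :=
          mul_le_mul_right (mul_le_mul_right h1 _) _
      _ = (L * (2 * (Z.opNrm T).toNNReal) : ℝ≥0) * Z.eNorm z := by push_cast; ring
      _ ≤ K * Z.eNorm z := by
          refine mul_le_mul_left (ENNReal.coe_le_coe.2 ?_) _
          rw [hK]
          exact mul_le_mul_right ((mul_le_mul_right hZm _).trans le_self_add) _
  refine ⟨(L : ℝ) • S', K, key X hXK (le_max_left _ _) le_sup_left,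
    key Y hYK (le_max_right _ _) le_sup_right, fun k hk => ?_⟩
  rw [LinearMap.smul_apply, hSx u hum, hT, Pi.smul_apply, avg_stepₗ v' hk, hv', Pi.smul_apply,
    smul_smul]
  rw [NNReal.coe_inv, mul_inv_cancel₀ (by exact_mod_cast hL0), one_smul]


/-! ### Consequences of concavity -/

/-- In a `p`-concave space, a function cannot dominate arbitrarily many disjoint functions whose
norms are bounded below. -/
theorem KotheSpace.PConcaveWith.fnorm_eq_top {Ω : Type*} [MeasurableSpace Ω] {μ : Measure Ω}
    {X : KotheSpace μ} {p : ℝ} {M : ℝ≥0} (hX : X.PConcaveWith p M) (hp : 1 ≤ p) {g : Ω → ℝ}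
    {η : ℝ≥0∞} (hη : η ≠ 0)
    (H : ∀ N : ℕ, ∃ f : Fin N → Ω → ℝ, (∀ i, AEStronglyMeasurable (f i) μ) ∧
      (∀ i j ω, f i ω ≠ 0 → f j ω ≠ 0 → i = j) ∧ (∀ i ω, |f i ω| ≤ |g ω|) ∧
      ∀ i, η ≤ X.fnorm (f i)) : X.fnorm g = ∞ := by
  by_contra hg
  have hp0 : 0 < p := by positivity
  have h1 : ∀ N : ℕ, N * η ^ p ≤ (M * X.fnorm g) ^ p := by
    intro N
    obtain ⟨f, hf, hd, hle, hfη⟩ := H N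
    have hfin : ∀ i, X.fnorm (f i) ≠ ∞ := fun i =>
      ne_top_of_le_ne_top hg (X.fnorm_mono (hf i) (ae_of_all _ (hle i)))
    have hm : AEStronglyMeasurable (fun ω => (∑ i, |f i ω| ^ p) ^ (1 / p)) μ := by
      refine AEMeasurable.aestronglyMeasurable ?_
      refine AEMeasurable.pow_const (Finset.aemeasurable_fun_sum _ fun i _ => ?_) _
      exact (hf i).norm.aemeasurable.pow_const _
    have h2 := hX (Fin N) f hf hfin
    have h3 : X.fnorm (fun ω => (∑ i, |f i ω| ^ p) ^ (1 / p)) ≤ X.fnorm g := by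
      refine X.fnorm_mono hm (ae_of_all _ fun ω => ?_)
      rw [abs_of_nonneg (by positivity)]
      by_cases h : ∃ i, f i ω ≠ 0
      · obtain ⟨i, hi⟩ := h
        rw [Finset.sum_eq_single_of_mem i (Finset.mem_univ i) fun j _ hj => by
          have : f j ω = 0 := by
            by_contra h0
            exact hj (hd j i ω h0 hi)
          rw [this, abs_zero, Real.zero_rpow hp0.ne'], ← Real.rpow_mul (abs_nonneg _),
          mul_one_div_cancel hp0.ne', Real.rpow_one]
        exact hle i ω
      · push Not at h
        rw [Finset.sum_eq_zero fun i _ => by rw [h i, abs_zero, Real.zero_rpow hp0.ne'],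
          Real.zero_rpow (by positivity)]
        exact abs_nonneg _
    have h4 := ENNReal.rpow_le_rpow (h2.trans (mul_le_mul_right h3 _)) hp0.le
    rw [← ENNReal.rpow_mul, one_div_mul_cancel hp0.ne', ENNReal.rpow_one] at h4
    refine le_trans ?_ h4
    calc (N : ℝ≥0∞) * η ^ p = ∑ _i : Fin N, η ^ p := by simp
      _ ≤ _ := Finset.sum_le_sum fun i _ => ENNReal.rpow_le_rpow (hfη i) hp0.le
  have h5 : (M * X.fnorm g) ^ p ≠ ∞ :=
    ENNReal.rpow_ne_top_of_nonneg hp0.le (ENNReal.mul_ne_top ENNReal.coe_ne_top hg)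
  have h6 : η ^ p ≠ 0 := by
    intro h
    rcases ENNReal.rpow_eq_zero_iff.1 h with h | h
    · exact hη h.1
    · exact absurd h.2 (not_lt.2 hp0.le)
  obtain ⟨N, hN⟩ := ENNReal.exists_nat_mul_gt h6 h5
  exact absurd (h1 N) (not_le.2 hN)

variable {D : Domain} {X : RISpace D} {p : ℝ} {M : ℝ≥0}

theorem RISpace.exists_eNorm_indicator_lt (hX : X.PConcaveWith p M) (hp : 1 ≤ p)
    {S : ℕ → Set ℤ} (hS : Antitone S) (hS0 : ∀ s : Finset ℤ, ∃ n, Disjoint (s : Set ℤ) (S n))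
    {x : ℤ → ℝ} (hx : X.eNorm x ≠ ∞) {ε : ℝ≥0∞} (hε : 0 < ε) :
    ∃ n, X.eNorm ((S n).indicator x) < ε := by
  by_contra! hcon
  have hN := X.isSeqNorm
  have hP := isPieces_dyadic (D := D) (subset_refl D.index)
  obtain ⟨η, hη0, hηε⟩ := exists_between hε
  have hex : ∀ n, ∃ s : Finset ℤ, η ≤ X.eNorm ((s : Set ℤ).indicator ((S n).indicator x)) := by
    intro n
    by_contra! h
    exact absurd (hN.fatou _ _ fun s => (h s).le) (not_le.2 (hηε.trans_le (hcon n)))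
  choose s hs using hex
  have hex2 : ∀ n, ∃ m, n ≤ m ∧ Disjoint (s n : Set ℤ) (S m) := by
    intro n
    obtain ⟨m, hm⟩ := hS0 (s n)
    exact ⟨max n m, le_max_left _ _, hm.mono_right (hS (le_max_right _ _))⟩
  choose φ hφ hφd using hex2
  set r : ℕ → ℕ := fun i => φ^[i] 0 with hr
  have hrs : ∀ i, r (i + 1) = φ (r i) := fun i => Function.iterate_succ_apply' φ i 0
  have hrm : Monotone r := monotone_nat_of_le_succ fun i => by rw [hrs]; exact hφ _
  have hdis : ∀ i j, i < j → ∀ k, k ∈ s (r i) → k ∉ S (r j) := by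
    intro i j hij k hk hk'
    have h1 : k ∈ S (φ (r i)) := by
      rw [← hrs]
      exact hS (hrm (Nat.succ_le_of_lt hij)) hk'
    exact (hφd (r i)).le_bot ⟨hk, h1⟩
  refine hx (hX.fnorm_eq_top hp hη0.ne' fun N => ⟨fun i => stepFn (dyadicPieces D.index)
    ((s (r i) : Set ℤ).indicator ((S (r i)).indicator x)), fun i => hP.aesm _, ?_, ?_,
    fun i => hs _⟩)
  · intro i j ω hi hj
    by_cases h : ∃ k, ω ∈ dyadicPieces D.index k
    · obtain ⟨k, hk⟩ := h
      simp only [hP.stepFn_eq _ hk] at hi hj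
      have hi1 := Set.mem_of_indicator_ne_zero hi
      have hj1 := Set.mem_of_indicator_ne_zero hj
      rw [Set.indicator_of_mem hi1] at hi
      rw [Set.indicator_of_mem hj1] at hj
      have hi2 := Set.mem_of_indicator_ne_zero hi
      have hj2 := Set.mem_of_indicator_ne_zero hj
      by_contra hne
      rcases lt_or_gt_of_ne (fun h => hne (Fin.ext h) : (i : ℕ) ≠ j) with h | h
      · exact hdis i j h k hi1 hj2
      · exact hdis j i h k hj1 hi2
    · push Not at h
      exact absurd (stepFn_eq_zero _ h) hi
  · intro i ω
    beta_reduce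
    by_cases h : ∃ k, ω ∈ dyadicPieces D.index k
    · obtain ⟨k, hk⟩ := h
      rw [hP.stepFn_eq _ hk, hP.stepFn_eq _ hk]
      by_cases h1 : k ∈ (s (r i) : Set ℤ)
      · by_cases h2 : k ∈ S (r i)
        · rw [Set.indicator_of_mem h1, Set.indicator_of_mem h2]
        · rw [Set.indicator_of_mem h1, Set.indicator_of_notMem h2, abs_zero]
          exact abs_nonneg _
      · rw [Set.indicator_of_notMem h1, abs_zero]
        exact abs_nonneg _
    · push Not at h
      rw [stepFn_eq_zero _ h, abs_zero]
      exact abs_nonneg _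

theorem RISpace.exists_eNorm_Iio_lt (hX : X.PConcaveWith p M) (hp : 1 ≤ p) {x : ℤ → ℝ}
    (hx : X.eNorm x ≠ ∞) {ε : ℝ≥0∞} (hε : 0 < ε) :
    ∃ n, X.eNorm ((Set.Iio n).indicator x) < ε := by
  obtain ⟨n, hn⟩ := exists_eNorm_indicator_lt hX hp (S := fun n : ℕ => Set.Iio (-(n : ℤ)))
    (fun i j h => Set.Iio_subset_Iio (by simpa using h)) (fun s => by
      obtain ⟨b, hb⟩ := s.bddBelow
      refine ⟨b.natAbs, Set.disjoint_left.2 fun k hk hk' => ?_⟩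
      have h1 := hb hk
      simp only [Set.mem_Iio] at hk'
      omega) hx hε
  exact ⟨_, hn⟩

theorem RISpace.exists_eNorm_Ici_lt (hX : X.PConcaveWith p M) (hp : 1 ≤ p) {x : ℤ → ℝ}
    (hx : X.eNorm x ≠ ∞) {ε : ℝ≥0∞} (hε : 0 < ε) :
    ∃ n, X.eNorm ((Set.Ici n).indicator x) < ε := by
  obtain ⟨n, hn⟩ := exists_eNorm_indicator_lt hX hp (S := fun n : ℕ => Set.Ici (n : ℤ))
    (fun i j h => Set.Ici_subset_Ici.2 (by simpa using h)) (fun s => by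
      obtain ⟨b, hb⟩ := s.bddAbove
      refine ⟨b.natAbs + 1, Set.disjoint_left.2 fun k hk hk' => ?_⟩
      have h1 := hb hk
      change ((b.natAbs + 1 : ℕ) : ℤ) ≤ k at hk'
      omega) hx hε
  exact ⟨_, hn⟩

theorem RISpace.measure_level_lt_top (hX : X.PConcaveWith p M) (hp : 1 ≤ p) {f : ℝ → ℝ}
    (hf : Measurable f) (hfin : X.fnorm f ≠ ∞) {s : ℝ} (hs : 0 < s) :
    D.measure {ω | s < |f ω|} < ∞ := by
  by_contra htop
  rw [not_lt, top_le_iff] at htop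
  obtain ⟨m, hm⟩ : ∃ m, m ∈ D.index := ⟨_, D.isClamp.mem 0⟩
  have hmeas : MeasurableSet {ω | s < |f ω|} := measurableSet_lt measurable_const hf.abs
  have hη : ‖s‖ₑ * X.eNorm (Pi.single m 1) ≠ 0 :=
    mul_ne_zero (by simpa using hs.ne') (X.isSeqNorm.single_ne_zero m hm)
  refine hfin (hX.fnorm_eq_top hp hη fun N => ?_)
  obtain ⟨B, hB, hBS, hBd, hBμ⟩ := D.exists_cells hm hmeas N (by rw [htop]; exact le_top)
  refine ⟨fun i ω => s * (B i).indicator (fun _ => (1 : ℝ)) ω, fun i =>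
    ((measurable_const.indicator (hB i)).const_mul s).aestronglyMeasurable, ?_, ?_, fun i => ?_⟩
  · intro i j ω hi hj
    by_contra hne
    have hi' := Set.mem_of_indicator_ne_zero (right_ne_zero_of_mul hi)
    have hj' := Set.mem_of_indicator_ne_zero (right_ne_zero_of_mul hj)
    exact (hBd i j hne).le_bot ⟨hi', hj'⟩
  · intro i ω
    beta_reduce
    by_cases h : ω ∈ B i
    · rw [Set.indicator_of_mem h, mul_one, abs_of_pos hs]
      exact (show s < |f ω| from hBS i h).le
    · rw [Set.indicator_of_notMem h, mul_zero, abs_zero]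
      exact abs_nonneg _
  · rw [X.fnorm_smul (measurable_const.indicator (hB i)).aestronglyMeasurable,
      X.fnorm_indicator hm (hB i) (hBμ i)]

theorem measure_level_lt_top_of_mem {Y : RISpace D} {q : ℝ} {M' : ℝ≥0} (hX : X.PConcaveWith p M)
    (hp : 1 ≤ p) (hY : Y.PConcaveWith q M') (hq : 1 ≤ q) {f : L0 D.measure}
    (hf : f ∈ KotheSpace.sumSpace X.toKotheSpace Y.toKotheSpace) {s : ℝ} (hs : 0 < s) :
    D.measure {ω | s < |f ω|} < ∞ := by
  obtain ⟨x, y, hx, hy, rfl⟩ := exists_decomposition hf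
  have h1 := RISpace.measure_level_lt_top hX hp x.measurable (by rwa [X.fnorm_coe]) (half_pos hs)
  have h2 := RISpace.measure_level_lt_top hY hq y.measurable (by rwa [Y.fnorm_coe]) (half_pos hs)
  refine lt_of_le_of_lt ?_ (lt_of_le_of_lt (measure_union_le _ _) (ENNReal.add_lt_top.2 ⟨h1, h2⟩))
  refine measure_mono_ae ?_
  filter_upwards [AEEqFun.coeFn_add x y] with ω hω (h : s < |_|)
  rw [hω, Pi.add_apply] at h
  by_contra hcon
  have h3 : ¬ s / 2 < |x ω| := fun h' => hcon (Or.inl h')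
  have h4 : ¬ s / 2 < |y ω| := fun h' => hcon (Or.inr h')
  have := abs_add_le (x ω) (y ω)
  linarith


namespace Domain

/-! ### Partitions adapted to a function -/

variable (D : Domain)

theorem measure_dyadic_of_notMem {n : ℤ} (hn : n ∉ D.index) : D.measure (dyadic n) = 0 := by
  cases D with
  | unitInterval =>
    have h0 : 0 ≤ n := not_lt.1 hn
    rw [measure, Measure.restrict_apply (measurableSet_dyadic n)]
    refine measure_mono_null (t := {1}) ?_ (by simp)
    rintro x ⟨h1, h2⟩
    have h3 : (1 : ℝ) ≤ 2 ^ n := one_le_zpow₀ (by norm_num) h0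
    exact le_antisymm h2.2 (h3.trans h1.1)
  | halfLine => exact absurd (Set.mem_univ n) hn
  | naturals =>
    have h0 : n < 0 := not_le.1 hn
    rw [naturals_measure_apply (measurableSet_dyadic n)]
    have : (fun m : ℕ => (m : ℝ) + 1) ⁻¹' dyadic n = ∅ := by
      ext m
      simp only [Set.mem_preimage, Set.mem_empty_iff_false, iff_false]
      intro h
      have h1 : (2 : ℝ) ^ (n + 1) ≤ 1 := zpow_le_one_of_nonpos₀ (by norm_num) (by omega)
      have h2 : (m : ℝ) + 1 < 2 ^ (n + 1) := h.2
      have h3 : (0 : ℝ) ≤ m := m.cast_nonneg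
      linarith
    rw [this]
    simp

/-- The measure of the initial segment below `2ⁿ`. -/
noncomputable def weight (n : ℤ) : ℝ≥0∞ := D.measure (Set.Iio (2 ^ n))

theorem weight_succ (n : ℤ) : D.weight (n + 1) = D.weight n + D.measure (dyadic n) := by
  rw [weight, weight, ← measure_union _ (measurableSet_dyadic n)]
  · congr 1
    rw [dyadic, Set.Iio_union_Ico_eq_Iio]
    exact zpow_le_zpow_right₀ (by norm_num) (by omega)
  · exact Set.disjoint_left.2 fun x hx hx' => absurd hx (not_lt.2 hx'.1)

theorem weight_mono : Monotone D.weight := fun _ _ h =>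
  measure_mono (Set.Iio_subset_Iio (zpow_le_zpow_right₀ (by norm_num) h))

theorem weight_ne_top (n : ℤ) : D.weight n ≠ ∞ := (D.measure_Iio_lt_top _).ne

theorem measure_Iic_zero : D.measure (Set.Iic 0) = 0 := by
  cases D with
  | unitInterval =>
    rw [measure, Measure.restrict_apply measurableSet_Iic]
    refine measure_mono_null (t := {0}) ?_ (by simp)
    rintro x ⟨h1, h2⟩
    exact le_antisymm h1 h2.1
  | halfLine =>
    rw [measure, Measure.restrict_apply measurableSet_Iic]
    refine measure_mono_null (t := {0}) ?_ (by simp)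
    rintro x ⟨h1, h2⟩
    exact le_antisymm h1 h2
  | naturals =>
    rw [naturals_measure_apply measurableSet_Iic]
    have : (fun m : ℕ => (m : ℝ) + 1) ⁻¹' Set.Iic 0 = ∅ := by
      ext m
      simp only [Set.mem_preimage, Set.mem_Iic, Set.mem_empty_iff_false, iff_false, not_le]
      positivity
    rw [this]
    simp

theorem iInf_weight : ⨅ n : ℕ, D.weight (-(n : ℤ)) = 0 := by
  have h1 : ⋂ n : ℕ, Set.Iio ((2 : ℝ) ^ (-(n : ℤ))) = Set.Iic 0 := by
    ext x
    simp only [Set.mem_iInter, Set.mem_Iio, Set.mem_Iic]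
    constructor
    · intro h
      by_contra hx
      obtain ⟨n, hn⟩ := exists_pow_lt_of_lt_one (not_le.1 hx) (show (1 / 2 : ℝ) < 1 by norm_num)
      have := h n
      rw [zpow_neg, zpow_natCast] at this
      rw [one_div, inv_pow] at hn
      linarith
    · intro h n
      exact lt_of_le_of_lt h (by positivity)
  have h2 := Antitone.measure_iInter (μ := D.measure) (s := fun n : ℕ => Set.Iio ((2 : ℝ) ^ (-(n : ℤ))))
    (fun i j h => Set.Iio_subset_Iio (zpow_le_zpow_right₀ (by norm_num) (by simpa using h)))
    (fun i => measurableSet_Iio.nullMeasurableSet) ⟨0, (D.measure_Iio_lt_top _).ne⟩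
  rw [h1, measure_Iic_zero] at h2
  exact h2.symm

theorem iSup_weight : ⨆ n : ℕ, D.weight n = D.measure Set.univ := by
  have h1 : ⋃ n : ℕ, Set.Iio ((2 : ℝ) ^ (n : ℤ)) = Set.univ := by
    refine Set.eq_univ_of_forall fun x => Set.mem_iUnion.2 ?_
    obtain ⟨n, hn⟩ := pow_unbounded_of_one_lt x (show (1 : ℝ) < 2 by norm_num)
    exact ⟨n, by rwa [Set.mem_Iio, zpow_natCast]⟩
  rw [← h1, Monotone.measure_iUnion]
  · rfl
  · exact fun i j h => Set.Iio_subset_Iio (zpow_le_zpow_right₀ (by norm_num) (by exact_mod_cast h))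

theorem admissible_sub {S T : Set ℝ} (hS : MeasurableSet S) (hT : MeasurableSet T)
    (hSfin : D.measure S ≠ ∞) (hTfin : D.measure T ≠ ∞) :
    D.Admissible (D.measure S - D.measure T) := by
  by_cases hD : D = naturals
  · subst hD
    have key : ∀ S : Set ℝ, MeasurableSet S → naturals.measure S ≠ ∞ →
        ∃ n : ℕ, naturals.measure S = n := by
      intro S hS hfin
      rw [naturals_measure_apply hS] at hfin ⊢
      obtain ⟨n, hn⟩ := ENat.ne_top_iff_exists.1 (fun h => hfin (by rw [h]; rfl) :
        ((fun n : ℕ => (n : ℝ) + 1) ⁻¹' S).encard ≠ ⊤)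
      exact ⟨n, by rw [← hn]; rfl⟩
    obtain ⟨m, hm⟩ := key S hS hSfin
    obtain ⟨n, hn⟩ := key T hT hTfin
    rw [hm, hn, ← ENNReal.natCast_sub]
    exact naturals_admissible _
  · exact D.admissible_of_ne hD _

variable (f : ℝ → ℝ)

/-- The levels above which `|f|` lives on a set of measure at most `c`. -/
def levels (c : ℝ≥0∞) : Set ℝ := {s | 0 ≤ s ∧ D.measure {ω | s < |f ω|} ≤ c}

/-- A set of measure `c` on which `|f|` is largest. -/
noncomputable def top (c : ℝ≥0∞) : Set ℝ :=
  if c = 0 then ∅ else {ω | sInf (D.levels f c) < |f ω|} ∪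
    D.initial {ω | |f ω| = sInf (D.levels f c)} (c - D.measure {ω | sInf (D.levels f c) < |f ω|})

variable {f} (hf : Measurable f) (hfin : ∀ s : ℝ, 0 < s → D.measure {ω | s < |f ω|} < ∞)

theorem levels_bddBelow (c : ℝ≥0∞) : BddBelow (D.levels f c) := ⟨0, fun _ h => h.1⟩

theorem sInf_levels_nonneg (c : ℝ≥0∞) : 0 ≤ sInf (D.levels f c) := Real.sInf_nonneg fun _ h => h.1

include hf in
theorem measurableSet_level (s : ℝ) : MeasurableSet {ω | s < |f ω|} :=
  measurableSet_lt measurable_const hf.abs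

include hf in
theorem measurableSet_top (c : ℝ≥0∞) : MeasurableSet (D.top f c) := by
  rw [top]
  split_ifs
  · exact MeasurableSet.empty
  · exact (measurableSet_level hf _).union
      (D.measurableSet_initial (measurableSet_eq_fun hf.abs measurable_const) _)

include hf hfin in
theorem levels_nonempty {c : ℝ≥0∞} (hc : c ≠ 0) : (D.levels f c).Nonempty := by
  have h := Antitone.measure_iInter (μ := D.measure) (s := fun n : ℕ => {ω | (n + 1 : ℝ) < |f ω|})
    (fun i j h ω (hω : (j + 1 : ℝ) < _) => lt_of_le_of_lt (by gcongr) hω)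
    (fun i => (measurableSet_level hf _).nullMeasurableSet)
    ⟨0, (hfin _ (by norm_num)).ne⟩
  have h1 : ⋂ n : ℕ, {ω | (n + 1 : ℝ) < |f ω|} = ∅ := by
    refine Set.eq_empty_of_forall_notMem fun ω hω => ?_
    obtain ⟨n, hn⟩ := exists_nat_gt |f ω|
    have : (n + 1 : ℝ) < |f ω| := Set.mem_iInter.1 hω n
    linarith
  rw [h1, measure_empty] at h
  obtain ⟨n, hn⟩ := iInf_lt_iff.1 (h ▸ pos_iff_ne_zero.2 hc)
  exact ⟨n + 1, by positivity, hn.le⟩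

include hf hfin in
theorem measure_lt_sInf_le {c : ℝ≥0∞} (hc : c ≠ 0) :
    D.measure {ω | sInf (D.levels f c) < |f ω|} ≤ c := by
  set s := sInf (D.levels f c)
  have h1 : {ω | s < |f ω|} = ⋃ n : ℕ, {ω | s + 1 / (n + 1 : ℝ) < |f ω|} := by
    ext ω
    simp only [Set.mem_ofPred_eq, Set.mem_iUnion]
    constructor
    · intro h
      obtain ⟨n, hn⟩ := exists_nat_one_div_lt (sub_pos.2 h)
      exact ⟨n, by linarith⟩
    · rintro ⟨n, hn⟩
      have : (0 : ℝ) < 1 / (n + 1 : ℝ) := by positivity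
      linarith
  rw [h1, Monotone.measure_iUnion]
  · refine iSup_le fun n => ?_
    obtain ⟨r, hr, hrs⟩ := exists_lt_of_csInf_lt (D.levels_nonempty hf hfin hc)
      (show s < s + 1 / (n + 1 : ℝ) from lt_add_of_pos_right _ (by positivity))
    exact (measure_mono fun ω (hω : _ < _) => hrs.trans hω).trans hr.2
  · intro i j h ω (hω : s + 1 / (i + 1 : ℝ) < |f ω|)
    refine lt_of_le_of_lt ?_ hω
    gcongr

include hf hfin in
theorem le_measure_sInf_le {c : ℝ≥0∞} (hcu : c ≤ D.measure Set.univ) :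
    c ≤ D.measure {ω | sInf (D.levels f c) ≤ |f ω|} := by
  set s := sInf (D.levels f c) with hs
  rcases (D.sInf_levels_nonneg (f := f) c).eq_or_lt with h0 | hpos
  · have : {ω | s ≤ |f ω|} = Set.univ := Set.eq_univ_of_forall fun ω => by
      rw [Set.mem_ofPred_eq, hs, ← h0]
      exact abs_nonneg _
    rwa [this]
  have hr : ∀ n : ℕ, 0 < s - s / (n + 2 : ℝ) ∧ s - s / (n + 2 : ℝ) < s := by
    intro n
    have h1 : s / (n + 2 : ℝ) < s := div_lt_self hpos (by
      have : (0 : ℝ) ≤ n := n.cast_nonneg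
      linarith)
    exact ⟨sub_pos.2 h1, sub_lt_self _ (by positivity)⟩
  have h1 : {ω | s ≤ |f ω|} = ⋂ n : ℕ, {ω | s - s / (n + 2 : ℝ) < |f ω|} := by
    ext ω
    simp only [Set.mem_ofPred_eq, Set.mem_iInter]
    constructor
    · exact fun h n => (hr n).2.trans_le h
    · intro h
      by_contra hcon
      obtain ⟨n, hn⟩ := exists_nat_one_div_lt (div_pos (sub_pos.2 (not_le.1 hcon)) hpos)
      have h2 := h n
      rw [lt_div_iff₀ hpos, one_div_mul_eq_div] at hn
      have h3 : s / (n + 2 : ℝ) ≤ s / (n + 1 : ℝ) := by gcongr; norm_num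
      linarith
  rw [h1, Antitone.measure_iInter]
  · refine le_iInf fun n => ?_
    by_contra hcon
    exact absurd (csInf_le (D.levels_bddBelow c) ⟨(hr n).1.le, (not_le.1 hcon).le⟩)
      (not_le.2 (hr n).2)
  · intro i j h ω (hω : s - s / (j + 2 : ℝ) < |f ω|)
    refine lt_of_le_of_lt ?_ hω
    gcongr
  · exact fun n => (measurableSet_level hf _).nullMeasurableSet
  · exact ⟨0, (hfin _ (hr 0).1).ne⟩

include hf hfin in
theorem measure_top {S : Set ℝ} (hS : MeasurableSet S) (hSfin : D.measure S ≠ ∞) :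
    D.measure (D.top f (D.measure S)) = D.measure S := by
  rw [top]
  split_ifs with hc
  · rw [hc, measure_empty]
  set c := D.measure S with hcdef
  set s := sInf (D.levels f c) with hs
  have h1 := D.measure_lt_sInf_le hf hfin hc
  have h2 := D.le_measure_sInf_le hf hfin (c := c) (measure_mono (Set.subset_univ _))
  rw [← hs] at h1 h2
  have hmeq : MeasurableSet {ω | |f ω| = s} := measurableSet_eq_fun hf.abs measurable_const
  have h3 : {ω | s ≤ |f ω|} = {ω | s < |f ω|} ∪ {ω | |f ω| = s} := by
    ext ω
    simp only [Set.mem_ofPred_eq, Set.mem_union]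
    rw [le_iff_lt_or_eq, eq_comm]
  have hd : Disjoint {ω | s < |f ω|} {ω | |f ω| = s} :=
    Set.disjoint_left.2 fun ω (h : _ < _) (h' : _ = _) => absurd h' h.ne'
  rw [h3, measure_union hd hmeq] at h2
  rw [measure_union (hd.mono_right (D.initial_subset _ _)) (D.measurableSet_initial hmeq _),
    D.measure_initial hmeq (D.admissible_sub hS (measurableSet_level hf _) hSfin
      (ne_top_of_le_ne_top hSfin h1)) (tsub_le_iff_left.2 h2), add_tsub_cancel_of_le h1]

include hf hfin in
theorem top_mono {c c' : ℝ≥0∞} (h : c ≤ c') : D.top f c ⊆ D.top f c' := by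
  by_cases hc : c = 0
  · rw [top, if_pos hc]; exact Set.empty_subset _
  have hc' : c' ≠ 0 := ne_bot_of_le_ne_bot hc h
  rw [top, top, if_neg hc, if_neg hc']
  have hle : sInf (D.levels f c') ≤ sInf (D.levels f c) :=
    csInf_le_csInf (D.levels_bddBelow c') (D.levels_nonempty hf hfin hc)
      fun s hs => ⟨hs.1, hs.2.trans h⟩
  rcases hle.eq_or_lt with heq | hlt
  · rw [heq]
    exact Set.union_subset_union_right _ (D.initial_mono _ (tsub_le_tsub_right h _))
  · refine Set.Subset.trans ?_ Set.subset_union_left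
    refine Set.union_subset (fun ω (hω : _ < _) => hlt.trans hω) fun ω hω => ?_
    have this := D.initial_subset _ _ hω
    change |f ω| = _ at this
    exact hlt.trans_eq this.symm

theorem abs_le_of_mem_top {c : ℝ≥0∞} {ω ω' : ℝ} (h : ω ∈ D.top f c) (h' : ω' ∉ D.top f c) :
    |f ω'| ≤ |f ω| := by
  rw [top] at h h'
  split_ifs at h h' with hc
  · exact absurd h (Set.notMem_empty _)
  · have h1 : |f ω'| ≤ sInf (D.levels f c) := not_lt.1 fun hlt => h' (Or.inl hlt)
    refine h1.trans ?_
    rcases h with h | h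
    · exact le_of_lt h
    · have this := D.initial_subset _ _ h
      change |f ω| = _ at this
      exact this.ge

include hf hfin in
theorem ae_mem_iUnion_top :
    ∀ᵐ ω ∂D.measure, f ω ≠ 0 → ω ∈ ⋃ n : ℕ, D.top f (D.weight n) := by
  have hUm : MeasurableSet (⋃ n : ℕ, D.top f (D.weight n)) :=
    MeasurableSet.iUnion fun n => D.measurableSet_top hf _
  have key : ∀ r : ℝ, 0 < r →
      D.measure ({ω | r < |f ω|} \ ⋃ n : ℕ, D.top f (D.weight n)) = 0 := by
    intro r hr
    by_cases h : ∃ n : ℕ, D.weight n ≠ 0 ∧ sInf (D.levels f (D.weight n)) ≤ r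
    · obtain ⟨n, hn, hnr⟩ := h
      have : {ω | r < |f ω|} \ ⋃ n : ℕ, D.top f (D.weight n) = ∅ := by
        rw [Set.sdiff_eq_empty]
        refine Set.Subset.trans ?_ (Set.subset_iUnion _ n)
        rw [top, if_neg hn]
        exact fun ω (hω : _ < _) => Or.inl (lt_of_le_of_lt hnr hω)
      rw [this, measure_empty]
    · push Not at h
      have hsub : ⋃ n : ℕ, D.top f (D.weight n) ⊆ {ω | r < |f ω|} := by
        refine Set.iUnion_subset fun n => ?_
        rw [top]
        split_ifs with hc
        · exact Set.empty_subset _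
        · refine Set.union_subset (fun ω (hω : _ < _) => (h n hc).trans hω) fun ω hω => ?_
          have this := D.initial_subset _ _ hω
          change |f ω| = _ at this
          exact (h n hc).trans_eq this.symm
      have hUfin : D.measure (⋃ n : ℕ, D.top f (D.weight n)) ≠ ∞ :=
        ((measure_mono hsub).trans_lt (hfin r hr)).ne
      refine measure_mono_null (t := (⋃ n : ℕ, D.top f (D.weight n))ᶜ)
        (fun ω hω => hω.2) ?_
      rw [measure_compl hUm hUfin, tsub_eq_zero_iff_le, ← D.iSup_weight]
      refine iSup_le fun n => ?_
      have h1 := D.measure_top hf hfin measurableSet_Iio (D.weight_ne_top n)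
      change D.weight n ≤ _
      rw [weight, ← h1]
      exact measure_mono (Set.subset_iUnion (fun n : ℕ => D.top f (D.weight n)) n)
  have h1 : ∀ᵐ ω ∂D.measure, ∀ j : ℕ,
      ω ∉ {ω | 1 / (j + 1 : ℝ) < |f ω|} \ ⋃ n : ℕ, D.top f (D.weight n) :=
    ae_all_iff.2 fun j => measure_eq_zero_iff_ae_notMem.1 (key _ (by positivity))
  filter_upwards [h1] with ω hω h0
  obtain ⟨j, hj⟩ := exists_nat_one_div_lt (abs_pos.2 h0)
  by_contra hcon
  exact hω j ⟨hj, hcon⟩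

end Domain

variable {D : Domain}

/-- Pieces on which the absolute values of `f` decrease from left to right. -/
structure IsDecreasing (D : Domain) (f : ℝ → ℝ) (A : ℤ → Set ℝ) : Prop where
  pieces : IsPieces D D.index A
  cover : ∀ᵐ ω ∂D.measure, f ω ≠ 0 → ∃ k, ω ∈ A k
  anti : ∀ k l, k < l → ∀ ω ∈ A k, ∀ ω' ∈ A l, |f ω'| ≤ |f ω|

theorem exists_isDecreasing {f : ℝ → ℝ} (hf : Measurable f)
    (hfin : ∀ s : ℝ, 0 < s → D.measure {ω | s < |f ω|} < ∞) : ∃ A, IsDecreasing D f A := by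
  set B : ℤ → Set ℝ := fun n => D.top f (D.weight n) with hB
  have hBm : ∀ n, MeasurableSet (B n) := fun n => D.measurableSet_top hf _
  have hBμ : ∀ n, D.measure (B n) = D.weight n := fun n =>
    D.measure_top hf hfin measurableSet_Iio (D.weight_ne_top n)
  have hmono : Monotone B := fun i j h => D.top_mono hf hfin (D.weight_mono h)
  refine ⟨fun n => B (n + 1) \ B n, ⟨fun n => (hBm _).diff (hBm _), ?_, ?_, ?_⟩, ?_, ?_⟩
  · have key : ∀ i j : ℤ, i < j → Disjoint (B (i + 1) \ B i) (B (j + 1) \ B j) := fun i j h =>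
      Set.disjoint_left.2 fun ω h1 h2 => h2.2 (hmono (Int.add_one_le_of_lt h) h1.1)
    intro i j hij
    rcases lt_or_gt_of_ne hij with h | h
    · exact key i j h
    · exact (key j i h).symm
  · intro n hn
    rw [measure_sdiff (hmono (by omega)) (hBm n).nullMeasurableSet
      (by rw [hBμ]; exact D.weight_ne_top n), hBμ, hBμ, D.weight_succ, D.measure_dyadic hn,
      ENNReal.add_sub_cancel_left (D.weight_ne_top n)]
  · intro n hn
    have : D.weight (n + 1) = D.weight n := by
      rw [D.weight_succ, D.measure_dyadic_of_notMem hn, add_zero]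
    simp only [hB, this, Set.sdiff_self]
  · have h0 : D.measure (⋂ n : ℕ, B (-(n : ℤ))) = 0 := by
      refine le_antisymm ?_ zero_le
      rw [← D.iInf_weight]
      exact le_iInf fun n => (measure_mono (Set.iInter_subset _ n)).trans (hBμ _).le
    filter_upwards [D.ae_mem_iUnion_top hf hfin, measure_eq_zero_iff_ae_notMem.1 h0] with ω h1 h2 hne
    obtain ⟨m, hm⟩ := Set.mem_iUnion.1 (h1 hne)
    rw [Set.mem_iInter] at h2
    push Not at h2
    obtain ⟨n, hn⟩ := h2
    obtain ⟨k, hk, hmin⟩ := Int.exists_least_of_bdd (P := fun k => ω ∈ B k) ⟨-(n : ℤ), fun z hz => by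
      by_contra h
      exact hn (hmono (not_le.1 h).le hz)⟩ ⟨(m : ℤ), hm⟩
    refine ⟨k - 1, by rwa [sub_add_cancel], fun h => ?_⟩
    have := hmin _ h
    omega
  · intro k l hkl ω hω ω' hω'
    exact D.abs_le_of_mem_top hω.1 fun h => hω'.2 (hmono (Int.add_one_le_of_lt hkl) h)


variable {D : Domain} {X Y : RISpace D}

/-! ### Representation of a function by a sequence -/

/-- The sign of `f`, with values `1` and `-1`. -/
noncomputable def signFn (f : ℝ → ℝ) (ω : ℝ) : ℝ := if f ω < 0 then -1 else 1

theorem measurable_signFn {f : ℝ → ℝ} (hf : Measurable f) : Measurable (signFn f) :=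
  Measurable.ite (measurableSet_lt hf measurable_const) measurable_const measurable_const

theorem abs_signFn_le (f : ℝ → ℝ) (ω : ℝ) : |signFn f ω| ≤ 1 := by
  rw [signFn]; split_ifs <;> simp

theorem mul_signFn (f : ℝ → ℝ) (ω : ℝ) : f ω * signFn f ω = |f ω| := by
  rw [signFn]
  split_ifs with h
  · rw [abs_of_neg h, mul_neg_one]
  · rw [abs_of_nonneg (not_lt.1 h), mul_one]

theorem Domain.naturals_ae_enorm_le {h : ℝ → ℝ} (S : Set ℝ) :
    ∀ᵐ ω ∂naturals.measure, ω ∈ S → ‖h ω‖ₑ ≤ ∫⁻ x in S, ‖h x‖ₑ ∂naturals.measure := by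
  have h1 : ∀ᵐ ω ∂naturals.measure, ω ∈ Set.range fun n : ℕ => (n : ℝ) + 1 := by
    have hm : MeasurableSet (Set.range fun n : ℕ => (n : ℝ) + 1)ᶜ :=
      (Set.countable_range _).measurableSet.compl
    rw [ae_iff]
    change naturals.measure (Set.range fun n : ℕ => (n : ℝ) + 1)ᶜ = 0
    rw [naturals_measure_apply hm, Set.preimage_compl, Set.preimage_range, Set.compl_univ]
    simp
  filter_upwards [h1] with ω hω hS
  obtain ⟨n, rfl⟩ := hω
  refine le_trans (le_of_eq ?_) (lintegral_mono_set (Set.singleton_subset_iff.2 hS))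
  rw [lintegral_singleton, naturals_measure_apply (measurableSet_singleton _)]
  have : (fun m : ℕ => (m : ℝ) + 1) ⁻¹' {(n : ℝ) + 1} = {n} := by
    ext m
    simp
  rw [this, Set.encard_singleton]
  simp

section

variable {f : ℝ → ℝ} {A : ℤ → Set ℝ}

theorem avg_signFn (k : ℤ) :
    avg D A (signFn f) f k = (2 ^ k)⁻¹ * ∫ ω in A k, |f ω| ∂D.measure := by
  rw [avg]
  simp only [mul_signFn]

theorem IsDecreasing.abs_le_avg (hA : IsDecreasing D f A)
    (hint : ∀ k, IntegrableOn f (A k) D.measure) {k l : ℤ} (hk : k ∈ D.index) (hkl : k < l) {ω : ℝ}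
    (hω : ω ∈ A l) : |f ω| ≤ avg D A (signFn f) f k := by
  have hpos : (0 : ℝ) < 2 ^ k := by positivity
  have hfin : D.measure (A k) ≠ ∞ := by
    rw [hA.pieces.measure k hk]; exact ENNReal.ofReal_ne_top
  have h1 : ∫ _ in A k, |f ω| ∂D.measure ≤ ∫ x in A k, |f x| ∂D.measure :=
    setIntegral_mono_on (integrableOn_const hfin) (hint k).norm (hA.pieces.measurable k)
      fun x hx => hA.anti k l hkl x hx ω hω
  rw [setIntegral_const, measureReal_def, hA.pieces.measure k hk, ENNReal.toReal_ofReal hpos.le,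
    smul_eq_mul] at h1
  rwa [avg_signFn, ← div_eq_inv_mul, le_div_iff₀ hpos, mul_comm]

theorem IsDecreasing.abs_le_avg_edge (hint : ∀ k, IntegrableOn f (A k) D.measure) {k : ℤ}
    (hk : k ∈ D.index) (hk' : k - 1 ∉ D.index) :
    ∀ᵐ ω ∂D.measure, ω ∈ A k → |f ω| ≤ avg D A (signFn f) f k := by
  cases D with
  | unitInterval =>
    refine absurd ?_ hk'
    change k < 0 at hk
    change k - 1 < 0
    omega
  | halfLine => exact absurd (Set.mem_univ _) hk'
  | naturals =>
    have h0 : k = 0 := by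
      change 0 ≤ k at hk
      have h1 : ¬ 0 ≤ k - 1 := hk'
      omega
    subst h0
    filter_upwards [Domain.naturals_ae_enorm_le (h := f) (A 0)] with ω hω hA
    have h1 := hω hA
    rw [← ofReal_integral_norm_eq_lintegral_enorm (hint 0), Real.enorm_eq_ofReal_abs,
      ENNReal.ofReal_le_ofReal_iff (integral_nonneg fun _ => norm_nonneg _)] at h1
    rw [avg_signFn]
    simpa using h1

open Classical in
/-- The index preceding `k`, if it belongs to the index set. -/
noncomputable def prevIndex (D : Domain) (k : ℤ) : ℤ := if k - 1 ∈ D.index then k - 1 else k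

theorem prevIndex_mem {k : ℤ} (hk : k ∈ D.index) : prevIndex D k ∈ D.index := by
  rw [prevIndex]
  split_ifs with h
  exacts [h, hk]

theorem IsDecreasing.ae_abs_le (hA : IsDecreasing D f A)
    (hint : ∀ k, IntegrableOn f (A k) D.measure) :
    ∀ᵐ ω ∂D.measure, ∀ k, ω ∈ A k → |f ω| ≤ avg D A (signFn f) f (prevIndex D k) := by
  rw [ae_all_iff]
  intro k
  by_cases hk : k ∈ D.index
  · rw [prevIndex]
    split_ifs with h
    · exact ae_of_all _ fun ω hω => hA.abs_le_avg hint h (by omega) hω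
    · exact abs_le_avg_edge hint hk h
  · rw [hA.pieces.empty k hk]
    exact ae_of_all _ fun ω hω => absurd hω (Set.notMem_empty _)

theorem RISpace.eNorm_prevIndex_le (X : RISpace D) (x : ℤ → ℝ) :
    X.eNorm (fun k => x (prevIndex D k)) ≤ 3 * X.eNorm x := by
  have hN := X.isSeqNorm
  calc X.eNorm (fun k => x (prevIndex D k))
      ≤ X.eNorm ((fun k => |shiftSeq D.index x k|) + fun k => |x k|) := by
        refine hN.mono' fun k => le_trans ?_ (le_abs_self _)
        rw [Pi.add_apply, prevIndex, shiftSeq]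
        split_ifs with h
        · rw [Set.indicator_of_mem (show k ∈ {n | n - 1 ∈ D.index} from h)]
          exact le_add_of_nonneg_right (abs_nonneg _)
        · exact le_add_of_nonneg_left (abs_nonneg _)
    _ ≤ X.eNorm (fun k => |shiftSeq D.index x k|) + X.eNorm fun k => |x k| := hN.add_le _ _
    _ = X.eNorm (shiftSeq D.index x) + X.eNorm x := by
        rw [hN.congr fun k _ => abs_abs (shiftSeq D.index x k), hN.congr fun k _ => abs_abs (x k)]
    _ ≤ 2 * X.eNorm x + X.eNorm x := add_le_add (X.eNorm_shiftSeq_le x) le_rfl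
    _ = 3 * X.eNorm x := by ring

/-- The multiple of `f` on `A k` whose size is controlled by the preceding coordinate of `x`. -/
noncomputable def synthFn (D : Domain) (f : ℝ → ℝ) (A : ℤ → Set ℝ) (x : ℤ → ℝ) : ℝ → ℝ :=
  glue A fun k ω => x (prevIndex D k) / avg D A (signFn f) f (prevIndex D k) * f ω

theorem IsPieces.synthFn_eq (hA : IsPieces D D.index A) (x : ℤ → ℝ) {k : ℤ} {ω : ℝ} (h : ω ∈ A k) :
    synthFn D f A x ω = x (prevIndex D k) / avg D A (signFn f) f (prevIndex D k) * f ω :=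
  glue_eq hA.disjoint _ h

theorem synthFn_eq_zero (x : ℤ → ℝ) {ω : ℝ} (h : ∀ k, ω ∉ A k) : synthFn D f A x ω = 0 :=
  glue_eq_zero _ h

theorem measurable_synthFn (hA : IsPieces D D.index A) (hf : Measurable f) (x : ℤ → ℝ) :
    Measurable (synthFn D f A x) :=
  measurable_glue hA.disjoint hA.measurable fun _ => hf.const_mul _

theorem RISpace.fnorm_synthFn_le (X : RISpace D) (hA : IsDecreasing D f A) (hf : Measurable f)
    (hint : ∀ k, IntegrableOn f (A k) D.measure) (x : ℤ → ℝ) :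
    X.fnorm (synthFn D f A x) ≤ 3 * X.eNorm x := by
  refine le_trans ?_ (X.eNorm_prevIndex_le x)
  rw [← X.fnorm_stepFn hA.pieces]
  refine X.fnorm_mono (measurable_synthFn hA.pieces hf x).aestronglyMeasurable ?_
  filter_upwards [hA.ae_abs_le hint] with ω hω
  by_cases h : ∃ k, ω ∈ A k
  · obtain ⟨k, hk⟩ := h
    have h1 := hω k hk
    rw [hA.pieces.synthFn_eq x hk, hA.pieces.stepFn_eq _ hk, abs_mul, abs_div,
      div_mul_eq_mul_div]
    exact div_le_of_le_mul₀ (abs_nonneg _) (abs_nonneg _)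
      (mul_le_mul_of_nonneg_left (h1.trans (le_abs_self _)) (abs_nonneg _))
  · push Not at h
    rw [synthFn_eq_zero x h, abs_zero]
    exact abs_nonneg _

theorem IsDecreasing.synthFn_avg (hA : IsDecreasing D f A)
    (hint : ∀ k, IntegrableOn f (A k) D.measure) :
    synthFn D f A (avg D A (signFn f) f) =ᵐ[D.measure] f := by
  filter_upwards [hA.ae_abs_le hint, hA.cover] with ω hω hcov
  by_cases h : ∃ k, ω ∈ A k
  · obtain ⟨k, hk⟩ := h
    have h1 := hω k hk
    rw [hA.pieces.synthFn_eq _ hk]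
    by_cases h0 : avg D A (signFn f) f (prevIndex D k) = 0
    · rw [h0] at h1
      rw [abs_nonpos_iff.1 h1, mul_zero]
    · rw [div_self h0, one_mul]
  · have h2 : f ω = 0 := by
      by_contra h0
      exact h (hcov h0)
    push Not at h
    rw [synthFn_eq_zero _ h, h2]

theorem IsPieces.synthFn_congr (hA : IsPieces D D.index A) {x y : ℤ → ℝ}
    (h : ∀ k ∈ D.index, x k = y k) : synthFn D f A x = synthFn D f A y := by
  ext ω
  by_cases h' : ∃ k, ω ∈ A k
  · obtain ⟨k, hk⟩ := h'
    rw [hA.synthFn_eq x hk, hA.synthFn_eq y hk, h _ (prevIndex_mem (hA.mem hk))]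
  · push Not at h'
    rw [synthFn_eq_zero _ h', synthFn_eq_zero _ h']

/-- The functions `synthFn`, as a linear map. -/
noncomputable def synthₗ (hA : IsPieces D D.index A) (hf : Measurable f) :
    (ℤ → ℝ) →ₗ[ℝ] L0 D.measure where
  toFun x := AEEqFun.mk (synthFn D f A x) (measurable_synthFn hA hf x).aestronglyMeasurable
  map_add' x y := by
    rw [AEEqFun.mk_add_mk]
    congr 1
    ext ω
    rw [Pi.add_apply]
    by_cases h : ∃ k, ω ∈ A k
    · obtain ⟨k, hk⟩ := h
      simp only [hA.synthFn_eq _ hk, Pi.add_apply]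
      ring
    · push Not at h
      simp only [synthFn_eq_zero _ h, add_zero]
  map_smul' c x := by
    rw [RingHom.id_apply, AEEqFun.smul_mk]
    congr 1
    ext ω
    rw [Pi.smul_apply]
    by_cases h : ∃ k, ω ∈ A k
    · obtain ⟨k, hk⟩ := h
      simp only [hA.synthFn_eq _ hk, Pi.smul_apply, smul_eq_mul]
      ring
    · push Not at h
      simp only [synthFn_eq_zero _ h, smul_zero]

end

/-- Bounded operators that represent `f` by a sequence, and recover it. -/
structure Representation (X Y : RISpace D) (τ : ℤ → ℝ≥0) (C : ℝ≥0)
    (f : KotheSpace.sumSpace X.toKotheSpace Y.toKotheSpace) where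
  /-- the analysis operator -/
  U : KotheSpace.sumSpace X.toKotheSpace Y.toKotheSpace →ₗ[ℝ] (ℤ → ℝ)
  /-- the synthesis operator -/
  V : (ℤ → ℝ) →ₗ[ℝ] L0 D.measure
  left_U : ∀ h, X.eNorm (U h) ≤ 2 * X.nrm h
  right_U : ∀ h, Y.eNorm (U h) ≤ 2 * Y.nrm h
  left_V : ∀ x, X.nrm (V x) ≤ 3 * X.eNorm x
  right_V : ∀ x, Y.nrm (V x) ≤ 3 * Y.eNorm x
  V_U : V (U f) = f
  V_congr : ∀ x y, (∀ k ∈ D.index, x k = y k) → V x = V y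
  gap_le : ∀ k, X.eNorm ((Set.Iio k).indicator (U f)) +
    τ k * Y.eNorm ((Set.Ici k).indicator (U f)) ≤
      (2 + 2 * C : ℝ≥0) * KotheSpace.K X.toKotheSpace Y.toKotheSpace (τ k) f

variable {τ : ℤ → ℝ≥0} {C : ℝ≥0}

theorem IsCouple.nonempty_representation (H : IsCouple D.index X.eNorm Y.eNorm τ C)
    (f : KotheSpace.sumSpace X.toKotheSpace Y.toKotheSpace)
    (hfin : ∀ s : ℝ, 0 < s → D.measure {ω | s < |(f : L0 D.measure) ω|} < ∞) :
    Nonempty (Representation X Y τ C f) := by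
  have hf := (f : L0 D.measure).measurable
  obtain ⟨A, hA⟩ := exists_isDecreasing hf hfin
  have hint := integrableOn_of_mem hA.pieces f.2
  have hσ := measurable_signFn hf
  have hσ1 := abs_signFn_le (f : L0 D.measure)
  exact ⟨{
    U := avgₗ hσ hσ1 hA.pieces X Y
    V := synthₗ hA.pieces hf
    left_U := fun h => by rw [← X.fnorm_coe]; exact X.eNorm_avg_le hσ1 hA.pieces _
    right_U := fun h => by rw [← Y.fnorm_coe]; exact Y.eNorm_avg_le hσ1 hA.pieces _
    left_V := fun x => (X.nrm_mk _).trans_le (X.fnorm_synthFn_le hA hf hint x)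
    right_V := fun x => (Y.nrm_mk _).trans_le (Y.fnorm_synthFn_le hA hf hint x)
    V_U := by
      refine Eq.trans ?_ (AEEqFun.mk_coeFn (f : L0 D.measure))
      exact AEEqFun.mk_eq_mk.2 (hA.synthFn_avg hint)
    V_congr := fun x y h => AEEqFun.mk_eq_mk.2 (ae_of_all _ fun ω => by
      rw [hA.pieces.synthFn_congr h])
    gap_le := fun k => eNorm_avg_le_K hσ hσ1 hA.pieces H f k }⟩

theorem K_ne_top (f : KotheSpace.sumSpace X.toKotheSpace Y.toKotheSpace) (t : ℝ≥0) :
    KotheSpace.K X.toKotheSpace Y.toKotheSpace t f ≠ ∞ := by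
  obtain ⟨x, y, hx, hy, hxy⟩ := exists_decomposition f.2
  rw [← hxy]
  exact ne_top_of_le_ne_top (ENNReal.add_ne_top.2 ⟨hx, ENNReal.mul_ne_top ENNReal.coe_ne_top hy⟩)
    KotheSpace.K_le_add

namespace Representation

variable {f g : KotheSpace.sumSpace X.toKotheSpace Y.toKotheSpace}

theorem K_le (R : Representation X Y τ C f) (t : ℝ≥0) (k : ℤ) :
    KotheSpace.K X.toKotheSpace Y.toKotheSpace t f ≤
      3 * (X.eNorm ((Set.Iio k).indicator (R.U f)) +
        t * Y.eNorm ((Set.Ici k).indicator (R.U f))) := by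
  have h := Set.indicator_self_add_compl (Set.Iio k) (R.U f)
  rw [Set.compl_Iio] at h
  have h1 : (f : L0 D.measure) =
      R.V ((Set.Iio k).indicator (R.U f)) + R.V ((Set.Ici k).indicator (R.U f)) := by
    rw [← map_add, h, R.V_U]
  calc _ ≤ X.nrm (R.V ((Set.Iio k).indicator (R.U f))) +
        t * Y.nrm (R.V ((Set.Ici k).indicator (R.U f))) := by
        conv_lhs => rw [h1]
        exact KotheSpace.K_le_add
    _ ≤ 3 * X.eNorm ((Set.Iio k).indicator (R.U f)) +
        t * (3 * Y.eNorm ((Set.Ici k).indicator (R.U f))) :=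
        add_le_add (R.left_V _) (mul_le_mul_right (R.right_V _) _)
    _ = _ := by ring

theorem gap_ne_top (R : Representation X Y τ C f) (H : IsCouple D.index X.eNorm Y.eNorm τ C) (k : ℤ) :
    X.eNorm ((Set.Iio k).indicator (R.U f)) ≠ ∞ ∧ Y.eNorm ((Set.Ici k).indicator (R.U f)) ≠ ∞ := by
  have h1 := ENNReal.add_ne_top.1 (ne_top_of_le_ne_top
    (ENNReal.mul_ne_top ENNReal.coe_ne_top (K_ne_top f (τ k))) (R.gap_le k))
  refine ⟨h1.1, fun h => h1.2 ?_⟩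
  rw [h, ENNReal.mul_top (by exact_mod_cast (H.pos k).ne')]

/-- Operators on sequences transfer to operators on `X + Y`. -/
theorem exists_transfer (Rf : Representation X Y τ C f) (Rg : Representation X Y τ C g)
    {S : (ℤ → ℝ) →ₗ[ℝ] (ℤ → ℝ)} {K : ℝ≥0} (hX : ∀ x, X.eNorm (S x) ≤ K * X.eNorm x)
    (hY : ∀ x, Y.eNorm (S x) ≤ K * Y.eNorm x) (hS : ∀ k ∈ D.index, S (Rg.U g) k = Rf.U f k) :
    ∃ T : KotheSpace.sumSpace X.toKotheSpace Y.toKotheSpace →ₗ[ℝ]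
        KotheSpace.sumSpace X.toKotheSpace Y.toKotheSpace,
      max (X.opNrm T) (Y.opNrm T) ≤ (6 * K : ℝ≥0) ∧ T g = f := by
  set W : KotheSpace.sumSpace X.toKotheSpace Y.toKotheSpace →ₗ[ℝ] L0 D.measure :=
    Rf.V.comp (S.comp Rg.U) with hW
  have hWX : ∀ h, X.nrm (W h) ≤ (6 * K : ℝ≥0) * X.nrm h := by
    intro h
    calc X.nrm (W h) ≤ 3 * X.eNorm (S (Rg.U h)) := Rf.left_V _
      _ ≤ 3 * (K * X.eNorm (Rg.U h)) := mul_le_mul_right (hX _) _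
      _ ≤ 3 * (K * (2 * X.nrm h)) := mul_le_mul_right (mul_le_mul_right (Rg.left_U h) _) _
      _ = (3 * 2) * K * X.nrm h := by ring
      _ = _ := by push_cast; norm_num
  have hWY : ∀ h, Y.nrm (W h) ≤ (6 * K : ℝ≥0) * Y.nrm h := by
    intro h
    calc Y.nrm (W h) ≤ 3 * Y.eNorm (S (Rg.U h)) := Rf.right_V _
      _ ≤ 3 * (K * Y.eNorm (Rg.U h)) := mul_le_mul_right (hY _) _
      _ ≤ 3 * (K * (2 * Y.nrm h)) := mul_le_mul_right (mul_le_mul_right (Rg.right_U h) _) _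
      _ = (3 * 2) * K * Y.nrm h := by ring
      _ = _ := by push_cast; norm_num
  have hmem : ∀ h, W h ∈ KotheSpace.sumSpace X.toKotheSpace Y.toKotheSpace := by
    rintro ⟨h, hh⟩
    obtain ⟨x, y, hx, hy, rfl⟩ := exists_decomposition hh
    have hxm : x ∈ KotheSpace.sumSpace X.toKotheSpace Y.toKotheSpace :=
      Submodule.mem_sup_left (lt_top_iff_ne_top.2 hx)
    have hym : y ∈ KotheSpace.sumSpace X.toKotheSpace Y.toKotheSpace :=
      Submodule.mem_sup_right (lt_top_iff_ne_top.2 hy)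
    have : W ⟨x + y, hh⟩ = W ⟨x, hxm⟩ + W ⟨y, hym⟩ := by
      rw [← map_add]; rfl
    rw [this]
    exact mem_sumSpace (ne_top_of_le_ne_top (ENNReal.mul_ne_top ENNReal.coe_ne_top hx) (hWX _))
      (ne_top_of_le_ne_top (ENNReal.mul_ne_top ENNReal.coe_ne_top hy) (hWY _))
  refine ⟨W.codRestrict _ hmem, max_le (KotheSpace.opNrm_le _ hWX) (KotheSpace.opNrm_le _ hWY),
    Subtype.ext ?_⟩
  change Rf.V (S (Rg.U g)) = f
  rw [Rf.V_congr _ _ hS, Rf.V_U]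

end Representation

theorem IsCouple.isUniformCalderonCouple (H : IsCouple D.index X.eNorm Y.eNorm τ C)
    {C₁ C₂ : ℝ≥0} (hE : RightShift X.eNorm X.eNorm C₁) (hF : LeftShift Y.eNorm Y.eNorm C₂)
    {p q : ℝ} {M₁ M₂ : ℝ≥0} (hX : X.PConcaveWith p M₁) (hp : 1 ≤ p) (hY : Y.PConcaveWith q M₂)
    (hq : 1 ≤ q) : KotheSpace.IsUniformCalderonCouple X.toKotheSpace Y.toKotheSpace := by
  obtain ⟨K, hK⟩ := H.exists_operator hE hF
    (fun x hx ε hε => RISpace.exists_eNorm_Iio_lt hX hp hx hε)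
    (fun x hx ε hε => RISpace.exists_eNorm_Ici_lt hY hq hx hε) ((2 + 2 * C) * 3)
  refine ⟨6 * K, fun f g hfg => ?_⟩
  obtain ⟨Rf⟩ := H.nonempty_representation f fun s hs =>
    measure_level_lt_top_of_mem hX hp hY hq f.2 hs
  obtain ⟨Rg⟩ := H.nonempty_representation g fun s hs =>
    measure_level_lt_top_of_mem hX hp hY hq g.2 hs
  obtain ⟨S, hSX, hSY, hS⟩ := hK (Rf.U f) (Rg.U g) (fun k => (Rg.gap_ne_top H k).1)
    (fun k => (Rg.gap_ne_top H k).2) fun k => by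
      refine (Rf.gap_le k).trans ?_
      rw [ENNReal.coe_mul, mul_assoc]
      exact mul_le_mul_right ((hfg _ (H.pos k)).trans (Rg.K_le _ k)) _
  exact Rf.exists_transfer Rg hSX hSY hS

theorem KotheSpace.IsUniformCalderonCouple.isCalderonCouple {Ω : Type*} [MeasurableSpace Ω]
    {μ : Measure Ω} {X Y : KotheSpace μ} (h : IsUniformCalderonCouple X Y) :
    IsCalderonCouple X Y := by
  obtain ⟨C, hC⟩ := h
  intro f g hfg
  obtain ⟨T, hT, hTg⟩ := hC f g hfg
  exact ⟨T, (le_max_left _ _).trans_lt (hT.trans_lt ENNReal.coe_lt_top),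
    (le_max_right _ _).trans_lt (hT.trans_lt ENNReal.coe_lt_top), hTg⟩

theorem RISpace.isStretchable_iff (X : RISpace D) :
    X.IsStretchable ↔ ∃ C, RightShift X.eNorm X.eNorm C := by
  rw [IsStretchable, hasRSP_iff (by rw [X.extendNorm_seqNrm]; exact X.isSeqNorm),
    X.extendNorm_seqNrm]

theorem RISpace.isCompressible_iff (X : RISpace D) :
    X.IsCompressible ↔ ∃ C, LeftShift X.eNorm X.eNorm C := by
  rw [IsCompressible, hasLSP_iff (by rw [X.extendNorm_seqNrm]; exact X.isSeqNorm),
    X.extendNorm_seqNrm]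

end CalderonRI

theorem theorem5p5 (D : CalderonRI.Domain) (X Y : CalderonRI.RISpace D)
    (h : ∃ p : ℝ, 1 ≤ p ∧ X.toKotheSpace.IsPConcave p ∧ Y.toKotheSpace.IsPConvex p)
    (hY : ∃ r : ℝ, 1 ≤ r ∧ Y.toKotheSpace.IsPConcave r) :
    (X.toKotheSpace.IsCalderonCouple Y.toKotheSpace ↔ X.IsStretchable ∧ Y.IsCompressible) ∧
      (X.toKotheSpace.IsUniformCalderonCouple Y.toKotheSpace ↔
        X.IsStretchable ∧ Y.IsCompressible) := by
  obtain ⟨p, hp, hXc, hYc⟩ := h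
  obtain ⟨r, hr, hYr⟩ := hY
  obtain ⟨C, H⟩ := CalderonRI.RISpace.exists_isCouple hp hXc hYc
  obtain ⟨M₁, hM₁⟩ := hXc.exists_with
  obtain ⟨M₂, hM₂⟩ := hYr.exists_with
  have h1 : X.toKotheSpace.IsCalderonCouple Y.toKotheSpace → X.IsStretchable ∧ Y.IsCompressible :=
    fun hcal => ⟨X.isStretchable_iff.2 (H.exists_rightShift (H.seqCalderon hcal)),
      Y.isCompressible_iff.2 (H.exists_leftShift (H.seqCalderon hcal))⟩
  have h2 : X.IsStretchable ∧ Y.IsCompressible →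
      X.toKotheSpace.IsUniformCalderonCouple Y.toKotheSpace := by
    rintro ⟨hs, hc⟩
    obtain ⟨C₁, hC₁⟩ := X.isStretchable_iff.1 hs
    obtain ⟨C₂, hC₂⟩ := Y.isCompressible_iff.1 hc
    exact H.isUniformCalderonCouple hC₁ hC₂ hM₁ hp hM₂ hr
  exact ⟨⟨h1, fun h => (h2 h).isCalderonCouple⟩, ⟨fun h => h1 h.isCalderonCouple, h2⟩⟩
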